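/- Model. A dynamic graph stream $\mathcal S$ on the vertex set $\{0,\dots,n-1\}$ is a finite sequence of insertions and deletions of edges, starting from the empty graph, in which only absent edges are inserted and only present edges are deleted; $G$ is the simple graph obtained at the end of $\mathcal S$. Every edge $e$ occurring in $\mathcal S$ has a fixed real weight $wt(e)>0$, which is specified at each of its insertions and deletions. Let $W'$ be the ratio of the largest to the smallest weight of an edge that occurs in $\mathcal S$ (and $W'=1$ if $\mathcal S$ is empty). A $k$-matching of $G$ is a set of exactly $k$ pairwise vertex-disjoint edges of $G$; the weight $wt(M)$ of a matching $M$ is the sum of the weights of its edges, and a maximum-weight $k$-matching is a $k$-matching of maximum weight among all $k$-matchings of $G$. A streaming algorithm is a randomized word-RAM program, consisting of a preprocessing routine (which receives $n$ and $k$), an update routine (run after each stream element, which receives the edge, its weight and the kind of the operation) and a query routine (run at the end of $\mathcal S$). Words have $O(\log(n+k+2))$ bits, and each word operation takes unit time. An edge weight occupies one cell; weights can be stored and copied. Two weights can be compared up to a factor $1+\varepsilon/m$, $m$ a word, in unit time, and two sums of $\ell$ stored weights can be compared in $\ell+1$ steps. Here $\varepsilon$ is the accuracy parameter. The machine has finitely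 many registers named by the program, and memory cells for words and for weights; the space is the number of cells of each of the two kinds that suffices for all routines, and the update time is the number of steps for one stream element. Theorem. There is a randomized streaming algorithm and there are constants $C,c$ such that for all $0<\varepsilon<1$, all $n\ge 0$ and $k\ge 1$, and all such weighted streams $\mathcal S$, the algorithm run on $(\mathcal S,k)$ with accuracy $\varepsilon$ always halts and outputs a set of edges $M'$ which is either $\emptyset$ or a $k$-matching of $G$, such that (1) if $M$ is a maximum-weight $k$-matching of $G$, then with probability at least $1-\frac{11}{20k^3\ln(2k)}$, $M'$ is a $k$-matching of $G$ with $wt(M')>(1-\varepsilon)\,wt(M)$; (2) if $G$ has no $k$-matching, then $M'=\emptyset$ (with certainty). Moreover, whatever the random choices, the space is at most $C\,k^2\,(1+\varepsilon^{-1}\ln W')\,\ln^c(n+k+2)$ cells of each kind, that is, $\tilde O\big(k^2(1+\varepsilon^{-1}\log W')\big)$, and the time of each update is at most $C\ln^c(n+k+2)$, that is, $\tilde O(1)$. -/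

import Mathlib

namespace KMatchStream

/-! ### Graphs, matchings and dynamic graph streams -/

/-- One element of a dynamic graph stream on the vertex set `{0, …, n-1}`: the insertion or the
deletion of the edge `uv`, where `u < v`. -/
structure Update (n : ℕ) where
  u : Fin n
  v : Fin n
  lt : u < v
  isInsert : Bool

/-- The edge that a stream element inserts or deletes. -/
def Update.edge {n : ℕ} (a : Update n) : Sym2 (Fin n) := s(a.u, a.v)

/-- The edge set after a stream; at the beginning it is empty. -/
def edgesAfter {n : ℕ} (S : List (Update n)) : Finset (Sym2 (Fin n)) :=
  S.foldl (fun E a => if a.isInsert then insert a.edge E else E.erase a.edge) ∅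

/-- The graph given by a stream. -/
def graphAfter {n : ℕ} (S : List (Update n)) : SimpleGraph (Fin n) :=
  SimpleGraph.fromEdgeSet (edgesAfter S : Set (Sym2 (Fin n)))

/-- A dynamic graph stream of simple graphs: at every moment only absent edges are inserted and only
present edges are deleted. -/
def IsDynamicStream {n : ℕ} (S : List (Update n)) : Prop :=
  ∀ (P Q : List (Update n)) (a : Update n), S = P ++ a :: Q →
    (a.isInsert = true ↔ a.edge ∉ edgesAfter P)

/-- The edges that occur in the stream. -/
def streamEdges {n : ℕ} (S : List (Update n)) : Finset (Sym2 (Fin n)) :=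
  (S.map Update.edge).toFinset

/-- The ratio of the largest to the smallest weight of an edge that occurs in the stream
(and `1` for the empty stream). -/
noncomputable def weightRatio {n : ℕ} (wt : Sym2 (Fin n) → ℝ) (S : List (Update n)) : ℝ :=
  if h : (streamEdges S).Nonempty then
    (streamEdges S).sup' h wt / (streamEdges S).inf' h wt
  else 1

/-- `M` is a matching of `G` with exactly `k` edges. -/
def IsKMatching {V : Type*} (G : SimpleGraph V) (k : ℕ) (M : Finset (Sym2 V)) : Prop :=
  (∀ e ∈ M, e ∈ G.edgeSet) ∧
  (∀ e ∈ M, ∀ f ∈ M, e ≠ f → ∀ x : V, x ∈ e → x ∉ f) ∧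
  M.card = k

/-- The weight of a set of edges. -/
noncomputable def weight {V : Type*} (wt : Sym2 V → ℝ) (M : Finset (Sym2 V)) : ℝ :=
  ∑ e ∈ M, wt e

/-- `M` is a `k`-matching whose weight is maximum over all `k`-matchings of `G`. -/
def IsMaxWeightKMatching {V : Type*} (G : SimpleGraph V) (wt : Sym2 V → ℝ) (k : ℕ)
    (M : Finset (Sym2 V)) : Prop :=
  IsKMatching G k M ∧ ∀ N : Finset (Sym2 V), IsKMatching G k N → weight wt N ≤ weight wt M

/-! ### A randomized word RAM with real edge weights

Integers are held in registers (named by the program, hence a constant number of them) and in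
memory cells.  Edge weights are arbitrary reals; a weight cell can only hold a weight that was read
from the stream, weights can be copied, and the only way to get information out of them is by the
two comparison instructions `wnear` and `wsum`.  -/

/-- Operations on words. -/
inductive WordOp where
  | add | sub | mul | div | mod | lt

/-- The value of an operation on words (`sub` is truncated, `lt` is `1` for true, `0` for false). -/
def WordOp.eval : WordOp → ℕ → ℕ → ℕ
  | .add, a, b => a + b
  | .sub, a, b => a - b
  | .mul, a, b => a * b
  | .div, a, b => a / b
  | .mod, a, b => a % b
  | .lt, a, b => if a < b then 1 else 0

/-- Programs. Below `r x` is the content of register `x`, `mem` is the memory and `wmem` is the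
weight memory. -/
inductive Cmd where
  /-- do nothing -/
  | skip
  /-- run the first program, then the second -/
  | seq (p q : Cmd)
  /-- run the first program if `r x ≠ 0`, and the second otherwise -/
  | branch (x : ℕ) (p q : Cmd)
  /-- while `r x ≠ 0`, run the program -/
  | loop (x : ℕ) (p : Cmd)
  /-- `r x := a` -/
  | const (x a : ℕ)
  /-- `r x := r y` -/
  | move (x y : ℕ)
  /-- `r x := r y op r z` -/
  | op (o : WordOp) (x y z : ℕ)
  /-- `r x := mem (r y)` -/
  | load (x y : ℕ)
  /-- `mem (r x) := r y` -/
  | store (x y : ℕ)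
  /-- `r x :=` a uniformly random element of `{0, …, r y - 1}`, independent of all else -/
  | rand (x y : ℕ)
  /-- `wmem (r x) :=` the weight of the current stream element -/
  | wread (x : ℕ)
  /-- `wmem (r x) := wmem (r y)` -/
  | wcopy (x y : ℕ)
  /-- `r x := 1` if `r m * wmem (r y) ≤ (r m + ε) * wmem (r z)`, and `0` otherwise -/
  | wnear (x m y z : ℕ)
  /-- `r x := 1` if the sum of the `r l` weights in `wmem` from cell `r y` on is at most the sum of
  the `r l` weights from cell `r z` on, and `0` otherwise; this takes `r l + 1` steps -/
  | wsum (x l y z : ℕ)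
  /-- write the pair `(r x, r y)` to the output -/
  | emit (x y : ℕ)

/-- The data of the machine. -/
structure State where
  r : ℕ → ℕ
  mem : ℕ → ℕ
  wmem : ℕ → ℝ
  /-- the weight of the current stream element -/
  win : ℝ
  /-- the pairs written to the output -/
  out : List (ℕ × ℕ)

/-- The size of the machine: `cells` memory cells and `cells` weight cells, and words of `bits`
bits. -/
structure Size where
  cells : ℕ
  bits : ℕ

/-- A configuration: the programs that are still to be run, in this order, and the data. The machine
has halted when there is nothing left to run. -/
abbrev Config := List Cmd × State

/-- `r x := a`; the machine crashes (`none`) if `a` does not fit into a word. -/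
def State.setReg (z : Size) (s : State) (x a : ℕ) : Option State :=
  if a < 2 ^ z.bits then some { s with r := Function.update s.r x a } else none

/-- One step of the machine with accuracy parameter `ε`. The result `none` is a crash: a value that
does not fit into a word, an access outside the cells, or a random choice from the empty set. -/
noncomputable def step (z : Size) (ε : ℝ) : Config → PMF (Option Config)
  | ([], s) => PMF.pure (some ([], s))
  | (.skip :: K, s) => PMF.pure (some (K, s))
  | (.seq p q :: K, s) => PMF.pure (some (p :: q :: K, s))
  | (.branch x p q :: K, s) => PMF.pure (some ((if s.r x ≠ 0 then p else q) :: K, s))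
  | (.loop x p :: K, s) =>
      PMF.pure (some (if s.r x ≠ 0 then (p :: .loop x p :: K, s) else (K, s)))
  | (.const x a :: K, s) => PMF.pure ((s.setReg z x a).map fun t => (K, t))
  | (.move x y :: K, s) => PMF.pure ((s.setReg z x (s.r y)).map fun t => (K, t))
  | (.op o x y w :: K, s) =>
      PMF.pure ((s.setReg z x (o.eval (s.r y) (s.r w))).map fun t => (K, t))
  | (.load x y :: K, s) =>
      PMF.pure (if s.r y < z.cells then
        (s.setReg z x (s.mem (s.r y))).map fun t => (K, t) else none)
  | (.store x y :: K, s) =>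
      PMF.pure (if s.r x < z.cells then
        some (K, { s with mem := Function.update s.mem (s.r x) (s.r y) }) else none)
  | (.rand x y :: K, s) =>
      if h : (Finset.range (s.r y)).Nonempty then
        (PMF.uniformOfFinset (Finset.range (s.r y)) h).map fun a =>
          (s.setReg z x a).map fun t => (K, t)
      else PMF.pure none
  | (.wread x :: K, s) =>
      PMF.pure (if s.r x < z.cells then
        some (K, { s with wmem := Function.update s.wmem (s.r x) s.win }) else none)
  | (.wcopy x y :: K, s) =>
      PMF.pure (if s.r x < z.cells ∧ s.r y < z.cells then
        some (K, { s with wmem := Function.update s.wmem (s.r x) (s.wmem (s.r y)) }) else none)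
  | (.wnear x m y w :: K, s) =>
      open Classical in
      PMF.pure (if s.r y < z.cells ∧ s.r w < z.cells then
        (s.setReg z x
          (if (s.r m : ℝ) * s.wmem (s.r y) ≤ ((s.r m : ℝ) + ε) * s.wmem (s.r w) then 1 else 0)).map
          fun t => (K, t) else none)
  | (.wsum x l y w :: K, s) =>
      open Classical in
      PMF.pure (if s.r y + s.r l ≤ z.cells ∧ s.r w + s.r l ≤ z.cells then
        (s.setReg z x
          (if ∑ i ∈ Finset.range (s.r l), s.wmem (s.r y + i) ≤
              ∑ i ∈ Finset.range (s.r l), s.wmem (s.r w + i) then 1 else 0)).map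
          fun t => (List.replicate (s.r l) .skip ++ K, t) else none)
  | (.emit x y :: K, s) => PMF.pure (some (K, { s with out := s.out ++ [(s.r x, s.r y)] }))

/-- The configuration after `t` steps, `none` after a crash. -/
noncomputable def steps (z : Size) (ε : ℝ) : ℕ → Config → PMF (Option Config)
  | 0, c => PMF.pure (some c)
  | t + 1, c => (step z ε c).bind fun o =>
      match o with
      | none => PMF.pure none
      | some d => steps z ε t d

/-- Run the program `p` on the data `s`; the result is `none` if the machine crashes or has not
halted after `t` steps. -/
noncomputable def runWithin (z : Size) (ε : ℝ) (t : ℕ) (p : Cmd) (s : State) :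
    PMF (Option State) :=
  (steps z ε t ([p], s)).map fun o =>
    match o with
    | some ([], s') => some s'
    | _ => none

/-- A streaming algorithm: a program that is run once before the stream, a program that is run after
the arrival of each stream element, and a program that answers the query. -/
structure StreamAlgorithm where
  preprocess : Cmd
  update : Cmd
  query : Cmd

/-- All data is zero before the stream, except that registers `0` and `1` hold `n` and `k`. -/
def startState (n k : ℕ) : State where
  r := Function.update (Function.update (fun _ => 0) 0 n) 1 k
  mem := fun _ => 0
  wmem := fun _ => 0
  win := 0
  out := []

/-- The arrival of a stream element `uv`: registers `0`, `1`, `2` receive `u`, `v` and the kind of the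
operation (`1` for an insertion, `0` for a deletion), and the weight of `uv` can be read. -/
def arrive {n : ℕ} (wt : Sym2 (Fin n) → ℝ) (a : Update n) (s : State) : State :=
  { s with
    r := Function.update (Function.update (Function.update s.r 0 a.u) 1 a.v) 2
      (if a.isInsert then 1 else 0)
    win := wt a.edge }

/-- Process the elements of a stream one after the other, each within `t` steps. -/
noncomputable def runUpdates (A : StreamAlgorithm) (z : Size) (ε : ℝ) (t : ℕ) {n : ℕ}
    (wt : Sym2 (Fin n) → ℝ) : List (Update n) → State → PMF (Option State)
  | [], s => PMF.pure (some s)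
  | a :: S, s => (runWithin z ε t A.update (arrive wt a s)).bind fun o =>
      match o with
      | none => PMF.pure none
      | some s' => runUpdates A z ε t wt S s'

/-- The final data of the algorithm on the parameter `k` and a stream `S`, queried at the end of the
stream, on a machine of size `z`. The result is `none` if the machine crashes, if an update takes
more than `tUpd` steps, or if the preprocessing or the query takes more than `T` steps. -/
noncomputable def execute (A : StreamAlgorithm) (z : Size) (ε : ℝ) (T tUpd : ℕ) {n : ℕ} (k : ℕ)
    (wt : Sym2 (Fin n) → ℝ) (S : List (Update n)) : PMF (Option State) :=
  (runWithin z ε T A.preprocess (startState n k)).bind fun o =>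
    match o with
    | none => PMF.pure none
    | some s => (runUpdates A z ε tUpd wt S s).bind fun o' =>
        match o' with
        | none => PMF.pure none
        | some s' => runWithin z ε T A.query s'

/-- The pairs written to the output are exactly the edges in `M`. -/
def Outputs {n : ℕ} (s : State) (M : Finset (Sym2 (Fin n))) : Prop :=
  (s.out.map fun p => s(p.1, p.2)).toFinset = M.image (Sym2.map Fin.val)

end KMatchStream

namespace KMatchStream

/-! ### A program logic for the machine -/

-- Weights are rounded to classes. The machine keeps representatives, which are weights of the
-- stream no two of which agree up to the factor `1 + ε / 2`. The class of a weight is the first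
-- representative near it; a weight without one becomes a new representative. Logarithms of
-- separated weights are at least `log (1 + ε / 2) ≥ ε / 4` apart, so there are at most `1 + 4 ε⁻¹
-- log W'` classes (`classBound`). Because the first near representative is taken, classes never
-- change when representatives are added (`cls_stable`), and a deletion reaches exactly the counters
-- that the insertion changed. The representatives depend on the stream alone (`reps`), not on the
-- random choices. Only the two neighbours of a weight in sorted order can be near it
-- (`Skip.eq_of_near`); a deterministic skip list, whose full gaps are split on the way down, finds
-- them in worst-case logarithmic time.
--
-- There are `R = 96 L` independent repetitions. Each hashes the vertices to `B = 8 k` buckets and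
-- gives every edge a pairwise independent value; the edge survives on level `j` if `2 ^ j` divides
-- its value. For each class, repetition, level and ordered pair of buckets, a sampler holds the
-- number of its present edges and the sum of their codes. An update touches at most one sampler per
-- repetition and level, hence polylogarithmic time. If the number is `1`, the sum is the code of a
-- present edge. The query runs through all `k`-tuples of samplers, keeps those that hold single,
-- pairwise disjoint edges, and returns one whose sum of representatives is largest. Whatever the
-- random choices, the output is therefore empty or a `k`-matching of the graph.
--
-- The quality rests on an exchange argument. An edge of an optimal matching need not be alone in
-- any sampler, but it can be traded for another edge of the same class and the same two buckets. If
-- in some repetition no vertex of another matching edge falls into a bucket of its endpoints, the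
-- traded set is still a matching (`Par.exch_good`). This isolation has probability at least `1 /
-- 2`, since there are at most `4 (k - 1)` collisions of probability `1 / B` (`num_iso`).
-- Independently, on a level where `2 ^ j` is between two and four times the size of the bucket, a
-- single edge survives with probability at least `1 / 8` (`num_unique`). So a repetition replaces a
-- given edge with probability at least `1 / 16` (`num_repl`), whatever the previous exchanges were.
-- After `R` repetitions some edge is still unreplaced with probability at most `k (15 / 16) ^ R`,
-- which `failure_bound` compares with the required bound. Otherwise there is a matching with the
-- classes of the optimal one, each edge of which sits alone in a sampler, and the query competes
-- with it. Passing to representatives and back costs the factor `(1 + ε / 2) ^ 2`, and `(1 - ε) (1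
-- + ε / 2) ^ 2 < 1` (`Answer.quality`).
--
-- All randomness is drawn in the preprocessing; updates and query are deterministic. A Hoare logic
-- with running times and frame conditions (`Ends`, `Unch`, `wp`) verifies the programs, and
-- probabilities are counts of random tables.

infixr:60 " ;; " => Cmd.seq

/-- Words are smaller than `z.lim`. -/
def Size.lim (z : Size) : ℕ := 2 ^ z.bits

namespace State

def set (s : State) (x a : ℕ) : State := { s with r := Function.update s.r x a }
def setMem (s : State) (x a : ℕ) : State := { s with mem := Function.update s.mem x a }
def setW (s : State) (x : ℕ) (a : ℝ) : State := { s with wmem := Function.update s.wmem x a }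
def addOut (s : State) (x : ℕ × ℕ) : State := { s with out := s.out ++ [x] }

variable (s : State) (x a y : ℕ) (b : ℝ) (o : ℕ × ℕ)

@[simp] theorem set_r : (s.set x a).r y = if y = x then a else s.r y := by
  simp [set, Function.update_apply]
@[simp] theorem set_mem : (s.set x a).mem = s.mem := rfl
@[simp] theorem set_wmem : (s.set x a).wmem = s.wmem := rfl
@[simp] theorem set_win : (s.set x a).win = s.win := rfl
@[simp] theorem set_out : (s.set x a).out = s.out := rfl
@[simp] theorem setMem_r : (s.setMem x a).r = s.r := rfl
@[simp] theorem setMem_mem : (s.setMem x a).mem y = if y = x then a else s.mem y := by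
  simp [setMem, Function.update_apply]
@[simp] theorem setMem_wmem : (s.setMem x a).wmem = s.wmem := rfl
@[simp] theorem setMem_out : (s.setMem x a).out = s.out := rfl
@[simp] theorem setW_r : (s.setW x b).r = s.r := rfl
@[simp] theorem setW_mem : (s.setW x b).mem = s.mem := rfl
@[simp] theorem setW_wmem : (s.setW x b).wmem y = if y = x then b else s.wmem y := by
  simp [setW, Function.update_apply]
@[simp] theorem setW_out : (s.setW x b).out = s.out := rfl
@[simp] theorem addOut_r : (s.addOut o).r = s.r := rfl
@[simp] theorem addOut_mem : (s.addOut o).mem = s.mem := rfl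
@[simp] theorem addOut_wmem : (s.addOut o).wmem = s.wmem := rfl
@[simp] theorem addOut_out : (s.addOut o).out = s.out ++ [o] := rfl

end State

/-- The program contains an instruction that writes to the register. -/
def Cmd.writes : Cmd → ℕ → Bool
  | .skip, _ => false
  | .seq p q, a => p.writes a || q.writes a
  | .branch _ p q, a => p.writes a || q.writes a
  | .loop _ p, a => p.writes a
  | .const x _, a => x == a
  | .move x _, a => x == a
  | .op _ x _ _, a => x == a
  | .load x _, a => x == a
  | .store _ _, _ => false
  | .rand x _, a => x == a
  | .wread _, _ => false
  | .wcopy _ _, _ => false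
  | .wnear x _ _ _, a => x == a
  | .wsum x _ _ _, a => x == a
  | .emit _ _, _ => false

/-- The program contains an instruction that writes to the memory. -/
def Cmd.stores : Cmd → Bool
  | .seq p q => p.stores || q.stores
  | .branch _ p q => p.stores || q.stores
  | .loop _ p => p.stores
  | .store _ _ => true
  | _ => false

/-- The program contains an instruction that writes to the weight memory. -/
def Cmd.wstores : Cmd → Bool
  | .seq p q => p.wstores || q.wstores
  | .branch _ p q => p.wstores || q.wstores
  | .loop _ p => p.wstores
  | .wread _ => true
  | .wcopy _ _ => true
  | _ => false

/-- The program contains an instruction that writes to the output. -/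
def Cmd.emits : Cmd → Bool
  | .seq p q => p.emits || q.emits
  | .branch _ p q => p.emits || q.emits
  | .loop _ p => p.emits
  | .emit _ _ => true
  | _ => false

/-- What the program cannot have changed is the same in both states. -/
structure Unch (p : Cmd) (s s' : State) : Prop where
  reg : ∀ y, p.writes y = false → s'.r y = s.r y
  mem : p.stores = false → s'.mem = s.mem
  wmem : p.wstores = false → s'.wmem = s.wmem
  win : s'.win = s.win
  out : p.emits = false → s'.out = s.out

theorem Unch.refl (p : Cmd) (s : State) : Unch p s s :=
  ⟨fun _ _ => rfl, fun _ => rfl, fun _ => rfl, rfl, fun _ => rfl⟩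

theorem Unch.trans {p : Cmd} {s t u : State} (h : Unch p s t) (g : Unch p t u) : Unch p s u :=
  ⟨fun y hy => (g.reg y hy).trans (h.reg y hy), fun e => (g.mem e).trans (h.mem e),
    fun e => (g.wmem e).trans (h.wmem e), g.win.trans h.win, fun e => (g.out e).trans (h.out e)⟩

theorem Unch.weaken {p q : Cmd} {s t : State} (h : Unch p s t)
    (hr : ∀ y, q.writes y = false → p.writes y = false) (hm : q.stores = false → p.stores = false)
    (hw : q.wstores = false → p.wstores = false) (ho : q.emits = false → p.emits = false) :
    Unch q s t :=
  ⟨fun y hy => h.reg y (hr y hy), fun e => h.mem (hm e), fun e => h.wmem (hw e), h.win,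
    fun e => h.out (ho e)⟩

theorem Unch.seq_left {p q : Cmd} {s t : State} (h : Unch p s t) : Unch (p ;; q) s t :=
  h.weaken (by simp +contextual [Cmd.writes]) (by simp +contextual [Cmd.stores])
    (by simp +contextual [Cmd.wstores]) (by simp +contextual [Cmd.emits])

theorem Unch.seq_right {p q : Cmd} {s t : State} (h : Unch q s t) : Unch (p ;; q) s t :=
  h.weaken (by simp +contextual [Cmd.writes]) (by simp +contextual [Cmd.stores])
    (by simp +contextual [Cmd.wstores]) (by simp +contextual [Cmd.emits])

theorem Unch.branch_left {x : ℕ} {p q : Cmd} {s t : State} (h : Unch p s t) :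
    Unch (.branch x p q) s t :=
  h.weaken (by simp +contextual [Cmd.writes]) (by simp +contextual [Cmd.stores])
    (by simp +contextual [Cmd.wstores]) (by simp +contextual [Cmd.emits])

theorem Unch.branch_right {x : ℕ} {p q : Cmd} {s t : State} (h : Unch q s t) :
    Unch (.branch x p q) s t :=
  h.weaken (by simp +contextual [Cmd.writes]) (by simp +contextual [Cmd.stores])
    (by simp +contextual [Cmd.wstores]) (by simp +contextual [Cmd.emits])

theorem Unch.loop {x : ℕ} {p : Cmd} {s t : State} (h : Unch p s t) : Unch (.loop x p) s t :=
  h.weaken (by simp [Cmd.writes]) (by simp [Cmd.stores]) (by simp [Cmd.wstores])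
    (by simp [Cmd.emits])

section

variable (z : Size) (ε : ℝ)

theorem steps_of_step {c d : Config} (h : step z ε c = PMF.pure (some d)) (t : ℕ) :
    steps z ε (t + 1) c = steps z ε t d := by
  simp [steps, h]

theorem steps_add (a b : ℕ) (c : Config) :
    steps z ε (a + b) c = (steps z ε a c).bind fun o =>
      match o with
      | none => PMF.pure none
      | some d => steps z ε b d := by
  induction a generalizing c with
  | zero => simp [steps]
  | succ a ih =>
    rw [Nat.add_right_comm, steps, steps, PMF.bind_bind]
    congr 1
    funext o
    cases o with
    | none => simp
    | some d => exact ih d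

/-- From `s` the program halts in exactly `t` steps, in the state `s'`. -/
def Exec (t : ℕ) (p : Cmd) (s s' : State) : Prop :=
  ∀ K, steps z ε t (p :: K, s) = PMF.pure (some (K, s'))

/-- From `s` the program halts within `t` steps, in a state that satisfies `Q`. -/
def Ends (t : ℕ) (p : Cmd) (s : State) (Q : State → Prop) : Prop :=
  ∃ t' ≤ t, ∃ s', Q s' ∧ Unch p s s' ∧ Exec z ε t' p s s'

variable {z ε}

theorem Exec.of_step {p : Cmd} {s s' : State}
    (h : ∀ K, step z ε (p :: K, s) = PMF.pure (some (K, s'))) : Exec z ε 1 p s s' := fun K => by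
  rw [steps_of_step z ε (h K)]; rfl

/-- The quantifier over continuations in `Exec` is what makes runs compose: the first run is applied
with `q :: K` as its continuation. The extra step unfolds the `seq`. -/
theorem Exec.seq {t₁ t₂ : ℕ} {p q : Cmd} {s s₁ s₂ : State} (h₁ : Exec z ε t₁ p s s₁)
    (h₂ : Exec z ε t₂ q s₁ s₂) : Exec z ε (t₁ + t₂ + 1) (p ;; q) s s₂ := fun K => by
  rw [steps_of_step z ε (d := (p :: q :: K, s)) rfl, steps_add, h₁, PMF.pure_bind]
  exact h₂ K

theorem Exec.loop_step {t₁ t₂ x : ℕ} {p : Cmd} {s s₁ s₂ : State} (hx : s.r x ≠ 0)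
    (h₁ : Exec z ε t₁ p s s₁) (h₂ : Exec z ε t₂ (.loop x p) s₁ s₂) :
    Exec z ε (t₁ + t₂ + 1) (.loop x p) s s₂ := fun K => by
  rw [steps_of_step z ε (d := (p :: .loop x p :: K, s)) (by simp [step, hx]), steps_add, h₁,
    PMF.pure_bind]
  exact h₂ K

theorem Exec.loop_end {x : ℕ} {p : Cmd} {s : State} (hx : s.r x = 0) :
    Exec z ε 1 (.loop x p) s s := Exec.of_step fun K => by simp [step, hx]

/-- The rule of consequence. The weakening of the postcondition may use the frame condition `Unch`.
-/
theorem Ends.mono {t t' : ℕ} {p : Cmd} {s : State} {Q Q' : State → Prop} (h : Ends z ε t p s Q)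
    (ht : t ≤ t') (hQ : ∀ s', Unch p s s' → Q s' → Q' s') : Ends z ε t' p s Q' := by
  obtain ⟨a, ha, s', h1, h2, h3⟩ := h
  exact ⟨a, ha.trans ht, s', hQ _ h2 h1, h2, h3⟩

/-- The second specification receives `Unch` for the first program, so facts about registers and
memory that the first program cannot write need not be carried through its postcondition. -/
theorem Ends.seq {t t₁ t₂ : ℕ} {p q : Cmd} {s : State} {Q₁ Q : State → Prop}
    (h₁ : Ends z ε t₁ p s Q₁) (h₂ : ∀ s', Unch p s s' → Q₁ s' → Ends z ε t₂ q s' Q)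
    (ht : t₁ + t₂ + 1 ≤ t) : Ends z ε t (p ;; q) s Q := by
  obtain ⟨a, ha, s₁, h1, h2, h3⟩ := h₁
  obtain ⟨b, hb, s₂, g1, g2, g3⟩ := h₂ s₁ h2 h1
  exact ⟨a + b + 1, by omega, s₂, g1, h2.seq_left.trans g2.seq_right, h3.seq g3⟩

theorem Ends.branch {t t' x : ℕ} {p q : Cmd} {s : State} {Q : State → Prop}
    (h₁ : s.r x ≠ 0 → Ends z ε t p s Q) (h₂ : s.r x = 0 → Ends z ε t q s Q) (ht : t + 1 ≤ t') :
    Ends z ε t' (.branch x p q) s Q := by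
  by_cases hx : s.r x = 0
  · obtain ⟨a, ha, s₁, h1, h2, h3⟩ := h₂ hx
    refine ⟨a + 1, by omega, s₁, h1, h2.branch_right, fun K => ?_⟩
    rw [steps_of_step z ε (d := (q :: K, s)) (by simp [step, hx])]
    exact h3 K
  · obtain ⟨a, ha, s₁, h1, h2, h3⟩ := h₁ hx
    refine ⟨a + 1, by omega, s₁, h1, h2.branch_left, fun K => ?_⟩
    rw [steps_of_step z ε (d := (p :: K, s)) (by simp [step, hx])]
    exact h3 K

/-- A loop whose invariant counts the remaining iterations. -/
theorem Ends.loop {T x : ℕ} {p : Cmd} {s : State} (I : ℕ → State → Prop) (N : ℕ) (h0 : I N s)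
    (hz : ∀ s', I 0 s' → s'.r x = 0)
    (hs : ∀ j < N, ∀ s', Unch (.loop x p) s s' → I (j + 1) s' →
      s'.r x ≠ 0 ∧ Ends z ε T p s' (I j)) :
    Ends z ε (N * (T + 1) + 1) (.loop x p) s (I 0) := by
  suffices H : ∀ M ≤ N, ∀ s', Unch (.loop x p) s s' → I M s' →
      Ends z ε (M * (T + 1) + 1) (.loop x p) s' (I 0) from H N le_rfl s (Unch.refl _ _) h0
  intro M
  induction M with
  | zero =>
    intro _ s' _ h
    exact ⟨1, by omega, s', h, Unch.refl _ _, Exec.loop_end (hz _ h)⟩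
  | succ M ih =>
    intro hM s' hu h
    obtain ⟨hx, a, ha, s₁, h1, h2, h3⟩ := hs M hM s' hu h
    obtain ⟨b, hb, s₂, g1, g2, g3⟩ := ih (by omega) s₁ (hu.trans h2.loop) h1
    exact ⟨a + b + 1, by rw [Nat.add_mul]; omega, s₂, g1, h2.loop.trans g2, h3.loop_step hx g3⟩

/-- The weakest precondition of a program without loops, random choices and sums of more than one
weight. -/
def wp (z : Size) (ε : ℝ) : Cmd → (State → Prop) → State → Prop
  | .skip, Q => Q
  | .seq p q, Q => wp z ε p (wp z ε q Q)
  | .branch x p q, Q => fun s => (s.r x ≠ 0 → wp z ε p Q s) ∧ (s.r x = 0 → wp z ε q Q s)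
  | .loop _ _, _ => fun _ => False
  | .const x a, Q => fun s => a < z.lim ∧ Q (s.set x a)
  | .move x y, Q => fun s => s.r y < z.lim ∧ Q (s.set x (s.r y))
  | .op o x y w, Q => fun s => o.eval (s.r y) (s.r w) < z.lim ∧ Q (s.set x (o.eval (s.r y) (s.r w)))
  | .load x y, Q => fun s => s.r y < z.cells ∧ s.mem (s.r y) < z.lim ∧ Q (s.set x (s.mem (s.r y)))
  | .store x y, Q => fun s => s.r x < z.cells ∧ Q (s.setMem (s.r x) (s.r y))
  | .rand _ _, _ => fun _ => False
  | .wread x, Q => fun s => s.r x < z.cells ∧ Q (s.setW (s.r x) s.win)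
  | .wcopy x y, Q => fun s =>
      s.r x < z.cells ∧ s.r y < z.cells ∧ Q (s.setW (s.r x) (s.wmem (s.r y)))
  | .wnear x m y w, Q => fun s => s.r y < z.cells ∧ s.r w < z.cells ∧ 1 < z.lim ∧
      ((s.r m : ℝ) * s.wmem (s.r y) ≤ ((s.r m : ℝ) + ε) * s.wmem (s.r w) → Q (s.set x 1)) ∧
      (¬ (s.r m : ℝ) * s.wmem (s.r y) ≤ ((s.r m : ℝ) + ε) * s.wmem (s.r w) → Q (s.set x 0))
  | .wsum x l y w, Q => fun s => s.r l = 1 ∧ s.r y < z.cells ∧ s.r w < z.cells ∧ 1 < z.lim ∧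
      (s.wmem (s.r y) ≤ s.wmem (s.r w) → Q (s.set x 1)) ∧
      (¬ s.wmem (s.r y) ≤ s.wmem (s.r w) → Q (s.set x 0))
  | .emit x y, Q => fun s => Q (s.addOut (s.r x, s.r y))

/-- An upper bound for the running time of a program without loops. -/
def Cmd.cost : Cmd → ℕ
  | .seq p q => p.cost + q.cost + 1
  | .branch _ p q => max p.cost q.cost + 1
  | .wsum _ _ _ _ => 2
  | _ => 1

theorem Ends.of_exec {t : ℕ} {p : Cmd} {s s' : State} {Q : State → Prop} (h : Exec z ε t p s s')
    (hu : Unch p s s') (hQ : Q s') : Ends z ε t p s Q := ⟨t, le_rfl, s', hQ, hu, h⟩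

theorem setReg_of_lt {s : State} {x a : ℕ} (h : a < z.lim) : s.setReg z x a = some (s.set x a) := by
  simp [State.setReg, State.set, show a < 2 ^ z.bits from h]

theorem Unch.set {p : Cmd} {s : State} {x a : ℕ} (h : ∀ y, p.writes y = false → y ≠ x) :
    Unch p s (s.set x a) :=
  ⟨fun y hy => by simp [h y hy], fun _ => rfl, fun _ => rfl, rfl, fun _ => rfl⟩

theorem steps_replicate_skip (l : ℕ) (K : List Cmd) (s : State) :
    steps z ε l (List.replicate l .skip ++ K, s) = PMF.pure (some (K, s)) := by
  induction l with
  | zero => simp [steps]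
  | succ l ih =>
    rw [List.replicate_succ, List.cons_append,
      steps_of_step z ε (d := (List.replicate l .skip ++ K, s)) rfl, ih]

theorem Ends.wsum {x l y w : ℕ} {s : State} {Q : State → Prop} (h1 : s.r y + s.r l ≤ z.cells)
    (h2 : s.r w + s.r l ≤ z.cells) (hz : 1 < z.lim)
    (hle : ∑ i ∈ Finset.range (s.r l), s.wmem (s.r y + i) ≤
      ∑ i ∈ Finset.range (s.r l), s.wmem (s.r w + i) → Q (s.set x 1))
    (hgt : ¬ ∑ i ∈ Finset.range (s.r l), s.wmem (s.r y + i) ≤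
      ∑ i ∈ Finset.range (s.r l), s.wmem (s.r w + i) → Q (s.set x 0)) :
    Ends z ε (s.r l + 1) (.wsum x l y w) s Q := by
  by_cases hc : ∑ i ∈ Finset.range (s.r l), s.wmem (s.r y + i) ≤
      ∑ i ∈ Finset.range (s.r l), s.wmem (s.r w + i)
  · refine Ends.of_exec (fun K => ?_) (Unch.set (a := 1) (by rintro y hy rfl; simp [Cmd.writes] at hy)) (hle hc)
    rw [steps_of_step z ε (d := (List.replicate (s.r l) .skip ++ K, s.set x 1))
      (by simp [step, h1, h2, hc, setReg_of_lt hz]), steps_replicate_skip]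
  · refine Ends.of_exec (fun K => ?_) (Unch.set (a := 0) (by rintro y hy rfl; simp [Cmd.writes] at hy)) (hgt hc)
    rw [steps_of_step z ε (d := (List.replicate (s.r l) .skip ++ K, s.set x 0))
      (by simp [step, h1, h2, hc, setReg_of_lt (zero_lt_one.trans hz)]), steps_replicate_skip]

/-- Soundness of the weakest precondition, by induction on the program. Loops and random choices
have precondition `False` and are treated separately. -/
theorem Ends.of_wp {p : Cmd} {s : State} {Q : State → Prop} (h : wp z ε p Q s) :
    Ends z ε p.cost p s Q := by
  induction p generalizing s Q with
  | skip => exact Ends.of_exec (Exec.of_step fun K => rfl) (Unch.refl _ _) h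
  | seq p q hp hq => exact Ends.seq (hp h) (fun s' _ h' => hq h') le_rfl
  | branch x p q hp hq =>
    exact Ends.branch (t := max p.cost q.cost)
      (fun hx => (hp (h.1 hx)).mono (le_max_left _ _) fun _ _ h => h)
      (fun hx => (hq (h.2 hx)).mono (le_max_right _ _) fun _ _ h => h) le_rfl
  | loop x p => exact h.elim
  | const x a =>
    exact Ends.of_exec (Exec.of_step fun K => by simp [step, setReg_of_lt h.1])
      (Unch.set (by rintro y hy rfl; simp [Cmd.writes] at hy)) h.2
  | move x y =>
    exact Ends.of_exec (Exec.of_step fun K => by simp [step, setReg_of_lt h.1])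
      (Unch.set (by rintro y hy rfl; simp [Cmd.writes] at hy)) h.2
  | op o x y w =>
    exact Ends.of_exec (Exec.of_step fun K => by simp [step, setReg_of_lt h.1])
      (Unch.set (by rintro y hy rfl; simp [Cmd.writes] at hy)) h.2
  | load x y =>
    exact Ends.of_exec (Exec.of_step fun K => by simp [step, h.1, setReg_of_lt h.2.1])
      (Unch.set (by rintro y hy rfl; simp [Cmd.writes] at hy)) h.2.2
  | store x y =>
    exact Ends.of_exec (s' := s.setMem (s.r x) (s.r y))
      (Exec.of_step fun K => by simp only [step, h.1, if_true]; rfl)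
      ⟨fun _ _ => rfl, by simp [Cmd.stores], fun _ => rfl, rfl, fun _ => rfl⟩ h.2
  | rand x y => exact h.elim
  | wread x =>
    exact Ends.of_exec (s' := s.setW (s.r x) s.win) (Exec.of_step fun K => by simp only [step, h.1, if_true]; rfl)
      ⟨fun _ _ => rfl, fun _ => rfl, by simp [Cmd.wstores], rfl, fun _ => rfl⟩ h.2
  | wcopy x y =>
    exact Ends.of_exec (s' := s.setW (s.r x) (s.wmem (s.r y)))
      (Exec.of_step fun K => by simp only [step, h.1, h.2.1, and_self, if_true]; rfl)
      ⟨fun _ _ => rfl, fun _ => rfl, by simp [Cmd.wstores], rfl, fun _ => rfl⟩ h.2.2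
  | wnear x m y w =>
    obtain ⟨h1, h2, h3, h4, h5⟩ := h
    by_cases hc : (s.r m : ℝ) * s.wmem (s.r y) ≤ ((s.r m : ℝ) + ε) * s.wmem (s.r w)
    · exact Ends.of_exec (Exec.of_step fun K => by simp [step, h1, h2, hc, setReg_of_lt h3])
        (Unch.set (by rintro y hy rfl; simp [Cmd.writes] at hy)) (h4 hc)
    · exact Ends.of_exec (Exec.of_step fun K => by
        simp [step, h1, h2, hc, setReg_of_lt (zero_lt_one.trans h3)])
        (Unch.set (by rintro y hy rfl; simp [Cmd.writes] at hy)) (h5 hc)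
  | wsum x l y w =>
    obtain ⟨h0, h1, h2, h3, h4, h5⟩ := h
    have := Ends.wsum (z := z) (ε := ε) (x := x) (l := l) (y := y) (w := w) (s := s) (Q := Q)
      (by omega) (by omega) h3 (by simpa [h0] using h4) (by simpa [h0] using h5)
    simpa [h0, Cmd.cost] using this
  | emit x y =>
    exact Ends.of_exec (s' := s.addOut (s.r x, s.r y)) (Exec.of_step fun K => rfl)
      ⟨fun _ _ => rfl, fun _ => rfl, fun _ => rfl, rfl, by simp [Cmd.emits]⟩ h

theorem Ends.wp {t : ℕ} {p : Cmd} {s : State} {Q : State → Prop} (h : wp z ε p Q s)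
    (ht : p.cost ≤ t := by decide) : Ends z ε t p s Q :=
  (Ends.of_wp h).mono ht fun _ _ h => h

/-- Run `p` with the register `x` counting down to `0`; register `3` holds `1`. -/
def down (x : ℕ) (p : Cmd) : Cmd := .loop x (.op .sub x x 3 ;; p)

/-- The body runs after the decrement, hence from `s'.set x j`. Besides the body an iteration costs
three steps: the loop test, the unfolding of `seq` and the decrement. The final `1` is the last
test. -/
theorem Ends.down {T t x : ℕ} {p : Cmd} {s : State} {Q : State → Prop} (I : ℕ → State → Prop)
    (N : ℕ) (hN : s.r x = N) (hl : N ≤ z.lim) (h1 : s.r 3 = 1) (hx : p.writes x = false)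
    (hx3 : x ≠ 3) (hp3 : p.writes 3 = false) (h0 : I N s)
    (hs : ∀ j < N, ∀ s', s'.r x = j + 1 → Unch (down x p) s s' → I (j + 1) s' →
      Ends z ε T p (s'.set x j) (I j))
    (hQ : ∀ s', Unch (KMatchStream.down x p) s s' → s'.r x = 0 → I 0 s' → Q s')
    (ht : N * (T + 3) + 1 ≤ t) : Ends z ε t (KMatchStream.down x p) s Q := by
  refine (Ends.loop (T := T + 2) (fun j s' => s'.r x = j ∧ I j s') N ⟨hN, h0⟩ (fun s' h => h.1)
    ?_).mono ht (fun s' h g => hQ s' h g.1 g.2)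
  rintro j hj s' hu ⟨h, hI⟩
  have h3 : s'.r 3 = 1 := by
    rw [hu.reg 3 (by simp [Cmd.writes, hp3, hx3]), h1]
  refine ⟨by omega, Ends.seq (t₁ := 1) (t₂ := T) (Q₁ := fun s'' => s'' = s'.set x j) ?_ ?_ (by omega)⟩
  · refine Ends.wp ?_ le_rfl
    simp only [KMatchStream.wp, WordOp.eval, h, h3]
    exact ⟨by omega, rfl⟩
  · rintro _ - rfl
    refine (hs j hj s' h hu hI).mono le_rfl fun s'' hu' hI' => ⟨?_, hI'⟩
    rw [hu'.reg x hx]; simp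

end


/-! ### Deterministic skip lists -/

open Classical in
/-- The elements of `A` after `t` and before the next element of `A'`. -/
noncomputable def gap (key : ℕ → ℝ) (A A' : Finset ℕ) (t : ℝ) : Finset ℕ :=
  A.filter fun c => t < key c ∧ ∀ d ∈ A', t < key d → key c < key d

/-- `y` is the successor of `x` in `A`, and `0` if there is none. -/
def IsNext (key : ℕ → ℝ) (A : Finset ℕ) (x y : ℕ) : Prop :=
  (y = 0 ∧ ∀ c ∈ A, key c ≤ key x) ∨
  (y ∈ A ∧ key x < key y ∧ ∀ c ∈ A, key x < key c → key y ≤ key c)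

open Classical in
/-- `x` is an element of `A`, or `0`, and at most `m` elements of `A` lie between `x` and `w`. -/
def Reach (key : ℕ → ℝ) (A : Finset ℕ) (w : ℝ) (x m : ℕ) : Prop :=
  (x = 0 ∨ x ∈ A) ∧ key x ≤ w ∧ (A.filter fun c => key x < key c ∧ key c ≤ w).card ≤ m

theorem mem_gap {key : ℕ → ℝ} {A A' : Finset ℕ} {t : ℝ} {c : ℕ} :
    c ∈ gap key A A' t ↔ c ∈ A ∧ t < key c ∧ ∀ d ∈ A', t < key d → key c < key d := by
  simp [gap]

theorem Reach.le {key : ℕ → ℝ} {A : Finset ℕ} {w : ℝ} {x : ℕ} (h : Reach key A w x 0) {c : ℕ}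
    (hc : c ∈ A) (hw : key c ≤ w) : key c ≤ key x := by
  by_contra hlt
  have := Finset.card_eq_zero.1 (Nat.le_zero.1 h.2.2)
  exact Finset.notMem_empty c (this ▸ Finset.mem_filter.2 ⟨hc, not_le.1 hlt, hw⟩)

theorem reach_zero {key : ℕ → ℝ} {A : Finset ℕ} {w : ℝ} {x : ℕ} (h1 : x = 0 ∨ x ∈ A)
    (h2 : key x ≤ w) (h3 : ∀ c ∈ A, key c ≤ w → key c ≤ key x) : Reach key A w x 0 := by
  refine ⟨h1, h2, Nat.le_zero.2 (Finset.card_eq_zero.2 (Finset.filter_eq_empty_iff.2 ?_))⟩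
  rintro c hc ⟨h4, h5⟩
  exact absurd (h3 c hc h5) (not_le.2 h4)

theorem Reach.mono {key : ℕ → ℝ} {A : Finset ℕ} {w : ℝ} {x m m' : ℕ} (h : Reach key A w x m)
    (hm : m ≤ m') : Reach key A w x m' := ⟨h.1, h.2.1, h.2.2.trans hm⟩

/-- Each admissible move to the successor consumes at least one of the elements that are still
ahead, namely the successor itself. -/
theorem Reach.move {key : ℕ → ℝ} {A : Finset ℕ} {w : ℝ} {x y m : ℕ} (h : Reach key A w x (m + 1))
    (hy : IsNext key A x y) (h0 : y ≠ 0) (hw : key y ≤ w) : Reach key A w y m := by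
  classical
  obtain ⟨h1, -⟩ | ⟨h1, h2, h3⟩ := hy
  · exact absurd h1 h0
  refine ⟨.inr h1, hw, Nat.le_of_lt_succ (lt_of_lt_of_le (Finset.card_lt_card ?_) h.2.2)⟩
  refine Finset.ssubset_iff_of_subset (fun c hc => ?_) |>.2 ⟨y, ?_, ?_⟩
  · simp only [Finset.mem_filter] at hc ⊢
    exact ⟨hc.1, h2.trans hc.2.1, hc.2.2⟩
  · simp [h1, h2, hw]
  · simp

theorem Reach.halt {key : ℕ → ℝ} {A : Finset ℕ} {w : ℝ} {x y m : ℕ} (h : Reach key A w x m)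
    (hy : IsNext key A x y) (hw : y ≠ 0 → ¬ key y ≤ w) (h0 : 0 ∉ A) : Reach key A w x 0 := by
  refine reach_zero h.1 h.2.1 fun c hc hcw => ?_
  obtain ⟨h1, h2⟩ | ⟨h1, h2, h3⟩ := hy
  · exact h2 c hc
  · by_contra hlt
    exact hw (fun e => h0 (e ▸ h1)) ((h3 c hc (not_le.1 hlt)).trans hcw)

/-- If `x` is the last element of the sparser set up to `w`, then every element of `A` between `x`
and `w` lies in the gap after `x`. So the size of the gap bounds the moves on the lower level. -/
theorem Reach.down {key : ℕ → ℝ} {A A' : Finset ℕ} {w : ℝ} {x m : ℕ} (h : Reach key A' w x 0)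
    (hA : A' ⊆ A) (hg : (gap key A A' (key x)).card ≤ m) : Reach key A w x m := by
  classical
  refine ⟨h.1.imp_right fun e => hA e, h.2.1, (Finset.card_le_card fun c hc => ?_).trans hg⟩
  simp only [Finset.mem_filter] at hc
  refine mem_gap.2 ⟨hc.1, hc.2.1, fun d hd hxd => ?_⟩
  by_contra hle
  exact absurd (h.le hd ((not_lt.1 hle).trans hc.2.2)) (not_le.2 hxd)

section insert

variable {key : ℕ → ℝ} {A A' : Finset ℕ} {b x y : ℕ}

/-- The new element enters only the gap that begins at its predecessor `q` in the sparser set. That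
gap had room, since it held at most two elements; all other gaps keep their size. For the head `q =
0`, every element is larger, which replaces the comparison with the threshold `t`. -/
theorem gap_insert_card {q : ℕ} (hq : Reach key A' (key b) q 0)
    (hqg : (gap key A A' (key q)).card ≤ 2) (hall : ∀ t, (gap key A A' t).card ≤ 3) 
    (hq0 : q = 0 → ∀ c ∈ A, key q < key c) (t : ℝ) :
    (gap key (insert b A) A' t).card ≤ 3 := by
  classical
  have hsub : gap key (insert b A) A' t ⊆ insert b (gap key A A' t) := fun c hc => by
    rw [mem_gap, Finset.mem_insert] at hc
    rw [Finset.mem_insert, mem_gap]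
    tauto
  by_cases hb : b ∈ gap key (insert b A) A' t
  · refine (Finset.card_le_card hsub).trans ((Finset.card_insert_le _ _).trans ?_)
    refine Nat.succ_le_succ ((Finset.card_le_card fun c hc => ?_).trans hqg)
    rw [mem_gap] at hb hc ⊢
    have hqt : q = 0 ∨ key q ≤ t := by
      refine hq.1.imp_right fun hqA => ?_
      by_contra hlt
      exact absurd (hb.2.2 q hqA (not_le.1 hlt)) (not_lt.2 hq.2.1)
    refine ⟨hc.1, ?_, fun d hd hqd => ?_⟩
    · exact hqt.elim (fun e => hq0 e c hc.1) fun e => e.trans_lt hc.2.1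
    · refine hc.2.2 d hd ?_
      by_contra hle
      have h1 : key d ≤ key b := (not_lt.1 hle).trans hb.2.1.le
      exact absurd (hq.le hd h1) (not_le.2 hqd)
  · refine (Finset.card_le_card fun c hc => ?_).trans (hall t)
    rcases Finset.mem_insert.1 (hsub hc) with rfl | h
    · exact absurd hc hb
    · exact h

/-- Insertion into a linked list: `b` takes over the successor of its predecessor `x`, and `x`
points to `b`. Any other element precedes `x` strictly, and then its successor is at most `x`, or it
lies behind `b`. -/
theorem isNext_insert (hx : Reach key A (key b) x 0) (hxb : key x < key b) (hy : IsNext key A x y)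
    (hinj : ∀ c ∈ A, ∀ d ∈ A, key c = key d → c = d) (hb0 : 0 < b) (hbA : b ∉ A)
    (h0 : ∀ c ∈ A, key 0 < key c) (h0b : key 0 < key b)
    (nx nx' : ℕ → ℕ) (hn : ∀ u, u = 0 ∨ u ∈ A → IsNext key A u (nx u))
    (h1 : nx' b = y) (h2 : nx' x = b) (h3 : ∀ u, u ≠ b → u ≠ x → nx' u = nx u) (u : ℕ)
    (hu : u = 0 ∨ u ∈ insert b A) : IsNext key (insert b A) u (nx' u) := by
  classical
  by_cases hub : u = b
  · subst hub
    rw [h1]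
    obtain ⟨e, h⟩ | ⟨e, g, h⟩ := hy
    · refine .inl ⟨e, fun c hc => ?_⟩
      rcases Finset.mem_insert.1 hc with rfl | hc
      · exact le_rfl
      · exact (h c hc).trans hxb.le
    · refine .inr ⟨Finset.mem_insert_of_mem e, ?_, fun c hc huc => ?_⟩
      · by_contra hle
        exact absurd (hx.le e (not_lt.1 hle)) (not_le.2 g)
      · rcases Finset.mem_insert.1 hc with rfl | hc
        · exact absurd huc (lt_irrefl _)
        · exact h c hc (hxb.trans huc)
  have huA : u = 0 ∨ u ∈ A := hu.imp_right fun h => (Finset.mem_insert.1 h).resolve_left hub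
  by_cases hux : u = x
  · subst hux
    rw [h2]
    refine .inr ⟨Finset.mem_insert_self _ _, hxb, fun c hc huc => ?_⟩
    rcases Finset.mem_insert.1 hc with rfl | hc
    · exact le_rfl
    · by_contra hlt
      exact absurd (hx.le hc (not_le.1 hlt).le) (not_le.2 huc)
  · rw [h3 u hub hux]
    have key_ne : key u ≠ key x := by
      intro e
      rcases huA with rfl | hA
      · rcases hx.1 with rfl | hxA
        · exact hux rfl
        · exact absurd e (h0 x hxA).ne
      · rcases hx.1 with rfl | hxA
        · exact absurd e (h0 u hA).ne'
        · exact hux (hinj u hA x hxA e)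
    obtain ⟨e, h⟩ | ⟨e, g, h⟩ := hn u huA
    · refine .inl ⟨e, fun c hc => ?_⟩
      rcases Finset.mem_insert.1 hc with rfl | hc
      · by_contra hlt
        have hlt' := not_le.1 hlt
        rcases hx.1 with rfl | hxA
        · rcases huA with rfl | huA
          · exact hux rfl
          · exact absurd (hx.le huA hlt'.le) (not_le.2 (h0 u huA))
        · have h4 := h x hxA
          rcases huA with rfl | huA
          · exact absurd (h0 x hxA) (not_lt.2 h4)
          · exact key_ne (le_antisymm (hx.le huA hlt'.le) h4)
      · exact h c hc
    · refine .inr ⟨Finset.mem_insert_of_mem e, g, fun c hc huc => ?_⟩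
      rcases Finset.mem_insert.1 hc with rfl | hc
      · rcases hx.1 with rfl | hxA
        · rcases huA with rfl | huA
          · exact absurd rfl hux
          · exact absurd (hx.le huA huc.le) (not_le.2 (h0 u huA))
        · have h4 : key u ≤ key x := by
            rcases huA with rfl | huA
            · exact (h0 x hxA).le
            · exact hx.le huA huc.le
          exact (h x hxA (lt_of_le_of_ne h4 key_ne)).trans hxb.le
      · exact h c hc huc

end insert

/-- A skip list: `Lev i` is the set of the elements on level `i`, and `nx i` the successor function
of this level. -/
structure Skip (key : ℕ → ℝ) (N H : ℕ) (Lev : ℕ → Finset ℕ) (nx : ℕ → ℕ → ℕ) : Prop where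
  lev0 : ∀ c, c ∈ Lev 0 ↔ 1 ≤ c ∧ c ≤ N
  sub : ∀ i, Lev (i + 1) ⊆ Lev i
  key0 : key 0 = 0
  pos : ∀ c, 1 ≤ c → c ≤ N → 0 < key c
  inj : ∀ c ∈ Lev 0, ∀ d ∈ Lev 0, key c = key d → c = d
  next : ∀ i < H, ∀ x, x = 0 ∨ x ∈ Lev i → IsNext key (Lev i) x (nx i x)
  upper : ∀ i t, (gap key (Lev i) (Lev (i + 1)) t).card ≤ 3
  lower : ∀ i, ∀ x ∈ Lev (i + 1), (gap key (Lev i) (Lev (i + 1)) (key x)).Nonempty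

namespace Skip

variable {key : ℕ → ℝ} {N H : ℕ} {Lev : ℕ → Finset ℕ} {nx : ℕ → ℕ → ℕ}

theorem sub_zero (h : Skip key N H Lev nx) (i : ℕ) : Lev i ⊆ Lev 0 := by
  induction i with
  | zero => exact subset_rfl
  | succ i ih => exact (h.sub i).trans ih

theorem le (h : Skip key N H Lev nx) {i c : ℕ} (hc : c ∈ Lev i) : 1 ≤ c ∧ c ≤ N :=
  (h.lev0 c).1 (h.sub_zero i hc)

theorem key_pos (h : Skip key N H Lev nx) {i c : ℕ} (hc : c ∈ Lev i) : key 0 < key c := by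
  rw [h.key0]; exact h.pos c (h.le hc).1 (h.le hc).2

theorem zero_notMem (h : Skip key N H Lev nx) (i : ℕ) : 0 ∉ Lev i := fun h0 => by
  have := (h.le h0).1; omega

/-- Every element of level `i + 1` is followed by a nonempty gap of level `i`. One element from each
of these gaps gives as many further elements of level `i`, distinct from each other and from level
`i + 1`. Only the gap of the head may be empty. -/
theorem two_mul_card (h : Skip key N H Lev nx) (i : ℕ) :
    2 * (Lev (i + 1)).card ≤ (Lev i).card := by
  classical
  choose! f hf using h.lower i
  have hf' := fun x hx => mem_gap.1 (hf x hx)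
  have h1 : ((Lev (i + 1)).image f).card = (Lev (i + 1)).card := by
    refine Finset.card_image_of_injOn fun x hx y hy e => ?_
    have e : f x = f y := e
    rcases lt_trichotomy (key x) (key y) with hlt | heq | hlt
    · have h2 := (hf' x hx).2.2 y hy hlt
      exact absurd (e ▸ h2) (not_lt.2 (hf' y hy).2.1.le)
    · exact h.inj _ (h.sub_zero _ hx) _ (h.sub_zero _ hy) heq
    · have h2 := (hf' y hy).2.2 x hx hlt
      exact absurd (e ▸ h2) (not_lt.2 (hf' x hx).2.1.le)
  have h2 : Disjoint (Lev (i + 1)) ((Lev (i + 1)).image f) := by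
    refine Finset.disjoint_left.2 fun c hc hc' => ?_
    obtain ⟨x, hx, rfl⟩ := Finset.mem_image.1 hc'
    exact lt_irrefl _ ((hf' x hx).2.2 _ hc (hf' x hx).2.1)
  have h3 : Lev (i + 1) ∪ (Lev (i + 1)).image f ⊆ Lev i := Finset.union_subset (h.sub i) fun c hc => by
    obtain ⟨x, hx, rfl⟩ := Finset.mem_image.1 hc
    exact (hf' x hx).1
  have := Finset.card_le_card h3
  rw [Finset.card_union_of_disjoint h2, h1] at this
  omega

theorem pow_mul_card (h : Skip key N H Lev nx) (i : ℕ) : 2 ^ i * (Lev i).card ≤ N := by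
  induction i with
  | zero =>
    have : Lev 0 = Finset.Icc 1 N := by ext c; rw [h.lev0, Finset.mem_Icc]
    simp [this]
  | succ i ih =>
    calc 2 ^ (i + 1) * (Lev (i + 1)).card = 2 ^ i * (2 * (Lev (i + 1)).card) := by ring
      _ ≤ 2 ^ i * (Lev i).card := Nat.mul_le_mul_left _ (h.two_mul_card i)
      _ ≤ N := ih

/-- This is why a number of levels fixed in advance suffices. -/
theorem lev_eq_empty (h : Skip key N H Lev nx) {i : ℕ} (hi : N < 2 ^ i) : Lev i = ∅ := by
  by_contra hne
  have h1 := Finset.card_pos.2 (Finset.nonempty_iff_ne_empty.2 hne)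
  have h2 := h.pow_mul_card i
  nlinarith

/-- The elements of a gap are found by following the pointers of the lower level. -/
theorem mem_gap_iff (h : Skip key N H Lev nx) {i x : ℕ} (hi : i + 1 < H)
    (hx : x = 0 ∨ x ∈ Lev (i + 1)) {c : ℕ} : c ∈ gap key (Lev i) (Lev (i + 1)) (key x) ↔
      c ∈ Lev i ∧ key x < key c ∧ (nx (i + 1) x ≠ 0 → key c < key (nx (i + 1) x)) := by
  rw [mem_gap]
  refine and_congr_right fun hc => and_congr_right fun hxc => ?_
  obtain ⟨e, g⟩ | ⟨e, g, g'⟩ := h.next (i + 1) hi x hx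
  · exact ⟨fun _ h => absurd e h, fun _ d hd hxd => absurd (g d hd) (not_le.2 hxd)⟩
  · exact ⟨fun h' _ => h' _ e g, fun h' d hd hxd =>
      (h' fun e0 => h.zero_notMem _ (e0 ▸ e)).trans_le (g' d hd hxd)⟩

/-- The program recognizes the end of a gap by comparing two pointers: the lower pointer of `u`
equals the upper pointer of `x` exactly behind the last element. Both being `0` covers the end of
the list. -/
theorem gap_next (h : Skip key N H Lev nx) {i x u : ℕ} (hi : i + 1 < H)
    (hx : x = 0 ∨ x ∈ Lev (i + 1)) (hu : u = x ∨ u ∈ gap key (Lev i) (Lev (i + 1)) (key x))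
    (ha : nx i u ≠ nx (i + 1) x) :
    nx i u ∈ gap key (Lev i) (Lev (i + 1)) (key x) ∧ key u < key (nx i u) := by
  rw [h.mem_gap_iff hi hx] at hu ⊢
  have hxu : key x ≤ key u := hu.elim (fun e => e ▸ le_rfl) fun e => e.2.1.le
  have hu' : u = 0 ∨ u ∈ Lev i := hu.elim (fun e => e ▸ hx.imp_right fun h' => h.sub i h') fun e => .inr e.1
  obtain ⟨e, g⟩ | ⟨e, g, g'⟩ := h.next (i + 1) hi x hx
  · obtain ⟨e1, g1⟩ | ⟨e1, g1, g1'⟩ := h.next i (by omega) u hu'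
    · exact absurd (e1.trans e.symm) ha
    · exact ⟨⟨e1, hxu.trans_lt g1, fun h' => absurd e h'⟩, g1⟩
  · have huy : key u < key (nx (i + 1) x) := hu.elim (fun e => e ▸ g) fun e' =>
      e'.2.2 fun e0 => h.zero_notMem _ (e0 ▸ e)
    obtain ⟨e1, g1⟩ | ⟨e1, g1, g1'⟩ := h.next i (by omega) u hu'
    · exact absurd (g1 _ (h.sub i e)) (not_le.2 huy)
    · refine ⟨⟨e1, hxu.trans_lt g1, fun _ => lt_of_le_of_ne (g1' _ (h.sub i e) huy) fun e2 => ?_⟩, g1⟩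
      exact ha (h.inj _ (h.sub_zero _ e1) _ (h.sub_zero _ e) e2)

theorem gap_end (h : Skip key N H Lev nx) {i x u : ℕ} (hi : i + 1 < H)
    (hx : x = 0 ∨ x ∈ Lev (i + 1)) (hu : u = x ∨ u ∈ gap key (Lev i) (Lev (i + 1)) (key x))
    (ha : nx i u = nx (i + 1) x) {c : ℕ} (hc : c ∈ gap key (Lev i) (Lev (i + 1)) (key x)) :
    key c ≤ key u := by
  rw [h.mem_gap_iff hi hx] at hu hc
  have hu' : u = 0 ∨ u ∈ Lev i := hu.elim (fun e => e ▸ hx.imp_right fun h' => h.sub i h') fun e => .inr e.1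
  obtain ⟨e1, g1⟩ | ⟨e1, g1, g1'⟩ := h.next i (by omega) u hu'
  · exact g1 c hc.1
  · by_contra hlt
    have h1 := g1' c hc.1 (not_le.1 hlt)
    rw [ha] at h1
    exact absurd (hc.2.2 fun e0 => h.zero_notMem i (e0 ▸ ha ▸ e1)) (not_lt.2 h1)

theorem key_cases (h : Skip key N H Lev nx) {i x u c : ℕ} (hi : i + 1 < H)
    (hx : x = 0 ∨ x ∈ Lev (i + 1)) (hu : u = x ∨ u ∈ gap key (Lev i) (Lev (i + 1)) (key x))
    (ha : nx i u ≠ nx (i + 1) x) (hc : c ∈ gap key (Lev i) (Lev (i + 1)) (key x)) :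
    key c ≤ key u ∨ c = nx i u ∨ key (nx i u) < key c := by
  have h1 := (h.gap_next hi hx hu ha).1
  rw [h.mem_gap_iff hi hx] at hu hc h1
  have hu' : u = 0 ∨ u ∈ Lev i := hu.elim (fun e => e ▸ hx.imp_right fun h' => h.sub i h') fun e => .inr e.1
  obtain ⟨e1, g1⟩ | ⟨e1, g1, g1'⟩ := h.next i (by omega) u hu'
  · exact .inl (g1 c hc.1)
  · rcases lt_or_ge (key u) (key c) with hlt | hle
    · rcases (g1' c hc.1 hlt).lt_or_eq with h2 | h2
      · exact .inr (.inr h2)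
      · exact .inr (.inl (h.inj _ (h.sub_zero _ hc.1) _ (h.sub_zero _ e1) h2.symm))
    · exact .inl hle

/-- If one of the first three lower pointers already agrees with the upper pointer, the walk through
the gap has met at most the two elements listed. -/
theorem gap_card_le_two (h : Skip key N H Lev nx) {i x : ℕ} (hi : i + 1 < H)
    (hx : x = 0 ∨ x ∈ Lev (i + 1))
    (hc : nx i x = nx (i + 1) x ∨ nx i (nx i x) = nx (i + 1) x ∨
      nx i (nx i (nx i x)) = nx (i + 1) x) :
    (gap key (Lev i) (Lev (i + 1)) (key x)).card ≤ 2 := by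
  classical
  have hnone : ∀ c ∈ gap key (Lev i) (Lev (i + 1)) (key x), ¬ key c ≤ key x := fun c hc' =>
    not_le.2 (mem_gap.1 hc').2.1
  suffices gap key (Lev i) (Lev (i + 1)) (key x) ⊆ {nx i x, nx i (nx i x)} from
    (Finset.card_le_card this).trans Finset.card_le_two
  intro c hcg
  simp only [Finset.mem_insert, Finset.mem_singleton]
  by_cases h1 : nx i x = nx (i + 1) x
  · exact absurd (h.gap_end hi hx (.inl rfl) h1 hcg) (hnone c hcg)
  have g1 := h.gap_next hi hx (.inl rfl) h1
  rcases h.key_cases hi hx (.inl rfl) h1 hcg with h2 | h2 | h2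
  · exact absurd h2 (hnone c hcg)
  · exact .inl h2
  by_cases h3 : nx i (nx i x) = nx (i + 1) x
  · exact absurd (h.gap_end hi hx (.inr g1.1) h3 hcg) (not_le.2 h2)
  have g2 := h.gap_next hi hx (.inr g1.1) h3
  rcases h.key_cases hi hx (.inr g1.1) h3 hcg with h4 | h4 | h4
  · exact absurd h4 (not_le.2 h2)
  · exact .inr h4
  · exact absurd (h.gap_end hi hx (.inr g2.1) ((hc.resolve_left h1).resolve_left h3) hcg)
      (not_le.2 h4)

/-- The middle element of a full gap is raised to the next level. -/
theorem raise (h : Skip key N H Lev nx) {i x : ℕ} {w : ℝ} (hi : i + 1 < H)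
    (hx : Reach key (Lev (i + 1)) w x 0) {q : ℕ} (hq : Reach key (Lev (i + 2)) w q 0)
    (hqg : (gap key (Lev (i + 1)) (Lev (i + 2)) (key q)).card ≤ 2)
    (h1 : nx i x ≠ nx (i + 1) x) (h2 : nx i (nx i x) ≠ nx (i + 1) x)
    (h3 : nx i (nx i (nx i x)) ≠ nx (i + 1) x) {nx' : ℕ → ℕ → ℕ}
    (hn1 : nx' (i + 1) (nx i (nx i x)) = nx (i + 1) x) (hn2 : nx' (i + 1) x = nx i (nx i x))
    (hn3 : ∀ j u, j < H → u ≤ N → ¬ (j = i + 1 ∧ (u = x ∨ u = nx i (nx i x))) → nx' j u = nx j u)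
    {x' : ℕ} (hx' : x' = if key (nx i (nx i x)) ≤ w then nx i (nx i x) else x) :
    ∃ Lev', Skip key N H Lev' nx' ∧ Reach key (Lev' (i + 1)) w x' 0 ∧
      (gap key (Lev' i) (Lev' (i + 1)) (key x')).card ≤ 2 ∧ nx i (nx i x) ∈ Lev 0 := by
  classical
  have g1 := h.gap_next hi hx.1 (.inl rfl) h1
  have g2 := h.gap_next hi hx.1 (.inr g1.1) h2
  have g3 := h.gap_next hi hx.1 (.inr g2.1) h3
  have hleN : ∀ {u j : ℕ}, u = 0 ∨ u ∈ Lev j → u ≤ N := fun hu =>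
    hu.elim (fun e => e ▸ Nat.zero_le _) fun e => (h.le e).2
  set a := nx i x
  set b := nx i a
  set c := nx i b
  have mb := mem_gap.1 g2.1
  have mc := mem_gap.1 g3.1
  have ma := mem_gap.1 g1.1
  have hbA : b ∉ Lev (i + 1) := fun hb => lt_irrefl _ (mb.2.2 b hb mb.2.1)
  have hxb : Reach key (Lev (i + 1)) (key b) x 0 := by
    refine reach_zero hx.1 mb.2.1.le fun d hd hdb => ?_
    by_contra hlt
    exact absurd (mb.2.2 d hd (not_le.1 hlt)) (not_lt.2 hdb)
  have hqx : key q ≤ key x := by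
    rcases hq.1 with rfl | hq'
    · rcases hx.1 with rfl | hx'
      · exact le_rfl
      · exact (h.key_pos hx').le
    · exact hx.le (h.sub _ hq') hq.2.1
  -- No element of level `i + 1` lies between `x` and `b`. Hence `q`, found as the predecessor of
  -- `w`, is also the predecessor of `b` on level `i + 2`, and its gap is the one that grows.
  have hqb : Reach key (Lev (i + 2)) (key b) q 0 := by
    refine reach_zero hq.1 (hqx.trans mb.2.1.le) fun d hd hdb => ?_
    exact hq.le hd ((hxb.le (h.sub _ hd) hdb).trans hx.2.1)
  have hlev' : ∀ j, j ≠ i + 1 →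
      Function.update Lev (i + 1) (insert b (Lev (i + 1))) j = Lev j := fun j hj =>
    Function.update_of_ne hj _ _
  have hlevi : Function.update Lev (i + 1) (insert b (Lev (i + 1))) (i + 1) =
      insert b (Lev (i + 1)) := Function.update_self _ _ _
  have hi2 : i ≠ i + 1 := by omega
  refine ⟨Function.update Lev (i + 1) (insert b (Lev (i + 1))), ⟨?_, ?_, h.key0, h.pos, ?_, ?_, ?_, ?_⟩,
    ?_, ?_, h.sub_zero _ mb.1⟩
  · rw [hlev' 0 (by omega)]; exact h.lev0
  · intro j
    by_cases hj : j = i + 1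
    · subst hj
      rw [hlevi, hlev' _ (by omega)]
      exact (h.sub _).trans (Finset.subset_insert _ _)
    by_cases hj' : j = i
    · subst hj'
      rw [hlevi, hlev' _ (by omega)]
      exact Finset.insert_subset mb.1 (h.sub _)
    · rw [hlev' _ (by omega), hlev' _ hj]; exact h.sub j
  · rw [hlev' 0 (by omega)]; exact h.inj
  · intro j hj u hu
    by_cases hji : j = i + 1
    · subst hji
      rw [hlevi] at hu ⊢
      refine isNext_insert hxb mb.2.1 (h.next _ hi x hx.1)
        (fun c hc d hd => h.inj c (h.sub_zero _ hc) d (h.sub_zero _ hd)) (h.le mb.1).1 hbA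
        (fun c hc => h.key_pos hc) (h.key_pos mb.1)
        (fun u => if u ≤ N then nx (i + 1) u else nx' (i + 1) u) (nx' (i + 1))
        (fun u hu => ?_) hn1 hn2 (fun u hu1 hu2 => ?_) u hu
      · simp only [hleN hu, if_true]
        exact h.next _ hi u hu
      · by_cases hu : u ≤ N
        · simp only [hu, if_true]
          exact hn3 _ _ hi hu (by tauto)
        · simp [hu]
    · rw [hlev' _ hji] at hu ⊢
      rw [hn3 j u hj (hleN hu) (by tauto)]
      exact h.next j hj u hu
  · intro j t
    by_cases hj : j = i + 1
    · subst hj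
      rw [hlevi, hlev' _ (by omega)]
      refine gap_insert_card hqb hqg (h.upper _) ?_ t
      rintro rfl d hd
      exact h.key_pos hd
    by_cases hj' : j = i
    · subst hj'
      rw [hlevi, hlev' _ (by omega)]
      refine (Finset.card_le_card fun d hd => ?_).trans (h.upper j t)
      rw [mem_gap] at hd ⊢
      exact ⟨hd.1, hd.2.1, fun e he => hd.2.2 e (Finset.mem_insert_of_mem he)⟩
    · rw [hlev' _ hj, hlev' (j + 1) (by omega)]; exact h.upper j t
  · intro j u hu
    by_cases hj : j = i + 1
    · subst hj
      rw [hlev' _ (by omega)] at hu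
      rw [hlevi, hlev' _ (by omega)]
      obtain ⟨d, hd⟩ := h.lower _ u hu
      refine ⟨d, ?_⟩
      rw [mem_gap] at hd ⊢
      exact ⟨Finset.mem_insert_of_mem hd.1, hd.2⟩
    by_cases hj' : j = i
    · subst hj'
      rw [hlevi] at hu
      rw [hlevi, hlev' _ (by omega)]
      -- Both halves of the split gap are nonempty: `c` follows `b` and `a` follows `x`. For any
      -- other `u` the old witness survives, because `b` can lie beyond `u` only with `x` in
      -- between.
      by_cases hub : u = b
      · refine ⟨c, mem_gap.2 ⟨mc.1, hub ▸ g3.2, fun d hd hud => ?_⟩⟩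
        subst hub
        rcases Finset.mem_insert.1 hd with rfl | hd
        · exact absurd hud (lt_irrefl _)
        · exact mc.2.2 d hd (mb.2.1.trans hud)
      have hu' := (Finset.mem_insert.1 hu).resolve_left hub
      by_cases hux : u = x
      · subst hux
        refine ⟨a, mem_gap.2 ⟨ma.1, ma.2.1, fun d hd hud => ?_⟩⟩
        rcases Finset.mem_insert.1 hd with rfl | hd
        · exact g2.2
        · exact ma.2.2 d hd hud
      · obtain ⟨d, hd⟩ := h.lower _ u hu'
        rw [mem_gap] at hd
        refine ⟨d, mem_gap.2 ⟨hd.1, hd.2.1, fun e he hue => ?_⟩⟩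
        rcases Finset.mem_insert.1 he with rfl | he
        · have hux' : key u ≤ key x := hxb.le hu' hue.le
          rcases hx.1 with h0 | hxA
          · rw [h0] at hux'
            exact absurd (h.key_pos hu') (not_lt.2 hux')
          · have hlt := lt_of_le_of_ne hux' fun e =>
              hux (h.inj _ (h.sub_zero _ hu') _ (h.sub_zero _ hxA) e)
            exact (hd.2.2 x hxA hlt).trans mb.2.1
        · exact hd.2.2 e he hue
    · rw [hlev' _ (by omega)] at hu
      rw [hlev' _ hj, hlev' (j + 1) (by omega)]
      exact h.lower j u hu
  · rw [hlevi, hx']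
    split_ifs with hbw
    · refine reach_zero (.inr (Finset.mem_insert_self _ _)) hbw fun d hd hdw => ?_
      rcases Finset.mem_insert.1 hd with rfl | hd
      · exact le_rfl
      · exact (hx.le hd hdw).trans mb.2.1.le
    · refine reach_zero (hx.1.imp_right Finset.mem_insert_of_mem) hx.2.1 fun d hd hdw => ?_
      rcases Finset.mem_insert.1 hd with rfl | hd
      · exact absurd hdw hbw
      · exact hx.le hd hdw
  · rw [hlevi, hlev' _ hi2]
    have hle : gap key (Lev i) (insert b (Lev (i + 1))) (key x') ⊆
        (gap key (Lev i) (Lev (i + 1)) (key x)).erase b := fun d hd => by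
      rw [mem_gap] at hd
      have hxx' : key x ≤ key x' := by
        rw [hx']; split_ifs
        · exact mb.2.1.le
        · exact le_rfl
      refine Finset.mem_erase.2 ⟨?_, mem_gap.2 ⟨hd.1, hxx'.trans_lt hd.2.1, fun e he hxe => ?_⟩⟩
      · intro e
        rw [e] at hd
        exact lt_irrefl _ (hd.2.2 b (Finset.mem_insert_self _ _) hd.2.1)
      · refine hd.2.2 e (Finset.mem_insert_of_mem he) ?_
        rw [hx']; split_ifs
        · exact mb.2.2 e he hxe
        · exact hxe
    -- The old gap had at most three elements, and `b` has left it.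
    have h4 := Finset.card_le_card hle
    rw [Finset.card_erase_of_mem g2.1] at h4
    have := h.upper i (key x)
    omega

/-- A new element on level `0`. -/
theorem insert (h : Skip key N H Lev nx) {x : ℕ} (hH : 0 < H) 
    (hx : Reach key (Lev 0) (key (N + 1)) x 0) {q : ℕ} (hq : Reach key (Lev 1) (key (N + 1)) q 0)
    (hqg : (gap key (Lev 0) (Lev 1) (key q)).card ≤ 2) (hpos : 0 < key (N + 1))
    (hne : ∀ c ∈ Lev 0, key c ≠ key (N + 1)) {nx' : ℕ → ℕ → ℕ}
    (hn1 : nx' 0 (N + 1) = nx 0 x) (hn2 : nx' 0 x = N + 1)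
    (hn3 : ∀ j u, j < H → u ≤ N → ¬ (j = 0 ∧ u = x) → nx' j u = nx j u) :
    ∃ Lev', Skip key (N + 1) H Lev' nx' := by
  classical
  have hxb : key x < key (N + 1) := by
    refine lt_of_le_of_ne hx.2.1 ?_
    rcases hx.1 with rfl | hxA
    · rw [h.key0]; exact hpos.ne
    · exact hne x hxA
  have hb : N + 1 ∉ Lev 0 := fun hb => by have := (h.le hb).2; omega
  have hleN : ∀ {u j : ℕ}, u = 0 ∨ u ∈ Lev j → u ≤ N := fun hu =>
    hu.elim (fun e => e ▸ Nat.zero_le _) fun e => (h.le e).2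
  have hlev' : ∀ j, Function.update Lev 0 (Insert.insert (N + 1) (Lev 0)) (j + 1) = Lev (j + 1) :=
    fun j => Function.update_of_ne (by omega) _ _
  have hlevi : Function.update Lev 0 (Insert.insert (N + 1) (Lev 0)) 0 =
      Insert.insert (N + 1) (Lev 0) := Function.update_self _ _ _
  refine ⟨Function.update Lev 0 (Insert.insert (N + 1) (Lev 0)), ⟨?_, ?_, h.key0, ?_, ?_, ?_, ?_, ?_⟩⟩
  · intro c
    rw [hlevi, Finset.mem_insert, h.lev0]; omega
  · rintro (_ | j)
    · rw [hlevi, hlev']; exact (h.sub _).trans (Finset.subset_insert _ _)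
    · rw [hlev', hlev']; exact h.sub _
  · intro c h1 h2
    by_cases hc : c = N + 1
    · rw [hc]; exact hpos
    · exact h.pos c h1 (by omega)
  · rw [hlevi]
    intro c hc d hd e
    rcases Finset.mem_insert.1 hc with rfl | hc <;> rcases Finset.mem_insert.1 hd with rfl | hd
    · rfl
    · exact absurd e.symm (hne d hd)
    · exact absurd e (hne c hc)
    · exact h.inj c hc d hd e
  · rintro (_ | j) hj u hu
    · rw [hlevi] at hu ⊢
      refine isNext_insert hx hxb (h.next _ hH x hx.1) h.inj (by omega) hb
        (fun c hc => h.key_pos hc) (by rw [h.key0]; exact hpos)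
        (fun u => if u ≤ N then nx 0 u else nx' 0 u) (nx' 0)
        (fun u hu => ?_) hn1 hn2 (fun u hu1 hu2 => ?_) u hu
      · simp only [hleN hu, if_true]
        exact h.next _ hH u hu
      · by_cases hu : u ≤ N
        · simp only [hu, if_true]
          exact hn3 _ _ hH hu (by tauto)
        · simp [hu]
    · rw [hlev'] at hu ⊢
      rw [hn3 _ u hj (hleN hu) (by simp)]
      exact h.next _ hj u hu
  · rintro (_ | j) t
    · rw [hlevi, hlev']
      refine gap_insert_card hq hqg (h.upper _) ?_ t
      rintro rfl d hd
      exact h.key_pos hd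
    · rw [hlev', hlev']; exact h.upper _ t
  · rintro (_ | j) u hu
    · rw [hlev'] at hu
      rw [hlevi, hlev']
      obtain ⟨d, hd⟩ := h.lower _ u hu
      refine ⟨d, ?_⟩
      rw [mem_gap] at hd ⊢
      exact ⟨Finset.mem_insert_of_mem hd.1, hd.2⟩
    · rw [hlev'] at hu
      rw [hlev', hlev']; exact h.lower _ u hu

end Skip


@[simp] theorem State.set_set (s : State) (x a b : ℕ) : (s.set x a).set x b = s.set x b := by
  simp [State.set]

/-! ### The parameters and the memory layout -/

/-- The parameters `n` and `k` of the problem, and `L` with `2 ^ L ≥ n + k + 2`. -/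
structure Par where
  n : ℕ
  k : ℕ
  L : ℕ

namespace Par

variable (P : Par)

/-- The number of random words of a repetition. -/
def m : ℕ := 3 * P.L + 1
/-- The number of levels of a repetition. -/
def lev : ℕ := 2 * P.L + 2
/-- The number of repetitions. -/
def R : ℕ := 96 * P.L
def RT : ℕ := P.R * P.lev
/-- The number of buckets. -/
def B : ℕ := 8 * P.k
def BB : ℕ := P.B * P.B
/-- The number of levels of the skip list. -/
def H : ℕ := 2 * P.L + 1
/-- The number of samplers of a weight class. -/
def Z : ℕ := P.RT * P.BB
/-- The number of memory cells of a weight class. -/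
def S : ℕ := P.H + 2 * P.Z
/-- The memory cells of the weight classes begin here. -/
def base : ℕ := P.R * P.m + 2 * P.k
/-- The random words are smaller than `D`. -/
def D : ℕ := 8 * P.k * 4 * 2 ^ P.L * 2 ^ P.L

/-- The registers that hold the parameters. -/
structure Regs (s : State) : Prop where
  one : s.r 3 = 1
  n : s.r 4 = P.n
  k : s.r 5 = P.k
  L : s.r 6 = P.L
  m : s.r 7 = P.m
  lev : s.r 8 = P.lev
  RT : s.r 9 = P.RT
  B : s.r 10 = P.B
  BB : s.r 11 = P.BB
  S : s.r 12 = P.S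
  base : s.r 13 = P.base
  H : s.r 14 = P.H
  Z : s.r 16 = P.Z
  D : s.r 17 = P.D
  R : s.r 18 = P.R
  two : s.r 19 = 2
  zero : s.r 20 = 0

/-- The machine is large enough for `NB` weight classes. -/
structure Fit (z : Size) (NB : ℕ) : Prop where
  k : 1 ≤ P.k
  n : P.n + P.k + 2 ≤ 2 ^ P.L
  cells : P.base + (NB + 2) * P.S ≤ z.cells
  lim : P.base + (NB + 2) * P.S < z.lim
  pow : NB < 2 ^ (2 * P.L)
  dot : (2 * P.L + 2) * P.D < z.lim
  pow_lev : 2 ^ P.lev < z.lim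
  n4 : (P.n * P.n + 1) * (P.n * P.n + 1) < z.lim

variable {P}

theorem Regs.of_eq {s s' : State} (h : P.Regs s) (e : ∀ y < 29, 3 ≤ y → s'.r y = s.r y) :
    P.Regs s' := by
  obtain ⟨h1, h2, h3, h4, h5, h6, h7, h8, h9, h10, h11, h12, h13, h14, h15, h16, h17⟩ := h
  constructor <;> rw [e _ (by norm_num) (by norm_num)] <;> assumption

theorem Regs.of_unch {s s' : State} {p : Cmd} (h : P.Regs s) (hu : Unch p s s')
    (hp : ∀ y < 29, 3 ≤ y → p.writes y = false := by decide) : P.Regs s' :=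
  h.of_eq fun y hy hy' => hu.reg y (hp y hy hy')

theorem H_le_S (P : Par) : P.H ≤ P.S := by simp [S]

theorem H_pos (P : Par) : 0 < P.H := by simp [H]

/-- The blocks of the classes have length `S` and do not overlap, so an address determines the class
and the offset. -/
theorem addr_inj {x x' i i' : ℕ} (hi : i < P.S) (hi' : i' < P.S)
    (e : P.base + x * P.S + i = P.base + x' * P.S + i') : x = x' ∧ i = i' := by
  have e' : P.S * x + i = P.S * x' + i' := by rw [mul_comm, mul_comm _ x']; omega
  have h1 := congrArg (· / P.S) e'
  simp only [Nat.mul_add_div (by omega : P.S > 0), Nat.div_eq_of_lt hi, Nat.div_eq_of_lt hi',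
    add_zero] at h1
  subst h1
  exact ⟨rfl, by omega⟩

theorem Fit.addr_le {z : Size} {NB : ℕ} (_h : P.Fit z NB) {x i : ℕ} (hx : x ≤ NB + 1) (hi : i < P.S) :
    x * P.S + i < (NB + 2) * P.S ∧ x * P.S ≤ (NB + 2) * P.S := by
  have h1 : x * P.S ≤ (NB + 1) * P.S := Nat.mul_le_mul_right _ hx
  have h2 : (NB + 2) * P.S = (NB + 1) * P.S + P.S := by ring
  omega

/-- The successor of `x` on level `i` of the skip list. -/
def nxt (P : Par) (s : State) (i x : ℕ) : ℕ := s.mem (P.base + x * P.S + i)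

end Par

@[simp] theorem Par.nxt_set (P : Par) (s : State) (x a : ℕ) : P.nxt (s.set x a) = P.nxt s := rfl

/-! ### The search for a weight class -/

def nxAddr (x i : ℕ) : Cmd := .op .mul 40 x 12 ;; .op .add 40 40 13 ;; .op .add 40 40 i
def getNx (d x i : ℕ) : Cmd := nxAddr x i ;; .load d 40
-- With truncated subtraction, the sum of the two differences vanishes only for equal words.
def neq (x y : ℕ) : Cmd := .op .sub 41 x y ;; .op .sub 42 y x ;; .op .add 41 41 42

/-- During the search register `31` holds the current element, `32` the level and `30` the cell of
the weight that is searched for. A `wsum` of length `1` is an exact comparison of two weights. The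
pointer `0` means that there is no successor. -/
def moveStep : Cmd :=
  getNx 33 31 32 ;; .branch 33 (.wsum 34 3 33 30 ;; .branch 34 (.move 31 33) .skip) .skip

/-- Registers `36`, `37`, `38` receive the first three elements after the current one on the lower
level. The gap is full if none of them is the upper successor in `33`; then the middle one is linked
into the upper level and becomes current if its weight does not exceed the one searched for. -/
def raiseStep : Cmd :=
  .branch 32 (.op .sub 35 32 3 ;; getNx 33 31 32 ;; getNx 36 31 35 ;; neq 36 33 ;;
    .branch 41 (getNx 37 36 35 ;; neq 37 33 ;;
      .branch 41 (getNx 38 37 35 ;; neq 38 33 ;;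
        .branch 41 (nxAddr 37 32 ;; .store 40 33 ;; nxAddr 31 32 ;; .store 40 37 ;;
          .wsum 34 3 37 30 ;; .branch 34 (.move 31 37) .skip) .skip) .skip) .skip) .skip

/-- Two moves suffice on every level, because the gap entered from above has at most two elements.
Splitting the next gap before the descent restores this. -/
def searchBody : Cmd := moveStep ;; moveStep ;; raiseStep

section

variable {z : Size} {ε : ℝ} {P : Par} {NB : ℕ}

theorem wp_nxAddr {x i : ℕ} {s : State} {Q : State → Prop} (hs : s.r 12 = P.S) (hb : s.r 13 = P.base)
    (hf : P.Fit z NB) (hx : s.r x ≤ NB + 1) (hi : s.r i < P.S) (hi0 : i ≠ 40)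
    (hQ : Q (s.set 40 (P.base + s.r x * P.S + s.r i))) : wp z ε (nxAddr x i) Q s := by
  have h1 := hf.addr_le hx hi
  have h2 := hf.lim
  simp only [nxAddr, wp, WordOp.eval, State.set_r, State.set_set, hs, hb]
  simp only [Nat.reduceEqDiff, hi0, if_false, if_true]
  rw [Nat.add_comm (s.r x * P.S)]
  exact ⟨by omega, by omega, by omega, hQ⟩

theorem wp_getNx {d x i : ℕ} {s : State} {Q : State → Prop} (hs : s.r 12 = P.S) (hb : s.r 13 = P.base)
    (hf : P.Fit z NB) (hx : s.r x ≤ NB + 1) (hi : s.r i < P.S) (hi0 : i ≠ 40)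
    (hl : P.nxt s (s.r i) (s.r x) < z.lim)
    (hQ : Q ((s.set 40 (P.base + s.r x * P.S + s.r i)).set d (P.nxt s (s.r i) (s.r x)))) :
    wp z ε (getNx d x i) Q s := by
  have h1 := hf.addr_le hx hi
  have h2 := hf.cells
  refine wp_nxAddr hs hb hf hx hi hi0 ?_
  simp only [wp, State.set_r, State.set_mem, if_true]
  exact ⟨by omega, hl, hQ⟩

theorem wp_neq {x y : ℕ} {s : State} {Q : State → Prop} (hx : s.r x < z.lim) (hy : s.r y < z.lim)
    (hx' : x ≠ 41) (hy' : y ≠ 41)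
    (hQ : ∀ a b, (a = 0 ↔ s.r x = s.r y) → Q (((s.set 41 b).set 42 (s.r y - s.r x)).set 41 a)) :
    wp z ε (neq x y) Q s := by
  simp only [neq, wp, WordOp.eval, State.set_r, if_neg hx', if_neg hy']
  simp
  exact ⟨by omega, by omega, by omega, hQ _ _ (by omega)⟩

theorem moveStep_spec {s : State} (hR : P.Regs s) (hf : P.Fit z NB) (hx : s.r 31 ≤ NB) 
    (hi : s.r 32 < P.H) (h30 : s.r 30 ≤ NB + 1) (hl : P.nxt s (s.r 32) (s.r 31) ≤ NB) :
    Ends z ε 15 moveStep s fun s' => s'.r 31 = if P.nxt s (s.r 32) (s.r 31) ≠ 0 ∧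
      s.wmem (P.nxt s (s.r 32) (s.r 31)) ≤ s.wmem (s.r 30) then P.nxt s (s.r 32) (s.r 31)
      else s.r 31 := by
  have hH := P.H_le_S
  have hS := P.H_pos
  have h1 := (hf.addr_le (x := NB + 1) (i := 0) le_rfl (by omega)).1
  have h2 := hf.cells
  have h3 := hf.lim
  have h4 : NB + 1 ≤ (NB + 1) * P.S := Nat.le_mul_of_pos_right _ (by omega)
  refine Ends.wp (wp_getNx hR.S hR.base hf (by omega) (by omega) (by norm_num) (by omega) ?_)
  generalize P.nxt s (s.r 32) (s.r 31) = y at *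
  simp only [wp, State.set_r, State.set_wmem]
  simp [hR.one]
  refine ⟨fun hy => ⟨by omega, by omega, by omega, fun h => ?_, fun h h' => ?_⟩, fun hy => ?_⟩
  · simp [hy, h]; omega
  · simp [not_le.2 h]
  · simp [hy]

theorem raiseStep_zero {s : State} (h : s.r 32 = 0) :
    Ends z ε 80 raiseStep s fun s' => s' = s := by
  refine Ends.wp ?_
  simp [raiseStep, wp, h]

theorem raiseStep_spec {s : State} {i x : ℕ} (hR : P.Regs s) (hf : P.Fit z NB) (hx : s.r 31 = x)
    (hxN : x ≤ NB) (hi : s.r 32 = i + 1) (hiH : i + 1 < P.H) (h30 : s.r 30 ≤ NB + 1)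
    (ha : P.nxt s i x ≤ NB) (hb : P.nxt s i (P.nxt s i x) ≤ NB)
    (hc : P.nxt s i (P.nxt s i (P.nxt s i x)) ≤ NB) (hy : P.nxt s (i + 1) x ≤ NB) :
    Ends z ε 80 raiseStep s fun s' =>
      ((P.nxt s i x = P.nxt s (i + 1) x ∨ P.nxt s i (P.nxt s i x) = P.nxt s (i + 1) x ∨
        P.nxt s i (P.nxt s i (P.nxt s i x)) = P.nxt s (i + 1) x) ∧ s'.mem = s.mem ∧
        s'.r 31 = x) ∨
      (P.nxt s i x ≠ P.nxt s (i + 1) x ∧ P.nxt s i (P.nxt s i x) ≠ P.nxt s (i + 1) x ∧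
        P.nxt s i (P.nxt s i (P.nxt s i x)) ≠ P.nxt s (i + 1) x ∧
        s'.mem = Function.update (Function.update s.mem
          (P.base + P.nxt s i (P.nxt s i x) * P.S + (i + 1)) (P.nxt s (i + 1) x))
          (P.base + x * P.S + (i + 1)) (P.nxt s i (P.nxt s i x)) ∧
        s'.r 31 = if s.wmem (P.nxt s i (P.nxt s i x)) ≤ s.wmem (s.r 30) then
          P.nxt s i (P.nxt s i x) else x) := by
  have hH := P.H_le_S
  have hS := P.H_pos
  have h1 := (hf.addr_le (x := NB + 1) (i := 0) le_rfl (by omega)).1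
  have h2 := hf.cells
  have h3 := hf.lim
  have h4 : NB + 1 ≤ (NB + 1) * P.S := Nat.le_mul_of_pos_right _ (by omega)
  have h5 : P.S ≤ (NB + 2) * P.S := Nat.le_mul_of_pos_left _ (by omega)
  have hR12 := hR.S
  have hR13 := hR.base
  have hR3 := hR.one
  refine Ends.wp ⟨fun _ => ?_, fun h => by omega⟩
  refine ⟨by simp only [WordOp.eval]; omega, ?_⟩
  simp only [WordOp.eval, hi, hR3, Nat.add_sub_cancel]
  refine wp_getNx (P := P) (NB := NB) (by simpa using hR12) (by simpa using hR13) hf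
    (by simp; omega) (by simp; omega) (by norm_num) (by simp [hi, hx]; omega) ?_
  simp only [State.set_r, Par.nxt_set, hi, hx]; simp only [Nat.reduceEqDiff, if_false]
  refine wp_getNx (P := P) (NB := NB) (by simpa using hR12) (by simpa using hR13) hf
    (by simp; omega) (by simp; omega) (by norm_num) (by simp [hx]; omega) ?_
  simp only [State.set_r, Par.nxt_set, hx]; simp only [Nat.reduceEqDiff, if_false, if_true]
  set y := P.nxt s (i + 1) x with hy_def
  set a := P.nxt s i x with ha_def
  set b := P.nxt s i a with hb_def
  set c := P.nxt s i b with hc_def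
  refine wp_neq (by simp; omega) (by simp; omega) (by norm_num) (by norm_num) fun d e hd => ?_
  simp only [State.set_r] at hd; simp only [Nat.reduceEqDiff, if_false, if_true] at hd
  refine ⟨fun h => ?_, fun h => ?_⟩
  swap
  · simp only [State.set_r, if_true] at h
    exact .inl ⟨.inl (hd.1 h), by simp, by simp [hx]⟩
  simp only [State.set_r, if_true] at h
  have hay : a ≠ y := fun e => h (hd.2 e)
  clear hd h
  refine wp_getNx (P := P) (NB := NB) (by simpa using hR12) (by simpa using hR13) hf
    (by simp; omega) (by simp; omega) (by norm_num) (by simp; omega) ?_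
  simp only [State.set_r, Par.nxt_set]; simp only [Nat.reduceEqDiff, if_false, if_true]
  rw [← hb_def]
  refine wp_neq (by simp; omega) (by simp; omega) (by norm_num) (by norm_num) fun d e hd => ?_
  simp only [State.set_r] at hd; simp only [Nat.reduceEqDiff, if_false, if_true] at hd
  refine ⟨fun h => ?_, fun h => ?_⟩
  swap
  · simp only [State.set_r, if_true] at h
    exact .inl ⟨.inr (.inl (hd.1 h)), by simp, by simp [hx]⟩
  simp only [State.set_r, if_true] at h
  have hby : b ≠ y := fun e => h (hd.2 e)
  clear hd h
  refine wp_getNx (P := P) (NB := NB) (by simpa using hR12) (by simpa using hR13) hf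
    (by simp; omega) (by simp; omega) (by norm_num) (by simp; omega) ?_
  simp only [State.set_r, Par.nxt_set]; simp only [Nat.reduceEqDiff, if_false, if_true]
  rw [← hc_def]
  refine wp_neq (by simp; omega) (by simp; omega) (by norm_num) (by norm_num) fun d e hd => ?_
  simp only [State.set_r] at hd; simp only [Nat.reduceEqDiff, if_false, if_true] at hd
  refine ⟨fun h => ?_, fun h => ?_⟩
  swap
  · simp only [State.set_r, if_true] at h
    exact .inl ⟨.inr (.inr (hd.1 h)), by simp, by simp [hx]⟩
  simp only [State.set_r, if_true] at h
  have hcy : c ≠ y := fun e => h (hd.2 e)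
  clear hd h
  have hA1 := hf.addr_le (x := b) (i := i + 1) (by omega) (by omega)
  have hA2 := hf.addr_le (x := x) (i := i + 1) (by omega) (by omega)
  refine wp_nxAddr (P := P) (NB := NB) (by simpa using hR12) (by simpa using hR13) hf
    (by simp; omega) (by simp; omega) (by norm_num) ?_
  refine ⟨by simp [hi]; omega, ?_⟩
  refine wp_nxAddr (P := P) (NB := NB) (by simpa using hR12) (by simpa using hR13) hf
    (by simp; omega) (by simp; omega) (by norm_num) ?_
  refine ⟨by simp [hi, hx]; omega, ?_⟩
  refine ⟨by simpa using hR3, by simp; omega, by simp; omega, by omega, fun h => ?_, fun h => ?_⟩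
  · simp at h
    refine ⟨fun _ => ?_, fun h => ?_⟩
    · refine ⟨by simp; omega, .inr ⟨hay, hby, hcy, ?_, ?_⟩⟩
      · funext v; simp [Function.update_apply, hi, hx]
      · simp [h]
    · simp at h
  · simp at h
    refine ⟨fun h => ?_, fun _ => ?_⟩
    · simp at h
    · refine .inr ⟨hay, hby, hcy, ?_, ?_⟩
      · funext v; simp [Function.update_apply, hi, hx]
      · simp [h, hx]

end


/-! ### Skip lists under changes of keys and pointers, and the complete search -/

theorem isNext_congr {key key' : ℕ → ℝ} {A : Finset ℕ} {x y : ℕ} (hA : ∀ c ∈ A, key' c = key c)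
    (hx : key' x = key x) (h : IsNext key A x y) : IsNext key' A x y := by
  obtain ⟨e, g⟩ | ⟨e, g, g'⟩ := h
  · exact .inl ⟨e, fun c hc => by rw [hA c hc, hx]; exact g c hc⟩
  · exact .inr ⟨e, by rwa [hA y e, hx], fun c hc hlt => by
      rw [hA c hc, hx] at hlt; rw [hA c hc, hA y e]; exact g' c hc hlt⟩

theorem gap_congr {key key' : ℕ → ℝ} {A A' : Finset ℕ} (hA : ∀ c ∈ A, key' c = key c)
    (hA' : A' ⊆ A) (t : ℝ) : gap key' A A' t = gap key A A' t := by
  ext c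
  rw [mem_gap, mem_gap]
  refine and_congr_right fun hc => ?_
  rw [hA c hc]
  refine and_congr_right fun _ => forall₂_congr fun d hd => ?_
  rw [hA d (hA' hd)]

theorem Skip.congr_key {key key' : ℕ → ℝ} {N H : ℕ} {Lev : ℕ → Finset ℕ} {nx : ℕ → ℕ → ℕ}
    (h : Skip key N H Lev nx) (e : ∀ c ≤ N, key' c = key c) : Skip key' N H Lev nx := by
  have e' : ∀ i, ∀ c ∈ Lev i, key' c = key c := fun i c hc => e c (h.le hc).2
  refine ⟨h.lev0, h.sub, by rw [e 0 (Nat.zero_le _), h.key0], fun c h1 h2 => ?_, ?_, ?_, ?_, ?_⟩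
  · rw [e c h2]; exact h.pos c h1 h2
  · intro c hc d hd
    rw [e' 0 c hc, e' 0 d hd]; exact h.inj c hc d hd
  · intro i hi x hx
    refine isNext_congr (e' i) (hx.elim (fun e0 => e0 ▸ e 0 (Nat.zero_le _)) (e' i x)) (h.next i hi x hx)
  · intro i t
    rw [gap_congr (e' i) (h.sub i)]; exact h.upper i t
  · intro i x hx
    rw [gap_congr (e' i) (h.sub i), e' _ x hx]; exact h.lower i x hx

theorem Skip.congr_nx {key : ℕ → ℝ} {N H : ℕ} {Lev : ℕ → Finset ℕ} {nx nx' : ℕ → ℕ → ℕ}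
    (h : Skip key N H Lev nx) (e : ∀ i < H, ∀ c ≤ N, nx' i c = nx i c) : Skip key N H Lev nx' :=
  ⟨h.lev0, h.sub, h.key0, h.pos, h.inj, fun i hi x hx => by
    rw [e i hi x (hx.elim (fun e0 => e0 ▸ Nat.zero_le _) fun hc => (h.le hc).2)]
    exact h.next i hi x hx, h.upper, h.lower⟩

theorem Skip.nx_le {key : ℕ → ℝ} {N H : ℕ} {Lev : ℕ → Finset ℕ} {nx : ℕ → ℕ → ℕ}
    (h : Skip key N H Lev nx) {i x : ℕ} (hi : i < H) (hx : x = 0 ∨ x ∈ Lev i) :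
    (nx i x = 0 ∨ nx i x ∈ Lev i) ∧ nx i x ≤ N := by
  obtain ⟨e, -⟩ | ⟨e, -⟩ := h.next i hi x hx
  · exact ⟨.inl e, e ▸ Nat.zero_le _⟩
  · exact ⟨.inr e, (h.le e).2⟩

section

variable {z : Size} {ε : ℝ} {P : Par} {NB : ℕ}

/-- The address is not that of a pointer of one of the first `N` elements of the skip list. -/
def Par.NotPtr (P : Par) (N a : ℕ) : Prop := ∀ x ≤ N, ∀ i < P.H, a ≠ P.base + x * P.S + i

/-- The invariant of the search: `j` levels remain. -/
def SearchInv (P : Par) (key : ℕ → ℝ) (N : ℕ) (w : ℝ) (mem : ℕ → ℕ) (j : ℕ) (s : State) : Prop :=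
  ∃ Lev, Skip key N P.H Lev (P.nxt s) ∧ (∀ a, P.NotPtr N a → s.mem a = mem a) ∧
    Reach key (Lev j) w (s.r 31) 0 ∧
    match j with
    | 0 => ∃ q, Reach key (Lev 1) w q 0 ∧ (gap key (Lev 0) (Lev 1) (key q)).card ≤ 2
    | j + 1 => (gap key (Lev j) (Lev (j + 1)) (key (s.r 31))).card ≤ 2

theorem searchBody_spec {s : State} {N j : ℕ} {mem : ℕ → ℕ} (hR : P.Regs s) (hf : P.Fit z NB)
    (hN : N ≤ NB) (h30 : s.r 30 ≤ NB + 1) (hj : s.r 32 = j) (hjH : j < P.H)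
    (h : SearchInv P s.wmem N (s.wmem (s.r 30)) mem (j + 1) s) :
    Ends z ε 120 searchBody s
      (SearchInv P s.wmem N (s.wmem (s.r 30)) mem j) := by
  obtain ⟨Lev, hS, hm, hx, hg⟩ := h
  set key := s.wmem with hkey
  set w := key (s.r 30) with hw
  have hx0 : s.r 31 = 0 ∨ s.r 31 ∈ Lev j := hx.1.imp_right fun h => hS.sub j h
  have hxN : ∀ {u i : ℕ}, u = 0 ∨ u ∈ Lev i → u ≤ N := fun hu =>
    hu.elim (fun e => e ▸ Nat.zero_le _) fun e => (hS.le e).2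
  have hx1 : Reach key (Lev j) w (s.r 31) 2 := hx.down (hS.sub j) hg
  -- a move
  have move : ∀ (s₁ : State) (m : ℕ), P.Regs s₁ → s₁.r 32 = j → s₁.r 30 = s.r 30 →
      s₁.mem = s.mem → s₁.wmem = s.wmem → Reach key (Lev j) w (s₁.r 31) m →
      Ends z ε 15 moveStep s₁ fun s₂ => Reach key (Lev j) w (s₂.r 31) (m - 1) := by
    intro s₁ m hR₁ h32 h30' hmem hwm hr
    have hnx : ∀ i u, P.nxt s₁ i u = P.nxt s i u := fun i u => by simp only [Par.nxt, hmem]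
    have hn := hS.next j hjH _ hr.1
    have hle := (hS.nx_le hjH hr.1).2
    refine (moveStep_spec hR₁ hf ((hxN hr.1).trans hN) (by omega) (by omega)
      (by rw [h32, hnx]; omega)).mono le_rfl fun s₂ _ h2 => ?_
    rw [h2, h32, hnx, hwm, h30']
    split_ifs with hc
    · rcases m with _ | m
      · exact (hr.mono (Nat.zero_le 1)).move hn hc.1 hc.2
      · exact hr.move hn hc.1 hc.2
    · exact (hr.halt hn (fun h0 => fun h' => hc ⟨h0, h'⟩) (hS.zero_notMem j)).mono (Nat.zero_le _)
  refine Ends.seq (move s 2 hR hj rfl rfl rfl hx1) (fun s₁ hu₁ hr₁ => ?_) (t₂ := 104) (by norm_num)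
  have hR₁ := hR.of_unch hu₁
  refine Ends.seq (move s₁ 1 hR₁ (by rw [hu₁.reg 32 rfl, hj]) (hu₁.reg 30 rfl)
    (hu₁.mem rfl) (hu₁.wmem rfl) hr₁) (fun s₂ hu₂ hr₂ => ?_) (t₂ := 80) (by norm_num)
  have hR₂ := hR₁.of_unch hu₂
  have hu := hu₁.trans hu₂
  have h32 : s₂.r 32 = j := by rw [hu.reg 32 rfl, hj]
  have hmem : s₂.mem = s.mem := hu.mem rfl
  have hnx : P.nxt s₂ = P.nxt s := by funext i u; simp only [Par.nxt, hmem]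
  have hwm : s₂.wmem = key := hu.wmem rfl
  have h30₂ : s₂.r 30 = s.r 30 := hu.reg 30 rfl
  rcases j with _ | i
  · refine (raiseStep_zero h32).mono le_rfl ?_
    rintro _ - rfl
    -- On level `0` there is no gap below to split. The element from which this level was entered
    -- serves as `q`: its gap has room for the new element.
    exact ⟨Lev, by rwa [hnx], by rwa [hmem], hr₂, s.r 31, hx, hg⟩
  · have hx2 := hr₂.1
    have hxi : s₂.r 31 = 0 ∨ s₂.r 31 ∈ Lev i := hx2.imp_right fun h => hS.sub i h
    have ha := hS.nx_le (i := i) (by omega) hxi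
    have hb := hS.nx_le (i := i) (by omega) ha.1
    have hc := hS.nx_le (i := i) (by omega) hb.1
    have hy := hS.nx_le hjH hx2
    refine (raiseStep_spec hR₂ hf rfl ((hxN hx2).trans hN) h32 hjH (by omega) ?_ ?_ ?_ ?_).mono le_rfl
      fun s₃ hu₃ h3 => ?_
    · rw [hnx]; exact ha.2.trans hN
    · rw [hnx]; exact hb.2.trans hN
    · rw [hnx]; exact hc.2.trans hN
    · rw [hnx]; exact hy.2.trans hN
    rw [hnx, hwm, h30₂, hmem] at h3
    obtain ⟨hc', hm₃, hx₃⟩ | ⟨h1, h2, h3, hm₃, hx₃⟩ := h3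
    · have hnx₃ : P.nxt s₃ = P.nxt s := by funext i u; simp only [Par.nxt, hm₃]
      refine ⟨Lev, by rwa [hnx₃], by rwa [hm₃], by rwa [hx₃], ?_⟩
      simp only [hx₃]
      exact hS.gap_card_le_two hjH hx2 hc'
    · have hSz := P.H_le_S
      have hn1 : P.nxt s₃ (i + 1) (P.nxt s i (P.nxt s i (s₂.r 31))) = P.nxt s (i + 1) (s₂.r 31) := by
        simp only [Par.nxt, hm₃]
        rw [Function.update_apply, Function.update_self]
        split_ifs with e
        · have := (Par.addr_inj (by omega) (by omega) e).1
          exact absurd (hS.gap_next hjH hx2 (.inr (hS.gap_next hjH hx2 (.inl rfl) h1).1) h2).1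
            (fun hmg => by
              have h5 := (mem_gap.1 hmg).2.1
              have h6 : P.nxt s i (P.nxt s i (s₂.r 31)) = s₂.r 31 := this
              rw [h6] at h5
              exact lt_irrefl _ h5)
        · rfl
      have hn2 : P.nxt s₃ (i + 1) (s₂.r 31) = P.nxt s i (P.nxt s i (s₂.r 31)) := by
        simp only [Par.nxt, hm₃, Function.update_self]
      have hn3 : ∀ j' u, j' < P.H → u ≤ N →
          ¬ (j' = i + 1 ∧ (u = s₂.r 31 ∨ u = P.nxt s i (P.nxt s i (s₂.r 31)))) →
          P.nxt s₃ j' u = P.nxt s j' u := by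
        intro j' u hj' hu' hne
        simp only [Par.nxt, hm₃]
        rw [Function.update_of_ne, Function.update_of_ne]
        · intro e
          have := Par.addr_inj (by omega) (by omega) e
          exact hne ⟨this.2, .inr this.1⟩
        · intro e
          have := Par.addr_inj (by omega) (by omega) e
          exact hne ⟨this.2, .inl this.1⟩
      obtain ⟨Lev', hS', hr', hg', hbl⟩ := hS.raise hjH hr₂ hx hg h1 h2 h3 hn1 hn2 hn3 hx₃
      refine ⟨Lev', hS', fun a ha' => ?_, hr', hg'⟩
      rw [hm₃, ← hm a ha', Function.update_of_ne (ha' _ (hxN hx2) _ hjH),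
        Function.update_of_ne (ha' _ hb.2 _ hjH)]

/-- The new weight is placed in cell `N + 1`, where it already stands in position should it become a
representative. The search begins at the head `0`, above the top level. -/
def search : Cmd :=
  .op .add 30 29 3 ;; .wread 30 ;; .const 31 0 ;; .move 32 14 ;; down 32 searchBody

theorem search_spec {s : State} {N : ℕ} {Lev : ℕ → Finset ℕ} (hR : P.Regs s) (hf : P.Fit z NB)
    (hN : N ≤ NB) (h29 : s.r 29 = N) (hw : 0 < s.win) (hS : Skip s.wmem N P.H Lev (P.nxt s)) :
    Ends z ε (P.H * 123 + 10) search s fun s' =>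
      s'.r 30 = N + 1 ∧ s'.wmem = Function.update s.wmem (N + 1) s.win ∧
      (∀ a, P.NotPtr N a → s'.mem a = s.mem a) ∧
      ∃ Lev q, Skip s'.wmem N P.H Lev (P.nxt s') ∧
        Reach s'.wmem (Lev 0) s.win (s'.r 31) 0 ∧ Reach s'.wmem (Lev 1) s.win q 0 ∧
        (gap s'.wmem (Lev 0) (Lev 1) (s'.wmem q)).card ≤ 2 := by
  have hH := P.H_le_S
  have hH0 := P.H_pos
  have h1 := (hf.addr_le (x := NB + 1) (i := 0) le_rfl (by omega)).1
  have h2 := hf.cells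
  have h3 := hf.lim
  have h4 : NB + 1 ≤ (NB + 1) * P.S := Nat.le_mul_of_pos_right _ (by omega)
  have h5 : P.S ≤ (NB + 2) * P.S := Nat.le_mul_of_pos_left _ (by omega)
  refine Ends.seq (t₂ := P.H * 123 + 7) (Q₁ := fun s' => s' = s.set 30 (N + 1)) (t₁ := 1) (Ends.wp ?_) ?_
    (by omega)
  · simp [wp, WordOp.eval, hR.one, h29]; omega
  rintro _ - rfl
  refine Ends.seq (t₂ := P.H * 123 + 5)
    (Q₁ := fun s' => s' = (s.set 30 (N + 1)).setW (N + 1) s.win) (t₁ := 1) (Ends.wp ?_) ?_ (by omega)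
  · simp [wp]; omega
  rintro _ - rfl
  refine Ends.seq (t₂ := P.H * 123 + 3)
    (Q₁ := fun s' => s' = ((s.set 30 (N + 1)).setW (N + 1) s.win).set 31 0) (t₁ := 1) (Ends.wp ?_) ?_ (by omega)
  · simp [wp]; omega
  rintro _ - rfl
  refine Ends.seq (t₂ := P.H * 123 + 1)
    (Q₁ := fun s' => s' = (((s.set 30 (N + 1)).setW (N + 1) s.win).set 31 0).set 32 P.H) (t₁ := 1)
    (Ends.wp ?_) ?_ (by omega)
  · simp [wp, hR.H]; omega
  rintro _ - rfl
  set s₀ := (((s.set 30 (N + 1)).setW (N + 1) s.win).set 31 0).set 32 P.H with hs₀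
  have hR₀ : P.Regs s₀ := hR.of_eq fun y hy hy' => by
    simp [hs₀, show y ≠ 32 by omega, show y ≠ 31 by omega, show y ≠ 30 by omega]
  have hwm : s₀.wmem = Function.update s.wmem (N + 1) s.win := by
    funext c; simp [hs₀, Function.update_apply]
  have hwin : s₀.wmem (N + 1) = s.win := by rw [hwm, Function.update_self]
  have hS₀ : Skip s₀.wmem N P.H Lev (P.nxt s₀) := hS.congr_key fun c hc => by
    rw [hwm, Function.update_of_ne (by omega)]
  -- Since there are fewer than `2 ^ (2 L)` classes, the levels from `2 L` on are empty. So the head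
  -- is trivially the predecessor on level `H = 2 L + 1`, and the first gap is empty.
  have hemp : ∀ i, 2 * P.L ≤ i → Lev i = ∅ := fun i hi => hS.lev_eq_empty
    ((hN.trans_lt hf.pow).trans_le (Nat.pow_le_pow_right (by norm_num) hi))
  refine Ends.down (SearchInv P s₀.wmem N s.win s.mem) P.H (by simp [hs₀]) (by omega)
    hR₀.one (by rfl) (by norm_num) (by rfl) ?_ (T := 120) ?_ ?_ le_rfl
  · refine ⟨Lev, hS₀, fun a _ => rfl, ?_, ?_⟩
    · refine reach_zero (.inl (by simp [hs₀])) ?_ ?_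
      · simp only [hs₀, State.set_r]
        simp only [Nat.reduceEqDiff, if_false, if_true]
        rw [hS₀.key0]; exact hw.le
      · simp [hemp P.H (by simp [Par.H])]
    · rw [Par.H]
      simp [gap, hemp (2 * P.L) (by simp)]
  · intro j hj s' h32 hu hI
    have hR' : P.Regs (s'.set 32 j) := (hR₀.of_unch hu).of_eq fun y hy hy' => by
      simp [show y ≠ 32 by omega]
    have hw' : (s'.set 32 j).wmem = s₀.wmem := hu.wmem rfl
    have h30 : (s'.set 32 j).r 30 = N + 1 := by
      simp; rw [hu.reg 30 rfl]; simp [hs₀]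
    have := searchBody_spec (ε := ε) (s := s'.set 32 j) (N := N) (j := j) (mem := s.mem) hR' hf hN
      (by omega) (by simp) hj (by
        rw [hw', h30, hwin]
        obtain ⟨Lev', a, b, c, d⟩ := hI
        exact ⟨Lev', a, b, by simpa using c, by simpa using d⟩)
    rwa [hw', h30, hwin] at this
  · rintro s' hu - ⟨Lev', a, b, c, q, d, e⟩
    have hw' : s'.wmem = s₀.wmem := hu.wmem rfl
    refine ⟨by rw [hu.reg 30 rfl]; simp [hs₀], by rw [hw', hwm], b, Lev', q, ?_⟩
    rw [hw']
    exact ⟨a, c, d, e⟩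

end


/-- Two weights that are equal up to the factor `1 + ε / 2`. -/
def near (ε a b : ℝ) : Prop := 2 * a ≤ (2 + ε) * b ∧ 2 * b ≤ (2 + ε) * a

/-- The class of the weight `w`: the first representative that is near it, `0` if there is none. -/
noncomputable def cls (ε : ℝ) (key : ℕ → ℝ) (N : ℕ) (w : ℝ) : ℕ :=
  sInf {c | 1 ≤ c ∧ c ≤ N ∧ near ε (key c) w}

theorem near.symm {ε a b : ℝ} (h : near ε a b) : near ε b a := ⟨h.2, h.1⟩

theorem near_self {ε a : ℝ} (hε : 0 < ε) (ha : 0 < a) : near ε a a :=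
  ⟨by nlinarith, by nlinarith⟩

theorem near_of_le {ε a b : ℝ} (hε : 0 < ε) (hb : 0 < b) (hab : a ≤ b) (h : 2 * b ≤ (2 + ε) * a) :
    near ε a b := ⟨by nlinarith, h⟩

/-! ### Weight classes and their stability -/

section cls

variable {ε w : ℝ} {key : ℕ → ℝ} {N : ℕ}

theorem cls_eq_zero : cls ε key N w = 0 ↔ ∀ c, 1 ≤ c → c ≤ N → ¬ near ε (key c) w := by
  rw [cls, Nat.sInf_eq_zero]
  constructor
  · rintro (h | h) c h1 h2 h3
    · exact absurd h.1 (by norm_num)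
    · exact (Set.eq_empty_iff_forall_notMem.1 h) c ⟨h1, h2, h3⟩
  · exact fun h => .inr (Set.eq_empty_iff_forall_notMem.2 fun c hc => h c hc.1 hc.2.1 hc.2.2)

theorem cls_spec (h : cls ε key N w ≠ 0) :
    1 ≤ cls ε key N w ∧ cls ε key N w ≤ N ∧ near ε (key (cls ε key N w)) w :=
  Nat.sInf_mem (s := {c | 1 ≤ c ∧ c ≤ N ∧ near ε (key c) w}) <| by
    by_contra hne
    exact h (Nat.sInf_eq_zero.2 (.inr (Set.not_nonempty_iff_eq_empty.1 hne)))

theorem cls_eq {c : ℕ} (h1 : 1 ≤ c) (h2 : c ≤ N) (h3 : near ε (key c) w)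
    (h4 : ∀ d, 1 ≤ d → d ≤ N → near ε (key d) w → c ≤ d) : cls ε key N w = c := by
  have hne : cls ε key N w ≠ 0 := fun e => cls_eq_zero.1 e c h1 h2 h3
  have := cls_spec hne
  exact le_antisymm (Nat.sInf_le ⟨h1, h2, h3⟩) (h4 _ this.1 this.2.1 this.2.2)

/-- The class of a weight does not change when representatives are added. -/
theorem cls_stable {key' : ℕ → ℝ} {N' : ℕ} (hN : N ≤ N') (hk : ∀ c, 1 ≤ c → c ≤ N → key' c = key c)
    (h : cls ε key N w ≠ 0) : cls ε key' N' w = cls ε key N w := by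
  obtain ⟨h1, h2, h3⟩ := cls_spec h
  refine cls_eq h1 (h2.trans hN) (by rwa [hk _ h1 h2]) fun d hd hdN hdw => ?_
  -- New representatives have indices above `N`, so they cannot undercut the old minimum; below it,
  -- nothing has changed.
  by_contra hlt
  have hd2 : d ≤ N := by omega
  exact hlt (Nat.sInf_le ⟨hd, hd2, by rwa [hk d hd hd2] at hdw⟩)

/-- Only the predecessor and the successor of `w` can be near `w`. -/
theorem Skip.eq_of_near {H : ℕ} {Lev : ℕ → Finset ℕ} {nx : ℕ → ℕ → ℕ} (h : Skip key N H Lev nx)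
    (hH : 0 < H) (hε : 0 < ε)
    (hsep : ∀ c d, 1 ≤ c → c ≤ N → 1 ≤ d → d ≤ N → c ≠ d → ¬ near ε (key c) (key d))
    {x : ℕ} (hx : Reach key (Lev 0) w x 0) {c : ℕ} (h1 : 1 ≤ c) (h2 : c ≤ N)
    (hc : near ε (key c) w) :
    (c = x ∧ key c ≤ w) ∨ (c = nx 0 x ∧ w < key c) := by
  have hcL := (h.lev0 c).2 ⟨h1, h2⟩
  have hcp := h.pos c h1 h2
  rcases le_or_gt (key c) w with hcw | hcw
  · left
    refine ⟨?_, hcw⟩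
    by_contra hne
    have hle := hx.le hcL hcw
    rcases hx.1 with rfl | hxL
    · exact absurd (h.key_pos hcL) (not_lt.2 hle)
    · have hxN := h.le hxL
      -- Here `key c ≤ key x ≤ w`. If `c` is near `w`, it is also near `x`, against the separation
      -- of the representatives.
      refine hsep c x h1 h2 hxN.1 hxN.2 hne (near_of_le hε (h.pos x hxN.1 hxN.2) hle ?_)
      linarith [hc.2, hx.2.1]
  · right
    refine ⟨?_, hcw⟩
    obtain ⟨-, e⟩ | ⟨e, g, g'⟩ := h.next 0 hH x hx.1
    · exact absurd (e c hcL) (not_le.2 (hx.2.1.trans_lt hcw))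
    · by_contra hne
      have hyN := h.le e
      have hle := g' c hcL (hx.2.1.trans_lt hcw)
      have hyw : w < key (nx 0 x) := by
        by_contra hyw
        exact absurd (hx.le e (not_lt.1 hyw)) (not_le.2 g)
      refine hsep _ c hyN.1 hyN.2 h1 h2 (Ne.symm hne) (near_of_le hε hcp hle ?_)
      nlinarith [hc.1]

end cls

/-! ### Determining the class of a weight from its two neighbours -/

def classPred : Cmd :=
  .const 36 0 ;; .branch 31 (.wnear 34 19 30 31 ;; .branch 34 (.move 36 31) .skip) .skip

/-- Both neighbours may be near the weight; then the smaller index wins, as the definition of `cls`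
demands. Register `19` holds `2`, so `wnear` tests the factor `1 + ε / 2`. As in `classPred`, one
direction of `near` is tested, the other being clear from the order of the two weights. -/
def classSucc : Cmd :=
  .branch 33 (.wnear 34 19 33 30 ;; .branch 34 (.branch 36
    (.op .lt 34 33 36 ;; .branch 34 (.move 36 33) .skip) (.move 36 33)) .skip) .skip

def classNew : Cmd :=
  .branch 36 .skip (.move 36 30 ;; .move 29 30 ;;
    nxAddr 36 20 ;; .store 40 33 ;; nxAddr 31 20 ;; .store 40 36)

def classify : Cmd := classPred ;; getNx 33 31 20 ;; classSucc ;; classNew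

section

variable {z : Size} {ε : ℝ} {P : Par} {NB : ℕ}

theorem classify_pred {s : State} {x : ℕ} {w : ℝ} (hR : P.Regs s) (hf : P.Fit z NB)
    (hx : s.r 31 = x) (hxN : x ≤ NB) (h30 : s.r 30 ≤ NB + 1) (hw : s.wmem (s.r 30) = w) :
    Ends z ε 10 classPred s fun s' =>
      (x ≠ 0 ∧ 2 * w ≤ (2 + ε) * s.wmem x ∧ s'.r 36 = x) ∨
      ((x = 0 ∨ ¬ 2 * w ≤ (2 + ε) * s.wmem x) ∧ s'.r 36 = 0) := by
  have hH := P.H_le_S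
  have hS := P.H_pos
  have h1 := (hf.addr_le (x := NB + 1) (i := 0) le_rfl (by omega)).1
  have h2 := hf.cells
  have h3 := hf.lim
  have h4 : NB + 1 ≤ (NB + 1) * P.S := Nat.le_mul_of_pos_right _ (by omega)
  refine Ends.wp ?_
  by_cases hx0 : x = 0
  · simp [classPred, wp, hx, hx0]; omega
  by_cases h : 2 * w ≤ (2 + ε) * s.wmem x
  · simp [classPred, wp, hx, hR.two, hw, hx0, h]; omega
  · simp [classPred, wp, hx, hR.two, hw, hx0, not_le.1 h]; omega

theorem classify_succ {s : State} {y c : ℕ} {w : ℝ} (hR : P.Regs s) (hf : P.Fit z NB)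
    (hy : s.r 33 = y) (hyN : y ≤ NB) (hc : s.r 36 = c)
    (h30 : s.r 30 ≤ NB + 1) (hw : s.wmem (s.r 30) = w) :
    Ends z ε 10 classSucc s fun s' =>
      (y ≠ 0 ∧ 2 * s.wmem y ≤ (2 + ε) * w ∧ s'.r 36 = if c = 0 ∨ y < c then y else c) ∨
      ((y = 0 ∨ ¬ 2 * s.wmem y ≤ (2 + ε) * w) ∧ s'.r 36 = c) := by
  have hH := P.H_le_S
  have hS := P.H_pos
  have h1 := (hf.addr_le (x := NB + 1) (i := 0) le_rfl (by omega)).1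
  have h2 := hf.cells
  have h3 := hf.lim
  have h4 : NB + 1 ≤ (NB + 1) * P.S := Nat.le_mul_of_pos_right _ (by omega)
  refine Ends.wp ?_
  by_cases hy0 : y = 0
  · simp [classSucc, wp, hy, hy0, hc]
  by_cases h : 2 * s.wmem y ≤ (2 + ε) * w
  · by_cases hc0 : c = 0
    · simp [classSucc, wp, hy, hR.two, hw, hy0, h, hc, hc0]; omega
    by_cases hlt : y < c
    · simp [classSucc, wp, hy, hR.two, hw, hy0, h, hc, hc0, hlt, WordOp.eval]; omega
    · simp [classSucc, wp, hy, hR.two, hw, hy0, h, hc, hc0, hlt, WordOp.eval]; omega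
  · simp [classSucc, wp, hy, hR.two, hw, hy0, not_le.1 h, hc]; omega

theorem classify_new {s : State} {N x y : ℕ} (hR : P.Regs s) (hf : P.Fit z NB) (h36 : s.r 36 = 0)
    (hx : s.r 31 = x) (hxN : x ≤ N) (hy : s.r 33 = y) (hN : N ≤ NB) (h30 : s.r 30 = N + 1) :
    Ends z ε 20 classNew s fun s' =>
      s'.r 36 = N + 1 ∧ s'.r 29 = N + 1 ∧
      s'.mem = Function.update (Function.update s.mem (P.base + (N + 1) * P.S + 0) y)
        (P.base + x * P.S + 0) (N + 1) := by
  have hH := P.H_le_S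
  have hS := P.H_pos
  have h1 := (hf.addr_le (x := NB + 1) (i := 0) le_rfl (by omega)).1
  have h2 := hf.cells
  have h3 := hf.lim
  have h4 : NB + 1 ≤ (NB + 1) * P.S := Nat.le_mul_of_pos_right _ (by omega)
  have hA1 := hf.addr_le (x := N + 1) (i := 0) (by omega) (by omega)
  have hA2 := hf.addr_le (x := x) (i := 0) (by omega) (by omega)
  have hR12 := hR.S
  have hR13 := hR.base
  have hR20 := hR.zero
  refine Ends.wp ⟨fun h => absurd h36 h, fun _ => ?_⟩
  refine ⟨by omega, by simp; omega, ?_⟩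
  refine wp_nxAddr (P := P) (NB := NB) (by simpa using hR12) (by simpa using hR13) hf
    (by simp; omega) (by simp [hR20]; omega) (by norm_num) ?_
  refine ⟨by simp [h30, hR20]; omega, ?_⟩
  refine wp_nxAddr (P := P) (NB := NB) (by simpa using hR12) (by simpa using hR13) hf
    (by simp; omega) (by simp [hR20]; omega) (by norm_num) ?_
  refine ⟨by simp [hR20, hx]; omega, ?_⟩
  refine ⟨by simp [h30], by simp [h30], ?_⟩
  funext v
  simp [Function.update_apply, h30, hx, hy, hR20]

/-- By `Skip.eq_of_near` the predecessor and the successor are the only candidates. If neither is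
near, the weight is linked in behind its predecessor; the bound on the gap of `q`, left behind by
the search, is what allows this on level `0`. -/
theorem classify_spec {s : State} {N : ℕ} {Lev : ℕ → Finset ℕ} {q : ℕ} {w : ℝ} (hε : 0 < ε)
    (hR : P.Regs s) (hf : P.Fit z NB) (hN : N ≤ NB) (h29 : s.r 29 = N) (h30 : s.r 30 = N + 1)
    (hw : 0 < w) (hwN : s.wmem (N + 1) = w) (hS : Skip s.wmem N P.H Lev (P.nxt s))
    (hsep : ∀ c d, 1 ≤ c → c ≤ N → 1 ≤ d → d ≤ N → c ≠ d → ¬ near ε (s.wmem c) (s.wmem d))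
    (hx : Reach s.wmem (Lev 0) w (s.r 31) 0) (hq : Reach s.wmem (Lev 1) w q 0)
    (hqg : (gap s.wmem (Lev 0) (Lev 1) (s.wmem q)).card ≤ 2) :
    Ends z ε 60 classify s fun s' => ∃ N', s'.r 29 = N' ∧ s'.r 36 = cls ε s.wmem N' w ∧
      cls ε s.wmem N' w ≠ 0 ∧ (N' = N ∨ N' = N + 1 ∧ cls ε s.wmem N w = 0) ∧
      (∃ Lev, Skip s.wmem N' P.H Lev (P.nxt s')) ∧ ∀ a, P.NotPtr N' a → s'.mem a = s.mem a := by
  have hH := P.H_le_S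
  have hHp := P.H_pos
  have hlim := hf.lim
  have hSS : P.S ≤ (NB + 2) * P.S := Nat.le_mul_of_pos_left _ (by omega)
  set key := s.wmem with hkey
  set x := s.r 31 with hxdef
  have hxN : x ≤ N := hx.1.elim (fun e => e ▸ Nat.zero_le _) fun e => (hS.le e).2
  have hy := hS.nx_le hHp hx.1
  set y := P.nxt s 0 x with hydef
  have hnear := fun c h1 h2 hc => hS.eq_of_near (c := c) hHp hε hsep hx h1 h2 hc
  have hyw : y ≠ 0 → w < key y := fun h0 => by
    obtain ⟨e, -⟩ | ⟨e, g, g'⟩ := hS.next 0 hHp x hx.1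
    · exact absurd e h0
    · by_contra hyw
      exact absurd (hx.le e (not_lt.1 hyw)) (not_le.2 g)
  have key0 := hS.key0
  have h4 : NB + 1 ≤ (NB + 1) * P.S := Nat.le_mul_of_pos_right _ (by omega)
  have h5 := (hf.addr_le (x := NB + 1) (i := 0) le_rfl (by omega)).1
  refine Ends.seq (classify_pred (x := x) (w := w) hR hf rfl (hxN.trans hN) (by omega) (by rw [h30]; exact hwN))
    (fun s₁ hu₁ h₁ => ?_) (t₂ := 49) (by norm_num)
  have hR₁ := hR.of_unch hu₁
  have hx₁ : s₁.r 31 = x := hu₁.reg 31 rfl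
  have hnx₁ : P.nxt s₁ 0 x = y := by simp only [Par.nxt, hu₁.mem rfl, hydef]
  refine Ends.seq (t₁ := 10) (t₂ := 38) (Q₁ := fun s' => s'.r 33 = y)
    (Ends.wp (wp_getNx hR₁.S hR₁.base hf (by omega) (by rw [hR₁.zero]; omega) (by norm_num) ?_ ?_))
    (fun s₂ hu₂ h₂ => ?_) (by norm_num)
  · rw [hx₁, hR₁.zero, hnx₁]; omega
  · simp [hx₁, hR₁.zero, hnx₁]
  have hR₂ := hR₁.of_unch hu₂
  have hu₂' : s₂.wmem = key := (hu₂.wmem rfl).trans (hu₁.wmem rfl)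
  have h30₂ : s₂.r 30 = N + 1 := by rw [hu₂.reg 30 rfl, hu₁.reg 30 rfl, h30]
  have h36₂ : s₂.r 36 = s₁.r 36 := hu₂.reg 36 rfl
  have h36le : s₁.r 36 ≤ NB := by
    rcases h₁ with ⟨-, -, e⟩ | ⟨-, e⟩ <;> rw [e] <;> omega
  refine Ends.seq (classify_succ (w := w) hR₂ hf h₂ (hy.2.trans hN) h36₂ (by omega)
    (by rw [h30₂, hu₂']; exact hwN)) (fun s₃ hu₃ h₃ => ?_) (t₂ := 27) (by norm_num)
  have hR₃ := hR₂.of_unch hu₃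
  rw [hu₂'] at h₃
  have hm₃ : s₃.mem = s.mem := (hu₃.mem rfl).trans ((hu₂.mem rfl).trans (hu₁.mem rfl))
  have h29₃ : s₃.r 29 = N := by rw [hu₃.reg 29 rfl, hu₂.reg 29 rfl, hu₁.reg 29 rfl, h29]
  have hnx₃ : P.nxt s₃ = P.nxt s := by funext i u; simp only [Par.nxt, hm₃]
  have hxnear : x ≠ 0 → 2 * w ≤ (2 + ε) * key x → near ε (key x) w := fun _ h =>
    near_of_le hε hw hx.2.1 h
  have hynear : y ≠ 0 → 2 * key y ≤ (2 + ε) * w → near ε (key y) w := fun h0 h =>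
    (near_of_le hε (hw.trans (hyw h0)) (hyw h0).le h).symm
  have hcls : s₃.r 36 = cls ε key N w := by
    by_cases h0 : cls ε key N w = 0
    · have hno := cls_eq_zero.1 h0
      rw [h0]
      rcases h₃ with ⟨g1, g2, -⟩ | ⟨-, g⟩
      · exact absurd (hynear g1 g2) (hno y (by omega) hy.2)
      · rcases h₁ with ⟨g1, g2, -⟩ | ⟨-, g'⟩
        · exact absurd (hxnear g1 g2) (hno x (by omega) hxN)
        · omega
    · symm
      obtain ⟨c1, c2, c3⟩ := cls_spec h0
      have hyor : ∀ d, 1 ≤ d → d ≤ N → near ε (key d) w →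
          (d = x ∧ s₁.r 36 = x) ∨ (d = y ∧ y ≠ 0 ∧ 2 * key y ≤ (2 + ε) * w) := by
        intro d d1 d2 d3
        rcases hnear d d1 d2 d3 with ⟨e, -⟩ | ⟨e, -⟩
        · left
          refine ⟨e, ?_⟩
          rcases h₁ with ⟨-, -, g⟩ | ⟨g, -⟩
          · exact g
          · rcases g with g | g
            · omega
            · exact absurd (by rw [← e]; exact d3.2) g
        · right
          exact ⟨e, by omega, by rw [hydef, ← e]; exact d3.1⟩
      rcases h₃ with ⟨g1, g2, g3⟩ | ⟨g1, g2⟩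
      · have hyn := hynear g1 g2
        rw [g3]
        split_ifs with hc
        · refine cls_eq (by omega) hy.2 hyn fun d d1 d2 d3 => ?_
          rcases hyor d d1 d2 d3 with ⟨e1, e2⟩ | ⟨e1, -⟩ <;> omega
        · rcases h₁ with ⟨f1, f2, f3⟩ | ⟨-, f3⟩
          · rw [f3] at hc ⊢
            refine cls_eq (by omega) hxN (hxnear f1 f2) fun d d1 d2 d3 => ?_
            rcases hyor d d1 d2 d3 with ⟨e1, -⟩ | ⟨e1, -⟩ <;> omega
          · omega
      · rw [g2]
        have hxc := (hyor _ c1 c2 c3).resolve_right fun e => g1.elim (fun g => e.2.1 g) fun g => g e.2.2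
        rcases h₁ with ⟨f1, f2, f3⟩ | ⟨f1, f3⟩
        · rw [f3]
          refine cls_eq (by omega) hxN (hxnear f1 f2) fun d d1 d2 d3 => ?_
          rcases hyor d d1 d2 d3 with ⟨e1, -⟩ | ⟨-, e1, e2⟩
          · exact e1.ge
          · exact absurd e2 (g1.resolve_left e1)
        · omega
  by_cases h0 : cls ε key N w = 0
  · refine (classify_new (N := N) (x := x) (y := y) hR₃ hf (by rw [hcls, h0])
      (by rw [hu₃.reg 31 rfl, hu₂.reg 31 rfl, hx₁]) hxN (by rw [hu₃.reg 33 rfl, h₂]) hN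
      (by rw [hu₃.reg 30 rfl, h30₂])).mono (by norm_num) fun s₄ hu₄ h₄ => ?_
    -- The weight is near itself, and no earlier representative was near it.
    have hnew : cls ε key (N + 1) w = N + 1 := by
      refine cls_eq (by omega) le_rfl (by rw [hwN]; exact near_self hε hw) fun d d1 d2 d3 => ?_
      by_contra hlt
      exact cls_eq_zero.1 h0 d d1 (by omega) d3
    refine ⟨N + 1, h₄.2.1, by rw [hnew, h₄.1], by rw [hnew]; omega, .inr ⟨rfl, h0⟩, ?_, ?_⟩
    · refine hS.insert hHp (x := x) (q := q) (by rwa [hwN]) (by rwa [hwN]) hqg (by rwa [hwN])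
        (fun c hc e => ?_) (nx' := P.nxt s₄) ?_ ?_ ?_
      · have hcN := hS.le hc
        refine cls_eq_zero.1 h0 c hcN.1 hcN.2 ?_
        rw [e, hwN]
        exact near_self hε hw
      · simp only [Par.nxt, h₄.2.2]
        rw [Function.update_of_ne, Function.update_self, hydef, Par.nxt]
        intro e
        have := (Par.addr_inj (P := P) (by omega) (by omega) e).1
        omega
      · simp only [Par.nxt, h₄.2.2, Function.update_self]
      · intro i u hi hu hne
        simp only [Par.nxt, h₄.2.2, hm₃]
        rw [Function.update_of_ne, Function.update_of_ne]
        · intro e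
          have := (Par.addr_inj (P := P) (by omega) (by omega) e).1
          omega
        · intro e
          have := Par.addr_inj (P := P) (by omega) (by omega) e
          exact hne ⟨this.2, this.1⟩
    · intro a ha
      rw [h₄.2.2, Function.update_of_ne (ha x (by omega) 0 hHp),
        Function.update_of_ne (ha (N + 1) le_rfl 0 hHp), hm₃]
  · refine Ends.mono (t := 5) (Q := fun s' => s' = s₃) (Ends.branch (t := 1) (fun _ => Ends.wp rfl)
      (fun h => absurd h (by rw [hcls]; exact h0)) (by norm_num)) (by norm_num) ?_
    rintro _ - rfl
    exact ⟨N, h29₃, hcls, h0, .inl rfl, ⟨Lev, by rwa [hnx₃]⟩, fun a _ => by rw [hm₃]⟩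

end


/-! ### The samplers -/

/-- The sum of the entries of `T` from `b` on that belong to binary digits `1` of `x`. -/
def dot (T : ℕ → ℕ) (b len x : ℕ) : ℕ := ∑ i ∈ Finset.range len, x / 2 ^ i % 2 * T (b + i)

namespace Par

variable (P : Par)

/-- The bucket of the vertex `x` in the repetition `r`. -/
def hv (T : ℕ → ℕ) (r x : ℕ) : ℕ := dot T (r * P.m) P.L x % P.B

/-- The hash value that determines in which levels of the repetition `r` the edge `e` survives. -/
def gv (T : ℕ → ℕ) (r e : ℕ) : ℕ :=
  T (r * P.m + P.L + (P.L + P.L)) + dot T (r * P.m + P.L) (P.L + P.L) e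

/-- The edge `e = u * n + v` is recorded by the sampler `q`. -/
def hit (T : ℕ → ℕ) (e q : ℕ) : Prop :=
  P.gv T (q / P.BB / P.lev) e % 2 ^ (q / P.BB % P.lev) = 0 ∧
  q % P.BB = P.hv T (q / P.BB / P.lev) (e / P.n) * P.B + P.hv T (q / P.BB / P.lev) (e % P.n)

end Par

theorem dot_congr {T T' : ℕ → ℕ} {b len : ℕ} (h : ∀ i < len, T (b + i) = T' (b + i)) (x : ℕ) :
    dot T b len x = dot T' b len x :=
  Finset.sum_congr rfl fun i hi => by rw [h i (Finset.mem_range.1 hi)]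

theorem dot_succ (T : ℕ → ℕ) (b len x : ℕ) :
    dot T b (len + 1) x = dot T b len x + x / 2 ^ len % 2 * T (b + len) :=
  Finset.sum_range_succ _ _

theorem dot_le {T : ℕ → ℕ} {b len D : ℕ} (h : ∀ i < len, T (b + i) < D) (x : ℕ) :
    dot T b len x ≤ len * D := by
  refine (Finset.sum_le_card_nsmul _ _ D fun i hi => ?_).trans (by simp)
  have h1 := h i (Finset.mem_range.1 hi)
  have h2 : x / 2 ^ i % 2 ≤ 1 := by omega
  calc x / 2 ^ i % 2 * T (b + i) ≤ 1 * T (b + i) := Nat.mul_le_mul_right _ h2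
    _ ≤ D := by omega

theorem Par.row_le {P : Par} {r : ℕ} (hr : r < P.R) : r * P.m + P.m ≤ P.R * P.m := by
  calc r * P.m + P.m = (r + 1) * P.m := by ring
    _ ≤ P.R * P.m := Nat.mul_le_mul_right _ hr

theorem Par.hv_congr {P : Par} {T T' : ℕ → ℕ} (h : ∀ a < P.R * P.m, T a = T' a) {r : ℕ}
    (hr : r < P.R) (x : ℕ) : P.hv T r x = P.hv T' r x := by
  have := P.row_le hr
  rw [Par.hv, Par.hv, dot_congr fun i hi => h _ ?_]
  simp only [Par.m] at *
  omega

theorem Par.gv_congr {P : Par} {T T' : ℕ → ℕ} (h : ∀ a < P.R * P.m, T a = T' a) {r : ℕ}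
    (hr : r < P.R) (x : ℕ) : P.gv T r x = P.gv T' r x := by
  have := P.row_le hr
  rw [Par.gv, Par.gv, dot_congr fun i hi => h _ ?_, h]
  all_goals
    simp only [Par.m] at *
    omega

theorem Par.rep_lt {P : Par} {q : ℕ} (hq : q < P.Z) : q / P.BB / P.lev < P.R := by
  have h1 : q / P.BB < P.RT := Nat.div_lt_of_lt_mul (by rw [mul_comm]; exact hq)
  exact Nat.div_lt_of_lt_mul (by rw [mul_comm]; exact h1)

theorem Par.hit_congr {P : Par} {T T' : ℕ → ℕ} (h : ∀ a < P.R * P.m, T a = T' a) {q : ℕ}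
    (hq : q < P.Z) (e : ℕ) : P.hit T e q ↔ P.hit T' e q := by
  simp only [Par.hit, Par.hv_congr h (Par.rep_lt hq), Par.gv_congr h (Par.rep_lt hq)]

def dotP (l x p : ℕ) : Cmd :=
  .const 50 0 ;; .move 60 x ;; .move 61 p ;; .move 62 l ;;
  down 62 (.op .mod 63 60 19 ;; .load 64 61 ;; .op .mul 63 63 64 ;; .op .add 50 50 63 ;;
    .op .div 60 60 19 ;; .op .add 61 61 3)

def powP (x : ℕ) : Cmd := .const 55 1 ;; .move 65 x ;; down 65 (.op .add 55 55 55)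

section

variable {z : Size} {ε : ℝ} {P : Par} {NB : ℕ}

theorem dotP_spec {s : State} {l x p D : ℕ} (h3 : s.r 3 = 1) (h19 : s.r 19 = 2)
    (hl : l < 50) (hx : x < 50) (hp : p < 50)
    (hxl : s.r x < z.lim) (hD : ∀ i < s.r l, s.mem (s.r p + i) < D)
    (hc : s.r p + s.r l ≤ z.cells) (hpl : s.r p + s.r l < z.lim) (hDl : (s.r l + 1) * D < z.lim) :
    Ends z ε (s.r l * 14 + 9) (dotP l x p) s fun s' =>
      s'.r 50 = dot s.mem (s.r p) (s.r l) (s.r x) := by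
  generalize hlen : s.r l = len at *
  have hDs : len < z.lim := by omega
  have hD1 : len * D + D < z.lim := by rwa [Nat.add_mul, one_mul] at hDl
  refine Ends.seq (t₁ := 1) (t₂ := len * 14 + 7) (Q₁ := fun s' => s' = s.set 50 0) (Ends.wp ?_) ?_
    (by omega)
  · simp [wp]; omega
  rintro _ - rfl
  refine Ends.seq (t₁ := 1) (t₂ := len * 14 + 5) (Q₁ := fun s' => s' = (s.set 50 0).set 60 (s.r x))
    (Ends.wp ?_ le_rfl) ?_ (by omega)
  · simp [wp, show x ≠ 50 by omega]; omega
  rintro _ - rfl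
  refine Ends.seq (t₁ := 1) (t₂ := len * 14 + 3)
    (Q₁ := fun s' => s' = ((s.set 50 0).set 60 (s.r x)).set 61 (s.r p)) (Ends.wp ?_ le_rfl) ?_ (by omega)
  · simp [wp, show p ≠ 50 by omega, show p ≠ 60 by omega]; omega
  rintro _ - rfl
  refine Ends.seq (t₁ := 1) (t₂ := len * 14 + 1)
    (Q₁ := fun s' => s' = (((s.set 50 0).set 60 (s.r x)).set 61 (s.r p)).set 62 len)
    (Ends.wp ?_ le_rfl) ?_ (by omega)
  · simp [wp, show l ≠ 50 by omega, show l ≠ 60 by omega, show l ≠ 61 by omega, hlen]; omega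
  rintro _ - rfl
  set s₀ := (((s.set 50 0).set 60 (s.r x)).set 61 (s.r p)).set 62 len with hs₀
  refine Ends.down (fun j s' => j ≤ len ∧ s'.r 50 = dot s.mem (s.r p) (len - j) (s.r x) ∧
    s'.r 60 = s.r x / 2 ^ (len - j) ∧ s'.r 61 = s.r p + (len - j)) len (by simp [hs₀]) hDs.le
    (by simp [hs₀, h3]) (by rfl) (by norm_num) (by rfl) ?_ (T := 11) ?_ ?_ le_rfl
  · simp [hs₀, dot]
  · rintro j hj s' h62 hu ⟨hjl, h50, h60, h61⟩
    have hmem : s'.mem = s.mem := hu.mem rfl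
    have hr3 : s'.r 3 = 1 := by rw [hu.reg 3 rfl]; simp [hs₀, h3]
    have hr19 : s'.r 19 = 2 := by rw [hu.reg 19 rfl]; simp [hs₀, h19]
    obtain ⟨i, hi⟩ : ∃ i, len - (j + 1) = i := ⟨_, rfl⟩
    have hi' : len - j = i + 1 := by omega
    have hmi := hD i (by omega)
    have hle : dot s.mem (s.r p) i (s.r x) ≤ i * D := dot_le (fun i' hi' => hD i' (by omega)) _
    have hiD : (i + 1) * D ≤ len * D := Nat.mul_le_mul_right _ (by omega)
    rw [Nat.add_mul, one_mul] at hiD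
    have hbit : s.r x / 2 ^ i % 2 * s.mem (s.r p + i) ≤ 1 * s.mem (s.r p + i) :=
      Nat.mul_le_mul_right _ (by omega)
    have hdiv : s.r x / 2 ^ i ≤ s.r x := Nat.div_le_self _ _
    refine Ends.wp ?_
    rw [hi] at h50 h60 h61
    simp only [wp, WordOp.eval, State.set_r, State.set_mem]
    simp only [Nat.reduceEqDiff, if_false, if_true, h50, h60, h61, hr3, hr19, hmem, hi', dot_succ]
    rw [pow_succ, Nat.div_div_eq_div_mul]
    refine ⟨?_, ?_, ?_, ?_, ?_, ?_, ?_, by omega, trivial, rfl, by omega⟩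
    · omega
    · omega
    · omega
    · omega
    · omega
    · rw [← Nat.div_div_eq_div_mul]; omega
    · omega
  · rintro s' - - ⟨-, h, -⟩
    simpa using h

theorem powP_spec {s : State} {x : ℕ} (h3 : s.r 3 = 1) (hx : x < 50)
    (hl : 2 ^ s.r x < z.lim) :
    Ends z ε (s.r x * 4 + 5) (powP x) s fun s' => s'.r 55 = 2 ^ s.r x := by
  generalize hj : s.r x = j at *
  have hjl : j < z.lim := Nat.lt_two_pow_self.trans hl
  have h1l : 1 < z.lim := Nat.one_le_two_pow.trans_lt hl
  refine Ends.seq (t₁ := 1) (t₂ := j * 4 + 3) (Q₁ := fun s' => s' = s.set 55 1) (Ends.wp ?_) ?_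
    (by omega)
  · simp [wp]; omega
  rintro _ - rfl
  refine Ends.seq (t₁ := 1) (t₂ := j * 4 + 1) (Q₁ := fun s' => s' = (s.set 55 1).set 65 j)
    (Ends.wp ?_ le_rfl) ?_ (by omega)
  · simp [wp, show x ≠ 55 by omega, hj]; omega
  rintro _ - rfl
  refine Ends.down (fun i s' => i ≤ j ∧ s'.r 55 = 2 ^ (j - i)) j (by simp) hjl.le
    (by simp [h3]) (by rfl) (by norm_num) (by rfl) (by simp) (T := 1) ?_ ?_ le_rfl
  · rintro i hi s' - - ⟨-, h⟩
    have e : j - i = (j - (i + 1)) + 1 := by omega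
    have hp : 2 ^ (j - i) ≤ 2 ^ j := Nat.pow_le_pow_right (by norm_num) (by omega)
    refine Ends.wp ?_
    simp only [wp, WordOp.eval, State.set_r]
    simp only [Nat.reduceEqDiff, if_false, if_true, h]
    rw [e, pow_succ] at *
    refine ⟨by omega, by omega, by ring⟩
  · rintro s' - - ⟨-, h⟩
    simpa using h

end

/-- Insertion or deletion of the amount `d`. -/
def upd (ins : Bool) (a d : ℕ) : ℕ := if ins then a + d else a - d

open Classical in
/-- The memory after the edge `e` was inserted into or deleted from the samplers in `Q`. -/
noncomputable def sampMem (mem : ℕ → ℕ) (A e : ℕ) (ins : Bool) (Q : ℕ → Prop) (a : ℕ) : ℕ :=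
  if ∃ q, Q q ∧ a = A + 2 * q then upd ins (mem a) 1
  else if ∃ q, Q q ∧ a = A + 2 * q + 1 then upd ins (mem a) e
  else mem a

theorem sampMem_congr {mem : ℕ → ℕ} {A e : ℕ} {ins : Bool} {Q Q' : ℕ → Prop} (h : ∀ q, Q q ↔ Q' q) :
    sampMem mem A e ins Q = sampMem mem A e ins Q' := by
  rw [show Q = Q' from funext fun q => propext (h q)]

theorem sampMem_of_lt {mem : ℕ → ℕ} {A e : ℕ} {ins : Bool} {Q : ℕ → Prop} {a : ℕ} (h : a < A) :
    sampMem mem A e ins Q a = mem a := by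
  rw [sampMem, if_neg, if_neg]
  · rintro ⟨q, -, hq⟩; omega
  · rintro ⟨q, -, hq⟩; omega

theorem sampMem_count {mem : ℕ → ℕ} {A e : ℕ} {ins : Bool} {Q : ℕ → Prop} [DecidablePred Q] (q : ℕ) :
    sampMem mem A e ins Q (A + 2 * q) = if Q q then upd ins (mem (A + 2 * q)) 1
      else mem (A + 2 * q) := by
  have h1 : (∃ q', Q q' ∧ A + 2 * q = A + 2 * q') ↔ Q q := by
    constructor
    · rintro ⟨q', h, e⟩; rwa [show q = q' by omega]
    · exact fun h => ⟨q, h, rfl⟩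
  have h2 : ¬ ∃ q', Q q' ∧ A + 2 * q = A + 2 * q' + 1 := by rintro ⟨q', h, e⟩; omega
  simp only [sampMem, h1, h2, if_false]

theorem sampMem_sum {mem : ℕ → ℕ} {A e : ℕ} {ins : Bool} {Q : ℕ → Prop} [DecidablePred Q] (q : ℕ) :
    sampMem mem A e ins Q (A + 2 * q + 1) = if Q q then upd ins (mem (A + 2 * q + 1)) e
      else mem (A + 2 * q + 1) := by
  have h1 : (∃ q', Q q' ∧ A + 2 * q + 1 = A + 2 * q' + 1) ↔ Q q := by
    constructor
    · rintro ⟨q', h, e⟩; rwa [show q = q' by omega]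
    · exact fun h => ⟨q, h, rfl⟩
  have h2 : ¬ ∃ q', Q q' ∧ A + 2 * q + 1 = A + 2 * q' := by rintro ⟨q', h, e⟩; omega
  simp only [sampMem, h1, h2, if_false]

/-- Lets a loop treat the samplers one at a time. Since `q₀` is new, its two cells still have their
original contents, from which the written values are computed. -/
theorem sampMem_insert {mem : ℕ → ℕ} {A e : ℕ} {ins : Bool} {Q Q' : ℕ → Prop} {q₀ : ℕ}
    (h : ∀ q, Q' q ↔ Q q ∨ q = q₀) (h0 : ¬ Q q₀) : sampMem mem A e ins Q' =
      Function.update (Function.update (sampMem mem A e ins Q) (A + 2 * q₀)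
        (upd ins (mem (A + 2 * q₀)) 1)) (A + 2 * q₀ + 1) (upd ins (mem (A + 2 * q₀ + 1)) e) := by
  classical
  funext a
  rw [Function.update_apply, Function.update_apply]
  split_ifs with h1 h2
  · rw [h1, sampMem_sum, if_pos ((h _).2 (.inr rfl))]
  · rw [h2, sampMem_count, if_pos ((h _).2 (.inr rfl))]
  · have e1 : (∃ q, Q' q ∧ a = A + 2 * q) ↔ ∃ q, Q q ∧ a = A + 2 * q := by
      refine exists_congr fun q => ?_
      rw [h]
      constructor
      · rintro ⟨g | rfl, g'⟩
        · exact ⟨g, g'⟩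
        · exact absurd g' h2
      · exact fun g => ⟨.inl g.1, g.2⟩
    have e2 : (∃ q, Q' q ∧ a = A + 2 * q + 1) ↔ ∃ q, Q q ∧ a = A + 2 * q + 1 := by
      refine exists_congr fun q => ?_
      rw [h]
      constructor
      · rintro ⟨g | rfl, g'⟩
        · exact ⟨g, g'⟩
        · exact absurd g' h1
      · exact fun g => ⟨.inl g.1, g.2⟩
    simp only [sampMem, e1, e2]


/-- Register `45` holds `t = r * lev + j`, which encodes the repetition `r` and the level `j`. The
row of `r` in the random table consists of `L` words for the vertices, `2 L` words for the edges and
one offset; register `48` is moved on to the edge part at the end. -/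
def sampHash : Cmd :=
  (.op .div 46 45 8 ;; .op .mod 47 45 8 ;; .op .mul 48 46 7) ;;
  dotP 6 0 48 ;; .op .mod 43 50 10 ;;
  dotP 6 1 48 ;; .op .mod 44 50 10 ;;
  (.op .add 48 48 6 ;; .op .add 49 6 6)

def sampAlive : Cmd :=
  dotP 49 37 48 ;; (.op .add 48 48 49 ;; .load 54 48 ;; .op .add 50 50 54) ;;
  powP 47 ;; .op .mod 50 50 55

/-- The number of the sampler is built from `t` and the two bucket numbers and then doubled, a
sampler having a counter followed by a sum of codes. -/
def sampWrite : Cmd :=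
  .op .mul 56 43 10 ;; .op .add 56 56 44 ;; .op .mul 57 45 11 ;; .op .add 56 56 57 ;;
  .op .add 56 56 56 ;; .op .add 56 56 38 ;; .op .add 57 56 3 ;; .load 58 56 ;; .load 59 57 ;;
  .branch 2 (.op .add 58 58 3 ;; .op .add 59 59 37) (.op .sub 58 58 3 ;; .op .sub 59 59 37) ;;
  .store 56 58 ;; .store 57 59

def sampBody : Cmd := sampHash ;; sampAlive ;; .branch 50 .skip sampWrite

/-- Record the edge in the samplers of the class in register `36`. -/
def sample : Cmd :=
  (.op .mul 37 0 4 ;; .op .add 37 37 1 ;; .op .mul 38 36 12 ;; .op .add 38 38 13 ;;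
    .op .add 38 38 14 ;; .move 45 9) ;; down 45 sampBody

theorem Par.L_pos {P : Par} {z : Size} {NB : ℕ} (hf : P.Fit z NB) : 1 ≤ P.L := by
  by_contra h
  have h0 : P.L = 0 := by omega
  have := hf.n
  rw [h0] at this
  simp at this

theorem Par.B_pos {P : Par} {z : Size} {NB : ℕ} (hf : P.Fit z NB) : 0 < P.B := by
  have := hf.k
  simp only [Par.B]; omega

theorem Par.D_pos {P : Par} {z : Size} {NB : ℕ} (hf : P.Fit z NB) : 0 < P.D := by
  have := hf.k
  simp only [Par.D]; positivity

theorem Par.B_le_D {P : Par} : P.B ≤ P.D := by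
  simp only [Par.B, Par.D, mul_assoc]
  rw [← mul_assoc]
  exact Nat.le_mul_of_pos_right _ (by positivity)

section

variable {z : Size} {ε : ℝ} {P : Par} {NB : ℕ}

theorem sampHash_spec {s : State} {t u v : ℕ} (hR : P.Regs s) (hf : P.Fit z NB) (ht : s.r 45 = t)
    (htR : t < P.RT) (hu : s.r 0 = u) (hv : s.r 1 = v) (hun : u < P.n) (hvn : v < P.n)
    (hT : ∀ a < P.R * P.m, s.mem a < P.D) :
    Ends z ε (P.L * 28 + 40) sampHash s fun s' => s'.r 47 = t % P.lev ∧
      s'.r 43 = P.hv s.mem (t / P.lev) u ∧ s'.r 44 = P.hv s.mem (t / P.lev) v ∧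
      s'.r 48 = t / P.lev * P.m + P.L ∧ s'.r 49 = P.L + P.L := by
  have hrR : t / P.lev < P.R := Nat.div_lt_of_lt_mul (by rw [mul_comm]; exact htR)
  generalize hr : t / P.lev = r at *
  have hrow := P.row_le hrR
  have hlim := hf.lim
  have hcells := hf.cells
  have hbase : P.R * P.m ≤ P.base := by simp [Par.base]
  have hm : P.m = 3 * P.L + 1 := rfl
  have hL := Par.L_pos hf
  have hdot := hf.dot
  have hDpos := Par.D_pos hf
  have hD1 : P.D ≤ (2 * P.L + 2) * P.D := Nat.le_mul_of_pos_left _ (by omega)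
  have hD2 : (P.L + 1) * P.D ≤ (2 * P.L + 2) * P.D := Nat.mul_le_mul_right _ (by omega)
  have hun' : P.n < z.lim := lt_of_le_of_lt (by nlinarith) hf.n4
  have hlev : t % P.lev < P.lev := Nat.mod_lt _ (by simp [Par.lev])
  have hlev2 : P.lev = 2 * P.L + 2 := rfl
  have htlim : t < z.lim := by
    have h1 : 1 * P.RT ≤ P.BB * P.RT := Nat.mul_le_mul_right _ (Nat.mul_pos (Par.B_pos hf) (Par.B_pos hf))
    have h2 : P.S = P.H + 2 * (P.RT * P.BB) := rfl
    have h3 : P.S ≤ (NB + 2) * P.S := Nat.le_mul_of_pos_left _ (by omega)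
    rw [mul_comm P.BB] at h1
    omega
  have hrt : r ≤ t := by rw [← hr]; exact Nat.div_le_self _ _
  have hBD : P.B ≤ P.D := Par.B_le_D
  refine Ends.seq (t₁ := 5) (t₂ := P.L * 28 + 34) (Q₁ := fun s' => s'.r 47 = t % P.lev ∧ s'.r 48 = r * P.m)
    (Ends.wp ?_) (fun s₁ hu₁ h₁ => ?_) (by omega)
  · simp only [wp, WordOp.eval, State.set_r]
    simp only [Nat.reduceEqDiff, if_false, if_true, ht, hR.lev, hR.m, hr]
    exact ⟨by omega, by omega, by omega, trivial, trivial⟩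
  have hR₁ := hR.of_unch hu₁
  have hm₁ : s₁.mem = s.mem := hu₁.mem rfl
  refine Ends.seq (dotP_spec (D := P.D) hR₁.one hR₁.two (by norm_num) (by norm_num) (by norm_num) ?_ ?_ ?_ ?_ ?_)
    (fun s₂ hu₂ h₂ => ?_) (t₂ := P.L * 14 + 24) (by rw [hR₁.L]; omega)
  · rw [hu₁.reg 0 rfl]; omega
  · rw [hR₁.L, h₁.2, hm₁]; exact fun i hi => hT _ (by omega)
  · rw [hR₁.L, h₁.2]; omega
  · rw [hR₁.L, h₁.2]; omega
  · rw [hR₁.L]; omega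
  have hR₂ := hR₁.of_unch hu₂
  have hu₂' := hu₂
  rw [hR₁.L, h₁.2, hm₁, hu₁.reg 0 rfl, hu] at h₂
  have hmod : ∀ a : ℕ, a % P.B < z.lim := fun a => by
    have := Nat.mod_lt a (Par.B_pos hf)
    omega
  refine Ends.seq (t₁ := 1) (t₂ := P.L * 14 + 22) (Q₁ := fun s' => s'.r 43 = P.hv s.mem r u)
    (Ends.wp ?_) (fun s₃ hu₃ h₃ => ?_) (by omega)
  · simp only [wp, WordOp.eval, State.set_r, if_true, h₂, hR₂.B]
    exact ⟨hmod _, rfl⟩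
  have hR₃ := hR₂.of_unch hu₃
  have h48 : s₃.r 48 = r * P.m := by rw [hu₃.reg 48 rfl, hu₂.reg 48 rfl, h₁.2]
  have hr1 : s₃.r 1 = v := by rw [hu₃.reg 1 rfl, hu₂.reg 1 rfl, hu₁.reg 1 rfl, hv]
  have hm₃ : s₃.mem = s.mem := by rw [hu₃.mem rfl, hu₂.mem rfl, hm₁]
  refine Ends.seq (dotP_spec (D := P.D) hR₃.one hR₃.two (by norm_num) (by norm_num) (by norm_num) ?_ ?_ ?_ ?_ ?_)
    (fun s₄ hu₄ h₄ => ?_) (t₂ := 12) (by rw [hR₃.L])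
  · rw [hr1]; omega
  · rw [hR₃.L, h48, hm₃]; exact fun i hi => hT _ (by omega)
  · rw [hR₃.L, h48]; omega
  · rw [hR₃.L, h48]; omega
  · rw [hR₃.L]; omega
  have hR₄ := hR₃.of_unch hu₄
  rw [hR₃.L, h48, hm₃, hr1] at h₄
  refine Ends.seq (t₁ := 1) (t₂ := 10) (Q₁ := fun s' => s'.r 44 = P.hv s.mem r v)
    (Ends.wp ?_) (fun s₅ hu₅ h₅ => ?_) (by omega)
  · simp only [wp, WordOp.eval, State.set_r, if_true, h₄, hR₄.B]
    exact ⟨hmod _, rfl⟩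
  have hR₅ := hR₄.of_unch hu₅
  have h48₅ : s₅.r 48 = r * P.m := by rw [hu₅.reg 48 rfl, hu₄.reg 48 rfl, h48]
  have h47₅ : s₅.r 47 = t % P.lev := by
    rw [hu₅.reg 47 rfl, hu₄.reg 47 rfl, hu₃.reg 47 rfl, hu₂.reg 47 rfl, h₁.1]
  have h43₅ : s₅.r 43 = P.hv s.mem r u := by rw [hu₅.reg 43 rfl, hu₄.reg 43 rfl, h₃]
  refine Ends.wp ?_
  simp only [wp, WordOp.eval, State.set_r]
  simp only [Nat.reduceEqDiff, if_false, if_true, h48₅, hR₅.L, h47₅, h43₅, h₅]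
  exact ⟨by omega, by omega, trivial, trivial, trivial, trivial, trivial⟩

theorem sampAlive_spec {s : State} {r e : ℕ} (hR : P.Regs s) (hf : P.Fit z NB) (h47 : s.r 47 < P.lev)
    (hr : r < P.R) (he : s.r 37 = e) (hel : e < z.lim) (h48 : s.r 48 = r * P.m + P.L)
    (h49 : s.r 49 = P.L + P.L) (hT : ∀ a < P.R * P.m, s.mem a < P.D) :
    Ends z ε (P.L * 36 + 40) sampAlive s fun s' => s'.r 50 = P.gv s.mem r e % 2 ^ s.r 47 := by
  have hrow := P.row_le hr
  have hlim := hf.lim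
  have hcells := hf.cells
  have hbase : P.R * P.m ≤ P.base := by simp [Par.base]
  have hm : P.m = 3 * P.L + 1 := rfl
  have hdot := hf.dot
  have hDpos := Par.D_pos hf
  have hlev2 : P.lev = 2 * P.L + 2 := rfl
  have hSS : P.S ≤ (NB + 2) * P.S := Nat.le_mul_of_pos_left _ (by omega)
  have hSp : 0 < P.S := P.H_pos.trans_le P.H_le_S
  have hd1 : (P.L + P.L + 1) * P.D + P.D = (2 * P.L + 2) * P.D := by ring
  have hd2 : (P.L + P.L + 1) * P.D = (P.L + P.L) * P.D + P.D := by ring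
  have hpow : 2 ^ s.r 47 < z.lim :=
    (Nat.pow_le_pow_right (by norm_num) h47.le).trans_lt hf.pow_lev
  have hdle : dot s.mem (r * P.m + P.L) (P.L + P.L) e ≤ (P.L + P.L) * P.D :=
    dot_le (fun i hi => hT _ (by omega)) e
  have hTl := hT (r * P.m + P.L + (P.L + P.L)) (by omega)
  refine Ends.seq (dotP_spec (D := P.D) hR.one hR.two (by norm_num) (by norm_num) (by norm_num) ?_ ?_ ?_ ?_ ?_)
    (fun s₁ hu₁ h₁ => ?_) (t₂ := P.L * 8 + 30) (by rw [h49]; omega)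
  · omega
  · rw [h48, h49]; exact fun i hi => hT _ (by omega)
  · rw [h48, h49]; omega
  · rw [h48, h49]; omega
  · rw [h49]; omega
  rw [h48, h49, he] at h₁
  have h48₁ : s₁.r 48 = r * P.m + P.L := by rw [hu₁.reg 48 rfl, h48]
  have h49₁ : s₁.r 49 = P.L + P.L := by rw [hu₁.reg 49 rfl, h49]
  have hm₁ : s₁.mem = s.mem := hu₁.mem rfl
  refine Ends.seq (t₁ := 5) (t₂ := P.L * 8 + 24) (Q₁ := fun s' => s'.r 50 = P.gv s.mem r e)
    (Ends.wp ?_) (fun s₂ hu₂ h₂ => ?_) (by omega)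
  · simp only [wp, WordOp.eval, State.set_r, State.set_mem]
    simp only [Nat.reduceEqDiff, if_false, if_true, h48₁, h49₁, h₁, hm₁]
    exact ⟨by omega, by omega, by omega, by omega, by rw [Par.gv, add_comm]⟩
  have h47₂ : s₂.r 47 = s.r 47 := by rw [hu₂.reg 47 rfl, hu₁.reg 47 rfl]
  refine Ends.seq (powP_spec (x := 47) (by rw [hu₂.reg 3 rfl, hu₁.reg 3 rfl, hR.one]) (by norm_num)
    (by rwa [h47₂])) (fun s₃ hu₃ h₃ => ?_) (t₂ := 1) (by rw [h47₂]; omega)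
  rw [h47₂] at h₃
  refine Ends.wp ?_
  simp only [wp, WordOp.eval, State.set_r, if_true, h₃]
  rw [hu₃.reg 50 rfl, h₂]
  exact ⟨(Nat.mod_lt _ (by positivity)).trans hpow, rfl⟩

theorem sampWrite_spec {s : State} {t e c b₁ b₂ A : ℕ} {ins : Bool} (hR : P.Regs s) (hf : P.Fit z NB)
    (ht : s.r 45 = t) (htR : t < P.RT) (hc : c ≤ NB) (hA : A = P.base + c * P.S + P.H)
    (h38 : s.r 38 = A) (he : s.r 37 = e) (h43 : s.r 43 = b₁) (hb₁ : b₁ < P.B) (h44 : s.r 44 = b₂)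
    (hb₂ : b₂ < P.B) (h2 : s.r 2 = if ins then 1 else 0)
    (hl1 : s.mem (A + 2 * (t * P.BB + (b₁ * P.B + b₂))) + 1 < z.lim)
    (hl2 : s.mem (A + 2 * (t * P.BB + (b₁ * P.B + b₂)) + 1) + e < z.lim) :
    Ends z ε 40 sampWrite s fun s' => s'.mem =
      Function.update (Function.update s.mem (A + 2 * (t * P.BB + (b₁ * P.B + b₂)))
        (upd ins (s.mem (A + 2 * (t * P.BB + (b₁ * P.B + b₂)))) 1))
        (A + 2 * (t * P.BB + (b₁ * P.B + b₂)) + 1)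
        (upd ins (s.mem (A + 2 * (t * P.BB + (b₁ * P.B + b₂)) + 1)) e) := by
  have hlim := hf.lim
  have hcells := hf.cells
  have hb : b₁ * P.B + b₂ < P.BB := by
    calc b₁ * P.B + b₂ < b₁ * P.B + P.B := by omega
      _ = (b₁ + 1) * P.B := by ring
      _ ≤ P.BB := Nat.mul_le_mul_right _ hb₁
  have hq : t * P.BB + (b₁ * P.B + b₂) < P.Z := by
    calc t * P.BB + (b₁ * P.B + b₂) < t * P.BB + P.BB := by omega
      _ = (t + 1) * P.BB := by ring
      _ ≤ P.Z := Nat.mul_le_mul_right _ htR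
  have hS : P.S = P.H + 2 * P.Z := rfl
  have hSp := P.H_pos
  have haddr := hf.addr_le (x := c) (i := P.H + 2 * (t * P.BB + (b₁ * P.B + b₂)) + 1) (by omega) (by omega)
  have e1 : b₁ * P.B + b₂ + t * P.BB + (b₁ * P.B + b₂ + t * P.BB) + A =
      A + 2 * (t * P.BB + (b₁ * P.B + b₂)) := by ring
  refine Ends.wp ?_
  simp only [sampWrite, wp, WordOp.eval, State.set_r, State.set_mem, State.setMem_r, State.set_set]
  simp only [Nat.reduceEqDiff, if_false, if_true, h43, h44, hR.B, ht, hR.BB, h38, hR.one, he, h2, e1]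
  refine ⟨by omega, by omega, by omega, by omega, by omega, by omega, by omega, by omega, by omega,
    by omega, by omega, ?_, ?_⟩
  · intro hi
    obtain rfl : ins = true := by
      cases ins
      · simp at hi
      · rfl
    exact ⟨by omega, by omega, by omega, by omega, by
      funext a; simp [Function.update_apply, upd]⟩
  · intro hi
    obtain rfl : ins = false := by
      cases ins
      · rfl
      · simp at hi
    exact ⟨by omega, by omega, by omega, by omega, by
      funext a; simp [Function.update_apply, upd]⟩

/-- For each repetition and level the edge has only one pair of buckets, so `RT` iterations treat
all samplers of the class. The invariant is that the samplers from `t * BB` on have been treated. -/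
theorem sample_spec {s : State} {u v c A : ℕ} {ins : Bool} (hR : P.Regs s) (hf : P.Fit z NB)
    (hu : s.r 0 = u) (hv : s.r 1 = v) (hun : u < P.n) (hvn : v < P.n) (h2 : s.r 2 = if ins then 1 else 0)
    (h36 : s.r 36 = c) (hc : c ≤ NB) (hA : A = P.base + c * P.S + P.H)
    (hT : ∀ a < P.R * P.m, s.mem a < P.D)
    (hl : ∀ q < P.Z, s.mem (A + 2 * q) + 1 < z.lim ∧ s.mem (A + 2 * q + 1) + (u * P.n + v) < z.lim) :
    Ends z ε (P.RT * (P.L * 64 + 150) + 20) sample s fun s' =>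
      s'.mem = sampMem s.mem A (u * P.n + v) ins fun q => q < P.Z ∧ P.hit s.mem (u * P.n + v) q := by
  have hlim := hf.lim
  have hcells := hf.cells
  have hS : P.S = P.H + 2 * P.Z := rfl
  have hSp := P.H_pos
  have haddr := hf.addr_le (x := c) (i := P.H) (by omega)
  have hBp := Par.B_pos hf
  have hBB : 0 < P.BB := Nat.mul_pos hBp hBp
  have hRTZ : P.RT ≤ P.Z := Nat.le_mul_of_pos_right _ hBB
  have hSS : P.S ≤ (NB + 2) * P.S := Nat.le_mul_of_pos_left _ (by omega)
  have hen : u * P.n + v < P.n * P.n := by nlinarith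
  have hel : u * P.n + v + 1 < z.lim := lt_of_le_of_lt (by nlinarith) hf.n4
  have hcS : c * P.S ≤ (NB + 1) * P.S := Nat.mul_le_mul_right _ (by omega)
  have hS2 : (NB + 2) * P.S = (NB + 1) * P.S + P.S := by ring
  generalize he : u * P.n + v = e at *
  have heu : e / P.n = u := by rw [← he, mul_comm, Nat.mul_add_div (by omega), Nat.div_eq_of_lt hvn, add_zero]
  have hev : e % P.n = v := by rw [← he, mul_comm, Nat.mul_add_mod, Nat.mod_eq_of_lt hvn]
  refine Ends.seq (t₁ := 11) (t₂ := P.RT * (P.L * 64 + 150) + 1) (Q₁ := fun s' =>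
    s'.r 37 = e ∧ s'.r 38 = A ∧ s'.r 45 = P.RT) (Ends.wp ?_) (fun s₁ hu₁ h₁ => ?_) (by omega)
  · simp only [wp, WordOp.eval, State.set_r, State.set_set]
    simp only [Nat.reduceEqDiff, if_false, if_true, hu, hR.n, hv, h36, hR.S, hR.base, hR.H, hR.RT]
    have : c * P.S + P.base + P.H = A := by rw [hA]; ring
    exact ⟨by omega, by omega, by omega, by omega, by omega, by omega, by omega, by omega, trivial⟩
  have hR₁ := hR.of_unch hu₁
  refine Ends.down (fun t s' => t ≤ P.RT ∧ s'.mem = sampMem s.mem A e ins fun q =>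
    (q < P.Z ∧ P.hit s.mem e q) ∧ t * P.BB ≤ q) P.RT h₁.2.2 (by omega) hR₁.one (by rfl) (by norm_num)
    (by rfl) ?_ (T := P.L * 64 + 144) ?_ ?_ (by ring_nf; omega)
  · refine ⟨le_rfl, ?_⟩
    rw [hu₁.mem rfl]
    funext a
    rw [sampMem, if_neg, if_neg]
    · rintro ⟨q, ⟨⟨h, -⟩, h'⟩, -⟩; exact absurd h (not_lt.2 h')
    · rintro ⟨q, ⟨⟨h, -⟩, h'⟩, -⟩; exact absurd h (not_lt.2 h')
  · rintro t ht s₂ h45 hu₂ ⟨-, hmem⟩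
    have hR₂' := (hR₁.of_unch hu₂)
    have hR₂ : P.Regs (s₂.set 45 t) := hR₂'.of_eq fun y hy hy' => by simp [show y ≠ 45 by omega]
    have hT₂ : ∀ a < P.R * P.m, s₂.mem a = s.mem a := fun a ha => by
      rw [hmem, sampMem_of_lt]
      have : P.R * P.m ≤ P.base := by simp [Par.base]
      omega
    have hrR : t / P.lev < P.R := Nat.div_lt_of_lt_mul (by rw [mul_comm]; exact ht)
    refine Ends.seq (t₁ := P.L * 28 + 40) (t₂ := P.L * 36 + 103)
      (sampHash_spec (t := t) (u := u) (v := v) hR₂ hf (by simp) ht ?_ ?_ hun hvn ?_)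
      (fun s₃ hu₃ h₃ => ?_) (by omega)
    · simp; rw [hu₂.reg 0 rfl, hu₁.reg 0 rfl, hu]
    · simp; rw [hu₂.reg 1 rfl, hu₁.reg 1 rfl, hv]
    · intro a ha
      rw [State.set_mem, hT₂ a ha]; exact hT a ha
    obtain ⟨h47, h43, h44, h48, h49⟩ := h₃
    rw [State.set_mem, Par.hv_congr hT₂ hrR] at h43 h44
    have hR₃ := hR₂.of_unch hu₃
    have hm₃ : s₃.mem = s₂.mem := hu₃.mem rfl
    have hlev0 : 0 < P.lev := by simp [Par.lev]
    refine Ends.seq (t₁ := P.L * 36 + 40) (t₂ := 60)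
      (sampAlive_spec (r := t / P.lev) (e := e) hR₃ hf (by rw [h47]; exact Nat.mod_lt _ hlev0) hrR ?_
      (by omega) h48 h49 ?_) (fun s₄ hu₄ h₄ => ?_) (by omega)
    · rw [hu₃.reg 37 rfl]; simp; rw [hu₂.reg 37 rfl, h₁.1]
    · intro a ha
      rw [hm₃, hT₂ a ha]; exact hT a ha
    rw [hm₃, Par.gv_congr hT₂ hrR, h47] at h₄
    have hR₄ := hR₃.of_unch hu₄
    have hm₄ : s₄.mem = s₂.mem := (hu₄.mem rfl).trans hm₃
    set b₁ := P.hv s.mem (t / P.lev) u with hb₁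
    set b₂ := P.hv s.mem (t / P.lev) v with hb₂
    have hb₁B : b₁ < P.B := Nat.mod_lt _ hBp
    have hb₂B : b₂ < P.B := Nat.mod_lt _ hBp
    have hb : b₁ * P.B + b₂ < P.BB := by
      calc b₁ * P.B + b₂ < b₁ * P.B + P.B := by omega
        _ = (b₁ + 1) * P.B := by ring
        _ ≤ P.BB := Nat.mul_le_mul_right _ hb₁B
    have hq : t * P.BB + (b₁ * P.B + b₂) < P.Z := by
      calc t * P.BB + (b₁ * P.B + b₂) < t * P.BB + P.BB := by omega
        _ = (t + 1) * P.BB := by ring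
        _ ≤ P.Z := Nat.mul_le_mul_right _ ht
    have hsucc : (t + 1) * P.BB = t * P.BB + P.BB := by ring
    -- Among the `BB` samplers that belong to `t`, the one with the bucket pair of the edge is the
    -- only candidate.
    have hhit : ∀ q, t * P.BB ≤ q → q < (t + 1) * P.BB →
        (P.hit s.mem e q ↔ P.gv s.mem (t / P.lev) e % 2 ^ (t % P.lev) = 0 ∧
          q = t * P.BB + (b₁ * P.B + b₂)) := by
      intro q h1 h2
      have hqd : q / P.BB = t := by
        rw [Nat.div_eq_iff hBB]
        constructor
        · exact h1
        · omega
      have hqm : q % P.BB = q - t * P.BB := by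
        have := Nat.div_add_mod q P.BB
        rw [hqd, mul_comm] at this
        omega
      rw [Par.hit, hqd, hqm, heu, hev, ← hb₁, ← hb₂]
      refine and_congr_right fun _ => ?_
      constructor <;> intro <;> omega
    -- Cells of samplers that are not treated yet still hold their contents from before the loop; so
    -- the overflow hypotheses about the initial state apply.
    have hcell : ∀ a, (∀ q, (t + 1) * P.BB ≤ q → a ≠ A + 2 * q ∧ a ≠ A + 2 * q + 1) → s₂.mem a = s.mem a := by
      intro a ha
      rw [hmem, sampMem, if_neg, if_neg]
      · rintro ⟨q, ⟨-, h⟩, h'⟩; exact (ha q h).2 h'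
      · rintro ⟨q, ⟨-, h⟩, h'⟩; exact (ha q h).1 h'
    have hc1 := hcell (A + 2 * (t * P.BB + (b₁ * P.B + b₂))) fun q hq => by omega
    have hc2 := hcell (A + 2 * (t * P.BB + (b₁ * P.B + b₂)) + 1) fun q hq => by omega
    refine Ends.branch (t := 50) (fun h50 => ?_) (fun h50 => ?_) (by norm_num)
    · refine Ends.wp (t := 50) ?_ (by decide)
      rw [h₄] at h50
      refine ⟨ht.le, ?_⟩
      rw [hm₄, hmem]
      refine sampMem_congr fun q => ?_
      constructor
      · rintro ⟨h, h'⟩; exact ⟨h, by omega⟩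
      · rintro ⟨h, h'⟩
        refine ⟨h, ?_⟩
        by_contra hlt
        exact h50 ((hhit q h' (by omega)).1 h.2).1
    · rw [h₄] at h50
      refine (sampWrite_spec (t := t) (e := e) (c := c) (b₁ := b₁) (b₂ := b₂) (A := A) (ins := ins) hR₄ hf
        ?_ ht hc hA ?_ ?_ ?_ hb₁B ?_ hb₂B ?_ ?_ ?_).mono (by norm_num) fun s₅ hu₅ h₅ => ⟨ht.le, ?_⟩
      · rw [hu₄.reg 45 rfl, hu₃.reg 45 rfl]; simp
      · rw [hu₄.reg 38 rfl, hu₃.reg 38 rfl]; simp; rw [hu₂.reg 38 rfl, h₁.2.1]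
      · rw [hu₄.reg 37 rfl, hu₃.reg 37 rfl]; simp; rw [hu₂.reg 37 rfl, h₁.1]
      · rw [hu₄.reg 43 rfl, h43]
      · rw [hu₄.reg 44 rfl, h44]
      · rw [hu₄.reg 2 rfl, hu₃.reg 2 rfl]; simp; rw [hu₂.reg 2 rfl, hu₁.reg 2 rfl, h2]
      · rw [hm₄, hc1]; exact (hl _ hq).1
      · rw [hm₄, hc2]; exact (hl _ hq).2
      · rw [h₅, hm₄, hc1, hc2, hmem]
        symm
        refine sampMem_insert (fun q => ?_) fun h => ?_
        · constructor
          · rintro ⟨h, h'⟩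
            by_cases hlt : q < (t + 1) * P.BB
            · exact .inr ((hhit q h' hlt).1 h.2).2
            · exact .inl ⟨h, not_lt.1 hlt⟩
          · rintro (⟨h, h'⟩ | rfl)
            · exact ⟨h, by omega⟩
            · exact ⟨⟨hq, (hhit _ (by omega) (by omega)).2 ⟨h50, rfl⟩⟩, by omega⟩
        · have := h.2
          omega
  · rintro s' - - ⟨-, h⟩
    rw [h]
    exact sampMem_congr fun q => by simp

end


/-! ### The invariant of the update routine -/

open Classical in
/-- The edges of class `c` that are recorded by the sampler `q`. -/
noncomputable def recorded (P : Par) (ε : ℝ) (T : ℕ → ℕ) (E : Finset ℕ) (wc : ℕ → ℝ) (key : ℕ → ℝ)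
    (N c q : ℕ) : Finset ℕ :=
  E.filter fun e => cls ε key N (wc e) = c ∧ P.hit T e q

theorem mem_recorded {P : Par} {ε : ℝ} {T : ℕ → ℕ} {E : Finset ℕ} {wc : ℕ → ℝ} {key : ℕ → ℝ}
    {N c q e : ℕ} : e ∈ recorded P ε T E wc key N c q ↔
      e ∈ E ∧ cls ε key N (wc e) = c ∧ P.hit T e q := by
  simp [recorded]

/-- The address of the counter of the sampler `q` of class `c`. -/
def Par.cell (P : Par) (c q : ℕ) : ℕ := P.base + c * P.S + P.H + 2 * q

/-- The data after a stream, where `T` is the random table, `E` the set of present edges, `wc` their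
weights, `W` the set of all weights of the stream and `N` the number of weight classes. -/
structure Inv (P : Par) (ε : ℝ) (T : ℕ → ℕ) (W : Set ℝ) (wc : ℕ → ℝ) (E : Finset ℕ) (N : ℕ)
    (s : State) : Prop where
  regs : P.Regs s
  cnt : s.r 29 = N
  out : s.out = []
  tab : ∀ a < P.R * P.m, s.mem a = T a
  scratch : ∀ a, P.R * P.m ≤ a → a < P.base → s.mem a = 0
  skip : ∃ Lev, Skip s.wmem N P.H Lev (P.nxt s)
  sep : ∀ c d, 1 ≤ c → c ≤ N → 1 ≤ d → d ≤ N → c ≠ d → ¬ near ε (s.wmem c) (s.wmem d)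
  wts : ∀ c, 1 ≤ c → c ≤ N → s.wmem c ∈ W
  cls : ∀ e ∈ E, cls ε s.wmem N (wc e) ≠ 0
  cell : ∀ c, 1 ≤ c → c ≤ N → ∀ q < P.Z,
    s.mem (P.cell c q) = (recorded P ε T E wc s.wmem N c q).card ∧
    s.mem (P.cell c q + 1) = ∑ e ∈ recorded P ε T E wc s.wmem N c q, e
  fresh : ∀ a, P.base + (N + 1) * P.S ≤ a → s.mem a = 0

/-- Pairwise separated weights in `W` number at most `NB`. -/
def ClassBound (ε : ℝ) (W : Set ℝ) (NB : ℕ) : Prop :=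
  ∀ (N : ℕ) (key : ℕ → ℝ), (∀ c, 1 ≤ c → c ≤ N → key c ∈ W) →
    (∀ c d, 1 ≤ c → c ≤ N → 1 ≤ d → d ≤ N → c ≠ d → ¬ near ε (key c) (key d)) → N ≤ NB

theorem Inv.le {P : Par} {ε : ℝ} {T : ℕ → ℕ} {W : Set ℝ} {wc : ℕ → ℝ} {E : Finset ℕ} {N NB : ℕ}
    {s : State} (h : Inv P ε T W wc E N s) (hB : ClassBound ε W NB) : N ≤ NB :=
  hB N s.wmem h.wts h.sep

theorem Par.cell_lt {P : Par} {q : ℕ} (hq : q < P.Z) : P.H + 2 * q + 1 < P.S := by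
  simp only [Par.S]; omega

theorem Par.cell_ne_ptr {P : Par} {c q x i : ℕ} (hq : q < P.Z) (hi : i < P.H) :
    P.cell c q ≠ P.base + x * P.S + i ∧ P.cell c q + 1 ≠ P.base + x * P.S + i := by
  have h1 := Par.cell_lt hq
  have h2 := P.H_le_S
  constructor
  · intro e
    have := Par.addr_inj (P := P) (x := c) (x' := x) (i := P.H + 2 * q) (i' := i) (by omega) (by omega)
      (by simp only [Par.cell] at e; omega)
    omega
  · intro e
    have := Par.addr_inj (P := P) (x := c) (x' := x) (i := P.H + 2 * q + 1) (i' := i) (by omega) (by omega)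
      (by simp only [Par.cell] at e; omega)
    omega

theorem Par.cell_inj {P : Par} {c c' q q' : ℕ} (hq : q < P.Z) (hq' : q' < P.Z)
    (e : P.cell c q = P.cell c' q') : c = c' ∧ q = q' := by
  have h1 := Par.cell_lt hq
  have h1' := Par.cell_lt hq'
  have := Par.addr_inj (P := P) (x := c) (x' := c') (i := P.H + 2 * q) (i' := P.H + 2 * q')
    (by omega) (by omega) (by simp only [Par.cell] at e; omega)
  omega

theorem Par.cell_ne_succ {P : Par} {c c' q q' : ℕ} (hq : q < P.Z) (hq' : q' < P.Z) :
    P.cell c q ≠ P.cell c' q' + 1 := by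
  intro e
  have h1 := Par.cell_lt hq
  have h1' := Par.cell_lt hq'
  have := Par.addr_inj (P := P) (x := c) (x' := c') (i := P.H + 2 * q) (i' := P.H + 2 * q' + 1)
    (by omega) (by omega) (by simp only [Par.cell] at e; omega)
  omega

def findClass : Cmd := search ;; classify

/-- The weight `w` becomes a new representative unless it is near one of the old ones. -/
noncomputable def grow (ε : ℝ) (K : ℕ × (ℕ → ℝ)) (w : ℝ) : ℕ × (ℕ → ℝ) :=
  open Classical in
  if cls ε K.2 K.1 w = 0 then (K.1 + 1, Function.update K.2 (K.1 + 1) w) else K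

/-- The representatives are the ones given by `K`. -/
def Agree (K : ℕ × (ℕ → ℝ)) (N : ℕ) (key : ℕ → ℝ) : Prop :=
  N = K.1 ∧ ∀ c, 1 ≤ c → c ≤ N → key c = K.2 c

theorem Agree.cls_eq {ε w : ℝ} {K : ℕ × (ℕ → ℝ)} {N : ℕ} {key : ℕ → ℝ} (h : Agree K N key) :
    cls ε key N w = cls ε K.2 K.1 w := by
  obtain ⟨rfl, h⟩ := h
  simp only [cls]
  congr 1
  ext c
  exact and_congr_right fun h1 => and_congr_right fun h2 => by rw [h c h1 h2]

theorem Agree.grow {ε w : ℝ} {K : ℕ × (ℕ → ℝ)} {N N' : ℕ} {key key' : ℕ → ℝ} (h : Agree K N key)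
    (hk : ∀ c, 1 ≤ c → c ≤ N → key' c = key c)
    (hN : N' = N ∧ cls ε key N w ≠ 0 ∨ N' = N + 1 ∧ cls ε key N w = 0 ∧ key' (N + 1) = w) :
    Agree (grow ε K w) N' key' := by
  have hc := h.cls_eq (ε := ε) (w := w)
  obtain ⟨h1, h2⟩ := h
  rw [hc] at hN
  rcases hN with ⟨rfl, h0⟩ | ⟨rfl, h0, hw⟩
  · rw [KMatchStream.grow, if_neg h0]
    exact ⟨h1, fun c c1 c2 => by rw [hk c c1 c2, h2 c c1 c2]⟩
  · rw [KMatchStream.grow, if_pos h0]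
    refine ⟨by rw [h1], fun c c1 c2 => ?_⟩
    by_cases e : c = N + 1
    · rw [e, hw, ← h1]; simp
    · simp only
      rw [Function.update_of_ne (by omega), hk c c1 (by omega), h2 c c1 (by omega)]

section

variable {z : Size} {ε : ℝ} {P : Par} {NB : ℕ} {T : ℕ → ℕ} {W : Set ℝ} {wc : ℕ → ℝ} {E : Finset ℕ}
  {N : ℕ}

/-- The present edges keep their classes, so all sampler contents remain correct although a class
may have been added. Pointer cells and sampler cells are disjoint. -/
theorem findClass_spec {s : State} (hε : 0 < ε) (hf : P.Fit z NB) (hB : ClassBound ε W NB)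
    (hs : Inv P ε T W wc E N s) (hw : 0 < s.win) (hwW : s.win ∈ W) {K : ℕ × (ℕ → ℝ)}
    (hK : Agree K N s.wmem) :
    Ends z ε (P.H * 123 + 80) findClass s fun s' => ∃ N', Inv P ε T W wc E N' s' ∧
      Agree (grow ε K s.win) N' s'.wmem ∧ s'.r 36 = KMatchStream.cls ε s'.wmem N' s.win ∧ s'.r 36 ≠ 0 := by
  obtain ⟨Lev, hSkip⟩ := hs.skip
  have hN := hs.le hB
  have hHS := P.H_le_S
  refine Ends.seq (search_spec hs.regs hf hN hs.cnt hw hSkip) (fun s₁ hu₁ h₁ => ?_) (t₂ := 60) (by omega)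
  obtain ⟨h30, hwm, hm₁, Lev₁, q, hS₁, hx, hq, hqg⟩ := h₁
  have hR₁ := hs.regs.of_unch hu₁
  have hkey : ∀ c, c ≤ N → s₁.wmem c = s.wmem c := fun c hc => by
    rw [hwm, Function.update_of_ne (by omega)]
  have hwN : s₁.wmem (N + 1) = s.win := by rw [hwm, Function.update_self]
  have hsep₁ : ∀ c d, 1 ≤ c → c ≤ N → 1 ≤ d → d ≤ N → c ≠ d → ¬ near ε (s₁.wmem c) (s₁.wmem d) :=
    fun c d c1 c2 d1 d2 h => by rw [hkey c c2, hkey d d2]; exact hs.sep c d c1 c2 d1 d2 h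
  refine (classify_spec hε hR₁ hf hN (by rw [hu₁.reg 29 rfl, hs.cnt]) h30 hw hwN hS₁ hsep₁ hx hq
    hqg).mono le_rfl fun s₂ hu₂ h₂ => ?_
  obtain ⟨N', h29, h36, hcls, hN', hS₂, hm₂⟩ := h₂
  have hNN' : N ≤ N' := by omega
  have hwm₂ : s₂.wmem = s₁.wmem := hu₂.wmem rfl
  have hmem : ∀ a, P.NotPtr N' a → s₂.mem a = s.mem a := fun a ha => by
    rw [hm₂ a ha, hm₁ a fun x hx => ha x (hx.trans hNN')]
  have hlow : ∀ a < P.base, P.NotPtr N' a := fun a ha x _ i _ => by omega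
  have hRm : P.R * P.m ≤ P.base := by simp [Par.base]
  -- The stability of classes, in the form needed for the samplers.
  have hstab : ∀ e ∈ E, KMatchStream.cls ε s₂.wmem N' (wc e) = KMatchStream.cls ε s.wmem N (wc e) :=
    fun e he => cls_stable hNN' (fun c _ hc => by rw [hwm₂, hkey c hc]) (hs.cls e he)
  have hAg : Agree (grow ε K s.win) N' s₂.wmem := by
    have hN₁ : KMatchStream.cls ε s₁.wmem N s.win = KMatchStream.cls ε s.wmem N s.win :=
      Agree.cls_eq (K := (N, s.wmem)) ⟨rfl, fun c _ hc => hkey c hc⟩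
    rw [hwm₂]
    refine hK.grow (fun c _ hc => hkey c hc) ?_
    rw [← hN₁]
    rcases hN' with rfl | ⟨rfl, h0⟩
    · exact .inl ⟨rfl, hcls⟩
    · exact .inr ⟨rfl, h0, hwN⟩
  refine ⟨N', ⟨hR₁.of_unch hu₂, h29, ?_, ?_, ?_, ?_, ?_, ?_, ?_, ?_, ?_⟩, hAg, by rw [hwm₂, h36], by rwa [h36]⟩
  · rw [hu₂.out rfl, hu₁.out rfl, hs.out]
  · exact fun a ha => by rw [hmem a (hlow a (by omega)), hs.tab a ha]
  · exact fun a ha ha' => by rw [hmem a (hlow a ha'), hs.scratch a ha ha']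
  · rw [hwm₂]; exact hS₂
  · rw [hwm₂]
    rcases hN' with rfl | ⟨rfl, h0⟩
    · exact hsep₁
    · intro c d c1 c2 d1 d2 hcd
      have h0' := cls_eq_zero.1 h0
      by_cases hc : c = N + 1
      · rw [hc, hwN]
        exact fun h => h0' d d1 (by omega) h.symm
      by_cases hd : d = N + 1
      · rw [hd, hwN]
        exact h0' c c1 (by omega)
      · exact hsep₁ c d c1 (by omega) d1 (by omega) hcd
  · rw [hwm₂]
    intro c c1 c2
    by_cases hc : c ≤ N
    · rw [hkey c hc]; exact hs.wts c c1 hc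
    · rw [show c = N + 1 by omega, hwN]; exact hwW
  · exact fun e he => by rw [hstab e he]; exact hs.cls e he
  · intro c c1 c2 q hq
    have hne1 : P.NotPtr N' (P.cell c q) := fun x _ i hi => (Par.cell_ne_ptr hq hi).1
    have hne2 : P.NotPtr N' (P.cell c q + 1) := fun x _ i hi => (Par.cell_ne_ptr hq hi).2
    rw [hmem _ hne1, hmem _ hne2]
    have hrec : recorded P ε T E wc s₂.wmem N' c q = recorded P ε T E wc s.wmem N c q := by
      ext e
      rw [mem_recorded, mem_recorded]
      refine and_congr_right fun he => ?_
      rw [hstab e he]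
    rw [hrec]
    by_cases hc : c ≤ N
    · exact hs.cell c c1 hc q hq
    · obtain rfl : c = N + 1 := by omega
      -- A new class contains no present edge, since all of these have a class at most `N`. This
      -- agrees with its fresh, hence zero, cells.
      have hempty : recorded P ε T E wc s.wmem N (N + 1) q = ∅ := by
        refine Finset.eq_empty_of_forall_notMem fun e h => ?_
        obtain ⟨he, h, -⟩ := mem_recorded.1 h
        have := (cls_spec (hs.cls e he)).2.1
        omega
      rw [hempty, hs.fresh, hs.fresh]
      · simp
      · simp only [Par.cell]; omega
      · simp only [Par.cell]; omega
  · intro a ha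
    have hle : (N + 1) * P.S ≤ (N' + 1) * P.S := Nat.mul_le_mul_right _ (by omega)
    rw [hmem a, hs.fresh a (by omega)]
    intro x hx i hi e
    have : (x + 1) * P.S ≤ (N' + 1) * P.S := Nat.mul_le_mul_right _ (by omega)
    rw [Nat.add_mul x] at this
    omega

/-- The set of edges after an insertion or a deletion. -/
def edgeUpd (ins : Bool) (E : Finset ℕ) (e : ℕ) : Finset ℕ := if ins then insert e E else E.erase e

/-- Truncated subtraction does no harm: in a dynamic stream a deleted edge is present, so its
contribution is really contained in the counter and in the sum. -/
theorem card_sum_edgeUpd {ins : Bool} {e : ℕ} (p : ℕ → Prop) [DecidablePred p] (hins : ins = true ↔ e ∉ E) :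
    ((edgeUpd ins E e).filter p).card = (if p e then upd ins (E.filter p).card 1 else (E.filter p).card) ∧
    ∑ x ∈ (edgeUpd ins E e).filter p, x =
      if p e then upd ins (∑ x ∈ E.filter p, x) e else ∑ x ∈ E.filter p, x := by
  cases ins with
  | true =>
    have he : e ∉ E := hins.1 rfl
    have he' : e ∉ E.filter p := fun h => he (Finset.mem_filter.1 h).1
    simp only [edgeUpd, if_true, upd, Finset.filter_insert]
    split_ifs
    · rw [Finset.card_insert_of_notMem he', Finset.sum_insert he', add_comm e]
      exact ⟨rfl, rfl⟩
    · exact ⟨rfl, rfl⟩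
  | false =>
    have he : e ∈ E := by
      by_contra h
      exact absurd (hins.2 h) (by simp)
    simp only [edgeUpd, upd, Finset.filter_erase, Bool.false_eq_true, if_false]
    split_ifs with hp
    · have he' : e ∈ E.filter p := Finset.mem_filter.2 ⟨he, hp⟩
      have := Finset.sum_erase_add (E.filter p) (fun x => x) he'
      exact ⟨Finset.card_erase_of_mem he', by omega⟩
    · have he' : e ∉ E.filter p := fun h => hp (Finset.mem_filter.1 h).2
      rw [Finset.erase_eq_of_notMem he']
      exact ⟨rfl, rfl⟩

/-- The samplers of the class of the edge that the edge hits are precisely the ones whose recorded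
sets change. -/
theorem sample_inv {s : State} {u v : ℕ} {ins : Bool} (hf : P.Fit z NB) (hB : ClassBound ε W NB)
    (hs : Inv P ε T W wc E N s) (hu : s.r 0 = u) (hv : s.r 1 = v) (hun : u < P.n) (hvn : v < P.n)
    (h2 : s.r 2 = if ins then 1 else 0) (h36 : s.r 36 = KMatchStream.cls ε s.wmem N (wc (u * P.n + v)))
    (h36' : s.r 36 ≠ 0) (hE : ∀ e ∈ E, e < P.n * P.n) (hins : ins = true ↔ u * P.n + v ∉ E)
    (hT : ∀ a < P.R * P.m, T a < P.D) :
    Ends z ε (P.RT * (P.L * 64 + 150) + 20) sample s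
      (Inv P ε T W wc (edgeUpd ins E (u * P.n + v)) N) := by
  classical
  have hN := hs.le hB
  have hcls : KMatchStream.cls ε s.wmem N (wc (u * P.n + v)) ≠ 0 := by rwa [← h36]
  obtain ⟨c1, c2, -⟩ := cls_spec hcls
  rw [← h36] at c1 c2
  generalize hc : s.r 36 = c at *
  have hen : u * P.n + v < P.n * P.n := by nlinarith
  have hn4 := hf.n4
  have hcardE : E.card ≤ P.n * P.n := by
    have : E ⊆ Finset.range (P.n * P.n) := fun e he => Finset.mem_range.2 (hE e he)
    simpa using Finset.card_le_card this
  have hS1 : c * P.S + P.S ≤ (N + 1) * P.S := by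
    rw [← Nat.succ_mul]; exact Nat.mul_le_mul_right _ (by omega)
  have hRm : P.R * P.m ≤ P.base := by simp [Par.base]
  refine (sample_spec (c := c) (A := P.base + c * P.S + P.H) hs.regs hf hu hv hun hvn h2 hc (by omega) rfl
    (fun a ha => by rw [hs.tab a ha]; exact hT a ha) (fun q hq => ?_)).mono le_rfl fun s' hu' h' => ?_
  · obtain ⟨h3, h4⟩ := hs.cell c c1 c2 q hq
    simp only [Par.cell] at h3 h4
    rw [h3, h4]
    have hsub : recorded P ε T E wc s.wmem N c q ⊆ E := Finset.filter_subset _ _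
    have hcard := (Finset.card_le_card hsub).trans hcardE
    -- At most `n ^ 2` present edges with codes below `n ^ 2`: the sum stays at most `n ^ 4`, and
    -- the field `n4` of `Fit` leaves room for one more code.
    have hsum : ∑ e ∈ recorded P ε T E wc s.wmem N c q, e ≤ P.n * P.n * (P.n * P.n) := by
      refine (Finset.sum_le_card_nsmul _ _ (P.n * P.n) fun e he => (hE e (hsub he)).le).trans ?_
      rw [smul_eq_mul]
      exact Nat.mul_le_mul_right _ hcard
    constructor
    · exact lt_of_le_of_lt (by nlinarith) hn4
    · exact lt_of_le_of_lt (by nlinarith) hn4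
  generalize he : u * P.n + v = e at *
  have hmem : ∀ a, (∀ q < P.Z, a ≠ P.cell c q ∧ a ≠ P.cell c q + 1) → s'.mem a = s.mem a := by
    intro a ha
    rw [h', sampMem, if_neg, if_neg]
    · rintro ⟨q, ⟨hq, -⟩, h⟩; exact (ha q hq).2 h
    · rintro ⟨q, ⟨hq, -⟩, h⟩; exact (ha q hq).1 h
  have hlow : ∀ a < P.base, s'.mem a = s.mem a := fun a ha => hmem a fun q _ => by
    simp only [Par.cell]; omega
  have hwm : s'.wmem = s.wmem := hu'.wmem rfl
  have hnx : ∀ i < P.H, ∀ x, P.nxt s' i x = P.nxt s i x := fun i hi x => hmem _ fun q hq =>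
    ⟨(Par.cell_ne_ptr hq hi).1.symm, (Par.cell_ne_ptr hq hi).2.symm⟩
  refine ⟨hs.regs.of_unch hu', by rw [hu'.reg 29 rfl, hs.cnt], by rw [hu'.out rfl, hs.out], ?_, ?_, ?_, ?_, ?_,
    ?_, ?_, ?_⟩
  · exact fun a ha => by rw [hlow a (by omega), hs.tab a ha]
  · exact fun a ha ha' => by rw [hlow a ha', hs.scratch a ha ha']
  · obtain ⟨Lev, hSkip⟩ := hs.skip
    rw [hwm]
    exact ⟨Lev, hSkip.congr_nx fun i hi x _ => hnx i hi x⟩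
  · rw [hwm]; exact hs.sep
  · rw [hwm]; exact hs.wts
  · rw [hwm]
    intro x hx
    have : x = e ∨ x ∈ E := by
      rw [edgeUpd] at hx
      split_ifs at hx
      · exact Finset.mem_insert.1 hx
      · exact .inr (Finset.mem_of_mem_erase hx)
    rcases this with rfl | h
    · exact hcls
    · exact hs.cls x h
  · intro c' c1' c2' q hq
    have hhit : P.hit s.mem e q ↔ P.hit T e q := Par.hit_congr hs.tab hq e
    have hcs := card_sum_edgeUpd (E := E) (ins := ins) (e := e)
      (fun x => KMatchStream.cls ε s.wmem N (wc x) = c' ∧ P.hit T x q) hins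
    have hold := hs.cell c' c1' c2' q hq
    rw [hwm]
    unfold recorded at hold ⊢
    rw [hcs.1, hcs.2, ← h36]
    by_cases hcc : c' = c
    · subst hcc
      have e1 := sampMem_count (mem := s.mem) (A := P.base + c' * P.S + P.H) (e := e) (ins := ins)
        (Q := fun q => q < P.Z ∧ P.hit s.mem e q) q
      have e2 := sampMem_sum (mem := s.mem) (A := P.base + c' * P.S + P.H) (e := e) (ins := ins)
        (Q := fun q => q < P.Z ∧ P.hit s.mem e q) q
      rw [← h'] at e1 e2
      simp only [hq, hhit, true_and] at e1 e2
      change s'.mem (P.cell c' q) = (if P.hit T e q then upd ins (s.mem (P.cell c' q)) 1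
        else s.mem (P.cell c' q)) at e1
      change s'.mem (P.cell c' q + 1) = (if P.hit T e q then upd ins (s.mem (P.cell c' q + 1)) e
        else s.mem (P.cell c' q + 1)) at e2
      rw [e1, e2, hold.1, hold.2]
      simp
    · rw [if_neg (by tauto), if_neg (by tauto), hmem, hmem]
      · exact hold
      · intro q' hq'
        refine ⟨(Par.cell_ne_succ hq' hq).symm, fun e => hcc (Par.cell_inj hq hq' (by omega)).1⟩
      · intro q' hq'
        exact ⟨fun e => hcc (Par.cell_inj hq hq' e).1, Par.cell_ne_succ hq hq'⟩
  · intro a ha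
    rw [hmem a fun q hq => ?_, hs.fresh a ha]
    have := Par.cell_lt hq
    simp only [Par.cell]
    omega

def updateCmd : Cmd := findClass ;; sample

/-- A bound for the running time of an update. -/
def Par.time (P : Par) : ℕ := P.H * 123 + P.RT * (P.L * 64 + 150) + 101

theorem updateCmd_spec {s : State} {u v : ℕ} {ins : Bool} (hε : 0 < ε) (hf : P.Fit z NB)
    (hB : ClassBound ε W NB) (hs : Inv P ε T W wc E N s) (hu : s.r 0 = u) (hv : s.r 1 = v)
    (hun : u < P.n) (hvn : v < P.n) (h2 : s.r 2 = if ins then 1 else 0)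
    (hwin : s.win = wc (u * P.n + v)) (hw : 0 < s.win) (hwW : s.win ∈ W)
    (hE : ∀ e ∈ E, e < P.n * P.n) (hins : ins = true ↔ u * P.n + v ∉ E)
    (hT : ∀ a < P.R * P.m, T a < P.D) {K : ℕ × (ℕ → ℝ)} (hK : Agree K N s.wmem) :
    Ends z ε P.time updateCmd s fun s' => ∃ N', Inv P ε T W wc (edgeUpd ins E (u * P.n + v)) N' s' ∧
      Agree (grow ε K s.win) N' s'.wmem := by
  refine Ends.seq (findClass_spec hε hf hB hs hw hwW hK) (fun s₁ hu₁ h₁ => ?_)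
    (t₂ := P.RT * (P.L * 64 + 150) + 20) (by simp only [Par.time]; omega)
  obtain ⟨N', hI, hA, h36, h36'⟩ := h₁
  exact (sample_inv hf hB hI (by rw [hu₁.reg 0 rfl, hu]) (by rw [hu₁.reg 1 rfl, hv]) hun hvn
    (by rw [hu₁.reg 2 rfl, h2]) (by rw [h36, hwin]) h36' hE hins hT).mono le_rfl
    fun s' hu' h => ⟨N', h, by rw [hu'.wmem rfl]; exact hA⟩

end


/-! ### The query routine -/

/-- Two edges without a common vertex. -/
def disj (n e f : ℕ) : Prop := e / n ≠ f / n ∧ e / n ≠ f % n ∧ e % n ≠ f / n ∧ e % n ≠ f % n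

namespace Par

variable (P : Par) (s : State)

/-- The counter, the sum and the weight of the class of the sampler with number `x`. -/
def cnt (x : ℕ) : ℕ := s.mem (P.cell (x / P.Z + 1) (x % P.Z))
def code (x : ℕ) : ℕ := s.mem (P.cell (x / P.Z + 1) (x % P.Z) + 1)
def wx (x : ℕ) : ℝ := s.wmem (x / P.Z + 1)

/-- The samplers `τ 0, …, τ (k - 1)` hold one edge each, and these edges form a matching. -/
def Valid (τ : ℕ → ℕ) (i : ℕ) : Prop :=
  P.cnt s (τ i) = 1 ∧ ∀ j < i, disj P.n (P.code s (τ i)) (P.code s (τ j))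

def AllValid (τ : ℕ → ℕ) : Prop := ∀ i < P.k, P.Valid s τ i

noncomputable def wsumOf (τ : ℕ → ℕ) : ℝ := ∑ i ∈ Finset.range P.k, P.wx s (τ i)

end Par

/-- The digits of `v` in base `b`, the last of which is the least significant one. -/
def dgt (b k v i : ℕ) : ℕ := v / b ^ (k - 1 - i) % b

/-- Samplers of all classes are numbered consecutively from `0`, class `c` being the block `c - 1`.
The results are the class in `43`, the counter in `46` and the sum in `47`. -/
def look (x : ℕ) : Cmd :=
  .op .div 43 x 16 ;; .op .add 43 43 3 ;; .op .mod 44 x 16 ;; .op .mul 45 43 12 ;; .op .add 45 45 13 ;;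
  .op .add 45 45 14 ;; .op .add 45 45 44 ;; .op .add 45 45 44 ;; .load 46 45 ;; .op .add 45 45 3 ;;
  .load 47 45

/-- Register `33` is the flag for a valid tuple; it is only ever cleared during a check. -/
def clash (x y : ℕ) : Cmd := neq x y ;; .branch 41 .skip (.const 33 0)

def checkInner : Cmd :=
  (.op .add 48 36 35 ;; .load 48 48) ;; look 48 ;; (.op .div 52 47 4 ;; .op .mod 53 47 4) ;;
  clash 50 52 ;; clash 50 53 ;; clash 51 52 ;; clash 51 53

def checkOuter : Cmd :=
  (.op .add 48 36 34 ;; .load 48 48) ;; look 48 ;; (.op .add 54 38 34 ;; .wcopy 54 43) ;;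
  (neq 46 3 ;; .branch 41 (.const 33 0) .skip) ;; (.op .div 50 47 4 ;; .op .mod 51 47 4 ;; .move 35 34) ;;
  down 35 checkInner

def check : Cmd := (.const 33 1 ;; .move 34 5) ;; down 34 checkOuter

def copyBest : Cmd :=
  .move 35 5 ;; down 35 (.op .add 48 36 35 ;; .load 49 48 ;; .op .add 48 37 35 ;; .store 48 49 ;;
    .op .add 48 38 35 ;; .op .add 49 39 35 ;; .wcopy 49 48)

/-- The stored best tuple, if any, is replaced whenever its sum of representatives is at most that
of the candidate, ties included. -/
def better : Cmd :=
  .branch 31 (.wsum 55 5 39 38) (.const 55 1) ;; .branch 55 (copyBest ;; .const 31 1) .skip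

/-- The candidate tuple is a counter in base `N * Z`; register `56` is the carry, running from the
last digit to the first. A carry out of the first digit makes register `32` zero and ends the
enumeration. -/
def incr : Cmd :=
  (.const 56 1 ;; .move 34 5) ;; down 34 (.op .add 48 36 34 ;; .load 49 48 ;; .op .add 49 49 56 ;;
    .op .lt 57 49 30 ;; .branch 57 (.const 56 0) (.const 49 0) ;; .store 48 49) ;; .op .sub 32 3 56

def queryBody : Cmd := check ;; .branch 33 better .skip ;; incr

def emitBest : Cmd :=
  .move 34 5 ;; down 34 ((.op .add 48 37 34 ;; .load 48 48) ;; look 48 ;;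
    (.op .div 50 47 4 ;; .op .mod 51 47 4 ;; .emit 50 51))

/-- The `2 k` scratch cells after the random table hold the candidate and the best tuple; the
weights of their classes are copied behind the representatives, so that `wsum` can compare them. The
guard is initially `N * Z`, so nothing is enumerated if there is no sampler. -/
def queryCmd : Cmd :=
  (.op .mul 30 29 16 ;; .const 31 0 ;; .move 32 30 ;; .op .mul 36 18 7 ;; .op .add 37 36 5 ;;
    .op .add 38 29 3 ;; .op .add 39 38 5) ;;
  .loop 32 queryBody ;; .branch 31 emitBest .skip

/-- What does not change during a query: `s₀` is the state at its beginning. -/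
structure QCtx (P : Par) (z : Size) (NB N : ℕ) (s₀ s : State) : Prop where
  fit : P.Fit z NB
  hN : N ≤ NB
  small : ∀ x < N * P.Z, P.cnt s₀ x < z.lim ∧ P.code s₀ x < z.lim
  regs : P.Regs s
  r30 : s.r 30 = N * P.Z
  r36 : s.r 36 = P.R * P.m
  r37 : s.r 37 = P.R * P.m + P.k
  r38 : s.r 38 = N + 1
  r39 : s.r 39 = N + 1 + P.k
  mem : ∀ a, P.base ≤ a → s.mem a = s₀.mem a
  wmem : ∀ c ≤ N, s.wmem c = s₀.wmem c

section

variable {z : Size} {ε : ℝ} {P : Par} {NB N : ℕ} {s₀ s : State}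

theorem QCtx.of_eq {s' : State} (h : QCtx P z NB N s₀ s)
    (hr : ∀ y, y < 31 ∨ 36 ≤ y ∧ y < 40 → 3 ≤ y → s'.r y = s.r y)
    (hm : ∀ a, P.base ≤ a → s'.mem a = s.mem a) (hw : ∀ c ≤ N, s'.wmem c = s.wmem c) :
    QCtx P z NB N s₀ s' :=
  ⟨h.fit, h.hN, h.small, h.regs.of_eq fun y hy hy' => hr y (by omega) hy',
    by rw [hr 30 (by omega) (by omega), h.r30],
    by rw [hr 36 (by omega) (by omega), h.r36], by rw [hr 37 (by omega) (by omega), h.r37],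
    by rw [hr 38 (by omega) (by omega), h.r38], by rw [hr 39 (by omega) (by omega), h.r39],
    fun a ha => by rw [hm a ha, h.mem a ha], fun c hc => by rw [hw c hc, h.wmem c hc]⟩

theorem QCtx.of_unch {p : Cmd} {s' : State} (h : QCtx P z NB N s₀ s) (hu : Unch p s s')
    (hm : ∀ a, P.base ≤ a → s'.mem a = s.mem a) (hw : ∀ c ≤ N, s'.wmem c = s.wmem c)
    (hp : ∀ y < 40, 3 ≤ y → y < 31 ∨ 36 ≤ y → p.writes y = false := by decide) : QCtx P z NB N s₀ s' :=
  h.of_eq (fun y hy hy' => hu.reg y (hp y (by omega) hy' (by omega))) hm hw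

theorem QCtx.bounds (h : QCtx P z NB N s₀ s) : N * P.Z < z.lim ∧ P.base < z.lim ∧ P.base ≤ z.cells ∧
    P.R * P.m + P.k + P.k = P.base ∧ N + 1 + P.k + P.k < z.lim ∧ N + 1 + P.k + P.k ≤ z.cells ∧ 1 ≤ P.k := by
  have hf := h.fit
  have h1 := hf.lim
  have h2 := hf.cells
  have h3 := h.hN
  have h4 : N * P.Z ≤ NB * P.S := Nat.mul_le_mul h3 (by simp only [Par.S]; omega)
  have h5 : (NB + 2) * P.S = NB * P.S + 2 * P.S := by ring
  have h6 : P.base = P.R * P.m + 2 * P.k := rfl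
  have h7 : 1 ≤ P.S := P.H_pos.trans_le P.H_le_S
  have h8 : NB ≤ NB * P.S := Nat.le_mul_of_pos_right _ h7
  refine ⟨by omega, by omega, by omega, by omega, by omega, by omega, hf.k⟩

theorem look_spec {x y : ℕ} (h : QCtx P z NB N s₀ s) (hx : s.r x = y) (hy : y < N * P.Z) (hx' : 48 ≤ x) :
    Ends z ε 30 (look x) s fun s' => s'.r 43 = y / P.Z + 1 ∧ s'.r 46 = P.cnt s₀ y ∧
      s'.r 47 = P.code s₀ y := by
  have hf := h.fit
  have h1 := hf.lim
  have h2 := hf.cells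
  have h3 := h.hN
  have hb := h.bounds
  have hR := h.regs
  have hZ : 0 < P.Z := by
    rcases Nat.eq_zero_or_pos P.Z with e | e
    · rw [e] at hy; omega
    · exact e
  have hc : y / P.Z < N := Nat.div_lt_of_lt_mul (by rwa [mul_comm])
  have hq : y % P.Z < P.Z := Nat.mod_lt _ hZ
  have ha := hf.addr_le (x := y / P.Z + 1) (i := P.H + 2 * (y % P.Z) + 1) (by omega)
    (by simp only [Par.S]; omega)
  have hm1 := h.mem (P.cell (y / P.Z + 1) (y % P.Z)) (by simp only [Par.cell]; omega)
  have hm2 := h.mem (P.cell (y / P.Z + 1) (y % P.Z) + 1) (by simp only [Par.cell]; omega)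
  have hs := h.small y hy
  have e : (y / P.Z + 1) * P.S + P.base + P.H + y % P.Z + y % P.Z = P.cell (y / P.Z + 1) (y % P.Z) := by
    simp only [Par.cell]; ring
  refine Ends.wp ?_ (by simp [Cmd.cost, look])
  · simp only [look, wp, WordOp.eval, State.set_r, State.set_mem, State.set_set]
    simp only [Nat.reduceEqDiff, if_false, if_true, hx, hR.Z, hR.one, hR.S, hR.base, hR.H,
      show x ≠ 43 by omega, e, hm1, hm2]
    simp only [Par.cell] at *
    refine ⟨by omega, by omega, by omega, by omega, by omega, by omega, by omega, by omega, by omega,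
      hs.1, by omega, by omega, hs.2, trivial, ?_, ?_⟩
    · simp only [Par.cnt, Par.cell]
    · simp only [Par.code, Par.cell]

theorem clash_spec {x y : ℕ} (hx : s.r x < z.lim) (hy : s.r y < z.lim) (hx' : 43 ≤ x) (hy' : 43 ≤ y)
    (hz : 0 < z.lim) : Ends z ε 10 (clash x y) s fun s' => s'.r 33 ≠ 0 ↔ s.r 33 ≠ 0 ∧ s.r x ≠ s.r y := by
  refine Ends.wp (wp_neq hx hy (by omega) (by omega) fun a b hab => ⟨fun h => ?_, fun h => ?_⟩) ?_
  · simp only [State.set_r, if_true] at h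
    simp [wp]
    tauto
  · simp only [State.set_r, if_true] at h
    simp [wp]
    tauto
  · simp [Cmd.cost, clash, neq]

theorem checkInner_spec {y j : ℕ} {τ : ℕ → ℕ} (h : QCtx P z NB N s₀ s) (hτ : ∀ i < P.k, s.mem (P.R * P.m + i) = τ i)
    (hτb : ∀ i < P.k, τ i < N * P.Z) (hy : y < N * P.Z) (h50 : s.r 50 = P.code s₀ y / P.n)
    (h51 : s.r 51 = P.code s₀ y % P.n) (h35 : s.r 35 = j) (hj : j < P.k) :
    Ends z ε 100 checkInner s fun s' => s'.r 33 ≠ 0 ↔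
      s.r 33 ≠ 0 ∧ disj P.n (P.code s₀ y) (P.code s₀ (τ j)) := by
  have hb := h.bounds
  have hR := h.regs
  have hτj := hτb j hj
  have hsm := fun a ha => (h.small a ha).2
  have hdiv : ∀ a < N * P.Z, P.code s₀ a / P.n < z.lim := fun a ha =>
    (Nat.div_le_self _ _).trans_lt (hsm a ha)
  have hmod : ∀ a < N * P.Z, P.code s₀ a % P.n < z.lim := fun a ha =>
    (Nat.mod_le _ _).trans_lt (hsm a ha)
  refine Ends.seq (t₁ := 3) (t₂ := 96) (Q₁ := fun s' => s'.r 48 = τ j) (Ends.wp ?_)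
    (fun s₁ hu₁ h₁ => ?_) (by norm_num)
  · simp only [wp, WordOp.eval, State.set_r, State.set_mem, if_true, h.r36, h35, hτ j hj]
    exact ⟨by omega, by omega, by omega, trivial⟩
  have hc₁ := h.of_unch hu₁ (fun a _ => by rw [hu₁.mem rfl]) fun c _ => by rw [hu₁.wmem rfl]
  refine Ends.seq (look_spec hc₁ h₁ hτj le_rfl) (fun s₂ hu₂ h₂ => ?_) (t₂ := 65) (by norm_num)
  have hc₂ := hc₁.of_unch hu₂ (fun a _ => by rw [hu₂.mem rfl]) fun c _ => by rw [hu₂.wmem rfl]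
  refine Ends.seq (t₁ := 3) (t₂ := 61) (Q₁ := fun s' => s'.r 52 = P.code s₀ (τ j) / P.n ∧
    s'.r 53 = P.code s₀ (τ j) % P.n) (Ends.wp ?_) (fun s₃ hu₃ h₃ => ?_) (by norm_num)
  · simp only [wp, WordOp.eval, State.set_r]
    simp only [Nat.reduceEqDiff, if_false, if_true, h₂.2.2, hc₂.regs.n]
    exact ⟨hdiv _ hτj, hmod _ hτj, trivial, trivial⟩
  have e50 : s₃.r 50 = P.code s₀ y / P.n := by rw [hu₃.reg 50 rfl, hu₂.reg 50 rfl, hu₁.reg 50 rfl, h50]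
  have e51 : s₃.r 51 = P.code s₀ y % P.n := by rw [hu₃.reg 51 rfl, hu₂.reg 51 rfl, hu₁.reg 51 rfl, h51]
  have e33 : s₃.r 33 = s.r 33 := by rw [hu₃.reg 33 rfl, hu₂.reg 33 rfl, hu₁.reg 33 rfl]
  have l50 : s₃.r 50 < z.lim := by rw [e50]; exact hdiv y hy
  have l51 : s₃.r 51 < z.lim := by rw [e51]; exact hmod y hy
  have l52 : s₃.r 52 < z.lim := by rw [h₃.1]; exact hdiv _ hτj
  have l53 : s₃.r 53 < z.lim := by rw [h₃.2]; exact hmod _ hτj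
  refine Ends.seq (clash_spec l50 l52 (by norm_num) (by norm_num) (by omega)) (fun s₄ hu₄ h₄ => ?_) (t₂ := 50)
    (by norm_num)
  refine Ends.seq (clash_spec (x := 50) (y := 53) (by rwa [hu₄.reg 50 rfl]) (by rwa [hu₄.reg 53 rfl])
    (by norm_num) (by norm_num) (by omega)) (fun s₅ hu₅ h₅ => ?_) (t₂ := 39) (by norm_num)
  have hu5 := fun x hx hx' => (hu₅.reg x hx).trans (hu₄.reg x hx')
  refine Ends.seq (clash_spec (x := 51) (y := 52) (by rwa [hu5 51 rfl rfl]) (by rwa [hu5 52 rfl rfl])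
    (by norm_num) (by norm_num) (by omega)) (fun s₆ hu₆ h₆ => ?_) (t₂ := 28) (by norm_num)
  have hu6 := fun x hx hx' hx'' => (hu₆.reg x hx).trans (hu5 x hx' hx'')
  refine (clash_spec (x := 51) (y := 53) (by rwa [hu6 51 rfl rfl rfl]) (by rwa [hu6 53 rfl rfl rfl])
    (by norm_num) (by norm_num) (by omega)).mono (by norm_num) fun s₇ hu₇ h₇ => ?_
  rw [h₇, h₆, h₅, h₄, e33, hu6 51 rfl rfl rfl, hu6 53 rfl rfl rfl, hu5 51 rfl rfl, hu5 52 rfl rfl,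
    hu₄.reg 50 rfl, hu₄.reg 53 rfl, e50, e51, h₃.1, h₃.2, disj]
  tauto

theorem checkOuter_spec {i : ℕ} {τ : ℕ → ℕ} (h : QCtx P z NB N s₀ s)
    (hτ : ∀ i < P.k, s.mem (P.R * P.m + i) = τ i) (hτb : ∀ i < P.k, τ i < N * P.Z) (h34 : s.r 34 = i)
    (hi : i < P.k) : Ends z ε (P.k * 103 + 80) checkOuter s fun s' =>
      (s'.r 33 ≠ 0 ↔ s.r 33 ≠ 0 ∧ P.Valid s₀ τ i) ∧
      s'.wmem = Function.update s.wmem (N + 1 + i) (P.wx s₀ (τ i)) := by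
  have hb := h.bounds
  have hR := h.regs
  have hτi := hτb i hi
  have hsm := h.small _ hτi
  have hZN : τ i / P.Z < N := Nat.div_lt_of_lt_mul (by rwa [mul_comm])
  have hle : N ≤ N + 1 + i := by omega
  refine Ends.seq (t₁ := 3) (t₂ := P.k * 103 + 76) (Q₁ := fun s' => s'.r 48 = τ i) (Ends.wp ?_)
    (fun s₁ hu₁ h₁ => ?_) (by omega)
  · simp only [wp, WordOp.eval, State.set_r, State.set_mem, if_true, h.r36, h34, hτ i hi]
    exact ⟨by omega, by omega, by omega, trivial⟩
  have hc₁ := h.of_unch hu₁ (fun a _ => by rw [hu₁.mem rfl]) fun c _ => by rw [hu₁.wmem rfl]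
  refine Ends.seq (look_spec hc₁ h₁ hτi le_rfl) (fun s₂ hu₂ h₂ => ?_) (t₂ := P.k * 103 + 45) (by omega)
  have hc₂ := hc₁.of_unch hu₂ (fun a _ => by rw [hu₂.mem rfl]) fun c _ => by rw [hu₂.wmem rfl]
  have w₂ : s₂.wmem = s.wmem := by rw [hu₂.wmem rfl, hu₁.wmem rfl]
  refine Ends.seq (t₁ := 3) (t₂ := P.k * 103 + 41) (Q₁ := fun s' =>
    s'.wmem = Function.update s.wmem (N + 1 + i) (P.wx s₀ (τ i))) (Ends.wp ?_) (fun s₃ hu₃ h₃ => ?_) (by omega)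
  · simp only [wp, WordOp.eval, State.set_r, State.set_wmem]
    simp only [Nat.reduceEqDiff, if_false, if_true, hc₂.r38, hu₂.reg 34 rfl, hu₁.reg 34 rfl, h34, h₂.1]
    refine ⟨by omega, by omega, by omega, ?_⟩
    funext c
    rw [hc₂.wmem _ (by omega)]
    simp [Function.update_apply, w₂, Par.wx]
  have hc₃ := hc₂.of_unch hu₃ (fun a _ => by rw [hu₃.mem rfl]) fun c hc => by
    rw [h₃, w₂, Function.update_of_ne (by omega)]
  have e46 : s₃.r 46 = P.cnt s₀ (τ i) := by rw [hu₃.reg 46 rfl, h₂.2.1]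
  have e47 : s₃.r 47 = P.code s₀ (τ i) := by rw [hu₃.reg 47 rfl, h₂.2.2]
  have e33 : s₃.r 33 = s.r 33 := by rw [hu₃.reg 33 rfl, hu₂.reg 33 rfl, hu₁.reg 33 rfl]
  refine Ends.seq (t₁ := 10) (t₂ := P.k * 103 + 30) (Q₁ := fun s' => s'.r 33 ≠ 0 ↔ s.r 33 ≠ 0 ∧ P.cnt s₀ (τ i) = 1)
    (Ends.wp (wp_neq (by rw [e46]; exact hsm.1) (by rw [hc₃.regs.one]; omega) (by norm_num) (by norm_num)
      fun a b hab => ⟨fun h => ?_, fun h => ?_⟩)) (fun s₄ hu₄ h₄ => ?_) (by omega)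
  · simp only [State.set_r, if_true] at h
    rw [e46, hc₃.regs.one] at hab
    simp [wp]
    exact ⟨by omega, fun _ h' => h (hab.2 h')⟩
  · simp only [State.set_r, if_true] at h
    rw [e46, hc₃.regs.one] at hab
    simp [wp, hab.1 h, e33]
  have hc₄ := hc₃.of_unch hu₄ (fun a _ => by rw [hu₄.mem rfl]) fun c _ => by rw [hu₄.wmem rfl]
  refine Ends.seq (t₁ := 5) (t₂ := P.k * 103 + 24) (Q₁ := fun s' => s'.r 50 = P.code s₀ (τ i) / P.n ∧
    s'.r 51 = P.code s₀ (τ i) % P.n ∧ s'.r 35 = i) (Ends.wp ?_) (fun s₅ hu₅ h₅ => ?_) (by omega)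
  · have h34' : s₄.r 34 = i := by
      rw [hu₄.reg 34 rfl, hu₃.reg 34 rfl, hu₂.reg 34 rfl, hu₁.reg 34 rfl, h34]
    simp only [wp, WordOp.eval, State.set_r]
    simp only [Nat.reduceEqDiff, if_false, if_true, hc₄.regs.n, hu₄.reg 47 rfl, e47, h34']
    exact ⟨(Nat.div_le_self _ _).trans_lt hsm.2, (Nat.mod_le _ _).trans_lt hsm.2, by omega, trivial,
      trivial, trivial⟩
  have hc₅ := hc₄.of_unch hu₅ (fun a _ => by rw [hu₅.mem rfl]) fun c _ => by rw [hu₅.wmem rfl]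
  have m₅ : s₅.mem = s.mem := by
    rw [hu₅.mem rfl, hu₄.mem rfl, hu₃.mem rfl, hu₂.mem rfl, hu₁.mem rfl]
  refine Ends.down (fun j s' => j ≤ i ∧ (s'.r 33 ≠ 0 ↔ (s.r 33 ≠ 0 ∧ P.cnt s₀ (τ i) = 1) ∧
    ∀ j', j ≤ j' → j' < i → disj P.n (P.code s₀ (τ i)) (P.code s₀ (τ j')))) i h₅.2.2 (by omega)
    hc₅.regs.one (by rfl) (by norm_num) (by rfl) ?_ (T := 100) ?_ ?_ ?_
  · refine ⟨le_rfl, ?_⟩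
    rw [hu₅.reg 33 rfl, h₄]
    constructor
    · exact fun h => ⟨h, fun j' h1 h2 => by omega⟩
    · exact fun h => h.1
  · rintro j hj s' h35 hu ⟨-, hI⟩
    have hc' : QCtx P z NB N s₀ (s'.set 35 j) := (hc₅.of_unch hu (fun a _ => by rw [hu.mem rfl])
      fun c _ => by rw [hu.wmem rfl]).of_eq (fun y hy hy' => by simp [show y ≠ 35 by omega])
      (fun _ _ => rfl) fun _ _ => rfl
    refine (checkInner_spec (y := τ i) (j := j) hc' (τ := τ) ?_ hτb hτi ?_ ?_ (by simp) (by omega)).mono le_rfl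
      fun s'' _ h'' => ⟨hj.le, ?_⟩
    · intro i' hi'
      rw [State.set_mem, hu.mem rfl, m₅, hτ i' hi']
    · simp; rw [hu.reg 50 rfl, h₅.1]
    · simp; rw [hu.reg 51 rfl, h₅.2.1]
    · rw [h'']
      simp only [State.set_r]
      simp only [Nat.reduceEqDiff, if_false]
      rw [hI]
      constructor
      · rintro ⟨⟨h1, h2⟩, h3⟩
        refine ⟨h1, fun j' h4 h5 => ?_⟩
        rcases h4.lt_or_eq with h4 | rfl
        · exact h2 j' h4 h5
        · exact h3
      · rintro ⟨h1, h2⟩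
        exact ⟨⟨h1, fun j' h4 h5 => h2 j' (by omega) h5⟩, h2 j le_rfl hj⟩
  · rintro s' hu - ⟨-, hI⟩
    constructor
    · rw [hI, Par.Valid, and_assoc]
      simp
    · rw [hu.wmem rfl, hu₅.wmem rfl, hu₄.wmem rfl, h₃]
  · have : i * 103 ≤ P.k * 103 := Nat.mul_le_mul_right _ hi.le
    omega

theorem check_spec {τ : ℕ → ℕ} (h : QCtx P z NB N s₀ s)
    (hτ : ∀ i < P.k, s.mem (P.R * P.m + i) = τ i) (hτb : ∀ i < P.k, τ i < N * P.Z) :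
    Ends z ε (P.k * (P.k * 103 + 83) + 10) check s fun s' =>
      (s'.r 33 ≠ 0 ↔ P.AllValid s₀ τ) ∧ (∀ i < P.k, s'.wmem (N + 1 + i) = P.wx s₀ (τ i)) ∧
      ∀ a, a < N + 1 ∨ N + 1 + P.k ≤ a → s'.wmem a = s.wmem a := by
  have hb := h.bounds
  have hR := h.regs
  refine Ends.seq (t₁ := 3) (t₂ := P.k * (P.k * 103 + 83) + 6) (Q₁ := fun s' => s'.r 33 = 1 ∧ s'.r 34 = P.k)
    (Ends.wp ?_) (fun s₁ hu₁ h₁ => ?_) (by omega)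
  · simp [wp, hR.k]; omega
  have hc₁ := h.of_unch hu₁ (fun a _ => by rw [hu₁.mem rfl]) fun c _ => by rw [hu₁.wmem rfl]
  have m₁ : s₁.mem = s.mem := hu₁.mem rfl
  have w₁ : s₁.wmem = s.wmem := hu₁.wmem rfl
  refine Ends.down (fun i s' => i ≤ P.k ∧ (s'.r 33 ≠ 0 ↔ ∀ i', i ≤ i' → i' < P.k → P.Valid s₀ τ i') ∧
    (∀ i', i ≤ i' → i' < P.k → s'.wmem (N + 1 + i') = P.wx s₀ (τ i')) ∧
      ∀ a, a < N + 1 ∨ N + 1 + P.k ≤ a → s'.wmem a = s.wmem a) P.k h₁.2 (by omega)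
    hc₁.regs.one (by rfl) (by norm_num) (by rfl) ?_ (T := P.k * 103 + 80) ?_ ?_
    (by rw [show P.k * 103 + 80 + 3 = P.k * 103 + 83 from rfl]; omega)
  · refine ⟨le_rfl, ?_, fun i' h1 h2 => by omega, fun a _ => by rw [w₁]⟩
    simp only [h₁.1, ne_eq, one_ne_zero, not_false_eq_true, true_iff]
    exact fun i' h1 h2 => by omega
  · rintro i hi s' h34 hu ⟨-, hI, hI2, hI3⟩
    have hc' : QCtx P z NB N s₀ (s'.set 34 i) := (hc₁.of_unch hu (fun a _ => by rw [hu.mem rfl])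
      fun c hc => by rw [hI3 c (by omega), w₁]).of_eq (fun y hy hy' => by simp [show y ≠ 34 by omega])
      (fun _ _ => rfl) fun _ _ => rfl
    refine (checkOuter_spec (i := i) hc' (τ := τ) ?_ hτb (by simp) hi).mono le_rfl
      fun s'' _ h'' => ⟨hi.le, ?_, ?_, ?_⟩
    · intro i' hi'
      rw [State.set_mem, hu.mem rfl, m₁, hτ i' hi']
    · rw [h''.1]
      simp only [State.set_r]
      simp only [Nat.reduceEqDiff, if_false]
      rw [hI]
      constructor
      · rintro ⟨h2, h3⟩ j' h4 h5
        rcases h4.lt_or_eq with h4 | rfl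
        · exact h2 j' h4 h5
        · exact h3
      · exact fun h2 => ⟨fun j' h4 h5 => h2 j' (by omega) h5, h2 i le_rfl hi⟩
    · intro i' h4 h5
      rw [h''.2, Function.update_apply]
      split_ifs with e
      · rw [show i' = i by omega]
      · exact hI2 i' (by omega) h5
    · intro a ha
      rw [h''.2, Function.update_of_ne (by omega)]
      exact hI3 a ha
  · rintro s' - - ⟨-, h1, h2, h3⟩
    exact ⟨by rw [h1]; simp [Par.AllValid], fun i hi => h2 i (Nat.zero_le _) hi, h3⟩

end


/-! ### Enumeration of all tuples by a counter -/

theorem dgt_succ {b v p : ℕ} (hb : 0 < b) :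
    (v + 1) / b ^ p % b = (if v / b ^ p % b + (if b ^ p ∣ v + 1 then 1 else 0) < b then
      v / b ^ p % b + (if b ^ p ∣ v + 1 then 1 else 0) else 0) ∧
    (b ^ (p + 1) ∣ v + 1 ↔ ¬ v / b ^ p % b + (if b ^ p ∣ v + 1 then 1 else 0) < b) := by
  have hd := Nat.mod_lt (v / b ^ p) hb
  have hdm := Nat.div_add_mod (v / b ^ p) b
  rw [Nat.succ_div]
  -- A carry arrives at the position `p` exactly when all lower digits of `v` are `b - 1`, that is,
  -- when `b ^ p` divides `v + 1`.
  by_cases h : b ^ p ∣ v + 1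
  · have hs : (v + 1) / b ^ p = v / b ^ p + 1 := by rw [Nat.succ_div, if_pos h]
    have h2 : b ^ (p + 1) ∣ v + 1 ↔ b ∣ v / b ^ p + 1 := by
      rw [← hs, Nat.dvd_div_iff_mul_dvd h, pow_succ]
    simp only [h, if_true, h2]
    generalize v / b ^ p = w at *
    by_cases hlt : w % b + 1 < b
    · have : (w + 1) % b = w % b + 1 := by
        rw [Nat.add_mod, Nat.mod_eq_of_lt (show 1 < b by omega), Nat.mod_eq_of_lt hlt]
      refine ⟨by rw [if_pos hlt, this], ?_⟩
      rw [Nat.dvd_iff_mod_eq_zero, this]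
      omega
    · have : (w + 1) % b = 0 := by
        have e : w + 1 = b * (w / b) + b := by omega
        rw [e]; simp
      exact ⟨by rw [if_neg hlt, this], by rw [Nat.dvd_iff_mod_eq_zero, this]; simp [hlt]⟩
  · have h2 : ¬ b ^ (p + 1) ∣ v + 1 := fun g => h ((pow_dvd_pow b p.le_succ).trans g)
    simp [h, h2, hd]

theorem dgt_lt {b k v i : ℕ} (hb : 0 < b) : dgt b k v i < b := Nat.mod_lt _ hb

/-- Every tuple is visited by the counter. This turns optimality among the visited tuples into
optimality among all tuples. -/
theorem exists_dgt {b : ℕ} : ∀ {k : ℕ} {τ : ℕ → ℕ}, (∀ i < k, τ i < b) →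
    ∃ v < b ^ k, ∀ i < k, dgt b k v i = τ i
  | 0, _, _ => ⟨0, by simp, by simp⟩
  | k + 1, τ, h => by
    obtain ⟨v, hv, hd⟩ := exists_dgt (k := k) (τ := τ) fun i hi => h i (by omega)
    have hk := h k (by omega)
    refine ⟨v * b + τ k, ?_, fun i hi => ?_⟩
    · have : (v + 1) * b ≤ b ^ k * b := Nat.mul_le_mul_right _ hv
      rw [pow_succ]
      linarith
    · rcases Nat.lt_succ_iff_lt_or_eq.1 hi with hi' | rfl
      · rw [← hd i hi', dgt, dgt, show k + 1 - 1 - i = (k - 1 - i) + 1 by omega, pow_succ', ← Nat.div_div_eq_div_mul]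
        rw [show (v * b + τ k) / b = v by
          rw [mul_comm, Nat.mul_add_div (by omega), Nat.div_eq_of_lt hk, add_zero]]
      · simp [dgt, Nat.mod_eq_of_lt hk]

section

variable {z : Size} {ε : ℝ} {P : Par} {NB N : ℕ} {s₀ s : State}

theorem copyBest_spec (h : QCtx P z NB N s₀ s) (hs : ∀ i < P.k, s.mem (P.R * P.m + i) < z.lim) :
    Ends z ε (P.k * 20 + 3) copyBest s fun s' =>
      (∀ i < P.k, s'.mem (P.R * P.m + P.k + i) = s.mem (P.R * P.m + i) ∧
        s'.wmem (N + 1 + P.k + i) = s.wmem (N + 1 + i)) ∧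
      (∀ a, a < P.R * P.m + P.k ∨ P.base ≤ a → s'.mem a = s.mem a) ∧
      ∀ a < N + 1 + P.k, s'.wmem a = s.wmem a := by
  have hb := h.bounds
  refine Ends.seq (t₁ := 1) (t₂ := P.k * 20 + 1) (Q₁ := fun s' => s' = s.set 35 P.k) (Ends.wp ?_)
    (fun s₁ hu₁ h₁ => ?_) (by omega)
  · simp [wp, h.regs.k]; omega
  subst h₁
  refine Ends.down (fun i s' => i ≤ P.k ∧
      (∀ i', i ≤ i' → i' < P.k → s'.mem (P.R * P.m + P.k + i') = s.mem (P.R * P.m + i') ∧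
        s'.wmem (N + 1 + P.k + i') = s.wmem (N + 1 + i')) ∧
      (∀ a, a < P.R * P.m + P.k ∨ P.base ≤ a → s'.mem a = s.mem a) ∧
      ∀ a < N + 1 + P.k, s'.wmem a = s.wmem a) P.k (by simp) (by omega) (by simp [h.regs.one]) (by rfl)
    (by norm_num) (by rfl) ?_ (T := 17) ?_ ?_ (by omega)
  · exact ⟨le_rfl, fun i' h1 h2 => by omega, fun a _ => rfl, fun a _ => rfl⟩
  · rintro i hi s' h35 hu ⟨-, hI1, hI2, hI3⟩
    have h36 : s'.r 36 = P.R * P.m := by rw [hu.reg 36 rfl]; exact h.r36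
    have h37 : s'.r 37 = P.R * P.m + P.k := by rw [hu.reg 37 rfl]; exact h.r37
    have h38 : s'.r 38 = N + 1 := by rw [hu.reg 38 rfl]; exact h.r38
    have h39 : s'.r 39 = N + 1 + P.k := by rw [hu.reg 39 rfl]; exact h.r39
    have hm := hI2 (P.R * P.m + i) (by omega)
    have := hs i hi
    refine Ends.wp ?_
    simp only [wp, WordOp.eval, State.set_r, State.set_mem, State.set_wmem, State.setMem_r, State.setMem_wmem]
    simp only [Nat.reduceEqDiff, if_false, if_true, h36, h37, h38, h39, hm]
    refine ⟨by omega, by omega, by omega, by omega, by omega, by omega, by omega, by omega, by omega, ?_⟩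
    refine ⟨hi.le, fun i' h1 h2 => ⟨?_, ?_⟩, fun a ha => ?_, fun a ha => ?_⟩
    · simp only [State.setW_mem, State.setMem_mem, State.set_mem]
      split_ifs with e
      · rw [show i' = i by omega]
      · exact (hI1 i' (by omega) h2).1
    · simp only [State.setW_wmem, State.setMem_wmem, State.set_wmem]
      split_ifs with e
      · rw [show i' = i by omega, hI3 _ (by omega)]
      · exact (hI1 i' (by omega) h2).2
    · simp only [State.setW_mem, State.setMem_mem, State.set_mem]
      rw [if_neg (by omega)]
      exact hI2 a ha
    · simp only [State.setW_wmem, State.setMem_wmem, State.set_wmem]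
      rw [if_neg (by omega)]
      exact hI3 a ha
  · rintro s' - - ⟨-, h1, h2, h3⟩
    exact ⟨fun i hi => h1 i (Nat.zero_le _) hi, h2, h3⟩

theorem incr_spec {v : ℕ} (h : QCtx P z NB N s₀ s) (hpos : 0 < N * P.Z) (hv : v < (N * P.Z) ^ P.k)
    (hs : ∀ i < P.k, s.mem (P.R * P.m + i) = dgt (N * P.Z) P.k v i) :
    Ends z ε (P.k * 20 + 10) incr s fun s' =>
      (∀ i < P.k, s'.mem (P.R * P.m + i) = dgt (N * P.Z) P.k (v + 1) i) ∧
      (∀ a, P.R * P.m + P.k ≤ a → s'.mem a = s.mem a) ∧ (s'.r 32 ≠ 0 ↔ v + 1 < (N * P.Z) ^ P.k) := by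
  have hb := h.bounds
  generalize hbe : N * P.Z = b at *
  refine Ends.seq (t₁ := 3) (t₂ := P.k * 20 + 6) (Q₁ := fun s' => s'.r 56 = 1 ∧ s'.r 34 = P.k)
    (Ends.wp ?_) (fun s₁ hu₁ h₁ => ?_) (by omega)
  · simp [wp, h.regs.k]; omega
  have hc₁ := h.of_unch hu₁ (fun a _ => by rw [hu₁.mem rfl]) fun c _ => by rw [hu₁.wmem rfl]
  refine Ends.seq (t₁ := P.k * 20 + 1) (t₂ := 1) (Q₁ := fun s' => s'.r 56 = (if b ^ P.k ∣ v + 1 then 1 else 0) ∧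
      (∀ i < P.k, s'.mem (P.R * P.m + i) = dgt b P.k (v + 1) i) ∧
      (∀ a, P.R * P.m + P.k ≤ a → s'.mem a = s.mem a)) ?_ (fun s₂ hu₂ h₂ => Ends.wp ?_) (by omega)
  · refine Ends.down (fun j s' => j ≤ P.k ∧ s'.r 56 = (if b ^ (P.k - j) ∣ v + 1 then 1 else 0) ∧
      (∀ i < P.k, s'.mem (P.R * P.m + i) = if j ≤ i then dgt b P.k (v + 1) i else dgt b P.k v i) ∧
      (∀ a, P.R * P.m + P.k ≤ a → s'.mem a = s.mem a)) P.k h₁.2 (by omega) hc₁.regs.one (by rfl)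
      (by norm_num) (by rfl) ?_ (T := 17) ?_ ?_ (by omega)
    · refine ⟨le_rfl, by simp [h₁.1], fun i hi => ?_, fun a _ => by rw [hu₁.mem rfl]⟩
      rw [if_neg (by omega), hu₁.mem rfl, hs i hi]
    · rintro j hj s' h34 hu ⟨-, h56, hI1, hI2⟩
      have h36 : s'.r 36 = P.R * P.m := by rw [hu.reg 36 rfl]; exact hc₁.r36
      have h30 : s'.r 30 = b := by rw [hu.reg 30 rfl]; exact hc₁.r30.trans hbe
      have hm := hI1 j hj
      rw [if_neg (by omega)] at hm
      have hd := @dgt_succ b v (P.k - 1 - j) hpos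
      rw [show P.k - (j + 1) = P.k - 1 - j by omega] at h56
      rw [show P.k - 1 - j + 1 = P.k - j by omega] at hd
      rw [← h56] at hd
      change dgt b P.k (v + 1) j = (if dgt b P.k v j + s'.r 56 < b then dgt b P.k v j + s'.r 56 else 0) ∧
        (b ^ (P.k - j) ∣ v + 1 ↔ ¬ dgt b P.k v j + s'.r 56 < b) at hd
      have hle : s'.r 56 ≤ 1 := by rw [h56]; split_ifs <;> simp
      have hdl : dgt b P.k v j < b := dgt_lt hpos
      -- Both branches, with and without a carry, write one digit and set the carry; this treats
      -- them together.
      have key : ∀ x w, w = dgt b P.k (v + 1) j → x = (if b ^ (P.k - j) ∣ v + 1 then 1 else 0) → ∀ M : ℕ → ℕ,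
          M = Function.update s'.mem (P.R * P.m + j) w → j ≤ P.k ∧
          x = (if b ^ (P.k - j) ∣ v + 1 then 1 else 0) ∧
          (∀ i < P.k, M (P.R * P.m + i) = if j ≤ i then dgt b P.k (v + 1) i else dgt b P.k v i) ∧
          (∀ a, P.R * P.m + P.k ≤ a → M a = s.mem a) := by
        rintro x w hw hx M hm'
        refine ⟨hj.le, hx, fun i hi => ?_, fun a ha => ?_⟩
        · rw [hm', Function.update_apply]
          by_cases e : i = j
          · subst e; simp [hw]
          · rw [if_neg (by omega), hI1 i hi]
            by_cases e2 : j ≤ i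
            · rw [if_pos e2, if_pos (by omega)]
            · rw [if_neg e2, if_neg (by omega)]
        · rw [hm', Function.update_of_ne (by omega), hI2 a ha]
      refine Ends.wp ?_
      simp only [wp, WordOp.eval, State.set_r, State.set_mem, State.setMem_r, State.set_set]
      simp only [Nat.reduceEqDiff, if_false, if_true, h36, h30, hm]
      refine ⟨by omega, by omega, by omega, by omega, by split_ifs <;> omega, fun hlt => ?_, fun hlt => ?_⟩
      · have hlt' : dgt b P.k v j + s'.r 56 < b := by by_contra hh; simp [hh] at hlt
        refine ⟨by omega, by omega, key 0 _ ?_ ?_ _ rfl⟩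
        · rw [hd.1, if_pos hlt']
        · rw [if_neg (by rw [hd.2]; simpa using hlt')]
      · have hlt' : ¬ dgt b P.k v j + s'.r 56 < b := by intro hh; simp [hh] at hlt
        refine ⟨by omega, by omega, key (s'.r 56) _ ?_ ?_ _ rfl⟩
        · rw [hd.1, if_neg hlt']
        · rw [if_pos (hd.2.2 hlt')]
          omega
    · rintro s' - - ⟨-, h1, h2, h3⟩
      exact ⟨by simpa using h1, fun i hi => by simpa using h2 i hi, h3⟩
  · have h3 : s₂.r 3 = 1 := by rw [hu₂.reg 3 rfl]; exact hc₁.regs.one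
    simp only [wp, WordOp.eval, State.set_r, State.set_mem]
    simp only [if_true, h3, h₂.1]
    refine ⟨by omega, h₂.2.1, h₂.2.2, ?_⟩
    by_cases e : v + 1 = b ^ P.k
    · simp [e]
    · have : ¬ b ^ P.k ∣ v + 1 := fun hd => by
        have := Nat.le_of_dvd (by omega) hd
        omega
      simp only [this, if_false]
      simp; omega

/-- The outcome of the search among the first `v` tuples. -/
def Best (P : Par) (N : ℕ) (s₀ : State) (v : ℕ) (s : State) : Prop :=
  (s.r 31 = 0 ∧ ∀ v' < v, ¬ P.AllValid s₀ (dgt (N * P.Z) P.k v')) ∨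
  (s.r 31 ≠ 0 ∧ ∃ v' < v, P.AllValid s₀ (dgt (N * P.Z) P.k v') ∧
    (∀ i < P.k, s.mem (P.R * P.m + P.k + i) = dgt (N * P.Z) P.k v' i ∧
      s.wmem (N + 1 + P.k + i) = P.wx s₀ (dgt (N * P.Z) P.k v' i)) ∧
    ∀ v'' < v, P.AllValid s₀ (dgt (N * P.Z) P.k v'') →
      P.wsumOf s₀ (dgt (N * P.Z) P.k v'') ≤ P.wsumOf s₀ (dgt (N * P.Z) P.k v'))

theorem better_spec {v : ℕ} (h : QCtx P z NB N s₀ s) (hpos : 0 < N * P.Z)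
    (hs : ∀ i < P.k, s.mem (P.R * P.m + i) = dgt (N * P.Z) P.k v i)
    (hw : ∀ i < P.k, s.wmem (N + 1 + i) = P.wx s₀ (dgt (N * P.Z) P.k v i))
    (hv : P.AllValid s₀ (dgt (N * P.Z) P.k v)) (hbest : Best P N s₀ v s) :
    Ends z ε (P.k * 21 + 12) better s fun s' => Best P N s₀ (v + 1) s' ∧
      (∀ a, a < P.R * P.m + P.k ∨ P.base ≤ a → s'.mem a = s.mem a) ∧
      ∀ a < N + 1 + P.k, s'.wmem a = s.wmem a := by
  have hb := h.bounds
  have hlt : ∀ v' i, dgt (N * P.Z) P.k v' i < N * P.Z := fun v' i => dgt_lt hpos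
  have hcand : ∑ i ∈ Finset.range P.k, s.wmem (N + 1 + i) = P.wsumOf s₀ (dgt (N * P.Z) P.k v) :=
    Finset.sum_congr rfl fun i hi => hw i (Finset.mem_range.1 hi)
  refine Ends.seq (t₁ := P.k + 2) (t₂ := P.k * 20 + 9) (Q₁ := fun s' =>
    (s'.r 55 ≠ 0 → ∀ v'' < v, P.AllValid s₀ (dgt (N * P.Z) P.k v'') →
      P.wsumOf s₀ (dgt (N * P.Z) P.k v'') ≤ P.wsumOf s₀ (dgt (N * P.Z) P.k v)) ∧
    (s'.r 55 = 0 → Best P N s₀ (v + 1) s')) ?_ (fun s₁ hu₁ h₁ => ?_) (by omega)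
  · refine Ends.branch (t := P.k + 1) (fun h31 => ?_) (fun h31 => ?_) le_rfl
    · rcases hbest with ⟨h0, -⟩ | ⟨-, v', hv', hval, hmem, hmax⟩
      · exact absurd h0 h31
      have hold : ∑ i ∈ Finset.range P.k, s.wmem (N + 1 + P.k + i) = P.wsumOf s₀ (dgt (N * P.Z) P.k v') :=
        Finset.sum_congr rfl fun i hi => (hmem i (Finset.mem_range.1 hi)).2
      have := Ends.wsum (z := z) (ε := ε) (x := 55) (l := 5) (y := 39) (w := 38) (s := s) (Q := fun s' =>
        (s'.r 55 ≠ 0 → ∀ v'' < v, P.AllValid s₀ (dgt (N * P.Z) P.k v'') →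
          P.wsumOf s₀ (dgt (N * P.Z) P.k v'') ≤ P.wsumOf s₀ (dgt (N * P.Z) P.k v)) ∧
        (s'.r 55 = 0 → Best P N s₀ (v + 1) s')) (by rw [h.r39, h.regs.k]; omega)
        (by rw [h.r38, h.regs.k]; omega) (by omega) ?_ ?_
      · rwa [h.regs.k] at this
      · rw [h.r39, h.r38, h.regs.k, hold, hcand]
        exact fun hle => ⟨fun _ v'' h1 h2 => (hmax v'' h1 h2).trans hle, by simp⟩
      · rw [h.r39, h.r38, h.regs.k, hold, hcand]
        refine fun hle => ⟨by simp, fun _ => Or.inr ⟨by simpa using h31, v', by omega, hval, ?_, ?_⟩⟩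
        · simpa using hmem
        · intro v'' h1 h2
          rcases Nat.lt_succ_iff_lt_or_eq.1 h1 with h1 | rfl
          · exact hmax v'' h1 h2
          · exact (not_le.1 hle).le
    · rcases hbest with ⟨-, h0⟩ | ⟨h0, -⟩
      · refine (Ends.wp (t := 1) ?_).mono (by omega) fun _ _ h => h
        simp only [wp]
        exact ⟨by omega, fun _ v'' h1 h2 => absurd h2 (h0 v'' h1), by simp⟩
      · exact absurd h31 h0
  have m₁ : s₁.mem = s.mem := hu₁.mem rfl
  have w₁ : s₁.wmem = s.wmem := hu₁.wmem rfl
  have hc₁ := h.of_unch hu₁ (fun a _ => by rw [m₁]) fun c _ => by rw [w₁]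
  refine Ends.branch (t := P.k * 20 + 8) (fun h55 => ?_) (fun h55 => ?_) (by omega)
  · refine Ends.seq (copyBest_spec hc₁ fun i hi => ?_) (fun s₂ hu₂ h₂ => Ends.wp (t := 1) ?_) (by omega)
    · rw [m₁, hs i hi]
      exact (hlt v i).trans hb.1
    simp only [wp]
    refine ⟨by omega, Or.inr ⟨by simp, v, by omega, hv, fun i hi => ⟨?_, ?_⟩, fun v'' h1 h2 => ?_⟩, fun a ha => ?_,
      fun a ha => ?_⟩
    · rw [State.set_mem, (h₂.1 i hi).1, m₁, hs i hi]
    · rw [State.set_wmem, (h₂.1 i hi).2, w₁, hw i hi]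
    · rcases Nat.lt_succ_iff_lt_or_eq.1 h1 with h1 | rfl
      · exact h₁.1 h55 v'' h1 h2
      · exact le_rfl
    · rw [State.set_mem, h₂.2.1 a ha, m₁]
    · rw [State.set_wmem, h₂.2.2 a ha, w₁]
  · refine (Ends.wp (t := 1) ?_).mono (by omega) fun _ _ h => h
    simp only [wp]
    exact ⟨h₁.2 h55, fun a _ => by rw [m₁], fun a _ => by rw [w₁]⟩

theorem queryBody_spec {v : ℕ} (h : QCtx P z NB N s₀ s) (hpos : 0 < N * P.Z)
    (hv : v < (N * P.Z) ^ P.k) (hs : ∀ i < P.k, s.mem (P.R * P.m + i) = dgt (N * P.Z) P.k v i)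
    (hbest : Best P N s₀ v s) :
    Ends z ε (P.k * (P.k * 103 + 83) + P.k * 41 + 40) queryBody s fun s' =>
      QCtx P z NB N s₀ s' ∧ (∀ i < P.k, s'.mem (P.R * P.m + i) = dgt (N * P.Z) P.k (v + 1) i) ∧
      Best P N s₀ (v + 1) s' ∧ (s'.r 32 ≠ 0 ↔ v + 1 < (N * P.Z) ^ P.k) := by
  have hb := h.bounds
  refine Ends.seq (check_spec h hs fun i _ => dgt_lt hpos) (fun s₁ hu₁ h₁ => ?_)
    (t₂ := P.k * 41 + 29) (by omega)
  have m₁ : s₁.mem = s.mem := hu₁.mem rfl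
  have hc₁ := h.of_unch hu₁ (fun a _ => by rw [m₁]) fun c hc => h₁.2.2 c (by omega)
  have hb₁ : Best P N s₀ v s₁ := by
    rcases hbest with ⟨h0, h1⟩ | ⟨h0, v', h1, h2, h3, h4⟩
    · exact Or.inl ⟨by rw [hu₁.reg 31 rfl, h0], h1⟩
    · exact Or.inr ⟨by rw [hu₁.reg 31 rfl]; exact h0, v', h1, h2, fun i hi => by
        rw [m₁, h₁.2.2 _ (by omega)]; exact h3 i hi, h4⟩
  refine Ends.seq (t₁ := P.k * 21 + 13) (t₂ := P.k * 20 + 14) (Q₁ := fun s' => Best P N s₀ (v + 1) s' ∧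
      (∀ a, a < P.R * P.m + P.k ∨ P.base ≤ a → s'.mem a = s.mem a) ∧
      ∀ a < N + 1, s'.wmem a = s₁.wmem a) ?_ (fun s₂ hu₂ h₂ => ?_) (by omega)
  · refine Ends.branch (fun h33 => ?_) (fun h33 => ?_) le_rfl
    · refine (better_spec hc₁ hpos (fun i hi => by rw [m₁, hs i hi]) h₁.2.1 (h₁.1.1 h33) hb₁).mono le_rfl
        fun s' _ h' => ⟨h'.1, fun a ha => by rw [h'.2.1 a ha, m₁], fun a ha => h'.2.2 a (by omega)⟩
    · refine (Ends.wp (t := 1) ?_).mono (by omega) fun _ _ h => h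
      have hn : ¬ P.AllValid s₀ (dgt (N * P.Z) P.k v) := fun hv => (h₁.1.2 hv) h33
      simp only [wp]
      refine ⟨?_, fun a _ => by rw [m₁], fun _ _ => trivial⟩
      rcases hb₁ with ⟨h0, h1⟩ | ⟨h0, v', h1, h2, h3, h4⟩
      · refine Or.inl ⟨h0, fun v' hv' => ?_⟩
        rcases Nat.lt_succ_iff_lt_or_eq.1 hv' with hv' | rfl
        · exact h1 v' hv'
        · exact hn
      · refine Or.inr ⟨h0, v', by omega, h2, h3, fun v'' hv'' hval => ?_⟩
        rcases Nat.lt_succ_iff_lt_or_eq.1 hv'' with hv'' | rfl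
        · exact h4 v'' hv'' hval
        · exact absurd hval hn
  have hc₂ := hc₁.of_unch hu₂ (fun a ha => by rw [h₂.2.1 a (Or.inr ha), m₁]) fun c hc => h₂.2.2 c (by omega)
  refine (incr_spec hc₂ hpos hv fun i hi => by rw [h₂.2.1 _ (by omega), hs i hi]).mono (by omega)
    fun s₃ hu₃ h₃ => ⟨hc₂.of_unch hu₃ (fun a ha => h₃.2.1 a (by omega)) fun c _ => by rw [hu₃.wmem rfl],
      h₃.1, ?_, h₃.2.2⟩
  rcases h₂.1 with ⟨h0, h1⟩ | ⟨h0, v', h1, h2, h3, h4⟩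
  · exact Or.inl ⟨by rw [hu₃.reg 31 rfl, h0], h1⟩
  · exact Or.inr ⟨by rw [hu₃.reg 31 rfl]; exact h0, v', h1, h2, fun i hi => by
      rw [h₃.2.1 _ (by omega), hu₃.wmem rfl]; exact h3 i hi, h4⟩

theorem emitBest_spec {τ : ℕ → ℕ} (h : QCtx P z NB N s₀ s) (ho : s.out = [])
    (hτ : ∀ i < P.k, s.mem (P.R * P.m + P.k + i) = τ i) (hτb : ∀ i < P.k, τ i < N * P.Z) :
    Ends z ε (P.k * 50 + 3) emitBest s fun s' =>
      ∀ x, x ∈ s'.out ↔ ∃ i < P.k, x = (P.code s₀ (τ i) / P.n, P.code s₀ (τ i) % P.n) := by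
  have hb := h.bounds
  refine Ends.seq (t₁ := 1) (t₂ := P.k * 50 + 1) (Q₁ := fun s' => s' = s.set 34 P.k) (Ends.wp ?_)
    (fun s₁ hu₁ h₁ => ?_) (by omega)
  · simp [wp, h.regs.k]; omega
  subst h₁
  have hc₁ := h.of_unch hu₁ (fun a _ => rfl) fun c _ => rfl
  refine Ends.down (fun i s' => i ≤ P.k ∧
      ∀ x, x ∈ s'.out ↔ ∃ i', i ≤ i' ∧ i' < P.k ∧ x = (P.code s₀ (τ i') / P.n, P.code s₀ (τ i') % P.n))
    P.k (by simp) (by omega) (by simp [h.regs.one]) (by rfl) (by norm_num) (by rfl) ?_ (T := 43) ?_ ?_ (by omega)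
  · refine ⟨le_rfl, fun x => ?_⟩
    simp only [State.set_out, ho, List.not_mem_nil, false_iff]
    rintro ⟨i', h1, h2, -⟩
    omega
  · rintro i hi s' h34 hu ⟨-, hI⟩
    have hc' : QCtx P z NB N s₀ (s'.set 34 i) := (hc₁.of_unch hu (fun a _ => by rw [hu.mem rfl])
      fun c hc => by rw [hu.wmem rfl]).of_eq (fun y hy hy' => by simp [show y ≠ 34 by omega])
      (fun _ _ => rfl) fun _ _ => rfl
    have hsm := (h.small _ (hτb i hi)).2
    refine Ends.seq (t₁ := 3) (t₂ := 37) (Q₁ := fun s'' => s''.r 48 = τ i) (Ends.wp ?_)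
      (fun s₂ hu₂ h₂ => ?_) (by norm_num)
    · simp only [wp, WordOp.eval, State.set_r, State.set_mem]
      simp only [Nat.reduceEqDiff, if_true, if_false, hu.reg 37 rfl, hu.mem rfl, State.set_r, State.set_mem, h.r37,
        hτ i hi]
      have := hτb i hi
      exact ⟨by omega, by omega, by omega, trivial⟩
    have hc₂ := hc'.of_unch hu₂ (fun a _ => by rw [hu₂.mem rfl]) fun c _ => by rw [hu₂.wmem rfl]
    refine Ends.seq (look_spec hc₂ h₂ (hτb i hi) le_rfl) (fun s₃ hu₃ h₃ => Ends.wp (t := 6) ?_) (by norm_num)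
    have h4 : s₃.r 4 = P.n := by rw [hu₃.reg 4 rfl]; exact hc₂.regs.n
    simp only [wp, WordOp.eval, State.set_r]
    simp only [Nat.reduceEqDiff, if_true, if_false, h₃.2.2, h4]
    refine ⟨(Nat.div_le_self _ _).trans_lt hsm, (Nat.mod_le _ _).trans_lt hsm, hi.le, fun x => ?_⟩
    have ho₃ : s₃.out = s'.out := by rw [hu₃.out rfl, hu₂.out rfl]; rfl
    simp only [State.addOut_out, State.set_out, ho₃, List.mem_append, hI, List.mem_singleton]
    constructor
    · rintro (⟨i', h1, h2, h3⟩ | h3)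
      · exact ⟨i', by omega, h2, h3⟩
      · exact ⟨i, le_rfl, hi, h3⟩
    · rintro ⟨i', h1, h2, h3⟩
      rcases h1.lt_or_eq with h1 | rfl
      · exact Or.inl ⟨i', h1, h2, h3⟩
      · exact Or.inr h3
  · rintro s' - - ⟨-, h1⟩ x
    rw [h1 x]
    simp

/-- The outcome of the query. -/
def Answer (P : Par) (N : ℕ) (s₀ s : State) : Prop :=
  (s.out = [] ∧ ∀ τ : ℕ → ℕ, (∀ i < P.k, τ i < N * P.Z) → ¬ P.AllValid s₀ τ) ∨
  ∃ τ : ℕ → ℕ, (∀ i < P.k, τ i < N * P.Z) ∧ P.AllValid s₀ τ ∧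
    (∀ x, x ∈ s.out ↔ ∃ i < P.k, x = (P.code s₀ (τ i) / P.n, P.code s₀ (τ i) % P.n)) ∧
    ∀ τ' : ℕ → ℕ, (∀ i < P.k, τ' i < N * P.Z) → P.AllValid s₀ τ' → P.wsumOf s₀ τ' ≤ P.wsumOf s₀ τ

theorem Par.allValid_congr {P : Par} {s : State} {τ τ' : ℕ → ℕ} (h : ∀ i < P.k, τ i = τ' i)
    (hv : P.AllValid s τ) : P.AllValid s τ' := fun i hi => by
  rw [Par.Valid, ← h i hi]
  exact ⟨(hv i hi).1, fun j hj => by rw [← h j (hj.trans hi)]; exact (hv i hi).2 j hj⟩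

theorem Par.wsumOf_congr {P : Par} {s : State} {τ τ' : ℕ → ℕ} (h : ∀ i < P.k, τ i = τ' i) :
    P.wsumOf s τ = P.wsumOf s τ' :=
  Finset.sum_congr rfl fun i hi => by rw [h i (Finset.mem_range.1 hi)]

/-- The query tries all `(N * Z) ^ k` tuples by brute force. Only its termination is needed, not a
bound for its time. -/
theorem queryCmd_spec (hf : P.Fit z NB) (hN : N ≤ NB) (hR : P.Regs s) (h29 : s.r 29 = N) (ho : s.out = [])
    (hz : ∀ i < P.k, s.mem (P.R * P.m + i) = 0)
    (hsm : ∀ x < N * P.Z, P.cnt s x < z.lim ∧ P.code s x < z.lim) :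
    ∃ t, Ends z ε t queryCmd s (Answer P N s) := by
  have hk := hf.k
  generalize ht : P.k * (P.k * 103 + 83) + P.k * 41 + 40 = T
  refine ⟨15 + ((N * P.Z) ^ P.k * (T + 1) + 1) + (P.k * 50 + 4) + 2, ?_⟩
  have hctx : ∀ s' : State, (∀ y < 29, 3 ≤ y → s'.r y = s.r y) → s'.r 30 = N * P.Z → s'.r 36 = P.R * P.m →
      s'.r 37 = P.R * P.m + P.k → s'.r 38 = N + 1 → s'.r 39 = N + 1 + P.k → s'.mem = s.mem →
      s'.wmem = s.wmem → QCtx P z NB N s s' := fun s' h1 h2 h3 h4 h5 h6 h7 h8 =>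
    ⟨hf, hN, hsm, hR.of_eq h1, h2, h3, h4, h5, h6, fun a _ => by rw [h7], fun c _ => by rw [h8]⟩
  have hb := (hctx { s with r := fun y => if y = 30 then N * P.Z else if y = 36 then P.R * P.m else
    if y = 37 then P.R * P.m + P.k else if y = 38 then N + 1 else if y = 39 then N + 1 + P.k else s.r y }
    (fun y h1 h2 => by
      simp [show y ≠ 30 by omega, show y ≠ 36 by omega, show y ≠ 37 by omega, show y ≠ 38 by omega,
        show y ≠ 39 by omega]) (by simp) (by simp) (by simp) (by simp) (by simp) rfl rfl).bounds
  refine Ends.seq (t₁ := 15) (Q₁ := fun s' => QCtx P z NB N s s' ∧ s'.r 31 = 0 ∧ s'.r 32 = N * P.Z)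
    (Ends.wp ?_) (fun s₁ hu₁ h₁ => ?_) (t₂ := ((N * P.Z) ^ P.k * (T + 1) + 1) + (P.k * 50 + 4) + 1) (by omega)
  · have hR' := hR
    simp only [wp, WordOp.eval, State.set_r]
    simp only [Nat.reduceEqDiff, if_false, if_true, h29, hR.Z, hR.R, hR.m, hR.k, hR.one]
    refine ⟨by omega, by omega, by omega, by omega, by omega, by omega, by omega, ?_, trivial, trivial⟩
    refine hctx _ (fun y h1 h2 => ?_) ?_ ?_ ?_ ?_ ?_ rfl rfl
    · simp [show y ≠ 30 by omega, show y ≠ 36 by omega, show y ≠ 37 by omega, show y ≠ 38 by omega,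
        show y ≠ 39 by omega, show y ≠ 31 by omega, show y ≠ 32 by omega]
    all_goals simp
  obtain ⟨hc₁, h31, h32⟩ := h₁
  refine Ends.seq (Q₁ := fun s' => QCtx P z NB N s s' ∧ s'.out = [] ∧ Best P N s ((N * P.Z) ^ P.k) s')
    (t₁ := (N * P.Z) ^ P.k * (T + 1) + 1) (t₂ := P.k * 50 + 4) ?_ (fun s₂ hu₂ h₂ => ?_) le_rfl
  · refine (Ends.loop (fun j s' => QCtx P z NB N s s' ∧ j ≤ (N * P.Z) ^ P.k ∧
        (∀ i < P.k, s'.mem (P.R * P.m + i) = dgt (N * P.Z) P.k ((N * P.Z) ^ P.k - j) i ∨ j = 0) ∧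
        Best P N s ((N * P.Z) ^ P.k - j) s' ∧ (s'.r 32 ≠ 0 ↔ j ≠ 0)) ((N * P.Z) ^ P.k) (T := T) ?_ ?_ ?_).mono
        le_rfl fun s' hu h' => ⟨h'.1, ?_, ?_⟩
    · refine ⟨hc₁, le_rfl, fun i hi => Or.inl ?_, Or.inl ⟨h31, by simp⟩, ?_⟩
      · rw [hu₁.mem rfl, hz i hi]; simp [dgt]
      -- As `k ≥ 1`, there are no tuples exactly when there are no samplers, so the initial guard is
      -- correct.
      · rw [h32, Ne, Ne, pow_eq_zero_iff (by omega)]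
    · rintro s' ⟨-, -, -, -, h⟩
      simpa using h
    · rintro j hj s' hu ⟨hc, hle, hd, hbest, hr⟩
      have hpos : 0 < N * P.Z := by
        rcases Nat.eq_zero_or_pos (N * P.Z) with e | e
        · rw [e, zero_pow (by omega)] at hj; omega
        · exact e
      refine ⟨hr.2 (by omega), ?_⟩
      refine (queryBody_spec hc hpos (by omega) (fun i hi => (hd i hi).resolve_right (by omega)) hbest).mono
        (by omega) fun s'' _ h'' => ⟨h''.1, by omega, fun i hi => Or.inl ?_, ?_, ?_⟩
      · rw [h''.2.1 i hi]; congr 1; omega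
      · rw [show (N * P.Z) ^ P.k - j = (N * P.Z) ^ P.k - (j + 1) + 1 by omega]; exact h''.2.2.1
      · rw [h''.2.2.2]; omega
    · rw [hu.out rfl, hu₁.out rfl, ho]
    · simpa using h'.2.2.2.1
  · obtain ⟨hc₂, ho₂, hbest⟩ := h₂
    refine Ends.branch (t := P.k * 50 + 3) (fun hr => ?_) (fun hr => ?_) le_rfl
    · rcases hbest with ⟨h0, -⟩ | ⟨-, v, hv, hval, hmem, hmax⟩
      · exact absurd h0 hr
      have hpos : 0 < N * P.Z := by
        rcases Nat.eq_zero_or_pos (N * P.Z) with e | e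
        · rw [e, zero_pow (by omega)] at hv; omega
        · exact e
      refine (emitBest_spec hc₂ ho₂ (fun i hi => (hmem i hi).1) fun i _ => dgt_lt hpos).mono le_rfl
        fun s' _ h' => Or.inr ⟨dgt (N * P.Z) P.k v, fun i _ => dgt_lt hpos, hval, h', fun τ hτ hτv => ?_⟩
      obtain ⟨v', hv', e⟩ := exists_dgt hτ
      rw [← Par.wsumOf_congr e]
      exact hmax v' hv' (Par.allValid_congr (fun i hi => (e i hi).symm) hτv)
    · rcases hbest with ⟨-, h0⟩ | ⟨h0, -⟩
      · refine (Ends.wp (t := 1) ?_).mono (by omega) fun _ _ h => h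
        refine Or.inl ⟨ho₂, fun τ hτ hτv => ?_⟩
        obtain ⟨v', hv', e⟩ := exists_dgt hτ
        exact h0 v' hv' (Par.allValid_congr (fun i hi => (e i hi).symm) hτv)
      · exact absurd hr h0

end


/-! ### Deterministic runs -/

section

variable {z : Size} {ε : ℝ}

theorem steps_halted (t : ℕ) (s : State) : steps z ε t ([], s) = PMF.pure (some ([], s)) := by
  induction t with
  | zero => rfl
  | succ t ih => rw [steps_of_step z ε rfl, ih]

/-- A halted configuration stays as it is, so every larger time limit gives the same result. -/
theorem runWithin_of_steps {Ω : Type} {μ : PMF Ω} {F : Ω → State} {t : ℕ} {p : Cmd} {s : State}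
    (h : steps z ε t ([p], s) = μ.map fun ω => some ([], F ω)) {T : ℕ} (hT : t ≤ T) :
    runWithin z ε T p s = μ.map fun ω => some (F ω) := by
  obtain ⟨d, rfl⟩ := Nat.exists_eq_add_of_le hT
  rw [runWithin, steps_add, h, PMF.bind_map, PMF.map_bind]
  simp only [Function.comp_def, steps_halted, PMF.pure_map]
  rfl

theorem Ends.runWithin {t : ℕ} {p : Cmd} {s : State} {Q : State → Prop} (h : Ends z ε t p s Q) :
    ∃ s', Q s' ∧ ∀ T, t ≤ T → KMatchStream.runWithin z ε T p s = PMF.pure (some s') := by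
  obtain ⟨a, ha, s', h1, -, h3⟩ := h
  refine ⟨s', h1, fun T hT => ?_⟩
  rw [runWithin_of_steps (μ := PMF.pure s') (F := id) (t := a) (by rw [h3 [], PMF.pure_map]; rfl) (ha.trans hT),
    PMF.pure_map]
  rfl

end

/-! ### The uniform distribution on tuples -/

theorem uniformOfFinset_range (D : ℕ) [NeZero D] (h : (Finset.range D).Nonempty) :
    PMF.uniformOfFinset (Finset.range D) h = (PMF.uniformOfFintype (Fin D)).map Fin.val := by
  ext a
  rw [PMF.uniformOfFinset_apply, PMF.map_apply]
  simp only [PMF.uniformOfFintype_apply, Fintype.card_fin, Finset.card_range, Finset.mem_range]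
  split_ifs with ha
  · rw [tsum_eq_single (⟨a, ha⟩ : Fin D)]
    · simp
    · rintro b hb
      rw [if_neg]
      rintro rfl
      exact hb rfl
  · symm
    simp only [ENNReal.tsum_eq_zero]
    intro b
    rw [if_neg]
    rintro rfl
    exact ha b.2

/-- The last coordinate is split off because the table is filled from its highest address downwards.
-/
theorem uniform_snoc (j : ℕ) (α : Type) [Fintype α] [Nonempty α] :
    PMF.uniformOfFintype (Fin (j + 1) → α) = (PMF.uniformOfFintype α).bind fun a =>
      (PMF.uniformOfFintype (Fin j → α)).map fun ω => (Fin.snoc ω a : Fin (j + 1) → α) := by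
  ext f
  rw [PMF.bind_apply, tsum_eq_single (f (Fin.last j)), PMF.map_apply, tsum_eq_single (Fin.init f)]
  · simp only [PMF.uniformOfFintype_apply, Fin.snoc_init_self, if_true, Fintype.card_fun, Fintype.card_fin]
    rw [pow_succ', Nat.cast_mul, ENNReal.mul_inv]
    · exact Or.inr (ENNReal.natCast_ne_top _)
    · exact Or.inl (ENNReal.natCast_ne_top _)
  · rintro ω hω
    rw [if_neg]
    intro e
    exact hω (by rw [e]; simp)
  · rintro a ha
    rw [PMF.map_apply]
    refine mul_eq_zero_of_right _ (ENNReal.tsum_eq_zero.2 fun ω => ?_)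
    rw [if_neg]
    intro e
    exact ha (by rw [e]; simp)

/-! ### The preprocessing routine -/

def fill : Cmd := down 24 (.rand 25 17 ;; .store 24 25)

/-- The only random part of the algorithm. A word costs six steps: loop test, two unfoldings of
`seq`, decrement, random choice and store. The final states are indexed by the table, so that later
a property can be proved for each table separately. -/
theorem fill_spec {z : Size} {ε : ℝ} {D : ℕ} [NeZero D] (hD : D < z.lim) : ∀ (j : ℕ) (s : State),
    s.r 24 = j → s.r 3 = 1 → s.r 17 = D → j < z.lim → j ≤ z.cells →
    ∃ F : (Fin j → Fin D) → State,
      steps z ε (6 * j + 1) ([fill], s) =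
        (PMF.uniformOfFintype (Fin j → Fin D)).map (fun ω => some ([], F ω)) ∧
      ∀ ω, (∀ i : Fin j, (F ω).mem i = ω i) ∧ (∀ a, j ≤ a → (F ω).mem a = s.mem a) ∧
        (∀ x, x ≠ 24 → x ≠ 25 → (F ω).r x = s.r x) ∧ (F ω).wmem = s.wmem ∧ (F ω).out = s.out
  | 0, s, h24, h3, h17, hl, hc => by
    refine ⟨fun _ => s, ?_, fun ω => ⟨fun i => i.elim0, fun _ _ => rfl, fun _ _ _ => rfl, rfl, rfl⟩⟩
    rw [steps_of_step z ε (d := ([], s)) (by simp [fill, down, step, h24])]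
    simp only [steps]
    exact (PMF.map_const _ _).symm
  | j + 1, s, h24, h3, h17, hl, hc => by
    have hn : (Finset.range D).Nonempty := Finset.nonempty_range_iff.2 (NeZero.ne D)
    have ih := fun a : Fin D => fill_spec (ε := ε) hD j (((s.set 24 j).set 25 a).setMem j a) (by simp)
      (by simp [h3]) (by simp [h17]) (by omega) (by omega)
    choose F hF1 hF2 using ih
    refine ⟨fun ω => F (ω (Fin.last j)) (Fin.init ω), ?_, fun ω => ?_⟩
    · have e1 : steps z ε 4 ([fill], s) =
          PMF.pure (some ([.rand 25 17, .store 24 25, fill], s.set 24 j)) := by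
        rw [steps_of_step z ε (d := ([.op .sub 24 24 3 ;; (.rand 25 17 ;; .store 24 25), fill], s))
          (by simp [fill, down, step, h24]), steps_of_step z ε
          (d := ([.op .sub 24 24 3, (.rand 25 17 ;; .store 24 25), fill], s)) rfl,
          steps_of_step z ε (d := ([.rand 25 17 ;; .store 24 25, fill], s.set 24 j)) ?_,
          steps_of_step z ε (d := ([.rand 25 17, .store 24 25, fill], s.set 24 j)) rfl]
        · rfl
        · simp only [step, WordOp.eval, h24, h3, Nat.add_sub_cancel]
          rw [setReg_of_lt (by omega)]
          rfl
      have e2 : ∀ a : Fin D, step z ε ([.store 24 25, fill], (s.set 24 j).set 25 a) =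
          PMF.pure (some ([fill], ((s.set 24 j).set 25 a).setMem j a)) := by
        intro a
        simp only [step, State.set_r]
        simp only [Nat.reduceEqDiff, if_false, if_true, show j < z.cells by omega]
        rfl
      have e3 : step z ε ([.rand 25 17, .store 24 25, fill], s.set 24 j) =
          (PMF.uniformOfFintype (Fin D)).map fun a : Fin D => some ([.store 24 25, fill], (s.set 24 j).set 25 (a : ℕ)) := by
        have h17' : (s.set 24 j).r 17 = D := by simp [h17]
        simp only [step, h17', dif_pos hn, uniformOfFinset_range, PMF.map_comp]
        congr 1
        funext a
        simp only [Function.comp_apply]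
        rw [setReg_of_lt (a.2.trans hD)]
        rfl
      rw [show 6 * (j + 1) + 1 = 4 + (6 * j + 1 + 1 + 1) by ring, steps_add, e1, PMF.pure_bind]
      simp only
      rw [steps, e3, PMF.bind_map, uniform_snoc, PMF.map_bind]
      congr 1
      funext a
      simp only [Function.comp_apply]
      rw [steps_of_step z ε (e2 a), hF1 a, PMF.map_comp]
      congr 1
      funext ω
      simp
    · obtain ⟨h1, h2, h4, h5, h6⟩ := hF2 (ω (Fin.last j)) (Fin.init ω)
      refine ⟨fun i => ?_, fun a ha => ?_, fun x hx hx' => ?_, by rw [h5]; rfl, by rw [h6]; rfl⟩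
      · refine Fin.lastCases ?_ (fun i => ?_) i
        · rw [h2 _ (by simp)]; simp
        · exact h1 i
      · rw [h2 a (by omega)]
        simp [show a ≠ j by omega]
      · rw [h4 x hx hx']
        simp [hx, hx']

/-- Repeated doubling up to `n + k + 2` yields `L` and `2 ^ L`; everything else is arithmetic on
`n`, `k` and these two. -/
def setup : Cmd :=
  (.const 3 1 ;; .move 4 0 ;; .move 5 1 ;; .const 19 2 ;; .op .add 21 4 5 ;; .op .add 21 21 19 ;; .const 6 0 ;;
    .const 22 1 ;; .op .lt 23 22 21) ;;
  .loop 23 (.op .add 22 22 22 ;; .op .add 6 6 3 ;; .op .lt 23 22 21) ;;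
  (.op .add 7 6 6 ;; .op .add 7 7 6 ;; .op .add 7 7 3 ;; .op .add 8 6 6 ;; .op .add 8 8 19 ;;
    .const 18 96 ;; .op .mul 18 18 6 ;; .op .mul 9 18 8) ;;
  (.const 10 8 ;; .op .mul 10 10 5 ;; .op .mul 11 10 10 ;; .op .add 14 6 6 ;; .op .add 14 14 3 ;;
    .op .mul 16 9 11 ;; .op .add 12 14 16 ;; .op .add 12 12 16) ;;
  (.op .mul 24 18 7 ;; .op .add 13 24 5 ;; .op .add 13 13 5 ;;
    .const 17 4 ;; .op .mul 17 10 17 ;; .op .mul 17 17 22 ;; .op .mul 17 17 22)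

theorem setup_spec {z : Size} {ε : ℝ} {n k NB : ℕ} (hf : (Par.mk n k (Nat.clog 2 (n + k + 2))).Fit z NB) :
    ∃ t, Ends z ε t setup (startState n k) fun s' =>
      (Par.mk n k (Nat.clog 2 (n + k + 2))).Regs s' ∧
      s'.r 24 = (Par.mk n k (Nat.clog 2 (n + k + 2))).R * (Par.mk n k (Nat.clog 2 (n + k + 2))).m ∧
      s'.r 29 = 0 := by
  generalize hL : Nat.clog 2 (n + k + 2) = L at *
  generalize hP : Par.mk n k L = P at *
  have en : P.n = n := by rw [← hP]
  have ek : P.k = k := by rw [← hP]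
  have eL : P.L = L := by rw [← hP]
  have hL1 := Par.L_pos hf
  have hB1 := Par.B_pos hf
  have hk := hf.k
  have hBD : P.B ≤ P.D := Par.B_le_D
  have hlim := hf.lim
  have hdot := hf.dot
  have hD1 : 2 * P.D < z.lim := lt_of_le_of_lt (Nat.mul_le_mul_right _ (by omega)) hdot
  have eD : P.D = P.B * 4 * 2 ^ L * 2 ^ L := by rw [← eL]; rfl
  have hpow : 1 ≤ 2 ^ L := Nat.one_le_two_pow
  have hB4 : P.B * 4 * 2 ^ L ≤ P.D := by rw [eD]; exact Nat.le_mul_of_pos_right _ hpow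
  have hB4' : P.B * 4 ≤ P.B * 4 * 2 ^ L := Nat.le_mul_of_pos_right _ hpow
  have h2L : 2 * 2 ^ L ≤ P.D := (Nat.mul_le_mul_right _ (by omega)).trans hB4
  have hnk := hf.n
  rw [en, ek, eL] at hnk
  have hSS : 2 * P.S ≤ (NB + 2) * P.S := Nat.mul_le_mul_right _ (by omega)
  have hS : P.S = P.H + 2 * P.Z := rfl
  have hRT0 : 0 < P.RT := Nat.mul_pos (show 0 < 96 * P.L by omega) (show 0 < 2 * P.L + 2 by omega)
  have hZ : P.Z = P.RT * P.BB := rfl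
  have hBB0 : 0 < P.BB := Nat.mul_pos hB1 hB1
  have hRTZ : P.RT ≤ P.Z := Nat.le_mul_of_pos_right _ hBB0
  have hBBZ : P.BB ≤ P.Z := Nat.le_mul_of_pos_left _ hRT0
  have hBBB : P.B ≤ P.BB := Nat.le_mul_of_pos_left _ hB1
  have hRRT : P.R ≤ P.RT := Nat.le_mul_of_pos_right _ (show 0 < 2 * P.L + 2 by omega)
  have eR : P.R = 96 * L := by rw [← eL]; rfl
  have em : P.m = 3 * L + 1 := by rw [← eL]; rfl
  have elev : P.lev = 2 * L + 2 := by rw [← eL]; rfl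
  have eH : P.H = 2 * L + 1 := by rw [← eL]; rfl
  have eB : P.B = 8 * k := by rw [← ek]; rfl
  have ebase : P.base = P.R * P.m + 2 * k := by rw [← ek]; rfl
  have eRT : P.R * P.lev = P.RT := rfl
  have eBB : P.B * P.B = P.BB := rfl
  refine ⟨19 + ((L * (7 + 1) + 1) + (15 + (15 + 13 + 1) + 1) + 1) + 1, ?_⟩
  refine Ends.seq (t₁ := 19) (Q₁ := fun s' => s'.r 3 = 1 ∧ s'.r 4 = n ∧ s'.r 5 = k ∧ s'.r 19 = 2 ∧
    s'.r 20 = 0 ∧ s'.r 21 = n + k + 2 ∧ s'.r 6 = 0 ∧ s'.r 22 = 1 ∧ s'.r 29 = 0 ∧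
    (s'.r 23 ≠ 0 ↔ 1 < n + k + 2)) (Ends.wp ?_) (fun s₁ _ h₁ => ?_) le_rfl
  · simp only [wp, WordOp.eval, State.set_r, startState]
    simp
    omega
  obtain ⟨h3, h4, h5, h19, h20, h21, h6, h22, h29, h23⟩ := h₁
  refine Ends.seq (t₁ := L * (7 + 1) + 1) (Q₁ := fun s' => s'.r 6 = L ∧ s'.r 22 = 2 ^ L) ?_
    (fun s₂ hu₂ h₂ => ?_) (t₂ := 15 + (15 + 13 + 1) + 1) le_rfl
  · refine (Ends.loop (fun j s' => j ≤ L ∧ s'.r 6 = L - j ∧ s'.r 22 = 2 ^ (L - j) ∧ (s'.r 23 ≠ 0 ↔ j ≠ 0))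
      L ?_ ?_ ?_).mono le_rfl fun s' _ h' => ⟨by simpa using h'.2.1, by simpa using h'.2.2.1⟩
    · refine ⟨le_rfl, by simp [h6], by simp [h22], h23.trans ?_⟩
      omega
    · rintro s' ⟨-, -, -, h⟩
      simpa using h
    · rintro j hj s' hu ⟨h1, h2, h8, h9⟩
      refine ⟨h9.2 (by omega), Ends.wp ?_⟩
      have e3 : s'.r 3 = 1 := by rw [hu.reg 3 rfl, h3]
      have e21 : s'.r 21 = n + k + 2 := by rw [hu.reg 21 rfl, h21]
      have hp : 2 ^ (L - (j + 1)) + 2 ^ (L - (j + 1)) = 2 ^ (L - j) := by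
        rw [show L - j = L - (j + 1) + 1 by omega, pow_succ]; ring
      have hp' : 2 ^ (L - j) ≤ 2 ^ L := Nat.pow_le_pow_right (by norm_num) (by omega)
      -- The doubling stops after exactly `clog` iterations.
      have hlt : 2 ^ (L - j) < n + k + 2 ↔ j ≠ 0 := by
        rw [← Nat.lt_clog_iff_pow_lt (by norm_num), hL]
        omega
      simp only [wp, WordOp.eval, State.set_r]
      simp only [Nat.reduceEqDiff, if_false, if_true, h2, h8, e3, e21, hp]
      refine ⟨by omega, by omega, by split_ifs <;> omega, by omega, by omega, trivial, ?_⟩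
      rw [← hlt]
      split_ifs with h <;> simp [h]
  obtain ⟨g6, g22⟩ := h₂
  refine Ends.seq (t₁ := 15) (Q₁ := fun s' => s'.r 7 = P.m ∧ s'.r 8 = P.lev ∧ s'.r 18 = P.R ∧ s'.r 9 = P.RT)
    (Ends.wp ?_) (fun s₃ hu₃ h₃ => ?_) le_rfl
  · have e3 : s₂.r 3 = 1 := by rw [hu₂.reg 3 rfl, h3]
    have e19 : s₂.r 19 = 2 := by rw [hu₂.reg 19 rfl, h19]
    simp only [wp, WordOp.eval, State.set_r]
    simp only [Nat.reduceEqDiff, if_false, if_true, g6, e3, e19, show L + L + 2 = P.lev by omega, ← eR, eRT,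
      show L + L + L + 1 = P.m by omega]
    refine ⟨by omega, by omega, by omega, by omega, by omega, by omega, by omega, by omega, trivial, trivial,
      trivial, trivial⟩
  have f5 : s₃.r 5 = k := by rw [hu₃.reg 5 rfl, hu₂.reg 5 rfl, h5]
  have f3 : s₃.r 3 = 1 := by rw [hu₃.reg 3 rfl, hu₂.reg 3 rfl, h3]
  have f6 : s₃.r 6 = L := by rw [hu₃.reg 6 rfl, g6]
  refine Ends.seq (t₁ := 15) (Q₁ := fun s' => s'.r 10 = P.B ∧ s'.r 11 = P.BB ∧ s'.r 14 = P.H ∧ s'.r 16 = P.Z ∧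
    s'.r 12 = P.S) (Ends.wp ?_) (fun s₄ hu₄ h₄ => ?_) (t₂ := 13) le_rfl
  · simp only [wp, WordOp.eval, State.set_r]
    simp only [Nat.reduceEqDiff, if_false, if_true, f5, f3, f6, ← eB, eBB, h₃.2.2.2, ← hZ,
      show L + L + 1 = P.H by omega]
    refine ⟨by omega, by omega, by omega, by omega, by omega, by omega, by omega, by omega, trivial, trivial,
      trivial, trivial, by omega⟩
  have d5 : s₄.r 5 = k := by rw [hu₄.reg 5 rfl, f5]
  have d22 : s₄.r 22 = 2 ^ L := by rw [hu₄.reg 22 rfl, hu₃.reg 22 rfl, g22]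
  have d7 : s₄.r 7 = P.m := by rw [hu₄.reg 7 rfl, h₃.1]
  have d18 : s₄.r 18 = P.R := by rw [hu₄.reg 18 rfl, h₃.2.2.1]
  refine (Ends.wp (t := 13) ?_ : Ends z ε 13 _ s₄ fun s' => s'.r 24 = P.R * P.m ∧ s'.r 13 = P.base ∧
    s'.r 17 = P.D).mono le_rfl fun s₅ hu₅ h₅ => ?_
  · simp only [wp, WordOp.eval, State.set_r]
    simp only [Nat.reduceEqDiff, if_false, if_true, d5, d22, d7, d18, h₄.1, ← eD]
    refine ⟨by omega, by omega, by omega, by omega, by omega, by omega, by omega, trivial, by omega, trivial⟩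
  · have hr := fun x h5 h4 h3 => (hu₅.reg x h5).trans ((hu₄.reg x h4).trans (hu₃.reg x h3))
    refine ⟨⟨?_, ?_, ?_, ?_, ?_, ?_, ?_, ?_, ?_, ?_, h₅.2.1, ?_, ?_, h₅.2.2, ?_, ?_, ?_⟩, h₅.1, ?_⟩
    · rw [hr 3 rfl rfl rfl, hu₂.reg 3 rfl, h3]
    · rw [hr 4 rfl rfl rfl, hu₂.reg 4 rfl, h4, en]
    · rw [hr 5 rfl rfl rfl, hu₂.reg 5 rfl, h5, ek]
    · rw [hr 6 rfl rfl rfl, g6, eL]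
    · rw [hu₅.reg 7 rfl, d7]
    · rw [hu₅.reg 8 rfl, hu₄.reg 8 rfl, h₃.2.1]
    · rw [hu₅.reg 9 rfl, hu₄.reg 9 rfl, h₃.2.2.2]
    · rw [hu₅.reg 10 rfl, h₄.1]
    · rw [hu₅.reg 11 rfl, h₄.2.1]
    · rw [hu₅.reg 12 rfl, h₄.2.2.2.2]
    · rw [hu₅.reg 14 rfl, h₄.2.2.1]
    · rw [hu₅.reg 16 rfl, h₄.2.2.2.1]
    · rw [hu₅.reg 18 rfl, d18]
    · rw [hr 19 rfl rfl rfl, hu₂.reg 19 rfl, h19]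
    · rw [hr 20 rfl rfl rfl, hu₂.reg 20 rfl, h20]
    · rw [hr 29 rfl rfl rfl, hu₂.reg 29 rfl, h29]

theorem Skip.empty {key : ℕ → ℝ} (h0 : key 0 = 0) (H : ℕ) : Skip key 0 H (fun _ => ∅) fun _ _ => 0 where
  lev0 c := by simp; omega
  sub _ := subset_rfl
  key0 := h0
  pos c h1 h2 := by omega
  inj := by simp
  next i _ x _ := Or.inl ⟨rfl, by simp⟩
  upper i t := by simp [gap]
  lower := by simp

def preCmd : Cmd := setup ;; fill

/-- The random table of `R * m` words as a function on all numbers. -/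
def table {N D : ℕ} (ω : Fin N → Fin D) (a : ℕ) : ℕ := if h : a < N then ω ⟨a, h⟩ else 0

theorem preCmd_spec {z : Size} {ε : ℝ} {n k NB : ℕ} {P : Par} (hP : P = ⟨n, k, Nat.clog 2 (n + k + 2)⟩)
    [NeZero P.D] (hf : P.Fit z NB) (W : Set ℝ) (wc : ℕ → ℝ) :
    ∃ (t : ℕ) (F : (Fin (P.R * P.m) → Fin P.D) → State), (∀ T, t ≤ T →
      runWithin z ε T preCmd (startState n k) =
        (PMF.uniformOfFintype (Fin (P.R * P.m) → Fin P.D)).map fun ω => some (F ω)) ∧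
      ∀ ω, Inv P ε (table ω) W wc ∅ 0 (F ω) := by
  subst hP
  obtain ⟨t₀, t', -, s₁, ⟨hR, h24, h29⟩, hu, he⟩ := setup_spec (ε := ε) hf
  generalize Par.mk n k (Nat.clog 2 (n + k + 2)) = P at *
  have hlim := hf.lim
  have hcells := hf.cells
  have hbase : P.base = P.R * P.m + 2 * P.k := rfl
  have hdot : 1 * P.D < z.lim := lt_of_le_of_lt (Nat.mul_le_mul_right _ (by omega)) hf.dot
  obtain ⟨F, hF1, hF2⟩ := fill_spec (z := z) (ε := ε) (D := P.D) (by omega) (P.R * P.m) s₁ h24 hR.one hR.D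
    (by omega) (by omega)
  refine ⟨1 + t' + (6 * (P.R * P.m) + 1), F, fun T hT => runWithin_of_steps ?_ hT, fun ω => ?_⟩
  · rw [add_assoc, add_comm, steps_of_step z ε (d := ([setup, fill], startState n k)) rfl, steps_add, he,
      PMF.pure_bind]
    exact hF1
  · obtain ⟨h1, h2, h3, h4, h5⟩ := hF2 ω
    have hmem : ∀ a, P.R * P.m ≤ a → (F ω).mem a = 0 := fun a ha => by
      rw [h2 a ha, hu.mem rfl]; rfl
    have hw : (F ω).wmem = fun _ => 0 := by rw [h4, hu.wmem rfl]; rfl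
    refine ⟨?_, ?_, ?_, fun a ha => ?_, fun a ha _ => hmem a ha, ⟨fun _ => ∅, ?_⟩, ?_,
      ?_, by simp, ?_, fun a ha => hmem a ?_⟩
    · obtain ⟨g1, g2, g3, g4, g5, g6, g7, g8, g9, g10, g11, g12, g13, g14, g15, g16, g17⟩ := hR
      constructor <;> rw [h3 _ (by norm_num) (by norm_num)] <;> assumption
    · rw [h3 29 (by norm_num) (by norm_num), h29]
    · rw [h5, hu.out rfl]; rfl
    · simp only [table, dif_pos ha]
      exact h1 ⟨a, ha⟩
    · have : P.nxt (F ω) = fun _ _ => 0 := by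
        funext i x
        exact hmem _ (by omega)
      rw [this]
      exact Skip.empty (by rw [hw]) _
    · intro c d h1 h2; omega
    · intro c h1 h2; omega
    · intro c h1 h2; omega
    · omega


/-! ### The stream and its codes -/

section

variable {n : ℕ}

/-- The codes `u * n + v` of the edges `uv` with `u < v` of a set. -/
def codes (X : Finset (Sym2 (Fin n))) : Finset ℕ :=
  (Finset.univ.filter fun p : Fin n × Fin n => p.1 < p.2 ∧ s(p.1, p.2) ∈ X).image fun p => p.1 * n + p.2

theorem code_div (u v : Fin n) : (u * n + v : ℕ) / n = u ∧ (u * n + v : ℕ) % n = v := by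
  have hn : 0 < n := u.pos
  constructor
  · rw [mul_comm, Nat.mul_add_div hn, Nat.div_eq_of_lt v.2, add_zero]
  · rw [mul_comm, Nat.mul_add_mod, Nat.mod_eq_of_lt v.2]

theorem mem_codes {X : Finset (Sym2 (Fin n))} {c : ℕ} :
    c ∈ codes X ↔ ∃ u v : Fin n, u < v ∧ s(u, v) ∈ X ∧ u * n + v = c := by
  simp [codes, and_assoc]

theorem codes_lt {X : Finset (Sym2 (Fin n))} {c : ℕ} (h : c ∈ codes X) : c < n * n := by
  obtain ⟨u, v, -, -, rfl⟩ := mem_codes.1 h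
  have := Nat.mul_le_mul_right n (Nat.succ_le_of_lt u.2)
  have := v.2
  rw [Nat.succ_mul] at *
  omega

theorem code_mem_codes {X : Finset (Sym2 (Fin n))} {u v : Fin n} (h : u < v) :
    (u * n + v : ℕ) ∈ codes X ↔ s(u, v) ∈ X := by
  rw [mem_codes]
  constructor
  · rintro ⟨u', v', -, h2, h3⟩
    have h4 := code_div u v
    rw [← h3, (code_div u' v').1, (code_div u' v').2] at h4
    rwa [← Fin.ext h4.1, ← Fin.ext h4.2]
  · exact fun h2 => ⟨u, v, h, h2, rfl⟩

theorem codes_upd (X : Finset (Sym2 (Fin n))) {u v : Fin n} (h : u < v) (ins : Bool) :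
    edgeUpd ins (codes X) (u * n + v) = codes (if ins then insert s(u, v) X else X.erase s(u, v)) := by
  have key : ∀ u' v' : Fin n, u' < v' → (s(u', v') = s(u, v) ↔ (u' * n + v' : ℕ) = u * n + v) := by
    intro u' v' h'
    constructor
    · intro e
      rcases Sym2.eq_iff.1 e with ⟨rfl, rfl⟩ | ⟨rfl, rfl⟩
      · rfl
      · exact absurd h' h.asymm
    · intro e
      have h4 := code_div u v
      rw [← e, (code_div u' v').1, (code_div u' v').2] at h4
      rw [Fin.ext h4.1, Fin.ext h4.2]
  ext c
  by_cases hc : ∃ u' v' : Fin n, u' < v' ∧ (u' * n + v' : ℕ) = c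
  · obtain ⟨u', v', h', rfl⟩ := hc
    rw [code_mem_codes h']
    cases ins
    · simp [edgeUpd, code_mem_codes h', key u' v' h']
    · simp [edgeUpd, code_mem_codes h', key u' v' h']
  · have h1 : ∀ Y : Finset (Sym2 (Fin n)), c ∉ codes Y := fun Y hY => by
      obtain ⟨u', v', g1, -, g2⟩ := mem_codes.1 hY
      exact hc ⟨u', v', g1, g2⟩
    have h2 : c ≠ u * n + v := fun e => hc ⟨u, v, h, e.symm⟩
    cases ins <;> simp [edgeUpd, h1, h2]

/-- The weight of the edge with a given code. -/
noncomputable def codeWt (wt : Sym2 (Fin n) → ℝ) (c : ℕ) : ℝ :=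
  if h : c / n < n ∧ c % n < n then wt s(⟨c / n, h.1⟩, ⟨c % n, h.2⟩) else 0

theorem codeWt_code (wt : Sym2 (Fin n) → ℝ) (u v : Fin n) : codeWt wt (u * n + v) = wt s(u, v) := by
  have := code_div u v
  simp [codeWt, this.1, this.2]

/-- The number and the sequence of the class representatives after a stream. -/
noncomputable def reps (ε : ℝ) (wt : Sym2 (Fin n) → ℝ) (S : List (Update n)) : ℕ × (ℕ → ℝ) :=
  S.foldl (fun K a => grow ε K (wt a.edge)) (0, fun _ => 0)

theorem reps_append (ε : ℝ) (wt : Sym2 (Fin n) → ℝ) (S : List (Update n)) (a : Update n) :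
    reps ε wt (S ++ [a]) = grow ε (reps ε wt S) (wt a.edge) := by
  simp [reps]

theorem edgesAfter_append (S : List (Update n)) (a : Update n) :
    edgesAfter (S ++ [a]) = if a.isInsert then insert a.edge (edgesAfter S) else (edgesAfter S).erase a.edge := by
  simp [edgesAfter]

theorem edgesAfter_subset (S : List (Update n)) : edgesAfter S ⊆ streamEdges S := by
  induction S using List.reverseRecOn with
  | nil => simp [edgesAfter]
  | append_singleton S a ih =>
    have h : streamEdges S ⊆ streamEdges (S ++ [a]) := by
      intro e
      simp only [streamEdges, List.mem_toFinset, List.map_append, List.mem_append]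
      exact Or.inl
    rw [edgesAfter_append]
    split_ifs
    · refine Finset.insert_subset ?_ (ih.trans h)
      simp [streamEdges]
    · exact (Finset.erase_subset _ _).trans (ih.trans h)

theorem exists_of_mem_edgesAfter {S : List (Update n)} {e : Sym2 (Fin n)} (h : e ∈ edgesAfter S) :
    ∃ u v : Fin n, u < v ∧ e = s(u, v) := by
  have := edgesAfter_subset S h
  simp only [streamEdges, List.mem_toFinset, List.mem_map] at this
  obtain ⟨a, -, rfl⟩ := this
  exact ⟨a.u, a.v, a.lt, rfl⟩

end

/-! ### The run of the algorithm -/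

theorem Inv.of_eq {P : Par} {ε : ℝ} {T : ℕ → ℕ} {W : Set ℝ} {wc : ℕ → ℝ} {E : Finset ℕ} {N : ℕ} {s s' : State}
    (h : Inv P ε T W wc E N s) (hr : ∀ y, 3 ≤ y → s'.r y = s.r y) (hm : s'.mem = s.mem)
    (hw : s'.wmem = s.wmem) (ho : s'.out = s.out) : Inv P ε T W wc E N s' := by
  have hn : P.nxt s' = P.nxt s := by funext i x; simp only [Par.nxt, hm]
  obtain ⟨h1, h2, h3, h4, h5, h6, h7, h8, h9, h10, h11⟩ := h
  refine ⟨h1.of_eq fun y _ hy => hr y hy, by rw [hr 29 (by norm_num), h2], by rw [ho, h3], by rwa [hm], by rwa [hm],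
    by rwa [hn, hw], by rwa [hw], by rwa [hw], by rwa [hw], by rwa [hm, hw], by rwa [hm]⟩

section

variable {z : Size} {ε : ℝ} {P : Par} {NB : ℕ} {T : ℕ → ℕ} {n : ℕ} {wt : Sym2 (Fin n) → ℝ}

/-- The algorithm. -/
def algorithm : StreamAlgorithm := ⟨preCmd, updateCmd, queryCmd⟩

/-- Induction along the remaining stream. The whole stream stays fixed, because the bound on the
number of classes and the weight ratio refer to it; the invariant refers to the prefix already
processed. -/
theorem runUpdates_spec {tUpd : ℕ} {S : List (Update n)} (hε : 0 < ε) (hn : P.n = n) (hf : P.Fit z NB)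
    (hB : ClassBound ε (wt '' streamEdges S) NB) (hS : IsDynamicStream S) (hw : ∀ e ∈ streamEdges S, 0 < wt e)
    (ht : P.time ≤ tUpd) (hT : ∀ a < P.R * P.m, T a < P.D) : ∀ (S₂ S₁ : List (Update n)), S = S₁ ++ S₂ →
    ∀ N s, Inv P ε T (wt '' streamEdges S) (codeWt wt) (codes (edgesAfter S₁)) N s →
    Agree (reps ε wt S₁) N s.wmem →
    ∃ N' s', Inv P ε T (wt '' streamEdges S) (codeWt wt) (codes (edgesAfter S)) N' s' ∧
      Agree (reps ε wt S) N' s'.wmem ∧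
      runUpdates algorithm z ε tUpd wt S₂ s = PMF.pure (some s')
  | [], S₁, hSS, N, s, h, hA => ⟨N, s, by simpa [hSS] using h, by simpa [hSS] using hA, rfl⟩
  | a :: S₂, S₁, hSS, N, s, h, hA => by
    have hmem : a.edge ∈ streamEdges S := by simp [streamEdges, hSS]
    have hcode : codeWt wt (a.u * P.n + a.v) = wt a.edge := by rw [hn, codeWt_code]; rfl
    have hI : Inv P ε T (wt '' streamEdges S) (codeWt wt) (codes (edgesAfter S₁)) N (arrive wt a s) := by
      refine h.of_eq (fun y hy => ?_) rfl rfl rfl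
      simp [arrive, show y ≠ 0 by omega, show y ≠ 1 by omega, show y ≠ 2 by omega]
    have hu := updateCmd_spec (u := a.u) (v := a.v) (ins := a.isInsert) hε hf hB hI (by simp [arrive])
      (by simp [arrive]) (by rw [hn]; exact a.u.2) (by rw [hn]; exact a.v.2) (by simp [arrive])
      (by rw [hcode]; rfl) (hw _ hmem) ⟨_, hmem, rfl⟩ (by rw [hn]; exact fun e he => codes_lt he)
      (by rw [hS S₁ S₂ a hSS, hn, code_mem_codes a.lt]; rfl) hT (K := reps ε wt S₁) hA
    obtain ⟨s₁, ⟨N₁, h₁, hA₁⟩, hr⟩ := hu.runWithin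
    rw [hn, codes_upd _ a.lt] at h₁
    change Inv P ε T _ _ (codes (if a.isInsert = true then insert a.edge _ else Finset.erase _ a.edge)) N₁ s₁ at h₁
    rw [← edgesAfter_append] at h₁
    change Agree (grow ε (reps ε wt S₁) (wt a.edge)) N₁ s₁.wmem at hA₁
    rw [← reps_append] at hA₁
    obtain ⟨N', s', h', hA', hr'⟩ := runUpdates_spec hε hn hf hB hS hw ht hT S₂ (S₁ ++ [a]) (by simp [hSS])
      N₁ s₁ h₁ hA₁
    refine ⟨N', s', h', hA', ?_⟩
    rw [runUpdates, show algorithm.update = updateCmd from rfl, hr _ ht, PMF.pure_bind]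
    exact hr'

theorem Inv.query {W : Set ℝ} {wc : ℕ → ℝ} {E : Finset ℕ} {N : ℕ} {s : State} (hf : P.Fit z NB)
    (hB : ClassBound ε W NB) (hE : ∀ e ∈ E, e < P.n * P.n) (h : Inv P ε T W wc E N s) :
    ∃ t, Ends z ε t queryCmd s (Answer P N s) := by
  have hbase : P.base = P.R * P.m + 2 * P.k := rfl
  refine queryCmd_spec hf (h.le hB) h.regs h.cnt h.out (fun i hi => h.scratch _ (by omega) (by omega)) fun x hx => ?_
  have hZ : 0 < P.Z := by
    rcases Nat.eq_zero_or_pos P.Z with e | e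
    · rw [e] at hx; omega
    · exact e
  have hc : x / P.Z < N := Nat.div_lt_of_lt_mul (by rwa [mul_comm])
  obtain ⟨h1, h2⟩ := h.cell (x / P.Z + 1) (Nat.le_add_left 1 _) hc (x % P.Z) (Nat.mod_lt _ hZ)
  have hn4 := hf.n4
  have hsub : recorded P ε T E wc s.wmem N (x / P.Z + 1) (x % P.Z) ⊆ Finset.range (P.n * P.n) := fun e he =>
    Finset.mem_range.2 (hE e (mem_recorded.1 he).1)
  have hcard := Finset.card_le_card hsub
  rw [Finset.card_range] at hcard
  have hsum : ∑ e ∈ recorded P ε T E wc s.wmem N (x / P.Z + 1) (x % P.Z), e ≤ P.n * P.n * (P.n * P.n) := by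
    refine (Finset.sum_le_card_nsmul _ _ (P.n * P.n) fun e he => (Finset.mem_range.1 (hsub he)).le).trans ?_
    rw [smul_eq_mul]
    exact Nat.mul_le_mul_right _ hcard
  simp only [Par.cnt, Par.code, h1, h2]
  constructor <;> nlinarith

/-- A run is a function of the random table. The representatives at the end agree with `reps`, which
does not involve the table; this allows the classes to be fixed before probabilities are computed.
-/
theorem execute_spec {tUpd k : ℕ} {S : List (Update n)} (hP : P = ⟨n, k, Nat.clog 2 (n + k + 2)⟩) [NeZero P.D]
    (hε : 0 < ε) (hf : P.Fit z NB) (hB : ClassBound ε (wt '' streamEdges S) NB) (hS : IsDynamicStream S)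
    (hw : ∀ e ∈ streamEdges S, 0 < wt e) (ht : P.time ≤ tUpd) :
    ∃ (T : ℕ) (F : (Fin (P.R * P.m) → Fin P.D) → State), execute algorithm z ε T tUpd k wt S =
        (PMF.uniformOfFintype (Fin (P.R * P.m) → Fin P.D)).map (fun ω => some (F ω)) ∧
      ∀ ω, ∃ N s₀, Inv P ε (table ω) (wt '' streamEdges S) (codeWt wt) (codes (edgesAfter S)) N s₀ ∧
        Agree (reps ε wt S) N s₀.wmem ∧ Answer P N s₀ (F ω) := by
  have hn : P.n = n := by rw [hP]
  obtain ⟨t₀, F₀, hF₀, hI₀⟩ := preCmd_spec (ε := ε) hP hf (wt '' streamEdges S) (codeWt wt)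
  have h1 : ∀ ω, ∃ N' s', Inv P ε (table ω) (wt '' streamEdges S) (codeWt wt) (codes (edgesAfter S)) N' s' ∧
      Agree (reps ε wt S) N' s'.wmem ∧ runUpdates algorithm z ε tUpd wt S (F₀ ω) = PMF.pure (some s') := fun ω => by
    refine runUpdates_spec hε hn hf hB hS hw ht (fun a ha => ?_) S [] rfl 0 (F₀ ω) ?_ ⟨rfl, fun c c1 c2 => by omega⟩
    · simp only [table, dif_pos ha]
      exact Fin.is_lt _
    · convert hI₀ ω using 1
      ext c
      simp [mem_codes, edgesAfter]
  choose N F₁ hI₁ hA₁ hF₁ using h1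
  have h2 : ∀ ω, ∃ t s', Answer P (N ω) (F₁ ω) s' ∧
      ∀ T, t ≤ T → runWithin z ε T queryCmd (F₁ ω) = PMF.pure (some s') := fun ω => by
    obtain ⟨t, h⟩ := (hI₁ ω).query hf hB (by rw [hn]; exact fun e he => codes_lt he)
    exact ⟨t, h.runWithin⟩
  choose t F hF hq using h2
  -- The time of the query may depend on the table, but there are only finitely many tables.
  refine ⟨max t₀ (Finset.univ.sup t), F, ?_, fun ω => ⟨N ω, F₁ ω, hI₁ ω, hA₁ ω, hF ω⟩⟩
  rw [execute, show algorithm.preprocess = preCmd from rfl, hF₀ _ (le_max_left _ _), PMF.bind_map, PMF.map]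
  congr 1
  funext ω
  simp only [Function.comp_apply, hF₁, PMF.pure_bind]
  exact hq ω _ ((Finset.le_sup (Finset.mem_univ ω)).trans (le_max_right _ _))

end


/-! ### Counting -/

open Classical in
/-- The indicator of a proposition. -/
noncomputable def ind (p : Prop) : ℕ := if p then 1 else 0

theorem ind_of {p : Prop} (h : p) : ind p = 1 := if_pos h
theorem ind_of_not {p : Prop} (h : ¬ p) : ind p = 0 := if_neg h
theorem ind_le_one (p : Prop) : ind p ≤ 1 := by unfold ind; split_ifs <;> simp

theorem ind_mono {p q : Prop} (h : p → q) : ind p ≤ ind q := by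
  by_cases hp : p
  · rw [ind_of hp, ind_of (h hp)]
  · rw [ind_of_not hp]; exact Nat.zero_le _

theorem ind_and (p q : Prop) : ind (p ∧ q) = ind p * ind q := by
  by_cases hp : p <;> by_cases hq : q <;> simp [ind, hp, hq]

/-- The number of outcomes with a property. -/
noncomputable def num {Ω : Type*} [Fintype Ω] (p : Ω → Prop) : ℕ := ∑ ω, ind (p ω)

section

variable {Ω : Type*} [Fintype Ω]

theorem num_mono {p q : Ω → Prop} (h : ∀ ω, p ω → q ω) : num p ≤ num q :=
  Finset.sum_le_sum fun ω _ => ind_mono (h ω)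

theorem num_add_num_not (p : Ω → Prop) : num p + num (fun ω => ¬ p ω) = Fintype.card Ω := by
  rw [num, num, ← Finset.sum_add_distrib, Fintype.card_eq_sum_ones]
  refine Finset.sum_congr rfl fun ω _ => ?_
  by_cases h : p ω <;> simp [ind, h]

/-- The union bound. -/
theorem num_exists_le {ι : Type*} (s : Finset ι) (p : ι → Ω → Prop) :
    num (fun ω => ∃ i ∈ s, p i ω) ≤ ∑ i ∈ s, num (p i) := by
  simp only [num]
  rw [Finset.sum_comm]
  refine Finset.sum_le_sum fun ω _ => ?_
  by_cases h : ∃ i ∈ s, p i ω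
  · obtain ⟨i, hi, hp⟩ := h
    calc ind _ ≤ 1 := ind_le_one _
      _ = ind (p i ω) := (ind_of hp).symm
      _ ≤ _ := Finset.single_le_sum (f := fun i => ind (p i ω)) (fun _ _ => Nat.zero_le _) hi
  · rw [ind_of_not h]; exact Nat.zero_le _

theorem num_equiv {Ω' : Type*} [Fintype Ω'] (e : Ω ≃ Ω') (p : Ω' → Prop) : num (fun ω => p (e ω)) = num p :=
  Equiv.sum_comp e fun ω => ind (p ω)

end

section

variable {ι α : Type*} [Fintype ι] [DecidableEq ι] [Fintype α]

/-- Resampling one coordinate. -/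
theorem sum_sum_update (i : ι) (f : (ι → α) → ℕ) :
    ∑ ρ : ι → α, ∑ a : α, f (Function.update ρ i a) = Fintype.card α * ∑ ρ, f ρ := by
  rw [← Finset.sum_product']
  have : ∑ x ∈ (Finset.univ : Finset (ι → α)) ×ˢ (Finset.univ : Finset α), f (Function.update x.1 i x.2) =
      ∑ x ∈ (Finset.univ : Finset (ι → α)) ×ˢ (Finset.univ : Finset α), f x.1 := by
    -- Exchanging the coordinate `i` with the extra value is an involution on pairs.
    refine Finset.sum_nbij' (fun x => (Function.update x.1 i x.2, x.1 i))
      (fun x => (Function.update x.1 i x.2, x.1 i)) ?_ ?_ ?_ ?_ ?_ <;> simp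
  rw [this, Finset.sum_product]
  simp [Finset.mul_sum]

/-- Resampling the coordinates in `A`. -/
theorem sum_sum_piecewise (A : Finset ι) (f : (ι → α) → ℕ) :
    ∑ ρ : ι → α, ∑ ρ' : ι → α, f (A.piecewise ρ' ρ) = Fintype.card (ι → α) * ∑ ρ, f ρ := by
  rw [← Finset.sum_product']
  have : ∑ x ∈ (Finset.univ : Finset (ι → α)) ×ˢ (Finset.univ : Finset (ι → α)), f (A.piecewise x.2 x.1) =
      ∑ x ∈ (Finset.univ : Finset (ι → α)) ×ˢ (Finset.univ : Finset (ι → α)), f x.1 := by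
    -- Exchanging the coordinates in `A` between the two tuples is an involution on pairs.
    refine Finset.sum_nbij' (fun x => (A.piecewise x.2 x.1, A.piecewise x.1 x.2))
      (fun x => (A.piecewise x.2 x.1, A.piecewise x.1 x.2)) ?_ ?_ ?_ ?_ ?_
    · simp
    · simp
    · rintro ⟨a, b⟩ -
      ext j <;> by_cases hj : j ∈ A <;> simp [hj]
    · rintro ⟨a, b⟩ -
      ext j <;> by_cases hj : j ∈ A <;> simp [hj]
    · simp
  rw [this, Finset.sum_product]
  simp only [Finset.sum_const, Finset.card_univ, smul_eq_mul, Finset.mul_sum]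

end

/-! ### A random process -/

/-- The state after `r` independent random steps. -/
def proc {σ A : Type*} (step : σ → A → σ) (s₀ : σ) : (r : ℕ) → (Fin r → A) → σ
  | 0, _ => s₀
  | r + 1, ω => step (proc step s₀ r (Fin.init ω)) (ω (Fin.last r))

theorem proc_inv {σ A : Type*} {step : σ → A → σ} {s₀ : σ} {I : σ → Prop} (h0 : I s₀)
    (hs : ∀ s a, I s → I (step s a)) : ∀ (r : ℕ) (ω : Fin r → A), I (proc step s₀ r ω)
  | 0, _ => h0
  | r + 1, _ => hs _ _ (proc_inv h0 hs r _)

/-- If every step fails with probability at most `15 / 16`, then `r` steps fail with probability at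
most `(15 / 16) ^ r`. -/
theorem num_proc_le {σ A : Type*} [Fintype A] {step : σ → A → σ} {s₀ : σ} {I U : σ → Prop} (h0 : I s₀)
    (hs : ∀ s a, I s → I (step s a)) (hU : ∀ s a, U (step s a) → U s)
    (hc : ∀ s, I s → 16 * num (fun a => U (step s a)) ≤ 15 * Fintype.card A) (r : ℕ) :
    16 ^ r * num (fun ω : Fin r → A => U (proc step s₀ r ω)) ≤ 15 ^ r * Fintype.card A ^ r := by
  induction r with
  | zero => simpa [num] using ind_le_one _
  | succ r ih =>
    -- Condition on the first `r` steps; the last one is independent of them.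
    have e : num (fun ω : Fin (r + 1) → A => U (proc step s₀ (r + 1) ω)) =
        ∑ ω : Fin r → A, num fun a => U (step (proc step s₀ r ω) a) := by
      rw [← num_equiv (Fin.snocEquiv fun _ => A), num, Fintype.sum_prod_type_right]
      refine Finset.sum_congr rfl fun ω _ => Finset.sum_congr rfl fun a _ => ?_
      simp [proc, Fin.snocEquiv]
    have hle : ∀ ω : Fin r → A, 16 * num (fun a => U (step (proc step s₀ r ω) a)) ≤
        ind (U (proc step s₀ r ω)) * (15 * Fintype.card A) := fun ω => by
      by_cases h : U (proc step s₀ r ω)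
      · rw [ind_of h, one_mul]
        exact hc _ (proc_inv h0 hs r ω)
      · rw [num, Finset.sum_eq_zero fun a _ => ind_of_not fun h' => h (hU _ _ h')]
        exact Nat.zero_le _
    calc 16 ^ (r + 1) * num (fun ω : Fin (r + 1) → A => U (proc step s₀ (r + 1) ω))
        = 16 ^ r * ∑ ω : Fin r → A, 16 * num fun a => U (step (proc step s₀ r ω) a) := by
          rw [e, ← Finset.mul_sum, pow_succ]; ring
      _ ≤ 16 ^ r * ∑ ω : Fin r → A, ind (U (proc step s₀ r ω)) * (15 * Fintype.card A) :=
          Nat.mul_le_mul_left _ (Finset.sum_le_sum fun ω _ => hle ω)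
      _ = (16 ^ r * num (fun ω : Fin r → A => U (proc step s₀ r ω))) * (15 * Fintype.card A) := by
          rw [← Finset.sum_mul, num]; ring
      _ ≤ (15 ^ r * Fintype.card A ^ r) * (15 * Fintype.card A) := Nat.mul_le_mul_right _ ih
      _ = 15 ^ (r + 1) * Fintype.card A ^ (r + 1) := by ring

/-! ### The hash functions -/

/-- Each block of `B` consecutive numbers contains exactly one solution, and `B` divides `D`. The
size `D` of the random words is chosen so that this applies to the number of buckets and to all
powers of two in use. -/
theorem num_mod {D B c d : ℕ} (hB : B ∣ D) (hd : d < B) :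
    num (fun a : Fin D => (c + a) % B = d) * B = D := by
  classical
  have hpos : 0 < B := by omega
  have key : ∀ K, ((Finset.range (B * K)).filter fun a => (c + a) % B = d).card = K := by
    intro K
    induction K with
    | zero => simp
    | succ K ih =>
      have e : Finset.range (B * (K + 1)) = Finset.range (B * K) ∪ Finset.Ico (B * K) (B * K + B) := by
        ext a; simp only [Finset.mem_range, Finset.mem_union, Finset.mem_Ico, Nat.mul_succ]; omega
      rw [e, Finset.filter_union, Finset.card_union_of_disjoint, ih]
      · congr 1
        -- The solution in the block is at the residue of `d - c`; adding `B - c % B` in place of `-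
        -- c` avoids truncated subtraction.
        have h1 : (c + (B * K + (B - c % B + d) % B)) % B = d := by
          have h2 : c + (B - c % B + d) = B * (c / B) + B + d := by
            have := Nat.div_add_mod c B
            have := Nat.mod_lt c hpos
            omega
          rw [← Nat.add_assoc, Nat.add_mod_mod, show c + B * K + (B - c % B + d) = d + B * (c / B + 1 + K) by
            rw [Nat.mul_add, Nat.mul_add]; omega, Nat.add_mul_mod_self_left, Nat.mod_eq_of_lt hd]
        rw [Finset.card_eq_one]
        refine ⟨B * K + (B - c % B + d) % B, ?_⟩
        ext a
        simp only [Finset.mem_filter, Finset.mem_Ico, Finset.mem_singleton]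
        have hlt := Nat.mod_lt (B - c % B + d) hpos
        constructor
        · rintro ⟨⟨h3, h4⟩, h5⟩
          have h6 : c + a ≡ c + (B * K + (B - c % B + d) % B) [MOD B] := h5.trans h1.symm
          have h7 := Nat.ModEq.add_left_cancel' c h6
          obtain ⟨a', rfl⟩ := Nat.exists_eq_add_of_le h3
          have h8 := Nat.ModEq.add_left_cancel' (B * K) h7
          rw [Nat.ModEq, Nat.mod_eq_of_lt (by omega), Nat.mod_mod] at h8
          omega
        · rintro rfl
          exact ⟨⟨by omega, by omega⟩, h1⟩
      · rw [Finset.disjoint_left]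
        intro a h1 h2
        simp only [Finset.mem_filter, Finset.mem_range, Finset.mem_Ico] at h1 h2
        omega
  obtain ⟨K, rfl⟩ := hB
  have : num (fun a : Fin (B * K) => (c + a) % B = d) =
      ((Finset.range (B * K)).filter fun a => (c + a) % B = d).card := by
    rw [num, Fin.sum_univ_eq_sum_range (fun a => ind ((c + a) % B = d)), Finset.card_filter]
    exact Finset.sum_congr rfl fun a _ => by simp [ind]
  rw [this, key, mul_comm]


theorem table_update {N D : ℕ} (ρ : Fin N → Fin D) (i : Fin N) (a : Fin D) :
    table (Function.update ρ i a) = Function.update (table ρ) i a := by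
  funext b
  by_cases hb : b < N
  · by_cases e : b = i
    · subst e; simp [table]
    · have : (⟨b, hb⟩ : Fin N) ≠ i := fun h => e (by rw [← h])
      simp [table, hb, this, e]
  · have : b ≠ i := fun h => hb (h ▸ i.2)
    simp [table, hb, this]

theorem table_update_mk {N D : ℕ} (ρ : Fin N → Fin D) {i : ℕ} (hi : i < N) (a : Fin D) :
    table (Function.update ρ ⟨i, hi⟩ a) = Function.update (table ρ) i a := table_update ρ ⟨i, hi⟩ a

theorem dot_update_of_lt {T : ℕ → ℕ} {b len t : ℕ} (ht : t < len) (a x : ℕ) :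
    dot (Function.update T (b + t) a) b len x =
      dot (Function.update T (b + t) 0) b len x + x / 2 ^ t % 2 * a := by
  simp only [dot]
  have hm : t ∈ Finset.range len := Finset.mem_range.2 ht
  rw [← Finset.add_sum_erase _ _ hm, ← Finset.add_sum_erase _ _ hm]
  simp only [Function.update_self, Nat.mul_zero, Nat.zero_add]
  rw [add_comm]
  congr 1
  refine Finset.sum_congr rfl fun i hi => ?_
  have : b + i ≠ b + t := by have := Finset.ne_of_mem_erase hi; omega
  rw [Function.update_of_ne this, Function.update_of_ne this]

theorem dot_update_of_ge {T : ℕ → ℕ} {b len t : ℕ} (ht : t < b ∨ b + len ≤ t) (a x : ℕ) :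
    dot (Function.update T t a) b len x = dot T b len x :=
  dot_congr (fun i hi => Function.update_of_ne (by omega) _ _) x

theorem exists_bit_ne {x y len : ℕ} (hx : x < 2 ^ len) (hy : y < 2 ^ len) (h : x ≠ y) :
    ∃ t < len, x / 2 ^ t % 2 ≠ y / 2 ^ t % 2 := by
  by_contra! hne
  refine h (Nat.eq_of_testBit_eq fun t => ?_)
  by_cases ht : t < len
  · simp only [Nat.testBit_eq_decide_div_mod_eq, hne t ht]
  · rw [Nat.testBit_lt_two_pow (hx.trans_le (Nat.pow_le_pow_right (by norm_num) (by omega))),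
      Nat.testBit_lt_two_pow (hy.trans_le (Nat.pow_le_pow_right (by norm_num) (by omega)))]

/-- Bounds a probability by conditioning on all coordinates except `i`: if the conditional
probability is at most `1 / M` where `q` holds and zero elsewhere, averaging gives the claim. -/
theorem resample {ι : Type*} [Fintype ι] [DecidableEq ι] {D : ℕ} [NeZero D] (i : ι) {p q : (ι → Fin D) → Prop}
    {M : ℕ} (h : ∀ ρ, num (fun a => p (Function.update ρ i a)) * M ≤ ind (q ρ) * D) :
    num p * M ≤ num q := by
  have h1 := sum_sum_update i fun ρ : ι → Fin D => ind (p ρ)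
  rw [Fintype.card_fin] at h1
  refine Nat.le_of_mul_le_mul_left (c := D) ?_ (NeZero.pos D)
  calc D * (num p * M) = (D * ∑ ρ, ind (p ρ)) * M := by rw [num]; ring
    _ = ∑ ρ : ι → Fin D, num (fun a => p (Function.update ρ i a)) * M := by
        rw [← h1, Finset.sum_mul]; rfl
    _ ≤ ∑ ρ : ι → Fin D, ind (q ρ) * D := Finset.sum_le_sum fun ρ _ => h ρ
    _ = D * num q := by rw [← Finset.sum_mul, num, mul_comm]

theorem num_true (Ω : Type*) [Fintype Ω] : num (fun _ : Ω => True) = Fintype.card Ω := by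
  simp [num, ind]

theorem Par.hv_lt {P : Par} (hB : 0 < P.B) (T : ℕ → ℕ) (r x : ℕ) : P.hv T r x < P.B := Nat.mod_lt _ hB

section

variable {P : Par} [NeZero P.D]

/-- The random words of one repetition. -/
abbrev Par.Row (P : Par) := Fin P.m → Fin P.D

theorem Par.B_dvd_D (P : Par) : P.B ∣ P.D := ⟨4 * 2 ^ P.L * 2 ^ P.L, by simp only [Par.D, Par.B]; ring⟩

theorem Par.pow_dvd_D {P : Par} {j : ℕ} (hj : j < P.lev) : 2 ^ j ∣ P.D := by
  have h : 2 ^ j ∣ 2 ^ (2 * P.L + 2) := pow_dvd_pow 2 (by simp only [Par.lev] at hj; omega)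
  refine h.trans ⟨8 * P.k, ?_⟩
  rw [pow_add, two_mul, pow_add, Par.D]
  ring

/-- Two vertices collide with probability at most `1 / B`. -/
theorem num_hv_eq (hB : 0 < P.B) {x y : ℕ} (hx : x < 2 ^ P.L) (hy : y < 2 ^ P.L) (h : x ≠ y) :
    num (fun ρ : P.Row => P.hv (table ρ) 0 x = P.hv (table ρ) 0 y) * P.B ≤ Fintype.card P.Row := by
  obtain ⟨t, ht, hne⟩ := exists_bit_ne hx hy h
  rw [← num_true]
  have htm : t < P.m := by simp only [Par.m]; omega
  refine resample ⟨t, htm⟩ fun ρ => ?_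
  rw [ind_of trivial, one_mul]
  have hu : ∀ a w, P.hv (table (Function.update ρ ⟨t, htm⟩ a)) 0 w =
      (dot (Function.update (table ρ) t 0) 0 P.L w + w / 2 ^ t % 2 * a) % P.B := fun a w => by
    have := dot_update_of_lt (T := table ρ) (b := 0) ht a w
    rw [zero_add] at this
    rw [Par.hv, zero_mul, table_update_mk, this]
  simp only [hu]
  -- Exactly one of the two vertices has the digit `1` at `t`. With the other words fixed, one hash
  -- value is constant and the other one is shifted by a uniform word.
  have hb : ∀ w, w / 2 ^ t % 2 = 0 ∨ w / 2 ^ t % 2 = 1 := fun w => by omega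
  rcases hb x with e1 | e1 <;> rcases hb y with e2 | e2
  · exact absurd (e1.trans e2.symm) hne
  · simp only [e1, e2, zero_mul, one_mul, add_zero]
    rw [show (fun a : Fin P.D => dot (Function.update (table ρ) t 0) 0 P.L x % P.B =
      (dot (Function.update (table ρ) t 0) 0 P.L y + a) % P.B) = fun a : Fin P.D =>
        (dot (Function.update (table ρ) t 0) 0 P.L y + a) % P.B =
        dot (Function.update (table ρ) t 0) 0 P.L x % P.B from funext fun a => propext eq_comm]
    exact (num_mod P.B_dvd_D (Nat.mod_lt _ hB)).le
  · simp only [e1, e2, zero_mul, one_mul, add_zero]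
    exact (num_mod P.B_dvd_D (Nat.mod_lt _ hB)).le
  · exact absurd (e1.trans e2.symm) hne

/-- An edge survives on level `j` with probability `2 ^ (-j)`. -/
theorem num_gv {j : ℕ} (hj : j < P.lev) (x : ℕ) :
    num (fun ρ : P.Row => P.gv (table ρ) 0 x % 2 ^ j = 0) * 2 ^ j = Fintype.card P.Row := by
  have hm : P.L + (P.L + P.L) < P.m := by simp only [Par.m]; omega
  have hu : ∀ (ρ : P.Row) (a : Fin P.D), P.gv (table (Function.update ρ ⟨P.L + (P.L + P.L), hm⟩ a)) 0 x =
      dot (table ρ) P.L (P.L + P.L) x + a := fun ρ a => by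
    rw [Par.gv, zero_mul, zero_add, table_update_mk, dot_update_of_ge (Or.inr le_rfl), Function.update_self, add_comm]
  have h1 := sum_sum_update (⟨P.L + (P.L + P.L), hm⟩ : Fin P.m) fun ρ : P.Row =>
    ind (P.gv (table ρ) 0 x % 2 ^ j = 0)
  simp only [hu, Fintype.card_fin] at h1
  refine Nat.eq_of_mul_eq_mul_left (NeZero.pos P.D) ?_
  rw [← mul_assoc, num, ← h1, Finset.sum_mul]
  have : ∀ ρ : P.Row, (∑ a : Fin P.D, ind ((dot (table ρ) P.L (P.L + P.L) x + a) % 2 ^ j = 0)) * 2 ^ j = P.D :=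
    fun ρ => num_mod (Par.pow_dvd_D hj) (by positivity)
  simp only [this, Finset.sum_const, Finset.card_univ, smul_eq_mul]
  rw [mul_comm]

/-- Two edges survive on level `j` with probability at most `4 ^ (-j)`. -/
theorem num_gv_pair {j : ℕ} (hj : j < P.lev) {x y : ℕ} (hx : x < 2 ^ (P.L + P.L)) (hy : y < 2 ^ (P.L + P.L))
    (h : x ≠ y) :
    num (fun ρ : P.Row => P.gv (table ρ) 0 x % 2 ^ j = 0 ∧ P.gv (table ρ) 0 y % 2 ^ j = 0) * (2 ^ j * 2 ^ j) ≤
      Fintype.card P.Row := by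
  obtain ⟨t, ht, hne⟩ := exists_bit_ne hx hy h
  -- The value of the edge with the digit `0` does not depend on the word at `t`, whereas that word
  -- makes the other value uniform: this is pairwise independence.
  wlog hb : x / 2 ^ t % 2 = 0 generalizing x y
  · have := this hy hx h.symm hne.symm (by omega)
    simpa only [and_comm] using this
  have hb' : y / 2 ^ t % 2 = 1 := by omega
  rw [← num_gv hj x, ← mul_assoc]
  refine Nat.mul_le_mul_right _ ?_
  have hm : P.L + t < P.m := by simp only [Par.m]; omega
  refine resample ⟨P.L + t, hm⟩ fun ρ => ?_
  have hu : ∀ a w, P.gv (table (Function.update ρ ⟨P.L + t, hm⟩ a)) 0 w =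
      table ρ (P.L + (P.L + P.L)) + dot (Function.update (table ρ) (P.L + t) 0) P.L (P.L + P.L) w +
        w / 2 ^ t % 2 * a := fun a w => by
    rw [Par.gv, zero_mul, zero_add, table_update_mk, dot_update_of_lt ht, Function.update_of_ne (by omega), add_assoc]
  have hx0 : ∀ a, P.gv (table (Function.update ρ ⟨P.L + t, hm⟩ a)) 0 x = P.gv (table ρ) 0 x := fun a => by
    have := (hu a x).trans (by rw [hu (ρ ⟨P.L + t, hm⟩) x, hb, zero_mul, zero_mul] :
      _ = P.gv (table (Function.update ρ ⟨P.L + t, hm⟩ (ρ ⟨P.L + t, hm⟩))) 0 x)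
    rwa [Function.update_eq_self] at this
  simp only [hx0]
  simp only [hu, hb', one_mul]
  rw [num]
  simp only [ind_and]
  rw [← Finset.mul_sum, mul_assoc]
  refine Nat.mul_le_mul_left _ ?_
  exact (num_mod (Par.pow_dvd_D hj) (by positivity)).le

/-- Some level has exactly one survivor with probability at least `1 / 8`. -/
theorem num_unique {X : Finset ℕ} (hX : ∀ e ∈ X, e < 2 ^ (P.L + P.L)) (hne : X.Nonempty) :
    ∃ j < P.lev, Fintype.card P.Row ≤ 8 * num (fun ρ : P.Row =>
      ∃ y, X.filter (fun e => P.gv (table ρ) 0 e % 2 ^ j = 0) = {y}) := by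
  classical
  have hf1 : 1 ≤ X.card := hne.card_pos
  have hf2 : X.card ≤ 2 ^ (P.L + P.L) := by
    have : X ⊆ Finset.range (2 ^ (P.L + P.L)) := fun e he => Finset.mem_range.2 (hX e he)
    simpa using Finset.card_le_card this
  have hc1 := Nat.le_pow_clog (b := 2) (by norm_num) (2 * X.card)
  have hc2 := Nat.pow_pred_clog_lt_self (b := 2) (by norm_num) (x := 2 * X.card) (by omega)
  have hj : Nat.clog 2 (2 * X.card) < P.lev := by
    refine lt_of_le_of_lt (Nat.clog_le_of_le_pow (y := P.L + P.L + 1) ?_) (by simp only [Par.lev]; omega)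
    rw [pow_succ]; omega
  have hj1 : 1 ≤ Nat.clog 2 (2 * X.card) := Nat.clog_pos (by norm_num) (by omega)
  refine ⟨_, hj, ?_⟩
  generalize Nat.clog 2 (2 * X.card) = j at *
  -- With `2 |X| ≤ 2 ^ j < 4 |X|` the expected number of survivors is between `1 / 4` and `1 / 2`.
  have hM : 2 ^ j < 4 * X.card := by
    have : 2 ^ j = 2 ^ (j - 1) * 2 := by rw [← pow_succ]; congr 1; omega
    rw [Nat.pred_eq_sub_one] at hc2
    omega
  -- A second-moment bound: for the set `Y` of survivors, `|Y| ≤ [|Y| = 1] + |Y| (|Y| - 1)`, the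
  -- last term counting ordered pairs.
  have hpt : ∀ ρ : P.Row, ∑ e ∈ X, ind (P.gv (table ρ) 0 e % 2 ^ j = 0) ≤
      ind (∃ y, X.filter (fun e => P.gv (table ρ) 0 e % 2 ^ j = 0) = {y}) +
      ∑ p ∈ X.offDiag, ind (P.gv (table ρ) 0 p.1 % 2 ^ j = 0 ∧ P.gv (table ρ) 0 p.2 % 2 ^ j = 0) := fun ρ => by
    have e1 : ∑ e ∈ X, ind (P.gv (table ρ) 0 e % 2 ^ j = 0) =
        (X.filter fun e => P.gv (table ρ) 0 e % 2 ^ j = 0).card := by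
      rw [Finset.card_filter]; exact Finset.sum_congr rfl fun e _ => by simp [ind]
    have e2 : ∑ p ∈ X.offDiag, ind (P.gv (table ρ) 0 p.1 % 2 ^ j = 0 ∧ P.gv (table ρ) 0 p.2 % 2 ^ j = 0) =
        (X.filter fun e => P.gv (table ρ) 0 e % 2 ^ j = 0).offDiag.card := by
      have : (X.filter fun e => P.gv (table ρ) 0 e % 2 ^ j = 0).offDiag =
          X.offDiag.filter fun p => P.gv (table ρ) 0 p.1 % 2 ^ j = 0 ∧ P.gv (table ρ) 0 p.2 % 2 ^ j = 0 := by
        ext p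
        simp only [Finset.mem_offDiag, Finset.mem_filter]
        tauto
      rw [this, Finset.card_filter]
      exact Finset.sum_congr rfl fun p _ => by simp [ind]
    rw [e1, e2, Finset.offDiag_card]
    generalize hY : X.filter (fun e => P.gv (table ρ) 0 e % 2 ^ j = 0) = Y
    by_cases h1 : Y.card = 1
    · rw [ind_of (Finset.card_eq_one.1 h1)]; omega
    · have : Y.card ≤ Y.card * Y.card - Y.card := by
        rcases Nat.lt_or_ge Y.card 1 with h | h
        · omega
        · have : 2 * Y.card ≤ Y.card * Y.card := Nat.mul_le_mul_right _ (by omega)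
          omega
      omega
  have hsum := Finset.sum_le_sum fun ρ (_ : ρ ∈ (Finset.univ : Finset P.Row)) => hpt ρ
  rw [Finset.sum_add_distrib, Finset.sum_comm, Finset.sum_comm (t := X.offDiag)] at hsum
  change ∑ e ∈ X, num (fun ρ : P.Row => P.gv (table ρ) 0 e % 2 ^ j = 0) ≤
    num (fun ρ : P.Row => ∃ y, X.filter (fun e => P.gv (table ρ) 0 e % 2 ^ j = 0) = {y}) +
    ∑ p ∈ X.offDiag, num (fun ρ : P.Row => P.gv (table ρ) 0 p.1 % 2 ^ j = 0 ∧ P.gv (table ρ) 0 p.2 % 2 ^ j = 0)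
    at hsum
  have s1 : (∑ e ∈ X, num (fun ρ : P.Row => P.gv (table ρ) 0 e % 2 ^ j = 0)) * 2 ^ j =
      X.card * Fintype.card P.Row := by
    rw [Finset.sum_mul, Finset.sum_congr rfl fun e _ => num_gv hj e]
    simp
  have s2 : (∑ p ∈ X.offDiag, num (fun ρ : P.Row => P.gv (table ρ) 0 p.1 % 2 ^ j = 0 ∧
      P.gv (table ρ) 0 p.2 % 2 ^ j = 0)) * (2 ^ j * 2 ^ j) ≤ (X.card * X.card - X.card) * Fintype.card P.Row := by
    rw [Finset.sum_mul, ← Finset.offDiag_card]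
    refine (Finset.sum_le_card_nsmul _ _ (Fintype.card P.Row) fun p hp => ?_).trans (by simp)
    obtain ⟨h1, h2, h3⟩ := Finset.mem_offDiag.1 hp
    exact num_gv_pair hj (hX _ h1) (hX _ h2) h3
  generalize num (fun ρ : P.Row => ∃ y, X.filter (fun e => P.gv (table ρ) 0 e % 2 ^ j = 0) = {y}) = U at *
  generalize (∑ e ∈ X, num (fun ρ : P.Row => P.gv (table ρ) 0 e % 2 ^ j = 0)) = A at *
  generalize (∑ p ∈ X.offDiag, num (fun ρ : P.Row => P.gv (table ρ) 0 p.1 % 2 ^ j = 0 ∧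
      P.gv (table ρ) 0 p.2 % 2 ^ j = 0)) = A' at *
  generalize Fintype.card P.Row = C at *
  generalize 2 ^ j = M at *
  generalize X.card = f at *
  have hMpos : 0 < M := by omega
  refine Nat.le_of_mul_le_mul_right (c := M * M) ?_ (Nat.mul_pos hMpos hMpos)
  -- In terms of probabilities: `U / C ≥ f / M - f (f - 1) / M ^ 2 ≥ f / (2 M) ≥ 1 / 8`.
  have e3 : f * C * M ≤ U * (M * M) + (f * f - f) * C := by
    calc f * C * M = A * (M * M) := by rw [← s1]; ring
      _ ≤ (U + A') * (M * M) := Nat.mul_le_mul_right _ hsum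
      _ = U * (M * M) + A' * (M * M) := by ring
      _ ≤ _ := Nat.add_le_add_left s2 _
  have e4 : 2 * (f * f - f) ≤ f * M := by
    have : f * (2 * f) ≤ f * M := Nat.mul_le_mul_left _ hc1
    have e : f * (2 * f) = 2 * (f * f) := by ring
    omega
  have e5 : 2 * ((f * f - f) * C) ≤ f * M * C := by rw [← mul_assoc]; exact Nat.mul_le_mul_right _ e4
  have e6 : M * M * C ≤ 4 * f * M * C := by
    rw [mul_assoc, mul_assoc (4 * f)]; exact Nat.mul_le_mul_right _ hM.le
  nlinarith

end


/-! ### The exchange argument -/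

/-- The first or the second vertex of the edge with the code `e`. -/
def ep (n : ℕ) (b : Bool) (e : ℕ) : ℕ := if b then e / n else e % n

theorem disj_iff {n e f : ℕ} : disj n e f ↔ ∀ b b', ep n b e ≠ ep n b' f := by
  simp only [disj, ep, Bool.forall_bool, if_true, Bool.false_eq_true, if_false]
  tauto

section

variable (P : Par) (E : Finset ℕ) (cl : ℕ → ℕ)

/-- The present edges that share the class and the bucket of `e`. -/
noncomputable def Par.bucket (T : ℕ → ℕ) (e : ℕ) : Finset ℕ :=
  open Classical in
  E.filter fun f => cl f = cl e ∧ ∀ b, P.hv T 0 (ep P.n b f) = P.hv T 0 (ep P.n b e)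

/-- No vertex of another edge of the matching `τ` collides with a vertex of `τ i`. -/
def Par.Iso (T τ : ℕ → ℕ) (i : ℕ) : Prop :=
  ∀ i' < P.k, i' ≠ i → ∀ b b', P.hv T 0 (ep P.n b (τ i)) ≠ P.hv T 0 (ep P.n b' (τ i'))

/-- The edge `τ i` can be replaced by the edge `y`, the only one of its bucket that survives on some
level. -/
def Par.Repl (T τ : ℕ → ℕ) (i y : ℕ) : Prop :=
  P.Iso T τ i ∧ ∃ j < P.lev, (P.bucket E cl T (τ i)).filter (fun e => P.gv T 0 e % 2 ^ j = 0) = {y}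

/-- Replace all edges that have not been replaced before and can be replaced now. -/
noncomputable def Par.exch (s : (ℕ → ℕ) × Set ℕ) (ρ : P.Row) : (ℕ → ℕ) × Set ℕ :=
  open Classical in
  (fun i => if h : i ∉ s.2 ∧ ∃ y, P.Repl E cl (table ρ) s.1 i y then h.2.choose else s.1 i,
    {i | i ∈ s.2 ∨ ∃ y, P.Repl E cl (table ρ) s.1 i y})

/-- The edges `τ i` are a matching of present edges whose classes are given by `c`. -/
def Par.Good (c : ℕ → ℕ) (τ : ℕ → ℕ) : Prop :=
  (∀ i < P.k, τ i ∈ E ∧ cl (τ i) = c i) ∧ ∀ i < P.k, ∀ i' < P.k, i ≠ i' → disj P.n (τ i) (τ i')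

end

section

variable {P : Par} {E : Finset ℕ} {cl : ℕ → ℕ}

theorem Par.mem_bucket {T : ℕ → ℕ} {e f : ℕ} : f ∈ P.bucket E cl T e ↔
    f ∈ E ∧ cl f = cl e ∧ ∀ b, P.hv T 0 (ep P.n b f) = P.hv T 0 (ep P.n b e) := by
  simp [Par.bucket]

theorem Par.bucket_congr {T : ℕ → ℕ} {e f : ℕ} (h : f ∈ P.bucket E cl T e) :
    P.bucket E cl T f = P.bucket E cl T e := by
  obtain ⟨-, h1, h2⟩ := Par.mem_bucket.1 h
  ext x
  simp only [Par.mem_bucket, h1, h2]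

theorem Par.Repl.mem {T τ : ℕ → ℕ} {i y : ℕ} (h : P.Repl E cl T τ i y) : y ∈ P.bucket E cl T (τ i) := by
  obtain ⟨-, j, -, hj⟩ := h
  have : y ∈ (P.bucket E cl T (τ i)).filter (fun e => P.gv T 0 e % 2 ^ j = 0) := by rw [hj]; simp
  exact (Finset.mem_filter.1 this).1

/-- What an exchange does with a slot. -/
theorem Par.exch_spec (s : (ℕ → ℕ) × Set ℕ) (ρ : P.Row) (i : ℕ) :
    ((P.exch E cl s ρ).1 i = s.1 i ∧ (i ∈ (P.exch E cl s ρ).2 → i ∈ s.2)) ∨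
    (P.Repl E cl (table ρ) s.1 i ((P.exch E cl s ρ).1 i)) := by
  by_cases h : i ∉ s.2 ∧ ∃ y, P.Repl E cl (table ρ) s.1 i y
  · right
    simp only [Par.exch, dif_pos h]
    exact h.2.choose_spec
  · left
    refine ⟨by simp only [Par.exch, dif_neg h], ?_⟩
    rintro (h' | h')
    · exact h'
    · by_contra hn
      exact h ⟨hn, h'⟩

/-- Exchanges never change the buckets of the endpoints. So an exchanged edge, isolated from all
others by its buckets, cannot share a vertex with any of them, even if these are exchanged in the
same repetition. -/
theorem Par.exch_good {c : ℕ → ℕ} {s : (ℕ → ℕ) × Set ℕ} (ρ : P.Row) (h : P.Good E cl c s.1) :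
    P.Good E cl c (P.exch E cl s ρ).1 := by
  have hb : ∀ i b, P.hv (table ρ) 0 (ep P.n b ((P.exch E cl s ρ).1 i)) =
      P.hv (table ρ) 0 (ep P.n b (s.1 i)) := fun i b => by
    rcases Par.exch_spec (E := E) (cl := cl) s ρ i with h' | h'
    · rw [h'.1]
    · exact (Par.mem_bucket.1 h'.mem).2.2 b
  refine ⟨fun i hi => ?_, fun i hi i' hi' hne => ?_⟩
  · rcases Par.exch_spec (E := E) (cl := cl) s ρ i with h' | h'
    · rw [h'.1]; exact h.1 i hi
    · obtain ⟨h1, h2, -⟩ := Par.mem_bucket.1 h'.mem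
      exact ⟨h1, h2.trans (h.1 i hi).2⟩
  · rcases Par.exch_spec (E := E) (cl := cl) s ρ i with h1 | h1
    · rcases Par.exch_spec (E := E) (cl := cl) s ρ i' with h2 | h2
      · rw [h1.1, h2.1]; exact h.2 i hi i' hi' hne
      -- Isolation is used for whichever of the two edges was replaced.
      · rw [disj_iff]
        intro b b' e
        refine h2.1 i hi hne b' b ?_
        rw [← hb i', ← hb i, e]
    · rw [disj_iff]
      intro b b' e
      refine h1.1 i' hi' hne.symm b b' ?_
      rw [← hb i', ← hb i, e]

theorem ep_lt {e : ℕ} (he : e < P.n * P.n) (hn : P.n ≤ 2 ^ P.L) (b : Bool) : ep P.n b e < 2 ^ P.L := by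
  have hpos : 0 < P.n := by
    rcases Nat.eq_zero_or_pos P.n with h | h
    · rw [h] at he; omega
    · exact h
  refine lt_of_lt_of_le ?_ hn
  rw [ep]
  split_ifs
  · exact Nat.div_lt_of_lt_mul he
  · exact Nat.mod_lt _ hpos

/-- The vertex hash uses the first `L` words of a row and the edge hash the others. Resampling the
latter leaves buckets and isolation unchanged, which expresses their independence from the survival
of edges. -/
theorem hv_piecewise (ρ ρ' : P.Row) (x : ℕ) :
    P.hv (table ((Finset.univ.filter fun i : Fin P.m => P.L ≤ i).piecewise ρ' ρ)) 0 x = P.hv (table ρ) 0 x := by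
  rw [Par.hv, Par.hv, dot_congr fun i hi => ?_]
  have : i < P.m := by simp only [Par.m]; omega
  simp [table, this, Finset.piecewise, hi.not_ge]

theorem gv_piecewise (ρ ρ' : P.Row) (x : ℕ) :
    P.gv (table ((Finset.univ.filter fun i : Fin P.m => P.L ≤ i).piecewise ρ' ρ)) 0 x = P.gv (table ρ') 0 x := by
  have h : ∀ a, P.L ≤ a → a < P.m →
      table ((Finset.univ.filter fun i : Fin P.m => P.L ≤ i).piecewise ρ' ρ) a = table ρ' a := fun a h1 h2 => by
    simp [table, h2, Finset.piecewise, h1]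
  rw [Par.gv, Par.gv, h _ (by omega) (by simp only [Par.m]; omega), dot_congr fun i hi => ?_]
  exact h _ (by omega) (by simp only [Par.m]; omega)

/-- Every replaced edge is the only one in its sampler of some repetition. -/
theorem proc_exch {τ₀ : ℕ → ℕ} : ∀ (r : ℕ) (ω : Fin r → P.Row) (i : ℕ), i < P.k →
    i ∈ (proc (P.exch E cl) (τ₀, ∅) r ω).2 → ∃ r' : Fin r, ∃ j < P.lev,
      (P.bucket E cl (table (ω r')) ((proc (P.exch E cl) (τ₀, ∅) r ω).1 i)).filter
        (fun e => P.gv (table (ω r')) 0 e % 2 ^ j = 0) = {(proc (P.exch E cl) (τ₀, ∅) r ω).1 i}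
  | 0, _, i, _, h => absurd h (Set.notMem_empty i)
  | r + 1, ω, i, hi, h => by
    rw [proc] at h ⊢
    rcases Par.exch_spec (E := E) (cl := cl) (proc (P.exch E cl) (τ₀, ∅) r (Fin.init ω)) (ω (Fin.last r)) i with
      h' | h'
    · obtain ⟨r', j, hj, hr⟩ := proc_exch r (Fin.init ω) i hi (h'.2 h)
      refine ⟨r'.castSucc, j, hj, ?_⟩
      rw [h'.1]
      exact hr
    -- The new edge lies in the bucket of the old one, so both have the same bucket.
    · obtain ⟨-, j, hj, hr⟩ := id h'
      exact ⟨Fin.last r, j, hj, by rw [Par.bucket_congr h'.mem]; exact hr⟩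

variable [NeZero P.D]

/-- An edge of a matching is isolated with probability at least `1 / 2`. -/
theorem num_iso {c τ : ℕ → ℕ} {i : ℕ} (hn : P.n ≤ 2 ^ P.L) (hE : ∀ e ∈ E, e < P.n * P.n)
    (h : P.Good E cl c τ) (hi : i < P.k) :
    Fintype.card P.Row ≤ 2 * num fun ρ : P.Row => P.Iso (table ρ) τ i := by
  have hB : 0 < P.B := by simp only [Par.B]; omega
  have h1 := num_add_num_not fun ρ : P.Row => P.Iso (table ρ) τ i
  have h2 : num (fun ρ : P.Row => ¬ P.Iso (table ρ) τ i) ≤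
      ∑ x ∈ ((Finset.range P.k).erase i) ×ˢ (Finset.univ : Finset (Bool × Bool)), num fun ρ : P.Row =>
        P.hv (table ρ) 0 (ep P.n x.2.1 (τ i)) = P.hv (table ρ) 0 (ep P.n x.2.2 (τ x.1)) := by
    refine le_trans (num_mono fun ρ hρ => ?_) (num_exists_le _ _)
    simp only [Par.Iso] at hρ
    push Not at hρ
    obtain ⟨i', h3, h4, b, b', h5⟩ := hρ
    exact ⟨(i', b, b'), by simp [h3, h4], h5⟩
  have h3 : (∑ x ∈ ((Finset.range P.k).erase i) ×ˢ (Finset.univ : Finset (Bool × Bool)), num fun ρ : P.Row =>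
        P.hv (table ρ) 0 (ep P.n x.2.1 (τ i)) = P.hv (table ρ) 0 (ep P.n x.2.2 (τ x.1))) * P.B ≤
      (P.k - 1) * 4 * Fintype.card P.Row := by
    rw [Finset.sum_mul]
    refine (Finset.sum_le_card_nsmul _ _ (Fintype.card P.Row) ?_).trans ?_
    · rintro ⟨i', b, b'⟩ hx
      simp only [Finset.mem_product, Finset.mem_erase, Finset.mem_range, Finset.mem_univ, and_true] at hx
      exact num_hv_eq hB (ep_lt (hE _ (h.1 i hi).1) hn _) (ep_lt (hE _ (h.1 i' hx.2).1) hn _)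
        (disj_iff.1 (h.2 i hi i' hx.2 (Ne.symm hx.1)) b b')
    · rw [Finset.card_product, Finset.card_erase_of_mem (Finset.mem_range.2 hi)]
      simp
  have h4 := (Nat.mul_le_mul_right P.B h2).trans h3
  generalize num (fun ρ : P.Row => ¬ P.Iso (table ρ) τ i) = U at *
  generalize num (fun ρ : P.Row => P.Iso (table ρ) τ i) = V at *
  generalize Fintype.card P.Row = C at *
  simp only [Par.B] at h4
  have h5 : (P.k - 1) * 4 * C ≤ P.k * 4 * C := Nat.mul_le_mul_right _ (by omega)
  -- With `B = 8 k`, a union of `4 (k - 1)` collisions has probability at most `(k - 1) / (2 k) < 1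
  -- / 2`.
  have h6 : 4 * P.k * (2 * U) ≤ 4 * P.k * C := by nlinarith
  have := Nat.le_of_mul_le_mul_left h6 (by omega)
  omega

/-- Isolation has probability at least `1 / 2` and depends on the vertex words only. Given the
buckets, fresh edge words leave a single survivor on a suitable level with probability at least `1 /
8`. The level may depend on the bucket, hence on the vertex words. -/
theorem num_repl {c τ : ℕ → ℕ} {i : ℕ} (hn : P.n ≤ 2 ^ P.L) (hE : ∀ e ∈ E, e < P.n * P.n)
    (h : P.Good E cl c τ) (hi : i < P.k) :
    Fintype.card P.Row ≤ 16 * num fun ρ : P.Row => ∃ y, P.Repl E cl (table ρ) τ i y := by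
  have h1 := num_iso hn hE h hi
  have h2 := sum_sum_piecewise (Finset.univ.filter fun i : Fin P.m => P.L ≤ i)
    fun ρ : P.Row => ind (∃ y, P.Repl E cl (table ρ) τ i y)
  have h3 : ∀ ρ : P.Row, ind (P.Iso (table ρ) τ i) * Fintype.card P.Row ≤ 8 * ∑ ρ' : P.Row,
      ind (∃ y, P.Repl E cl (table ((Finset.univ.filter fun i : Fin P.m => P.L ≤ i).piecewise ρ' ρ)) τ i y) := by
    intro ρ
    by_cases hiso : P.Iso (table ρ) τ i
    · rw [ind_of hiso, one_mul]
      have hX : ∀ e ∈ P.bucket E cl (table ρ) (τ i), e < 2 ^ (P.L + P.L) := fun e he => by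
        refine (hE e (Par.mem_bucket.1 he).1).trans_le ?_
        rw [pow_add]
        exact Nat.mul_le_mul hn hn
      obtain ⟨j, hj, hle⟩ := num_unique hX ⟨τ i, Par.mem_bucket.2 ⟨(h.1 i hi).1, rfl, fun _ => rfl⟩⟩
      refine hle.trans (Nat.mul_le_mul_left _ (num_mono fun ρ' hy => ?_))
      obtain ⟨y, hy⟩ := hy
      refine ⟨y, fun i' h1 h2 b b' => ?_, j, hj, ?_⟩
      · rw [hv_piecewise, hv_piecewise]
        exact hiso i' h1 h2 b b'
      · have hbk : P.bucket E cl (table ((Finset.univ.filter fun i : Fin P.m => P.L ≤ i).piecewise ρ' ρ)) (τ i) =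
            P.bucket E cl (table ρ) (τ i) := by
          ext e
          simp only [Par.mem_bucket, hv_piecewise]
        rw [hbk, ← hy]
        simp only [gv_piecewise]
    · rw [ind_of_not hiso, zero_mul]; exact Nat.zero_le _
  have h4 := Finset.sum_le_sum fun ρ (_ : ρ ∈ (Finset.univ : Finset P.Row)) => h3 ρ
  rw [← Finset.sum_mul, ← Finset.mul_sum, h2] at h4
  change num (fun ρ : P.Row => P.Iso (table ρ) τ i) * Fintype.card P.Row ≤
    8 * (Fintype.card P.Row * num fun ρ : P.Row => ∃ y, P.Repl E cl (table ρ) τ i y) at h4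
  have hC : 0 < Fintype.card P.Row := Fintype.card_pos
  have h5 := Nat.le_of_mul_le_mul_left (c := Fintype.card P.Row)
    (a := num fun ρ : P.Row => P.Iso (table ρ) τ i)
    (b := 8 * num fun ρ : P.Row => ∃ y, P.Repl E cl (table ρ) τ i y) (by linarith) hC
  omega

/-- With high probability there is a matching with the same classes, each of whose edges is the only
one in its sampler of some repetition. -/
theorem num_exch {c τ₀ : ℕ → ℕ} (hn : P.n ≤ 2 ^ P.L) (hE : ∀ e ∈ E, e < P.n * P.n)
    (h : P.Good E cl c τ₀) (R : ℕ) :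
    16 ^ R * num (fun ω : Fin R → P.Row => ¬ ∃ τ, P.Good E cl c τ ∧ ∀ i < P.k, ∃ r : Fin R, ∃ j < P.lev,
      (P.bucket E cl (table (ω r)) (τ i)).filter (fun e => P.gv (table (ω r)) 0 e % 2 ^ j = 0) = {τ i}) ≤
    P.k * (15 ^ R * Fintype.card (Fin R → P.Row)) := by
  have hcard : Fintype.card (Fin R → P.Row) = Fintype.card P.Row ^ R := by simp
  have hinv : ∀ s ρ, P.Good E cl c s.1 → P.Good E cl c (P.exch E cl s ρ).1 := fun s ρ => Par.exch_good ρ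
  have h1 : ∀ i < P.k, 16 ^ R * num (fun ω : Fin R → P.Row => i ∉ (proc (P.exch E cl) (τ₀, ∅) R ω).2) ≤
      15 ^ R * Fintype.card P.Row ^ R := by
    intro i hi
    -- The matching at the beginning of a repetition depends on earlier rows only, so `num_repl`
    -- applies to it whatever it is. Replaced slots are frozen, which makes the event that a slot is
    -- unreplaced decreasing in time.
    refine num_proc_le (step := P.exch E cl) (s₀ := (τ₀, ∅)) (I := fun s => P.Good E cl c s.1)
      (U := fun s => i ∉ s.2) h hinv
      (fun s a hu hs => hu (Or.inl hs)) (fun s hs => ?_) R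
    have h2 := num_repl hn hE hs hi
    have h3 := num_add_num_not fun ρ : P.Row => ∃ y, P.Repl E cl (table ρ) s.1 i y
    have h4 : num (fun ρ : P.Row => i ∉ (P.exch E cl s ρ).2) ≤
        num fun ρ : P.Row => ¬ ∃ y, P.Repl E cl (table ρ) s.1 i y := num_mono fun ρ h' h'' => h' (Or.inr h'')
    omega
  have h2 : num (fun ω : Fin R → P.Row => ¬ ∃ τ, P.Good E cl c τ ∧ ∀ i < P.k, ∃ r : Fin R, ∃ j < P.lev,
      (P.bucket E cl (table (ω r)) (τ i)).filter (fun e => P.gv (table (ω r)) 0 e % 2 ^ j = 0) = {τ i}) ≤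
      ∑ i ∈ Finset.range P.k, num fun ω : Fin R → P.Row => i ∉ (proc (P.exch E cl) (τ₀, ∅) R ω).2 := by
    refine le_trans (num_mono fun ω hω => ?_) (num_exists_le _ _)
    by_contra hne
    push Not at hne
    exact hω ⟨_, proc_inv (step := P.exch E cl) (s₀ := (τ₀, ∅)) (I := fun s => P.Good E cl c s.1) h hinv R ω, fun i hi =>
      proc_exch R ω i hi (hne i (Finset.mem_range.2 hi))⟩
  rw [hcard]
  refine (Nat.mul_le_mul_left _ h2).trans ?_
  rw [Finset.mul_sum]
  refine (Finset.sum_le_card_nsmul _ _ _ fun i hi => h1 i (Finset.mem_range.1 hi)).trans ?_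
  simp

end


/-! ### Matchings and tuples of samplers -/

section

variable {n k : ℕ} {S : List (Update n)} {wt : Sym2 (Fin n) → ℝ}

theorem mem_graphAfter {e : Sym2 (Fin n)} : e ∈ (graphAfter S).edgeSet ↔ e ∈ edgesAfter S := by
  simp only [graphAfter, SimpleGraph.edgeSet_fromEdgeSet, Set.mem_sdiff, Finset.mem_coe]
  constructor
  · exact fun h => h.1
  · intro h
    refine ⟨h, ?_⟩
    obtain ⟨u, v, huv, rfl⟩ := exists_of_mem_edgesAfter h
    simpa using huv.ne

theorem disj_code {u v u' v' : Fin n} : disj n (u * n + v) (u' * n + v') ↔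
    u ≠ u' ∧ u ≠ v' ∧ v ≠ u' ∧ v ≠ v' := by
  simp only [disj, (code_div u v).1, (code_div u v).2, (code_div u' v').1, (code_div u' v').2, ne_eq, Fin.val_inj]

/-- A tuple of codes of pairwise disjoint edges yields a matching. -/
theorem exists_matching {τ : ℕ → ℕ} (h1 : ∀ i < k, τ i ∈ codes (edgesAfter S))
    (h2 : ∀ i < k, ∀ j < k, i ≠ j → disj n (τ i) (τ j)) :
    ∃ M : Finset (Sym2 (Fin n)), IsKMatching (graphAfter S) k M ∧
      weight wt M = ∑ i ∈ Finset.range k, codeWt wt (τ i) ∧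
      ∀ s : State, (∀ x, x ∈ s.out ↔ ∃ i < k, x = (τ i / n, τ i % n)) → Outputs s M := by
  have h3 : ∀ i : Fin k, ∃ u v : Fin n, u < v ∧ s(u, v) ∈ edgesAfter S ∧ u * n + v = τ i := fun i =>
    mem_codes.1 (h1 i i.2)
  choose u v huv hmem hcode using h3
  have hdj : ∀ i j : Fin k, i ≠ j → u i ≠ u j ∧ u i ≠ v j ∧ v i ≠ u j ∧ v i ≠ v j := fun i j hij => by
    rw [← disj_code, hcode, hcode]
    exact h2 i i.2 j j.2 fun e => hij (Fin.ext e)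
  have hinj : Function.Injective fun i : Fin k => s(u i, v i) := fun i j e => by
    by_contra hij
    have := hdj i j hij
    rcases Sym2.eq_iff.1 e with ⟨e1, -⟩ | ⟨e1, -⟩
    · exact this.1 e1
    · exact this.2.1 e1
  refine ⟨Finset.univ.image fun i : Fin k => s(u i, v i), ⟨?_, ?_, ?_⟩, ?_, fun s hs => ?_⟩
  · intro e he
    obtain ⟨i, -, rfl⟩ := Finset.mem_image.1 he
    exact mem_graphAfter.2 (hmem i)
  · intro e he f hf hef x hx hx'
    obtain ⟨i, -, rfl⟩ := Finset.mem_image.1 he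
    obtain ⟨j, -, rfl⟩ := Finset.mem_image.1 hf
    have := hdj i j fun e => hef (by rw [e])
    rw [Sym2.mem_iff] at hx hx'
    rcases hx with rfl | rfl <;> rcases hx' with e | e <;> simp_all
  · rw [Finset.card_image_of_injective _ hinj]; simp
  · rw [weight, Finset.sum_image fun i _ j _ e => hinj e, Finset.sum_range]
    exact Finset.sum_congr rfl fun i _ => by rw [← hcode, codeWt_code]
  · rw [Outputs]
    ext e
    simp only [List.mem_toFinset, List.mem_map, hs, Finset.mem_image, Finset.mem_univ, true_and,
      exists_exists_eq_and]
    have hdm : ∀ i : Fin k, τ i / n = u i ∧ τ i % n = v i := fun i => by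
      rw [← hcode]; exact code_div _ _
    constructor
    · rintro ⟨-, ⟨i, hi, rfl⟩, rfl⟩
      have := hdm ⟨i, hi⟩
      simp only at this
      exact ⟨⟨i, hi⟩, by simp only [this.1, this.2, Sym2.map_mk]⟩
    · rintro ⟨i, rfl⟩
      exact ⟨_, ⟨i, i.2, rfl⟩, by simp only [(hdm i).1, (hdm i).2, Sym2.map_mk]⟩

/-- The edges of a matching as a tuple of codes. -/
theorem exists_tuple {M : Finset (Sym2 (Fin n))} (h : IsKMatching (graphAfter S) k M) :
    ∃ τ : ℕ → ℕ, (∀ i < k, τ i ∈ codes (edgesAfter S)) ∧ (∀ i < k, ∀ j < k, i ≠ j → disj n (τ i) (τ j)) ∧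
      ∑ i ∈ Finset.range k, codeWt wt (τ i) = weight wt M := by
  obtain ⟨h1, h2, h3⟩ := h
  have e : Fin k ≃ M := (finCongr h3.symm).trans M.equivFin.symm
  have h4 : ∀ i : Fin k, ∃ u v : Fin n, u < v ∧ (e i : Sym2 (Fin n)) = s(u, v) := fun i =>
    exists_of_mem_edgesAfter (mem_graphAfter.1 (h1 _ (e i).2))
  choose u v huv he using h4
  refine ⟨fun i => if h : i < k then u ⟨i, h⟩ * n + v ⟨i, h⟩ else 0, fun i hi => ?_, fun i hi j hj hij => ?_, ?_⟩
  · simp only [dif_pos hi]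
    rw [code_mem_codes (huv _), ← he]
    exact mem_graphAfter.1 (h1 _ (e _).2)
  · simp only [dif_pos hi, dif_pos hj]
    rw [disj_code]
    have hne : (e ⟨i, hi⟩ : Sym2 (Fin n)) ≠ e ⟨j, hj⟩ := fun h => hij (by simpa using e.injective (Subtype.ext h))
    have h5 := h2 _ (e ⟨i, hi⟩).2 _ (e ⟨j, hj⟩).2 hne
    simp only [he, Sym2.mem_iff] at h5
    refine ⟨fun h => h5 (u ⟨i, hi⟩) (Or.inl rfl) (Or.inl h), fun h => h5 (u ⟨i, hi⟩) (Or.inl rfl) (Or.inr h),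
      fun h => h5 (v ⟨i, hi⟩) (Or.inr rfl) (Or.inl h), fun h => h5 (v ⟨i, hi⟩) (Or.inr rfl) (Or.inr h)⟩
  · rw [weight, Finset.sum_range, ← Finset.sum_coe_sort M, ← e.sum_comp]
    refine Finset.sum_congr rfl fun i _ => ?_
    simp [codeWt_code, he]

end

section

variable {P : Par} {ε : ℝ} {T : ℕ → ℕ} {W : Set ℝ} {wc : ℕ → ℝ} {E : Finset ℕ} {N : ℕ} {s : State}

theorem Par.Z_pos_of_lt {x N : ℕ} (hx : x < N * P.Z) : 0 < P.Z := by
  rcases Nat.eq_zero_or_pos P.Z with e | e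
  · rw [e] at hx; omega
  · exact e

/-- A sampler with count `1` holds a present edge, and the weight of this edge is near the weight of
the class of the sampler. -/
theorem Inv.sampler (h : Inv P ε T W wc E N s) {x : ℕ} (hx : x < N * P.Z) (h1 : P.cnt s x = 1) :
    P.code s x ∈ E ∧ near ε (P.wx s x) (wc (P.code s x)) ∧
      P.wx s x = s.wmem (KMatchStream.cls ε s.wmem N (wc (P.code s x))) := by
  have hZ := Par.Z_pos_of_lt hx
  have hc : x / P.Z < N := Nat.div_lt_of_lt_mul (by rwa [mul_comm])
  obtain ⟨h2, h3⟩ := h.cell (x / P.Z + 1) (Nat.le_add_left 1 _) hc (x % P.Z) (Nat.mod_lt _ hZ)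
  rw [Par.cnt, h2, Finset.card_eq_one] at h1
  obtain ⟨e, he⟩ := h1
  have hcode : P.code s x = e := by rw [Par.code, h3, he, Finset.sum_singleton]
  obtain ⟨h4, h5, -⟩ := mem_recorded.1 (show e ∈ recorded P ε T E wc s.wmem N (x / P.Z + 1) (x % P.Z) by
    rw [he]; simp)
  rw [hcode]
  have h6 := (cls_spec (h.cls e h4)).2.2
  rw [h5] at h6 ⊢
  exact ⟨h4, h6, rfl⟩

/-- The random words of the repetition `r`. -/
def Par.row (ω : Fin (P.R * P.m) → Fin P.D) (r : Fin P.R) : P.Row := fun i =>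
  ω ⟨r * P.m + i, lt_of_lt_of_le (Nat.add_lt_add_left i.2 _) (Par.row_le r.2)⟩

theorem table_row (ω : Fin (P.R * P.m) → Fin P.D) (r : Fin P.R) {i : ℕ} (hi : i < P.m) :
    table ω (r * P.m + i) = table (P.row ω r) i := by
  have : r * P.m + i < P.R * P.m := lt_of_lt_of_le (Nat.add_lt_add_left hi _) (Par.row_le r.2)
  simp [table, this, hi, Par.row]

theorem dot_shift {T T' : ℕ → ℕ} {b b' len : ℕ} (h : ∀ i < len, T (b + i) = T' (b' + i)) (x : ℕ) :
    dot T b len x = dot T' b' len x :=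
  Finset.sum_congr rfl fun i hi => by rw [h i (Finset.mem_range.1 hi)]

theorem hv_row (ω : Fin (P.R * P.m) → Fin P.D) (r : Fin P.R) (x : ℕ) :
    P.hv (table ω) r x = P.hv (table (P.row ω r)) 0 x := by
  rw [Par.hv, Par.hv, dot_shift fun i hi => ?_]
  rw [zero_mul, zero_add]
  exact table_row ω r (by simp only [Par.m]; omega)

theorem gv_row (ω : Fin (P.R * P.m) → Fin P.D) (r : Fin P.R) (x : ℕ) :
    P.gv (table ω) r x = P.gv (table (P.row ω r)) 0 x := by
  have hm : P.L + (P.L + P.L) < P.m := by simp only [Par.m]; omega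
  have h1 := table_row ω r hm
  rw [Par.gv, Par.gv, add_assoc, h1, zero_mul, zero_add]
  congr 1
  refine dot_shift (fun i hi => ?_) x
  rw [add_assoc]
  exact table_row ω r (by omega)

/-- An edge that is the only one of its bucket on a level of a repetition is held by a sampler. -/
theorem Inv.exists_sampler {ω : Fin (P.R * P.m) → Fin P.D} (h : Inv P ε (table ω) W wc E N s) (hB : 0 < P.B)
    {e : ℕ} {r : Fin P.R} {j : ℕ} (he : e ∈ E) (hj : j < P.lev)
    (hr : (P.bucket E (fun e => KMatchStream.cls ε s.wmem N (wc e)) (table (P.row ω r)) e).filter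
      (fun e => P.gv (table (P.row ω r)) 0 e % 2 ^ j = 0) = {e}) :
    ∃ x < N * P.Z, P.cnt s x = 1 ∧ P.code s x = e := by
  obtain ⟨c1, c2, -⟩ := cls_spec (h.cls e he)
  generalize hc : KMatchStream.cls ε s.wmem N (wc e) = c at *
  have h1 := Par.hv_lt hB (table ω) r (e / P.n)
  have h2 := Par.hv_lt hB (table ω) r (e % P.n)
  have hpair : P.hv (table ω) r (e / P.n) * P.B + P.hv (table ω) r (e % P.n) < P.BB := by
    calc _ < P.hv (table ω) r (e / P.n) * P.B + P.B := by omega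
      _ = (P.hv (table ω) r (e / P.n) + 1) * P.B := by ring
      _ ≤ P.BB := Nat.mul_le_mul_right _ h1
  generalize hb : P.hv (table ω) r (e / P.n) * P.B + P.hv (table ω) r (e % P.n) = b at *
  have hBB : 0 < P.BB := by omega
  have hlev : 0 < P.lev := by omega
  have hg : r * P.lev + j < P.RT := by
    calc r * P.lev + j < r * P.lev + P.lev := by omega
      _ = (r + 1) * P.lev := by ring
      _ ≤ P.RT := Nat.mul_le_mul_right _ r.2
  have hq : (r * P.lev + j) * P.BB + b < P.Z := by
    calc _ < (r * P.lev + j) * P.BB + P.BB := by omega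
      _ = (r * P.lev + j + 1) * P.BB := by ring
      _ ≤ P.Z := Nat.mul_le_mul_right _ hg
  have hdiv : ∀ {a b c : ℕ}, b < c → (a * c + b) / c = a ∧ (a * c + b) % c = b := fun {a b c} h => by
    rw [mul_comm, Nat.mul_add_div (by omega), Nat.div_eq_of_lt h, Nat.mul_add_mod, Nat.mod_eq_of_lt h]
    exact ⟨rfl, rfl⟩
  have hrec : recorded P ε (table ω) E wc s.wmem N c ((r * P.lev + j) * P.BB + b) = {e} := by
    rw [← hr]
    ext f
    simp only [mem_recorded, Finset.mem_filter, Par.mem_bucket, hc, Par.hit, (hdiv hpair).1, (hdiv hpair).2,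
      (hdiv hj).1, (hdiv hj).2, gv_row, ep, Bool.forall_bool, if_true, Bool.false_eq_true, if_false, ← hv_row]
    have h3 := Par.hv_lt hB (table ω) r (f / P.n)
    have h4 := Par.hv_lt hB (table ω) r (f % P.n)
    -- Division with remainder by `B` recovers both bucket numbers from the number of the pair.
    have : b = P.hv (table ω) r (f / P.n) * P.B + P.hv (table ω) r (f % P.n) ↔
        P.hv (table ω) r (f % P.n) = P.hv (table ω) r (e % P.n) ∧
        P.hv (table ω) r (f / P.n) = P.hv (table ω) r (e / P.n) := by
      constructor
      · intro e'
        have e1 := hdiv (a := P.hv (table ω) r (e / P.n)) h2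
        have e2 := hdiv (a := P.hv (table ω) r (f / P.n)) h4
        rw [hb] at e1
        rw [← e'] at e2
        omega
      · rintro ⟨e1, e2⟩
        rw [e1, e2, hb]
    rw [this]
    tauto
  have hcell := h.cell c c1 c2 _ hq
  rw [hrec, Finset.card_singleton, Finset.sum_singleton] at hcell
  -- Classes start at `1`, numbers of samplers at `0`.
  refine ⟨(c - 1) * P.Z + ((r * P.lev + j) * P.BB + b), ?_, ?_⟩
  · calc _ < (c - 1) * P.Z + P.Z := by omega
      _ = (c - 1 + 1) * P.Z := by ring
      _ ≤ N * P.Z := Nat.mul_le_mul_right _ (by omega)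
  · rw [Par.cnt, Par.code, (hdiv hq).1, (hdiv hq).2, Nat.sub_add_cancel c1]
    exact hcell

theorem Par.AllValid.disj {σ : ℕ → ℕ} (h : P.AllValid s σ) {i j : ℕ} (hi : i < P.k) (hj : j < P.k) (hij : i ≠ j) :
    disj P.n (P.code s (σ i)) (P.code s (σ j)) := by
  rcases lt_or_gt_of_ne hij with h' | h'
  · obtain ⟨h1, h2, h3, h4⟩ := (h j hj).2 i h'
    exact ⟨h1.symm, h3.symm, h2.symm, h4.symm⟩
  · exact (h i hi).2 j h'

/-- If the random table is good for the matching `τ₀`, then the answer is a matching of nearly the same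
weight. -/
theorem Answer.quality {ω : Fin (P.R * P.m) → Fin P.D} {s' : State} {τ₀ : ℕ → ℕ} (hε : 0 < ε) (hε1 : ε < 1)
    (hk : 1 ≤ P.k) (hpos : ∀ e ∈ E, 0 < wc e)
    (h : Inv P ε (table ω) W wc E N s) (ha : Answer P N s s') (hτ₀ : ∀ i < P.k, τ₀ i ∈ E)
    (hg : ∃ τ, P.Good E (fun e => KMatchStream.cls ε s.wmem N (wc e))
        (fun i => KMatchStream.cls ε s.wmem N (wc (τ₀ i))) τ ∧
      ∀ i < P.k, ∃ r : Fin P.R, ∃ j < P.lev,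
        (P.bucket E (fun e => KMatchStream.cls ε s.wmem N (wc e)) (table (P.row ω r)) (τ i)).filter
          (fun e => P.gv (table (P.row ω r)) 0 e % 2 ^ j = 0) = {τ i}) :
    ∃ τ : ℕ → ℕ, (∀ i < P.k, τ i ∈ E) ∧ (∀ i < P.k, ∀ j < P.k, i ≠ j → disj P.n (τ i) (τ j)) ∧
      (∀ x, x ∈ s'.out ↔ ∃ i < P.k, x = (τ i / P.n, τ i % P.n)) ∧
      (1 - ε) * ∑ i ∈ Finset.range P.k, wc (τ₀ i) < ∑ i ∈ Finset.range P.k, wc (τ i) := by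
  have hB : 0 < P.B := by simp only [Par.B]; omega
  obtain ⟨τ, ⟨hg1, hg2⟩, hg3⟩ := hg
  have h1 : ∀ i : ℕ, ∃ x, i < P.k → x < N * P.Z ∧ P.cnt s x = 1 ∧ P.code s x = τ i := fun i => by
    by_cases hi : i < P.k
    · obtain ⟨r, j, hj, hr⟩ := hg3 i hi
      obtain ⟨x, hx⟩ := h.exists_sampler hB (hg1 i hi).1 hj hr
      exact ⟨x, fun _ => hx⟩
    · exact ⟨0, fun h => absurd h hi⟩
  choose σ hσ using h1
  have hval : P.AllValid s σ := fun i hi => ⟨(hσ i hi).2.1, fun j hj => by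
    rw [(hσ i hi).2.2, (hσ j (hj.trans hi)).2.2]
    exact hg2 i hi j (hj.trans hi) (by omega)⟩
  rcases ha with ⟨-, ha⟩ | ⟨σ', hσ', hval', hout, hmax⟩
  · exact absurd hval (ha σ fun i hi => (hσ i hi).1)
  refine ⟨fun i => P.code s (σ' i), fun i hi => (h.sampler (hσ' i hi) (hval' i hi).1).1,
    fun i hi j hj hij => hval'.disj hi hj hij, hout, ?_⟩
  have hle := hmax σ (fun i hi => (hσ i hi).1) hval
  -- The exchanged matching has the classes of `τ₀`, so its rounded weight is compared directly with
  -- the true weight of `τ₀`; the true weights of the exchanged edges play no role.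
  have e1 : 2 * ∑ i ∈ Finset.range P.k, wc (τ₀ i) ≤ (2 + ε) * P.wsumOf s σ := by
    rw [Par.wsumOf, Finset.mul_sum, Finset.mul_sum]
    refine Finset.sum_le_sum fun i hi => ?_
    have hi' := Finset.mem_range.1 hi
    have h2 := (h.sampler (hσ i hi').1 (hσ i hi').2.1).2.2
    have h3 := (hg1 i hi').2
    simp only at h3
    rw [(hσ i hi').2.2, h3] at h2
    rw [h2]
    exact (cls_spec (h.cls _ (hτ₀ i hi'))).2.2.2
  have e2 : 2 * P.wsumOf s σ' ≤ (2 + ε) * ∑ i ∈ Finset.range P.k, wc (P.code s (σ' i)) := by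
    rw [Par.wsumOf, Finset.mul_sum, Finset.mul_sum]
    refine Finset.sum_le_sum fun i hi => ?_
    have hi' := Finset.mem_range.1 hi
    exact (h.sampler (hσ' i hi') (hval' i hi').1).2.1.1
  have e3 : 0 < ∑ i ∈ Finset.range P.k, wc (P.code s (σ' i)) := by
    refine Finset.sum_pos (fun i hi => hpos _ ?_) ⟨0, Finset.mem_range.2 hk⟩
    have hi' := Finset.mem_range.1 hi
    exact (h.sampler (hσ' i hi') (hval' i hi').1).1
  generalize ∑ i ∈ Finset.range P.k, wc (P.code s (σ' i)) = w' at *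
  generalize ∑ i ∈ Finset.range P.k, wc (τ₀ i) = w at *
  have e4 : 4 * w ≤ (2 + ε) ^ 2 * w' := by nlinarith
  have e5 : (1 - ε) * (4 * w) ≤ (1 - ε) * ((2 + ε) ^ 2 * w') := mul_le_mul_of_nonneg_left e4 (by linarith)
  -- Indeed `(1 - ε) (2 + ε) ^ 2 = 4 - 3 ε ^ 2 - ε ^ 3`.
  have e6 : (1 - ε) * (2 + ε) ^ 2 < 4 := by nlinarith [pow_pos hε 2, pow_pos hε 3]
  nlinarith

end


/-! ### The probability of success -/

/-- A uniform table is the same as `R` independent uniform rows. -/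
theorem row_bijective (P : Par) : Function.Bijective (P.row : (Fin (P.R * P.m) → Fin P.D) → Fin P.R → P.Row) := by
  rw [Fintype.bijective_iff_injective_and_card]
  constructor
  · intro ω ω' h
    ext ⟨a, ha⟩
    have hm : 0 < P.m := by simp only [Par.m]; omega
    have h1 : a / P.m < P.R := Nat.div_lt_of_lt_mul (by rwa [mul_comm])
    have h2 := congrFun (congrFun h ⟨a / P.m, h1⟩) ⟨a % P.m, Nat.mod_lt _ hm⟩
    have h3 : a / P.m * P.m + a % P.m = a := Nat.div_add_mod' a P.m
    simp only [Par.row, h3] at h2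
    rw [h2]
  · simp [pow_mul, pow_right_comm]

theorem le_toOuterMeasure_map {Ω α : Type} [Fintype Ω] [Nonempty Ω] (F : Ω → α) (A : Set α) {δ : ℝ}
    (h : (num fun ω => F ω ∉ A : ℝ) ≤ δ * Fintype.card Ω) :
    ENNReal.ofReal (1 - δ) ≤ ((PMF.uniformOfFintype Ω).map F).toOuterMeasure A := by
  classical
  rw [PMF.toOuterMeasure_map_apply, PMF.toOuterMeasure_uniformOfFintype_apply]
  have h1 : Fintype.card (F ⁻¹' A) = num fun ω => F ω ∈ A := by
    rw [num, Fintype.card_subtype, Finset.card_filter]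
    exact Finset.sum_congr rfl fun ω _ => by simp [ind]
  have h2 := num_add_num_not fun ω => F ω ∈ A
  have hC : (0 : ℝ) < Fintype.card Ω := by exact_mod_cast Fintype.card_pos
  rw [h1, ← ENNReal.ofReal_natCast, ← ENNReal.ofReal_natCast (Fintype.card Ω), ← ENNReal.ofReal_div_of_pos hC]
  refine ENNReal.ofReal_le_ofReal ?_
  rw [le_div_iff₀ hC]
  have h3 : ((num fun ω => F ω ∈ A : ℕ) : ℝ) + (num fun ω => F ω ∉ A : ℕ) = Fintype.card Ω := by
    exact_mod_cast h2
  linarith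

/-- From `15 ^ 96 * 2 ^ 6 ≤ 16 ^ 96` and `k + 2 ≤ 2 ^ L`, the failure probability is at most `k / (k
+ 2) ^ 6`. With `log (2 k) ≤ 2 k` it remains to see `40 k ^ 5 ≤ 11 (k + 2) ^ 6`. -/
theorem failure_bound {U C k L : ℕ} (hk : 1 ≤ k) (hL : k + 2 ≤ 2 ^ L)
    (h : 16 ^ (96 * L) * U ≤ k * (15 ^ (96 * L) * C)) :
    (U : ℝ) ≤ 11 / (20 * (k : ℝ) ^ 3 * Real.log (2 * (k : ℝ))) * C := by
  have h1 : 15 ^ (96 * L) * (2 ^ L) ^ 6 ≤ 16 ^ (96 * L) := by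
    calc 15 ^ (96 * L) * (2 ^ L) ^ 6 = (15 ^ 96 * 2 ^ 6) ^ L := by
          rw [mul_pow, ← pow_mul, ← pow_mul, ← pow_mul, mul_comm L 6]
      _ ≤ (16 ^ 96) ^ L := Nat.pow_le_pow_left (by norm_num) L
      _ = 16 ^ (96 * L) := by rw [pow_mul]
  have h2 : (k + 2) ^ 6 * U ≤ k * C := by
    refine (Nat.mul_le_mul_right _ (Nat.pow_le_pow_left hL 6)).trans ?_
    refine Nat.le_of_mul_le_mul_left (c := 15 ^ (96 * L)) ?_ (by positivity)
    calc 15 ^ (96 * L) * ((2 ^ L) ^ 6 * U) = 15 ^ (96 * L) * (2 ^ L) ^ 6 * U := by ring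
      _ ≤ 16 ^ (96 * L) * U := Nat.mul_le_mul_right _ h1
      _ ≤ _ := h
      _ = _ := by ring
  have hkr : (1 : ℝ) ≤ k := by exact_mod_cast hk
  have hlog : 0 < Real.log (2 * (k : ℝ)) := Real.log_pos (by linarith)
  have hlog2 : Real.log (2 * (k : ℝ)) ≤ 2 * k := (Real.log_le_sub_one_of_pos (by linarith)).trans (by linarith)
  have h3 : ((k : ℝ) + 2) ^ 6 * U ≤ k * C := by exact_mod_cast h2
  have h4 : (40 : ℝ) * k ^ 5 ≤ 11 * (k + 2) ^ 6 := by
    have e : (11 : ℝ) * (k + 2) ^ 6 = 11 * k ^ 6 + 132 * k ^ 5 + 660 * k ^ 4 + 1760 * k ^ 3 + 2640 * k ^ 2 +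
      2112 * k + 704 := by ring
    rw [e]
    have : (0 : ℝ) ≤ k ^ 5 := by positivity
    nlinarith [show (0 : ℝ) ≤ 11 * k ^ 6 + 660 * k ^ 4 + 1760 * k ^ 3 + 2640 * k ^ 2 + 2112 * k + 704 by positivity]
  rw [div_mul_eq_mul_div, le_div_iff₀ (by positivity)]
  have hU : (0 : ℝ) ≤ U := Nat.cast_nonneg _
  have hC : (0 : ℝ) ≤ C := Nat.cast_nonneg _
  have h5 : (U : ℝ) * (20 * k ^ 3 * Real.log (2 * k)) ≤ U * (40 * k ^ 4) := by
    refine mul_le_mul_of_nonneg_left ?_ hU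
    calc 20 * (k : ℝ) ^ 3 * Real.log (2 * k) ≤ 20 * k ^ 3 * (2 * k) :=
          mul_le_mul_of_nonneg_left hlog2 (by positivity)
      _ = 40 * k ^ 4 := by ring
  refine h5.trans ?_
  have h6 : (k : ℝ) * ((U : ℝ) * (40 * (k : ℝ) ^ 4)) ≤ (k : ℝ) * (11 * (C : ℝ)) := by
    calc (k : ℝ) * ((U : ℝ) * (40 * (k : ℝ) ^ 4)) = U * (40 * (k : ℝ) ^ 5) := by ring
      _ ≤ U * (11 * ((k : ℝ) + 2) ^ 6) := mul_le_mul_of_nonneg_left h4 hU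
      _ = 11 * (((k : ℝ) + 2) ^ 6 * U) := by ring
      _ ≤ 11 * ((k : ℝ) * C) := by linarith
      _ = (k : ℝ) * (11 * (C : ℝ)) := by ring
  exact le_of_mul_le_mul_left h6 (by linarith)

/-! ### The number of weight classes -/

section

variable {n : ℕ} {S : List (Update n)} {wt : Sym2 (Fin n) → ℝ} {ε : ℝ}

theorem card_streamEdges_le : (streamEdges S).card ≤ n * n := by
  have : streamEdges S ⊆ (Finset.univ : Finset (Fin n × Fin n)).image fun p => s(p.1, p.2) := by
    intro e he
    simp only [streamEdges, List.mem_toFinset, List.mem_map] at he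
    obtain ⟨a, -, rfl⟩ := he
    exact Finset.mem_image.2 ⟨(a.u, a.v), Finset.mem_univ _, rfl⟩
  refine (Finset.card_le_card this).trans (Finset.card_image_le.trans ?_)
  simp

theorem weightRatio_ge_one (hw : ∀ e ∈ streamEdges S, 0 < wt e) : 1 ≤ weightRatio wt S := by
  rw [weightRatio]
  split_ifs with h
  · have hpos : 0 < (streamEdges S).inf' h wt := (Finset.lt_inf'_iff h).2 hw
    rw [one_le_div hpos]
    obtain ⟨e, he⟩ := h
    exact (Finset.inf'_le wt he).trans (Finset.le_sup' wt he)
  · exact le_rfl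

theorem half_le_log (hε : 0 < ε) (hε1 : ε < 1) : ε / 4 ≤ Real.log (1 + ε / 2) := by
  refine le_trans ?_ (Real.one_sub_inv_le_log_of_pos (by linarith))
  rw [← sub_nonneg]
  have : 1 - (1 + ε / 2)⁻¹ - ε / 4 = ε * (2 - ε) / (8 * (1 + ε / 2)) := by
    field_simp
    ring
  rw [this]
  exact div_nonneg (mul_nonneg hε.le (by linarith)) (by linarith)

theorem near_of_log {a b : ℝ} (hε : 0 < ε) (ha : 0 < a) (hb : 0 < b)
    (h : |Real.log a - Real.log b| < Real.log (1 + ε / 2)) : near ε a b := by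
  have hpos : 0 < 1 + ε / 2 := by linarith
  obtain ⟨h1, h2⟩ := abs_lt.1 h
  have key : ∀ {x y : ℝ}, 0 < x → 0 < y → Real.log x < Real.log (1 + ε / 2) + Real.log y →
      2 * x ≤ (2 + ε) * y := fun {x y} hx hy hxy => by
    rw [← Real.log_mul hpos.ne' hy.ne'] at hxy
    have := (Real.log_lt_log_iff hx (mul_pos hpos hy)).1 hxy
    linarith
  exact ⟨key ha hb (by linarith), key hb ha (by linarith)⟩

/-- The second bound gives the space. The first one, since separated representatives are weights of
different edges, keeps addresses within words whose length depends neither on `ε` nor on the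
weights. -/
theorem classBound (hε : 0 < ε) (hε1 : ε < 1) (hw : ∀ e ∈ streamEdges S, 0 < wt e) :
    ClassBound ε (wt '' streamEdges S) (min (n * n) ⌊1 + 4 * (ε⁻¹ * Real.log (weightRatio wt S))⌋₊) := by
  intro N key hkey hsep
  have hpos : ∀ c, 1 ≤ c → c ≤ N → 0 < key c := fun c c1 c2 => by
    obtain ⟨e, he, h⟩ := hkey c c1 c2
    rw [← h]; exact hw e he
  refine le_min ?_ (Nat.le_floor ?_)
  · have h1 : ((Finset.Icc 1 N).image key).card = N := by
      rw [Finset.card_image_of_injOn, Nat.card_Icc, Nat.add_sub_cancel]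
      intro c hc d hd e
      rw [Finset.mem_coe, Finset.mem_Icc] at hc hd
      by_contra hne
      refine hsep c d hc.1 hc.2 hd.1 hd.2 hne ?_
      rw [show key c = key d from e]
      exact near_self hε (hpos d hd.1 hd.2)
    have h2 : (Finset.Icc 1 N).image key ⊆ (streamEdges S).image wt := by
      intro x hx
      obtain ⟨c, hc, rfl⟩ := Finset.mem_image.1 hx
      rw [Finset.mem_Icc] at hc
      obtain ⟨e, he, h⟩ := hkey c hc.1 hc.2
      exact Finset.mem_image.2 ⟨e, he, h⟩
    calc N = _ := h1.symm
      _ ≤ _ := Finset.card_le_card h2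
      _ ≤ _ := Finset.card_image_le
      _ ≤ _ := card_streamEdges_le
  · rcases Nat.eq_zero_or_pos N with rfl | hN
    · have := Real.log_nonneg (weightRatio_ge_one hw)
      simp only [Nat.cast_zero]
      positivity
    have hne : (streamEdges S).Nonempty := by
      obtain ⟨e, he, -⟩ := hkey 1 le_rfl hN
      exact ⟨e, he⟩
    have hmin : 0 < (streamEdges S).inf' hne wt := (Finset.lt_inf'_iff hne).2 hw
    have hmax : 0 < (streamEdges S).sup' hne wt := by
      obtain ⟨e, he⟩ := hne
      exact (hw e he).trans_le (Finset.le_sup' wt he)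
    have hratio : Real.log (weightRatio wt S) =
        Real.log ((streamEdges S).sup' hne wt) - Real.log ((streamEdges S).inf' hne wt) := by
      rw [weightRatio, dif_pos hne, Real.log_div hmax.ne' hmin.ne']
    have hl := half_le_log hε hε1
    have hlpos : 0 < Real.log (1 + ε / 2) := by linarith
    have hlow : ∀ c, 1 ≤ c → c ≤ N → Real.log ((streamEdges S).inf' hne wt) ≤ Real.log (key c) := fun c c1 c2 => by
      obtain ⟨e, he, h⟩ := hkey c c1 c2
      rw [← h]
      exact Real.log_le_log hmin (Finset.inf'_le wt he)
    have hup : ∀ c, 1 ≤ c → c ≤ N → Real.log (key c) ≤ Real.log ((streamEdges S).sup' hne wt) := fun c c1 c2 => by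
      obtain ⟨e, he, h⟩ := hkey c c1 c2
      rw [← h]
      exact Real.log_le_log (hw e he) (Finset.le_sup' wt he)
    generalize Real.log ((streamEdges S).sup' hne wt) = b at *
    generalize Real.log ((streamEdges S).inf' hne wt) = a at *
    generalize hl' : Real.log (1 + ε / 2) = l at *
    -- Cut the range of the logarithms into intervals of length `l = log (1 + ε / 2)`. Two
    -- representatives in one interval would be near each other.
    have h1 : N ≤ ⌊(b - a) / l⌋₊ + 1 := by
      have h2 : ((Finset.Icc 1 N).image fun c => ⌊(Real.log (key c) - a) / l⌋₊).card = N := by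
        rw [Finset.card_image_of_injOn, Nat.card_Icc, Nat.add_sub_cancel]
        intro c hc d hd e
        rw [Finset.mem_coe, Finset.mem_Icc] at hc hd
        by_contra hne
        refine hsep c d hc.1 hc.2 hd.1 hd.2 hne (near_of_log hε (hpos c hc.1 hc.2) (hpos d hd.1 hd.2) ?_)
        rw [hl']
        have e' : ⌊(Real.log (key c) - a) / l⌋₊ = ⌊(Real.log (key d) - a) / l⌋₊ := e
        have c1 := Nat.floor_le (div_nonneg (sub_nonneg.2 (hlow c hc.1 hc.2)) hlpos.le)
        have c2 := Nat.lt_floor_add_one ((Real.log (key c) - a) / l)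
        have d1 := Nat.floor_le (div_nonneg (sub_nonneg.2 (hlow d hd.1 hd.2)) hlpos.le)
        have d2 := Nat.lt_floor_add_one ((Real.log (key d) - a) / l)
        rw [e'] at c1 c2
        have h5 : |(Real.log (key c) - a) / l - (Real.log (key d) - a) / l| < 1 :=
          abs_lt.2 ⟨by linarith, by linarith⟩
        rwa [← sub_div, sub_sub_sub_cancel_right, abs_div, abs_of_pos hlpos, div_lt_one hlpos] at h5
      rw [← h2]
      refine (Finset.card_le_card (t := Finset.range (⌊(b - a) / l⌋₊ + 1)) ?_).trans (by simp)
      intro x hx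
      obtain ⟨c, hc, rfl⟩ := Finset.mem_image.1 hx
      rw [Finset.mem_Icc] at hc
      rw [Finset.mem_range, Nat.lt_succ_iff]
      refine Nat.floor_le_floor (div_le_div_of_nonneg_right ?_ hlpos.le)
      linarith [hup c hc.1 hc.2]
    have h3 : 0 ≤ b - a := by linarith [hlow 1 le_rfl hN, hup 1 le_rfl hN]
    calc (N : ℝ) ≤ (⌊(b - a) / l⌋₊ : ℝ) + 1 := by exact_mod_cast h1
      _ ≤ (b - a) / l + 1 := by linarith [Nat.floor_le (div_nonneg h3 hlpos.le)]
      _ ≤ (b - a) / (ε / 4) + 1 := by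
          have := div_le_div_of_nonneg_left h3 (by linarith : 0 < ε / 4) hl
          linarith
      _ = 1 + 4 * (ε⁻¹ * Real.log (weightRatio wt S)) := by
          rw [hratio]; field_simp; ring

end

/-! ### The size of the machine -/

theorem clog_bounds {X : ℕ} (hX : 3 ≤ X) :
    1 ≤ Real.log X ∧ (Nat.clog 2 X : ℝ) ≤ 3 * Real.log X := by
  have hXr : (3 : ℝ) ≤ X := by exact_mod_cast hX
  have h1 : 1 ≤ Real.log X := by
    rw [Real.le_log_iff_exp_le (by linarith)]
    have := Real.exp_one_lt_d9
    linarith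
  refine ⟨h1, ?_⟩
  have h2 := Nat.pow_pred_clog_lt_self (b := 2) (by norm_num) (x := X) (by omega)
  have h3 : (2 : ℝ) ^ (Nat.clog 2 X - 1) < X := by exact_mod_cast h2
  have h4 := Real.log_lt_log (by positivity) h3
  rw [Real.log_pow] at h4
  have h5 := Real.log_two_gt_d9
  have h6 : (Nat.clog 2 X : ℝ) ≤ ((Nat.clog 2 X - 1 : ℕ) : ℝ) + 1 := by
    have : Nat.clog 2 X ≤ Nat.clog 2 X - 1 + 1 := by omega
    exact_mod_cast this
  have h7 : (0 : ℝ) ≤ ((Nat.clog 2 X - 1 : ℕ) : ℝ) := Nat.cast_nonneg _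
  nlinarith

theorem Par.size_le {P : Par} (hk : 1 ≤ P.k) (hL : 1 ≤ P.L) :
    P.S ≤ 49155 * (P.L ^ 2 * P.k ^ 2) ∧ P.base ≤ 386 * (P.L ^ 2 * P.k ^ 2) ∧ P.time ≤ 82646 * P.L ^ 3 := by
  have hk2 : 1 ≤ P.k ^ 2 := Nat.one_le_pow _ _ hk
  have hkk : P.k ≤ P.k ^ 2 := Nat.le_self_pow (by norm_num) _
  have hLL : P.L ≤ P.L ^ 2 := Nat.le_self_pow (by norm_num) _
  have h1 : P.L ^ 2 ≤ P.L ^ 2 * P.k ^ 2 := Nat.le_mul_of_pos_right _ hk2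
  have h2 : P.k ^ 2 ≤ P.L ^ 2 * P.k ^ 2 := Nat.le_mul_of_pos_left _ (hL.trans hLL)
  have h3 : P.L * P.k ^ 2 ≤ P.L ^ 2 * P.k ^ 2 := Nat.mul_le_mul_right _ hLL
  have h4 : P.L ^ 2 ≤ P.L ^ 3 := Nat.pow_le_pow_right hL (by norm_num)
  simp only [Par.S, Par.base, Par.time, Par.H, Par.Z, Par.RT, Par.R, Par.m, Par.lev, Par.BB, Par.B]
  refine ⟨?_, ?_, ?_⟩ <;> nlinarith

/-- The cells follow from the size of a class block times the number of classes. For the words, `n +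
k + 2 ≤ 2 ^ L` bounds every quantity by a small power of `2 ^ L`, and `2 ^ (25 L)` exceeds all of
them. -/
theorem Par.fit {n k : ℕ} (hk : 1 ≤ k) {NB : ℕ} (hNB : NB ≤ n * n) {w : ℝ} (hw : 1 ≤ w) (hNBw : (NB : ℝ) ≤ 4 * w)
    {z : Size} (hc : z.cells = ⌊((3000000 : ℕ) : ℝ) * (k : ℝ) ^ 2 * w * Real.log ((n : ℝ) + (k : ℝ) + 2) ^ 3⌋₊)
    (hb : z.bits = ⌊((3000000 : ℕ) : ℝ) * Real.log ((n : ℝ) + (k : ℝ) + 2)⌋₊) :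
    (Par.mk n k (Nat.clog 2 (n + k + 2))).Fit z NB := by
  have hlog := clog_bounds (X := n + k + 2) (by omega)
  have hpow := Nat.le_pow_clog (b := 2) (by norm_num) (n + k + 2)
  have hL1 : 1 ≤ Nat.clog 2 (n + k + 2) := Nat.clog_pos (by norm_num) (by omega)
  push_cast at hlog
  generalize Real.log ((n : ℝ) + (k : ℝ) + 2) = l at *
  generalize Nat.clog 2 (n + k + 2) = L at *
  obtain ⟨hl1, hl2⟩ := hlog
  generalize hP : Par.mk n k L = P
  have en : P.n = n := by rw [← hP]
  have ek : P.k = k := by rw [← hP]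
  have eL : P.L = L := by rw [← hP]
  obtain ⟨hS, hbase, -⟩ := Par.size_le (P := P) (by omega) (by omega)
  rw [ek, eL] at hS hbase
  -- The exponent is ample: the largest requirement below is bounded by `2 ^ (22 L)`.
  have hbits : 25 * L ≤ z.bits := by
    rw [hb]
    refine Nat.le_floor ?_
    push_cast
    linarith
  have hlim : 2 ^ (25 * L) ≤ z.lim := Nat.pow_le_pow_right (by norm_num) hbits
  have hLL : L < 2 ^ L := Nat.lt_two_pow_self
  have hkL : k ≤ 2 ^ L := by omega
  have hnL : n + 1 ≤ 2 ^ L := by omega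
  have h2L : 2 ≤ 2 ^ L := by
    calc 2 = 2 ^ 1 := rfl
      _ ≤ 2 ^ L := Nat.pow_le_pow_right (by norm_num) hL1
  have hn3 : n + 3 ≤ 2 ^ L := by omega
  have hD : P.D = 32 * k * 2 ^ L * 2 ^ L := by simp only [Par.D, ek, eL]; ring
  have hlev : 2 ^ P.lev = 4 * 2 ^ L * 2 ^ L := by simp only [Par.lev, eL]; ring
  have hcells : (P.base + (NB + 2) * P.S : ℕ) ≤ z.cells := by
    rw [hc]
    refine Nat.le_floor ?_
    have h1 : ((P.base + (NB + 2) * P.S : ℕ) : ℝ) ≤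
        386 * ((L : ℝ) ^ 2 * (k : ℝ) ^ 2) + ((NB : ℝ) + 2) * (49155 * ((L : ℝ) ^ 2 * (k : ℝ) ^ 2)) := by
      exact_mod_cast Nat.add_le_add hbase (Nat.mul_le_mul_left (NB + 2) hS)
    have h2 : (L : ℝ) ^ 2 ≤ (3 * l) ^ 2 := pow_le_pow_left₀ (Nat.cast_nonneg _) hl2 2
    have h3 : (L : ℝ) ^ 2 * (k : ℝ) ^ 2 ≤ 9 * (l ^ 3 * (k : ℝ) ^ 2) := by
      have : l ^ 2 ≤ l ^ 3 := pow_le_pow_right₀ hl1 (by norm_num)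
      calc (L : ℝ) ^ 2 * (k : ℝ) ^ 2 ≤ (9 * l ^ 3) * (k : ℝ) ^ 2 :=
            mul_le_mul_of_nonneg_right (by linarith) (by positivity)
        _ = 9 * (l ^ 3 * (k : ℝ) ^ 2) := by ring
    have h4 : 0 ≤ (L : ℝ) ^ 2 * (k : ℝ) ^ 2 := by positivity
    refine h1.trans ?_
    -- By `NB ≤ 4 w` and `1 ≤ w` the bracket is at most `295316 w`. Then `L ≤ 3 l` brings in the
    -- factor `9`.
    calc 386 * ((L : ℝ) ^ 2 * (k : ℝ) ^ 2) + ((NB : ℝ) + 2) * (49155 * ((L : ℝ) ^ 2 * (k : ℝ) ^ 2))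
        = (386 + ((NB : ℝ) + 2) * 49155) * ((L : ℝ) ^ 2 * (k : ℝ) ^ 2) := by ring
      _ ≤ (300000 * w) * ((L : ℝ) ^ 2 * (k : ℝ) ^ 2) := mul_le_mul_of_nonneg_right (by linarith) h4
      _ ≤ (300000 * w) * (9 * (l ^ 3 * (k : ℝ) ^ 2)) := mul_le_mul_of_nonneg_left h3 (by linarith)
      _ ≤ ((3000000 : ℕ) : ℝ) * (k : ℝ) ^ 2 * w * l ^ 3 := by
        have : 0 ≤ w * l ^ 3 * (k : ℝ) ^ 2 := by positivity
        push_cast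
        linarith
  have hlt : P.base + (NB + 2) * P.S < 2 ^ (25 * L) := by
    rw [mul_comm 25, pow_mul 2 L 25]
    generalize 2 ^ L = p at *
    have h1 : L ^ 2 * k ^ 2 ≤ p ^ 4 := by
      calc L ^ 2 * k ^ 2 ≤ p ^ 2 * p ^ 2 := Nat.mul_le_mul (Nat.pow_le_pow_left hLL.le 2) (Nat.pow_le_pow_left hkL 2)
        _ = p ^ 4 := by ring
    have h2 : NB + 2 ≤ p ^ 2 := by nlinarith
    have h3 : p ^ 4 ≤ p ^ 6 := Nat.pow_le_pow_right (by omega) (by norm_num)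
    have h4 : 0 < p ^ 6 := by positivity
    calc P.base + (NB + 2) * P.S ≤ 386 * p ^ 4 + p ^ 2 * (49155 * p ^ 4) :=
          Nat.add_le_add (hbase.trans (Nat.mul_le_mul_left _ h1))
            (Nat.mul_le_mul h2 (hS.trans (Nat.mul_le_mul_left _ h1)))
      _ = 386 * p ^ 4 + 49155 * p ^ 6 := by ring
      _ < 2 ^ 16 * p ^ 6 := by omega
      _ ≤ p ^ 16 * p ^ 6 := Nat.mul_le_mul_right _ (Nat.pow_le_pow_left h2L 16)
      _ = p ^ 22 := by ring
      _ ≤ p ^ 25 := Nat.pow_le_pow_right (by omega) (by norm_num)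
  have hsmall : ∀ {x : ℕ}, x ≤ 2 ^ 7 * (2 ^ L) ^ 4 → x < z.lim := fun {x} hx => by
    refine lt_of_lt_of_le ?_ hlim
    rw [mul_comm 25, pow_mul 2 L 25]
    generalize 2 ^ L = p at *
    calc x ≤ p ^ 7 * p ^ 4 := hx.trans (Nat.mul_le_mul_right _ (Nat.pow_le_pow_left h2L 7))
      _ = p ^ 11 := by ring
      _ < p ^ 25 := Nat.pow_lt_pow_right (by omega) (by norm_num)
  have hnn : n * n + 1 ≤ 2 ^ L * 2 ^ L := by nlinarith
  have hpp : 2 ^ L * 2 ^ L ≤ (2 ^ L) ^ 4 := by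
    calc 2 ^ L * 2 ^ L = (2 ^ L) ^ 2 := by ring
      _ ≤ (2 ^ L) ^ 4 := Nat.pow_le_pow_right (by positivity) (by norm_num)
  refine ⟨by omega, by rwa [en, ek, eL], hcells, hlt.trans_le hlim, ?_, hsmall ?_, hsmall ?_, hsmall ?_⟩
  · rw [eL, two_mul, pow_add]
    omega
  · rw [hD, eL]
    generalize 2 ^ L = p at *
    calc (2 * L + 2) * (32 * k * p * p) ≤ (4 * p) * (32 * p * p * p) := by
          refine Nat.mul_le_mul (by omega) ?_
          gcongr
      _ = 2 ^ 7 * p ^ 4 := by ring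
  · rw [hlev, mul_assoc]
    omega
  · rw [en]
    calc (n * n + 1) * (n * n + 1) ≤ (2 ^ L * 2 ^ L) * (2 ^ L * 2 ^ L) := Nat.mul_le_mul hnn hnn
      _ = (2 ^ L) ^ 4 := by ring
      _ ≤ 2 ^ 7 * (2 ^ L) ^ 4 := Nat.le_mul_of_pos_left _ (by norm_num)


/-! ### From the answer of the query to the claims about the output -/

section

variable {n k : ℕ} {S : List (Update n)} {wt : Sym2 (Fin n) → ℝ} {ε : ℝ} {W : Set ℝ} {P : Par} {N : ℕ} {s s' : State}

theorem Answer.outputs {T : ℕ → ℕ} (hn : P.n = n) (hk : P.k = k)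
    (h : Inv P ε T W (codeWt wt) (codes (edgesAfter S)) N s) (ha : Answer P N s s') :
    Outputs s' (∅ : Finset (Sym2 (Fin n))) ∨
      ∃ M : Finset (Sym2 (Fin n)), Outputs s' M ∧ IsKMatching (graphAfter S) k M := by
  rcases ha with ⟨hout, -⟩ | ⟨σ, hσ, hval, hout, -⟩
  · exact Or.inl (by simp [Outputs, hout])
  · rw [hn, hk] at hout
    have hdisj : ∀ i < k, ∀ j < k, i ≠ j → disj n (P.code s (σ i)) (P.code s (σ j)) := fun i hi j hj hij => by
      rw [← hn]
      exact hval.disj (by omega) (by omega) hij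
    obtain ⟨M, hM, -, hO⟩ := exists_matching (wt := wt) (τ := fun i => P.code s (σ i))
      (fun i hi => (h.sampler (hσ i (by omega)) (hval i (by omega)).1).1) hdisj
    exact Or.inr ⟨M, hO s' hout, hM⟩

/-- The answers are nearly optimal except for a small fraction of the random tables. -/
theorem num_bad_le [NeZero P.D] (hn : P.n = n) (hk : P.k = k) (hk1 : 1 ≤ k) (hL : n + k + 2 ≤ 2 ^ P.L)
    (hε : 0 < ε) (hε1 : ε < 1) (hw : ∀ e ∈ streamEdges S, 0 < wt e) {K : ℕ × (ℕ → ℝ)}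
    {F : (Fin (P.R * P.m) → Fin P.D) → State}
    (hF : ∀ ω, ∃ N s, Inv P ε (table ω) W (codeWt wt) (codes (edgesAfter S)) N s ∧ Agree K N s.wmem ∧
      Answer P N s (F ω)) {M : Finset (Sym2 (Fin n))} (hM : IsKMatching (graphAfter S) k M) :
    (num (fun ω => ¬ ∃ M' : Finset (Sym2 (Fin n)), Outputs (F ω) M' ∧ IsKMatching (graphAfter S) k M' ∧
      (1 - ε) * weight wt M < weight wt M') : ℝ) ≤
      11 / (20 * (k : ℝ) ^ 3 * Real.log (2 * (k : ℝ))) * Fintype.card (Fin (P.R * P.m) → Fin P.D) := by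
  obtain ⟨τ₀, h1, h2, h3⟩ := exists_tuple (wt := wt) hM
  have hE : ∀ e ∈ codes (edgesAfter S), e < P.n * P.n := fun e he => by rw [hn]; exact codes_lt he
  have hpos : ∀ e ∈ codes (edgesAfter S), 0 < codeWt wt e := fun e he => by
    obtain ⟨u, v, -, hm, rfl⟩ := mem_codes.1 he
    rw [codeWt_code]
    exact hw _ (edgesAfter_subset _ hm)
  have hgood : P.Good (codes (edgesAfter S)) (fun e => cls ε K.2 K.1 (codeWt wt e))
      (fun i => cls ε K.2 K.1 (codeWt wt (τ₀ i))) τ₀ :=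
    ⟨fun i hi => ⟨h1 i (by omega), rfl⟩, fun i hi j hj hij => by rw [hn]; exact h2 i (by omega) j (by omega) hij⟩
  have hU := num_exch (by omega) hE hgood P.R
  rw [← num_equiv (Equiv.ofBijective _ (row_bijective P)),
    ← Fintype.card_congr (Equiv.ofBijective _ (row_bijective P)), hk] at hU
  refine le_trans ?_ (failure_bound (L := P.L) hk1 (by omega) hU)
  refine Nat.cast_le.2 (num_mono fun ω => ?_)
  contrapose!
  intro hg
  obtain ⟨N, s, hI, hA, hans⟩ := hF ω
  rw [← hk] at hg
  -- The exchange argument was run with the classes of `K`, which were fixed before the table was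
  -- drawn; they are the classes that the machine has found.
  have hcls : ∀ w, cls ε K.2 K.1 w = cls ε s.wmem N w := fun w => (hA.cls_eq).symm
  simp only [hcls] at hg
  obtain ⟨τ, q1, q2, q3, q4⟩ := hans.quality hε hε1 (by omega) hpos hI (fun i hi => h1 i (by omega)) hg
  rw [hk] at q1 q2 q3 q4
  rw [hn] at q2 q3
  obtain ⟨M', m1, m2, m3⟩ := exists_matching (wt := wt) q1 q2
  exact ⟨M', m3 _ q3, m1, by rw [m2, ← h3]; exact q4⟩

end

end KMatchStream

/-! ### The main theorem -/

open KMatchStream in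
theorem mainTheorem4 :
    ∃ (A : StreamAlgorithm) (C c : ℕ),
      ∀ (ε : ℝ), 0 < ε → ε < 1 →
      ∀ (n k : ℕ), 1 ≤ k →
      ∀ (wt : Sym2 (Fin n) → ℝ) (S : List (Update n)),
        IsDynamicStream S →
        (∀ e ∈ streamEdges S, 0 < wt e) →
        ∀ (z : Size) (tUpd : ℕ),
          z.cells = ⌊(C : ℝ) * (k : ℝ) ^ 2 * (1 + ε⁻¹ * Real.log (weightRatio wt S)) *
            Real.log ((n : ℝ) + (k : ℝ) + 2) ^ c⌋₊ →
          z.bits = ⌊(C : ℝ) * Real.log ((n : ℝ) + (k : ℝ) + 2)⌋₊ →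
          tUpd = ⌊(C : ℝ) * Real.log ((n : ℝ) + (k : ℝ) + 2) ^ c⌋₊ →
          ∃ T : ℕ,
            -- the bounds on space, word length and update time are always kept
            none ∉ (execute A z ε T tUpd k wt S).support ∧
            -- the output is always empty or a `k`-matching of the graph
            (∀ s : State, some s ∈ (execute A z ε T tUpd k wt S).support →
              ∃ M' : Finset (Sym2 (Fin n)), Outputs s M' ∧
                (M' = ∅ ∨ IsKMatching (graphAfter S) k M')) ∧
            -- (1) the quality of the output
            (∀ M : Finset (Sym2 (Fin n)), IsMaxWeightKMatching (graphAfter S) wt k M →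
              ENNReal.ofReal (1 - 11 / (20 * (k : ℝ) ^ 3 * Real.log (2 * (k : ℝ)))) ≤
                (execute A z ε T tUpd k wt S).toOuterMeasure
                  {o | ∃ s : State, o = some s ∧ ∃ M' : Finset (Sym2 (Fin n)), Outputs s M' ∧
                    IsKMatching (graphAfter S) k M' ∧
                    (1 - ε) * weight wt M < weight wt M'}) ∧
            -- (2) the output when there is no `k`-matching
            ((¬ ∃ M : Finset (Sym2 (Fin n)), IsKMatching (graphAfter S) k M) →
              ∀ s : State, some s ∈ (execute A z ε T tUpd k wt S).support →
                Outputs s (∅ : Finset (Sym2 (Fin n)))) := by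
  -- The exponent comes from the update time, of order `L ^ 3`. The constant has to exceed `27 *
  -- 82646` for the time and `9 * 300000` for the cells.
  refine ⟨algorithm, 3000000, 3, fun ε hε hε1 n k hk wt S hS hw z tUpd hc hb ht => ?_⟩
  generalize hP : Par.mk n k (Nat.clog 2 (n + k + 2)) = P
  have hn : P.n = n := by rw [← hP]
  have hPk : P.k = k := by rw [← hP]
  have hPL : P.L = Nat.clog 2 (n + k + 2) := by rw [← hP]
  have hL : n + k + 2 ≤ 2 ^ P.L := by rw [hPL]; exact Nat.le_pow_clog (by norm_num) _
  have : NeZero P.D := ⟨by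
    simp only [Par.D, hPk]
    positivity⟩
  have hlog := Real.log_nonneg (weightRatio_ge_one hw)
  have hw1 : 1 ≤ 1 + ε⁻¹ * Real.log (weightRatio wt S) := by
    have : 0 ≤ ε⁻¹ * Real.log (weightRatio wt S) := by positivity
    linarith
  have hB := classBound hε hε1 hw
  generalize hNB : min (n * n) ⌊1 + 4 * (ε⁻¹ * Real.log (weightRatio wt S))⌋₊ = NB at hB
  have hfit : P.Fit z NB := by
    rw [← hP]
    refine Par.fit hk (hNB ▸ min_le_left _ _) hw1 ?_ hc hb
    calc (NB : ℝ) ≤ ⌊1 + 4 * (ε⁻¹ * Real.log (weightRatio wt S))⌋₊ := Nat.cast_le.2 (hNB ▸ min_le_right _ _)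
      _ ≤ 1 + 4 * (ε⁻¹ * Real.log (weightRatio wt S)) := Nat.floor_le (by linarith)
      _ ≤ 4 * (1 + ε⁻¹ * Real.log (weightRatio wt S)) := by linarith
  have htime : P.time ≤ tUpd := by
    rw [ht]
    refine Nat.le_floor ?_
    obtain ⟨h1, h2⟩ := clog_bounds (X := n + k + 2) (by omega)
    push_cast at h1 h2
    have hpos : 1 ≤ P.L := by rw [hPL]; exact Nat.clog_pos (by norm_num) (by omega)
    have h3 : (P.time : ℝ) ≤ 82646 * (P.L : ℝ) ^ 3 := by
      exact_mod_cast (Par.size_le (by omega) hpos).2.2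
    rw [← hPL] at h2
    have h4 := pow_le_pow_left₀ (Nat.cast_nonneg _) h2 3
    rw [mul_pow] at h4
    have h5 := pow_nonneg (zero_le_one.trans h1) 3
    push_cast
    linarith
  obtain ⟨T, F, hT, hF⟩ := execute_spec hP.symm hε hfit hB hS hw htime
  have hsupp : ∀ s, some s ∈ (execute algorithm z ε T tUpd k wt S).support → ∃ ω, F ω = s := fun s hs => by
    rw [hT, PMF.mem_support_map_iff] at hs
    obtain ⟨ω, -, h⟩ := hs
    exact ⟨ω, Option.some_inj.1 h⟩
  refine ⟨T, ?_, fun s hs => ?_, fun M hM => ?_, fun hno s hs => ?_⟩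
  · rw [hT, PMF.mem_support_map_iff]
    rintro ⟨ω, -, h⟩
    exact Option.some_ne_none _ h
  · obtain ⟨ω, rfl⟩ := hsupp s hs
    obtain ⟨N, s₀, hI, -, hA⟩ := hF ω
    rcases hA.outputs hn hPk hI with h | ⟨M', h1, h2⟩
    · exact ⟨∅, h, Or.inl rfl⟩
    · exact ⟨M', h1, Or.inr h2⟩
  · rw [hT]
    refine le_toOuterMeasure_map _ _ ?_
    convert num_bad_le hn hPk hk hL hε hε1 hw hF hM.1 using 4 with ω
    simp
  · obtain ⟨ω, rfl⟩ := hsupp s hs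
    obtain ⟨N, s₀, hI, -, hA⟩ := hF ω
    rcases hA.outputs hn hPk hI with h | ⟨M', -, h2⟩
    · exact h
    · exact absurd ⟨M', h2⟩ hno
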